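/- **Setting.** Let $p>3$ be a prime and let $F$ be a non-archimedean local field whose residue field $k$ has $p^f$ elements, $f>1$. Let $\overline{\mathbb F}_p$ be an algebraic closure of $k$, $\varpi$ a uniformizer of $F$, $K=\mathrm{GL}_2(\mathcal O_F)$, $\Gamma=\mathrm{GL}_2(k)$, $Z$ the centre of $\mathrm{GL}_2(F)$, $B\supset U$ the upper triangular and upper triangular unipotent subgroups of $\Gamma$, $I\supset I(1)$ their preimages in $K$, $\Pi=\begin{pmatrix}0&1\\ \varpi&0\end{pmatrix}$, and $N$ the subgroup of $\mathrm{GL}_2(F)$ generated by $I$ and $\Pi$ (the normalizer of $I$). A *basic $0$-diagram* is a triple $(V_0,V_1,\mathrm{can})$ of a smooth $\overline{\mathbb F}_p$-representation $V_0$ of $KZ$ and a smooth $\overline{\mathbb F}_p$-representation $V_1$ of $N$, on both of which $\varpi$ acts trivially, and an injective $IZ$-equivariant linear map $\mathrm{can}:V_1\to V_0$ with image $V_0^{I(1)}$. It is *irreducible* if $V_0\ne0$ and there is no $KZ$-stable $W_0\subset V_0$ with $0\neq W_0\neq V_0$ such that $\mathrm{can}^{-1}(W_0)$ is $N$-stable.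 **Weights.** For integers $0\le r_j\le p-1$ ($0\le j\le f-1$) and $m\in\mathbb Z$ let $\mathbf r\otimes\det^m=\bigl(\bigotimes_j \mathrm{Sym}^{r_j}\overline{\mathbb F}_p^2\circ\Phi^j\bigr)\otimes\det^m$, a representation of $\Gamma$, where $\Phi$ is induced by $x\mapsto x^p$ on $k$. Put $r=\sum_j r_jp^j$. For $\tau=\mathbf r\otimes\det^m$ let $\chi(\tau)$ be the character $\begin{pmatrix}a&b\\0&d\end{pmatrix}\mapsto a^r(ad)^m$ of $B$, and let $\tau^{[s]}=(p-1-r_0,\dots,p-1-r_{f-1})\otimes\det^{m+r}$. For a character $\chi$ of $B$ let $\chi^s\begin{pmatrix}a&b\\0&d\end{pmatrix}=\chi\begin{pmatrix}d&0\\0&a\end{pmatrix}$, and let $V^\chi$ be the $\chi$-isotypic part of a representation $V$ of $B$. Write $E(\sigma,\tau)$ for a non-split extension of $\tau$ by $\sigma$ (so $\sigma$ is the subrepresentation). Indices $j$ of $f$-tuples are taken modulo $f$. Let $\mu=(x-1,\,p-2-x,\,p-1-x,\dots,p-1-x)$ ($f$ entries), let $(g\nu)_j=\nu_{j+1}$ for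 an $f$-tuple $\nu$, let $\mu^{(0)}=(x,\dots,x)$, and let $\mu^{(n)}=g^{n-1}\mu\circ\cdots\circ g\mu\circ\mu$ (componentwise composition). For a tuple $\nu$ of polynomials and $\mathbf x\in\mathbb Z^f$ put $\nu(\mathbf x)=(\nu_j(x_j))_j$, and let $e(\nu)(\mathbf x)=\frac12\sum_j p^j(x_j-\nu_j(x_j))$ if $\nu_{f-1}\in\{x,x-1\}$ and $e(\nu)(\mathbf x)=\frac12\bigl(p^f-1+\sum_j p^j(x_j-\nu_j(x_j))\bigr)$ otherwise. Let $l=f$ if $f$ is odd and $l=2f$ if $f$ is even. Fix $\mathbf r\in\mathbb Z^f$ with $1\le r_j\le p-3$ for all $j$. Put $\sigma_n=\mu^{(n)}(\mathbf r)\otimes\det^{e_n}$ with $e_n=\sum_{i<n}e(g^i\mu)(\mu^{(i)}(\mathbf r))$, and $\sigma_n'=(g\mu^{(n)})(\mathbf r)\otimes\det^{e_n'}$ with $e_n'=\sum_{i<n}e(g^{i+1}\mu)((g\mu^{(i)})(\mathbf r))$, for $0\le n\le l$; then $\sigma:=\mathbf r\otimes\det^0=\sigma_0=\sigma_l=\sigma_0'=\sigma_l'$.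 **Spliced module.** Let $C=\bigoplus_{n=1}^{l}E(\sigma_n,\sigma_{n-1}^{[s]})$ and $C'=\bigoplus_{n=1}^{l}E(\sigma_n',\sigma_{n-1}'^{[s]})$. Let $\iota_\sigma:\sigma\to C\oplus C'$ be the diagonal embedding into the subrepresentations $\sigma_l=\sigma$ and $\sigma'_l=\sigma$ of $E(\sigma_l,\sigma_{l-1}^{[s]})$ and $E(\sigma_l',\sigma_{l-1}'^{[s]})$. The spliced module $D_0\subset (C\oplus C')/\iota_\sigma(\sigma)$ is the image of the set of all vectors of $C\oplus C'$ whose components in $E(\sigma_1,\sigma^{[s]})$ and $E(\sigma_1',\sigma^{[s]})$ have the same image in $\sigma^{[s]}$. Let $D_1=D_0^U$ and $S_1=(\mathrm{soc}_\Gamma D_0)^U$, and let $D_1=S_1\oplus Q_1$ be a decomposition of $B$-representations in which $Q_1$ is mapped isomorphically to $(\mathrm{cosoc}_\Gamma D_0)^U$ by the projection $D_0\to\mathrm{cosoc}_\Gamma D_0$. Let $\Pi:D_1\to D_1$ be a linear map with $\Pi^2=1$ and $\Pi(S_1^\chi)=Q_1^{\chi^s}$ for all characters $\chi:B\to\overline{\mathbb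 F}_p^\times$ with $S_1^\chi\ne0$. **The diagram $D(\lambda)$.** Let $\lambda=(\lambda_i)_{i\in\mathbb Z}$ with $\lambda_i\in\overline{\mathbb F}_p^\times$. Let $D_0(\infty)=\bigoplus_{i\in\mathbb Z}D_0$, with $K$ acting on every summand through $K\twoheadrightarrow\Gamma$ and $\varpi$ acting trivially, write $v_i$ for the copy of $v\in D_0$ in the $i$-th summand, and let $D_1(\infty)=D_0(\infty)^{I(1)}$. Let $N$ act on $D_1(\infty)$ so that $IZ$ acts as on $D_0(\infty)$, $\varpi=\Pi^2$ acts trivially, and for all $i\in\mathbb Z$ $$\Pi v_i=\begin{cases}\lambda_i(\Pi v)_i & v\in S_1^{\chi(\sigma)},\\ (\Pi v)_{i-1}& v\in S_1^{\chi(\sigma_1)},\\ (\Pi v)_{i+1}& v\in S_1^{\chi(\sigma_1')},\\ (\Pi v)_i & v\in S_1^{\chi}\text{ with }\chi\in\{\chi(\sigma_n),\chi(\sigma_n'):2\le n\le l-1\}.\end{cases}$$ Let $D(\lambda)=(D_0(\infty),D_1(\infty),\mathrm{can})$ with $\mathrm{can}$ the inclusion. **Proposition.** Suppose $\lambda_i\ne\pm\lambda_0$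 for all $i\ne0$. Then non-split extensions as above, an operator $\Pi$ on $D_1$ as above and the resulting basic $0$-diagram $D(\lambda)$ exist, and for every choice of the extensions, of $Q_1$ and of $\Pi$, every basic $0$-diagram $D(\lambda)$ as described is irreducible. -/

import Mathlib

open scoped ValuativeRel

universe u v

namespace SplicedDiagram

/-! ### Subgroups and characters of `GL₂` of a field -/

section Groups

/-- The group `GL₂(R)`. -/
abbrev GL2 (R : Type*) [CommRing R] : Type _ := Matrix.GeneralLinearGroup (Fin 2) R

/-- The homomorphism `GL₂(R) → GL₂(S)` induced by a ring homomorphism. -/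
abbrev mapGL {R S : Type*} [CommRing R] [CommRing S] (φ : R →+* S) : GL2 R →* GL2 S :=
  Matrix.GeneralLinearGroup.map φ

variable (k : Type*) [Field k]

/-- The subgroup `B` of upper triangular matrices of `GL₂(k)`. -/
def borel : Subgroup (GL2 k) where
  carrier := {g | g 1 0 = 0}
  one_mem' := by simp
  mul_mem' := by
    intro a b ha hb
    simp only [Set.mem_ofPred_eq] at ha hb ⊢
    simp [Matrix.mul_apply, Fin.sum_univ_two, ha, hb]
  inv_mem' := by
    intro a ha
    simp only [Set.mem_ofPred_eq] at ha ⊢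
    simp [Matrix.coe_units_inv, Matrix.inv_def, Matrix.adjugate_fin_two, ha]

/-- The subgroup `U` of upper triangular unipotent matrices of `GL₂(k)`. -/
def unip : Subgroup (GL2 k) where
  carrier := {g | g 1 0 = 0 ∧ g 0 0 = 1 ∧ g 1 1 = 1}
  one_mem' := by simp
  mul_mem' := by
    rintro a b ⟨ha, ha0, ha1⟩ ⟨hb, hb0, hb1⟩
    simp [Matrix.mul_apply, Fin.sum_univ_two, ha, hb, ha0, ha1, hb0, hb1]
  inv_mem' := by
    rintro a ⟨ha, ha0, ha1⟩
    simp [Matrix.coe_units_inv, Matrix.inv_def, Matrix.adjugate_fin_two, Matrix.det_fin_two,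
      ha, ha0, ha1]

/-- The character `(a b; 0 d) ↦ a` of `B`. -/
def borelA : borel k →* kˣ :=
  MonoidHom.toHomUnits
    { toFun := fun b => (b : GL2 k) 0 0
      map_one' := by simp
      map_mul' := by
        rintro ⟨a, ha⟩ ⟨b, hb⟩
        have hb' : b 1 0 = 0 := hb
        simp [Matrix.mul_apply, Fin.sum_univ_two, hb'] }

/-- The character `(a b; 0 d) ↦ d` of `B`. -/
def borelD : borel k →* kˣ :=
  MonoidHom.toHomUnits
    { toFun := fun b => (b : GL2 k) 1 1
      map_one' := by simp
      map_mul' := by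
        rintro ⟨a, ha⟩ ⟨b, hb⟩
        have ha' : a 1 0 = 0 := ha
        simp [Matrix.mul_apply, Fin.sum_univ_two, ha'] }

/-- The homomorphism `(a, d) ↦ (a 0; 0 d)`. -/
def torus : kˣ × kˣ →* borel k where
  toFun t :=
    ⟨⟨!![(t.1 : k), 0; 0, (t.2 : k)], !![((t.1⁻¹ : kˣ) : k), 0; 0, ((t.2⁻¹ : kˣ) : k)],
      by simp [Matrix.one_fin_two], by simp [Matrix.one_fin_two]⟩, by simp [borel]⟩
  map_one' := by
    apply Subtype.ext
    apply Units.ext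
    simp [Matrix.one_fin_two]
  map_mul' := by
    intro s t
    apply Subtype.ext
    apply Units.ext
    simp

variable {k}

/-- For a character `χ` of `B`, the character `χ^s : (a b; 0 d) ↦ χ(d 0; 0 a)`. -/
def conjChar {M : Type*} [MulOneClass M] (χ : borel k →* M) : borel k →* M :=
  χ.comp ((torus k).comp ((borelD k).prod (borelA k)))

end Groups

/-! ### General notions on representations -/

section Reps

variable {𝔽 : Type*} [Field 𝔽] {H : Type*} [Group H] {V : Type*} [AddCommGroup V] [Module 𝔽 V]

/-- The socle: the sum of all irreducible subrepresentations. -/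
def socle (ρ : Representation 𝔽 H V) : Submodule 𝔽 V :=
  sSup {W | ∃ S : Subrepresentation ρ, IsAtom S ∧ S.toSubmodule = W}

/-- The radical: the intersection of all maximal proper subrepresentations. -/
def radical (ρ : Representation 𝔽 H V) : Submodule 𝔽 V :=
  sInf {W | ∃ S : Subrepresentation ρ, IsCoatom S ∧ S.toSubmodule = W}

theorem radical_le_comap (ρ : Representation 𝔽 H V) (g : H) :
    radical ρ ≤ (radical ρ).comap (ρ g) := by
  intro x hx
  simp only [radical, Submodule.mem_comap, Submodule.mem_sInf] at hx ⊢
  rintro W ⟨S, hS, rfl⟩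
  exact S.apply_mem_toSubmodule g (hx _ ⟨S, hS, rfl⟩)

/-- The cosocle `V ⧸ rad V` (for `V` of finite length the largest semisimple quotient). -/
def cosocle (ρ : Representation 𝔽 H V) : Representation 𝔽 H (V ⧸ radical ρ) :=
  ρ.quotient (radical ρ) (radical_le_comap ρ)

/-- The vectors fixed by a subgroup. -/
noncomputable def fixedBy (ρ : Representation 𝔽 H V) (J : Subgroup H) : Submodule 𝔽 V :=
  Representation.invariants (ρ.comp J.subtype)

/-- The `χ`-isotypic component for a character `χ` of a subgroup `J`. -/
def isotypic (ρ : Representation 𝔽 H V) (J : Subgroup H) (χ : J →* 𝔽ˣ) : Submodule 𝔽 V where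
  carrier := {x | ∀ b : J, ρ b x = (χ b : 𝔽) • x}
  zero_mem' := by simp
  add_mem' := by
    intro x y hx hy b
    simp [hx b, hy b]
  smul_mem' := by
    intro c x hx b
    simp [hx b, smul_comm c]

/-- Product of a family of representations. -/
def piRep {ι : Type*} {V : ι → Type*} [∀ i, AddCommGroup (V i)] [∀ i, Module 𝔽 (V i)]
    (ρ : ∀ i, Representation 𝔽 H (V i)) : Representation 𝔽 H (∀ i, V i) where
  toFun g := LinearMap.pi fun i => (ρ i g).comp (LinearMap.proj i)
  map_one' := by
    ext
    simp
  map_mul' := by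
    intro a b
    ext
    simp

end Reps

/-- A non-split extension `0 → σ → E → τ → 0` of representations of `H`. -/
structure NonsplitExtension {𝔽 : Type v} [Field 𝔽] {H : Type*} [Monoid H]
    {V W : Type v} [AddCommGroup V] [Module 𝔽 V] [AddCommGroup W] [Module 𝔽 W]
    (σ : Representation 𝔽 H V) (τ : Representation 𝔽 H W) where
  E : Type v
  [addCommGroup : AddCommGroup E]
  [module : Module 𝔽 E]
  rep : Representation 𝔽 H E
  incl : Representation.IntertwiningMap σ rep
  proj : Representation.IntertwiningMap rep τ
  incl_injective : Function.Injective incl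
  proj_surjective : Function.Surjective proj
  exact : Function.Exact incl proj
  nonsplit : ¬ ∃ s : Representation.IntertwiningMap τ rep, ∀ x, proj (s x) = x

attribute [instance] NonsplitExtension.addCommGroup NonsplitExtension.module

/-! ### Weights -/

section Weights

/-- The index `(r, m)` of the weight `(r₀, …, r_{f-1}) ⊗ det ^ m`. -/
structure Weight (f : ℕ) where
  deg : Fin f → ℕ
  tw : ℤ

/-- The algebra endomorphism of `𝔽[X₀, X₁]` given by `X_j ↦ ∑ i, g i j • X_i`. -/
noncomputable def symHom {𝔽 : Type*} [Field 𝔽] (g : GL2 𝔽) :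
    MvPolynomial (Fin 2) 𝔽 →ₐ[𝔽] MvPolynomial (Fin 2) 𝔽 :=
  MvPolynomial.aeval fun j => ∑ i : Fin 2, MvPolynomial.C (g i j) * MvPolynomial.X i

theorem symHom_one {𝔽 : Type*} [Field 𝔽] : symHom (1 : GL2 𝔽) = AlgHom.id 𝔽 _ := by
  apply MvPolynomial.algHom_ext
  intro j
  fin_cases j <;> simp [symHom]

theorem symHom_mul {𝔽 : Type*} [Field 𝔽] (g h : GL2 𝔽) :
    symHom (g * h) = (symHom g).comp (symHom h) := by
  apply MvPolynomial.algHom_ext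
  intro j
  simp [symHom, Matrix.mul_apply, Fin.sum_univ_two, MvPolynomial.algHom_C,
    MvPolynomial.algebraMap_eq]
  ring

theorem symHom_mem {𝔽 : Type*} [Field 𝔽] (g : GL2 𝔽) (r : ℕ) :
    ∀ P ∈ MvPolynomial.homogeneousSubmodule (Fin 2) 𝔽 r,
      (symHom g).toLinearMap P ∈ MvPolynomial.homogeneousSubmodule (Fin 2) 𝔽 r := by
  intro P hP
  rw [MvPolynomial.mem_homogeneousSubmodule] at hP ⊢
  have := hP.aeval (fun j : Fin 2 => ∑ i : Fin 2, MvPolynomial.C (g i j) * MvPolynomial.X i)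
    (n := 1) (fun j => MvPolynomial.IsHomogeneous.sum _ _ _ fun i _ =>
      MvPolynomial.isHomogeneous_C_mul_X _ _)
  simpa [symHom] using this

/-- `Sym ^ r 𝔽²`, as the space of homogeneous polynomials of degree `r` in the two standard basis
vectors `X₀`, `X₁`, on which `g` acts by `X_j ↦ ∑ i, g i j • X_i`. -/
noncomputable def symRep (𝔽 : Type*) [Field 𝔽] (r : ℕ) :
    Representation 𝔽 (GL2 𝔽) (MvPolynomial.homogeneousSubmodule (Fin 2) 𝔽 r) where
  toFun g := (symHom g).toLinearMap.restrict (symHom_mem g r)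
  map_one' := by
    apply LinearMap.ext
    intro P
    apply Subtype.ext
    simp [symHom_one]
  map_mul' := by
    intro g h
    apply LinearMap.ext
    intro P
    apply Subtype.ext
    simp [symHom_mul]

/-- The space `⨂_j Sym ^ {r_j} 𝔽²` underlying the weight `w`. -/
def Weight.Space (𝔽 : Type v) [Field 𝔽] {f : ℕ} (w : Weight f) : Type v :=
  PiTensorProduct 𝔽 fun j : Fin f => MvPolynomial.homogeneousSubmodule (Fin 2) 𝔽 (w.deg j)

noncomputable instance (𝔽 : Type v) [Field 𝔽] {f : ℕ} (w : Weight f) :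
    AddCommGroup (w.Space 𝔽) :=
  inferInstanceAs (AddCommGroup (PiTensorProduct 𝔽 fun j : Fin f =>
    MvPolynomial.homogeneousSubmodule (Fin 2) 𝔽 (w.deg j)))

noncomputable instance (𝔽 : Type v) [Field 𝔽] {f : ℕ} (w : Weight f) :
    Module 𝔽 (w.Space 𝔽) :=
  inferInstanceAs (Module 𝔽 (PiTensorProduct 𝔽 fun j : Fin f =>
    MvPolynomial.homogeneousSubmodule (Fin 2) 𝔽 (w.deg j)))

variable (p : ℕ) [Fact p.Prime] (k : Type u) [Field k] [CharP k p] (𝔽 : Type v) [Field 𝔽]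
  [Algebra k 𝔽]

/-- The operator `⨂_j Sym ^ {r_j}(Φ ^ j (g))`. -/
noncomputable def Weight.tensorOp {f : ℕ} (w : Weight f) (g : GL2 k) : Module.End 𝔽 (w.Space 𝔽) :=
  (PiTensorProduct.map fun j : Fin f =>
      symRep 𝔽 (w.deg j) (mapGL ((algebraMap k 𝔽).comp (iterateFrobenius k p j)) g) :
    (PiTensorProduct 𝔽 fun j : Fin f => MvPolynomial.homogeneousSubmodule (Fin 2) 𝔽 (w.deg j)) →ₗ[𝔽]
      PiTensorProduct 𝔽 fun j : Fin f => MvPolynomial.homogeneousSubmodule (Fin 2) 𝔽 (w.deg j))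

theorem Weight.tensorOp_one {f : ℕ} (w : Weight f) : w.tensorOp p k 𝔽 1 = 1 := by
  unfold Weight.tensorOp
  simp only [map_one]
  exact PiTensorProduct.map_one

theorem Weight.tensorOp_mul {f : ℕ} (w : Weight f) (g h : GL2 k) :
    w.tensorOp p k 𝔽 (g * h) = w.tensorOp p k 𝔽 g * w.tensorOp p k 𝔽 h := by
  unfold Weight.tensorOp
  simp only [map_mul]
  exact PiTensorProduct.map_mul _ _

/-- The representation `(⨂_j Sym ^ {r_j} 𝔽² ∘ Φ ^ j) ⊗ det ^ m` of `GL₂(k)`, with `Φ` induced by the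
Frobenius `x ↦ x ^ p` of `k`. -/
noncomputable def Weight.rep {f : ℕ} (w : Weight f) :
    Representation 𝔽 (GL2 k) (w.Space 𝔽) where
  toFun g := ((mapGL (algebraMap k 𝔽) g).det ^ w.tw : 𝔽ˣ).val • w.tensorOp p k 𝔽 g
  map_one' := by
    simp [Weight.tensorOp_one]
  map_mul' := by
    intro g h
    simp only [map_mul, mul_zpow, Weight.tensorOp_mul, Units.val_mul]
    rw [smul_mul_smul_comm]

/-- The character `χ(w) : (a b; 0 d) ↦ a ^ r (a d) ^ m` of `B`, where `r = ∑ j, r_j p ^ j`. -/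
noncomputable def Weight.chi {f : ℕ} (w : Weight f) : borel k →* 𝔽ˣ :=
  (Units.map (algebraMap k 𝔽).toMonoidHom).comp
    (borelA k ^ (∑ j : Fin f, w.deg j * p ^ (j : ℕ)) * (borelA k * borelD k) ^ w.tw)

/-- The index of the weight `σ^{[s]} = (p-1-r₀, …, p-1-r_{f-1}) ⊗ det ^ {m + r}`. -/
def Weight.conj {f : ℕ} (w : Weight f) : Weight f where
  deg j := p - 1 - w.deg j
  tw := w.tw + ∑ j : Fin f, (w.deg j : ℤ) * (p : ℤ) ^ (j : ℕ)

end Weights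

/-! ### The weights of the two cyclic modules -/

section Cyclic

open Polynomial

variable (p f : ℕ) [NeZero f]

/-- The action of the cyclic permutation `g` on `f`-tuples: `(g μ)_j = μ_{j+1}`. -/
def shift {α : Type*} (x : Fin f → α) : Fin f → α := fun j => x (j + 1)

/-- The tuple `μ = (x - 1, p - 2 - x, p - 1 - x, …, p - 1 - x)`. -/
noncomputable def mu : Fin f → ℤ[X] := fun j =>
  if (j : ℕ) = 0 then X - 1
  else if (j : ℕ) = 1 then C ((p : ℤ) - 2) - X
  else C ((p : ℤ) - 1) - X

/-- The tuple `μ^{(n)} = g^{n-1} μ ∘ ⋯ ∘ g μ ∘ μ`. -/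
noncomputable def muIter : ℕ → Fin f → ℤ[X]
  | 0 => fun _ => X
  | n + 1 => fun j => ((shift f)^[n] (mu p f) j).comp (muIter n j)

open Classical in
/-- The integer `e(μ)(x₀, …, x_{f-1})`. It is used only for cyclic permutations of `mu`, for which
the numerator is even. -/
noncomputable def eExp (nu : Fin f → ℤ[X]) (x : Fin f → ℤ) : ℤ :=
  if nu (Fin.rev 0) = X ∨ nu (Fin.rev 0) = X - 1 then
    (∑ j : Fin f, (p : ℤ) ^ (j : ℕ) * (x j - (nu j).eval (x j))) / 2
  else
    ((p : ℤ) ^ f - 1 + ∑ j : Fin f, (p : ℤ) ^ (j : ℕ) * (x j - (nu j).eval (x j))) / 2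

/-- The length `l` of the two cyclic modules. -/
def len : ℕ := if Odd f then f else 2 * f

variable {f}

/-- The tuple `(g^c μ^{(n)})(r)`. -/
noncomputable def cycVal (r : Fin f → ℕ) (c n : ℕ) (j : Fin f) : ℤ :=
  ((shift f)^[c] (muIter p f n) j).eval (r j : ℤ)

/-- The weight `σ_n` (for `c = 0`) or `σ'_n` (for `c = 1`). If `1 ≤ r_j ≤ p - 3` then the
integers `cycVal p r c n j` with `n ≤ l` lie between `0` and `p - 2`. -/
noncomputable def cycWeight (r : Fin f → ℕ) (c n : ℕ) : Weight f where
  deg j := (cycVal p r c n j).toNat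
  tw := ∑ i ∈ Finset.range n, eExp p f ((shift f)^[i + c] (mu p f)) (cycVal p r c i)

/-- The weight `σ = σ_0 = σ_l = σ'_0 = σ'_l`. -/
def baseWeight (r : Fin f → ℕ) : Weight f := ⟨r, 0⟩

end Cyclic

/-! ### The spliced module -/

section Spliced

variable (p : ℕ) [Fact p.Prime] {f : ℕ} [NeZero f] (k : Type u) [Field k] [CharP k p]
  (𝔽 : Type v) [Field 𝔽] [Algebra k 𝔽] (r : Fin f → ℕ)

/-- The extensions which make up the cyclic modules `C` (for `c = 0`) and `C'` (for `c = 1`). -/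
structure CyclicPair where
  /-- `E(σ_1, σ^{[s]})` -/
  first (c : Fin 2) : NonsplitExtension (Weight.rep p k 𝔽 (cycWeight p r c 1))
    (Weight.rep p k 𝔽 (Weight.conj p (baseWeight r)))
  /-- `E(σ_{n+2}, σ_{n+1}^{[s]})` for `0 ≤ n < l - 2` -/
  mid (c : Fin 2) (n : Fin (len f - 2)) : NonsplitExtension (Weight.rep p k 𝔽 (cycWeight p r c (n + 2)))
    (Weight.rep p k 𝔽 (Weight.conj p (cycWeight p r c (n + 1))))
  /-- `E(σ, σ_{l-1}^{[s]})` -/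
  last (c : Fin 2) : NonsplitExtension (Weight.rep p k 𝔽 (baseWeight r))
    (Weight.rep p k 𝔽 (Weight.conj p (cycWeight p r c (len f - 1))))

namespace CyclicPair

variable {p k 𝔽 r} (S : CyclicPair p k 𝔽 r)

/-- The space of the cyclic module `C` (for `c = 0`) or `C'` (for `c = 1`). -/
abbrev Cyc (c : Fin 2) : Type v :=
  (S.first c).E × (∀ n : Fin (len f - 2), (S.mid c n).E) × (S.last c).E

/-- The action of `Γ = GL₂(k)` on `C` or `C'`. -/
noncomputable def cycRep (c : Fin 2) : Representation 𝔽 (GL2 k) (S.Cyc c) :=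
  (S.first c).rep.prod ((piRep fun n => (S.mid c n).rep).prod (S.last c).rep)

/-- The representation `C ⊕ C'`. -/
noncomputable def sumRep : Representation 𝔽 (GL2 k) (S.Cyc 0 × S.Cyc 1) :=
  (S.cycRep 0).prod (S.cycRep 1)

/-- The diagonal embedding of `σ` into the socle of `C ⊕ C'`. -/
noncomputable def iotaSigma : Weight.Space 𝔽 (baseWeight r) →ₗ[𝔽] S.Cyc 0 × S.Cyc 1 :=
  LinearMap.prod
    (LinearMap.prod 0 (LinearMap.prod 0 (S.last 0).incl.toLinearMap))
    (LinearMap.prod 0 (LinearMap.prod 0 (S.last 1).incl.toLinearMap))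

/-- The vectors of `C ⊕ C'` whose images in the two copies of `σ^{[s]}` in the cosocle agree. -/
noncomputable def fiber : Submodule 𝔽 (S.Cyc 0 × S.Cyc 1) :=
  LinearMap.eqLocus
    ((S.first 0).proj.toLinearMap ∘ₗ LinearMap.fst 𝔽 _ _ ∘ₗ LinearMap.fst 𝔽 _ _)
    ((S.first 1).proj.toLinearMap ∘ₗ LinearMap.fst 𝔽 _ _ ∘ₗ LinearMap.snd 𝔽 _ _)

theorem range_le_comap (g : GL2 k) :
    LinearMap.range S.iotaSigma ≤ (LinearMap.range S.iotaSigma).comap (S.sumRep g) := by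
  rintro _ ⟨x, rfl⟩
  refine ⟨Weight.rep p k 𝔽 (baseWeight r) g x, ?_⟩
  have h0 := (S.last 0).incl.isIntertwining _ _ g x
  have h1 := (S.last 1).incl.isIntertwining _ _ g x
  simp [iotaSigma, sumRep, cycRep, h0, h1]

/-- The representation `(C ⊕ C') ⧸ ι_σ(σ)`. -/
noncomputable def quotRep :
    Representation 𝔽 (GL2 k) ((S.Cyc 0 × S.Cyc 1) ⧸ LinearMap.range S.iotaSigma) :=
  S.sumRep.quotient _ S.range_le_comap

theorem fiber_le_comap (g : GL2 k) : S.fiber ≤ S.fiber.comap (S.sumRep g) := by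
  intro x hx
  have hx' : (S.first 0).proj x.1.1 = (S.first 1).proj x.2.1 := hx
  change (S.first 0).proj ((S.first 0).rep g x.1.1) = (S.first 1).proj ((S.first 1).rep g x.2.1)
  rw [(S.first 0).proj.isIntertwining, (S.first 1).proj.isIntertwining, hx']

/-- The spliced module as a subspace of `(C ⊕ C') ⧸ ι_σ(σ)`: the classes whose image in the cosocle
of `C ⊕ C'` lies in the sum of the diagonal copy of `σ^{[s]}` and all the other summands. -/
noncomputable def spliced : Submodule 𝔽 ((S.Cyc 0 × S.Cyc 1) ⧸ LinearMap.range S.iotaSigma) :=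
  S.fiber.map (LinearMap.range S.iotaSigma).mkQ

theorem spliced_le_comap (g : GL2 k) : S.spliced ≤ S.spliced.comap (S.quotRep g) := by
  rintro _ ⟨x, hx, rfl⟩
  exact ⟨S.sumRep g x, S.fiber_le_comap g hx, rfl⟩

/-- The underlying space of the spliced module `D₀`. -/
def D0 : Type v := S.spliced

noncomputable instance : AddCommGroup S.D0 := inferInstanceAs (AddCommGroup S.spliced)

noncomputable instance : Module 𝔽 S.D0 := inferInstanceAs (Module 𝔽 S.spliced)

/-- The action of `Γ = GL₂(k)` on the spliced module `D₀`. -/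
noncomputable def rep0 : Representation 𝔽 (GL2 k) S.D0 :=
  S.quotRep.subrepresentation S.spliced S.spliced_le_comap

end CyclicPair

end Spliced

section PiOperator

variable {k : Type u} [Field k] {𝔽 : Type v} [Field 𝔽] {V : Type*} [AddCommGroup V] [Module 𝔽 V]
  (ρ : Representation 𝔽 (GL2 k) V)

/-- `D₁ = D₀^U`, for a representation `D₀` of `GL₂(k)`. -/
noncomputable def D1 : Submodule 𝔽 V := fixedBy ρ (unip k)

/-- `S₁ = (soc D₀)^U`. -/
noncomputable def S1 : Submodule 𝔽 V := socle ρ ⊓ D1 ρ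

/-- `S₁^χ`. -/
noncomputable def S1chi (χ : borel k →* 𝔽ˣ) : Submodule 𝔽 V := S1 ρ ⊓ isotypic ρ (borel k) χ

/-- The operator `Π` on `D₁`. The decomposition `D₁ = S₁ ⊕ Q₁` of `B`-representations, where `Q₁` is
a subspace of `D₁` which the projection to the cosocle identifies with `(cosoc D₀)^U`, is part of
the data. -/
structure PiAction where
  Q1 : Submodule 𝔽 V
  sup_eq : S1 ρ ⊔ Q1 = D1 ρ
  inf_eq : S1 ρ ⊓ Q1 = ⊥
  Q1_stable : ∀ b ∈ borel k, ∀ x ∈ Q1, ρ b x ∈ Q1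
  Q1_inf : Q1 ⊓ radical ρ = ⊥
  Q1_map : Q1.map (radical ρ).mkQ = fixedBy (cosocle ρ) (unip k)
  op : D1 ρ →ₗ[𝔽] D1 ρ
  op_op : ∀ x, op (op x) = x
  /-- `Π` maps `S₁^χ` onto `Q₁^{χ^s}` whenever `S₁^χ ≠ 0`. -/
  op_map : ∀ χ : borel k →* 𝔽ˣ, S1chi ρ χ ≠ ⊥ →
    (((S1chi ρ χ).comap (D1 ρ).subtype).map op).map (D1 ρ).subtype =
      Q1 ⊓ isotypic ρ (borel k) (conjChar χ)

end PiOperator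

/-! ### Basic `0`-diagrams over a non-archimedean local field -/

section Diagrams

variable (F : Type u) [Field F] [ValuativeRel F]

/-- The inclusion `GL₂(𝒪_F) → GL₂(F)`. -/
noncomputable def inclK : GL2 𝒪[F] →* GL2 F := mapGL (algebraMap 𝒪[F] F)

/-- The reduction `GL₂(𝒪_F) → Γ = GL₂(𝓀_F)`. -/
noncomputable def redK : GL2 𝒪[F] →* GL2 𝓀[F] := mapGL (IsLocalRing.residue 𝒪[F])

/-- `K = GL₂(𝒪_F)` as a subgroup of `GL₂(F)`. -/
noncomputable def groupK : Subgroup (GL2 F) := (inclK F).range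

/-- The centre `Z` of `GL₂(F)`. -/
def groupZ : Subgroup (GL2 F) := Subgroup.center (GL2 F)

/-- The Iwahori subgroup `I`. -/
noncomputable def groupI : Subgroup (GL2 F) := ((borel 𝓀[F]).comap (redK F)).map (inclK F)

/-- The pro-`p` Iwahori subgroup `I(1)`. -/
noncomputable def groupI1 : Subgroup (GL2 F) := ((unip 𝓀[F]).comap (redK F)).map (inclK F)

/-- The group `KZ`. -/
noncomputable def groupKZ : Subgroup (GL2 F) := groupK F ⊔ groupZ F

variable {F}

/-- `ϖ` is a uniformizer of `F`. -/
def IsUniformizer (ϖ : Fˣ) : Prop := ∃ h : (ϖ : F) ∈ 𝒪[F], Irreducible (⟨(ϖ : F), h⟩ : 𝒪[F])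

/-- The matrix `Π = (0 1; ϖ 0)`. -/
def matPi (ϖ : Fˣ) : GL2 F :=
  ⟨!![0, 1; (ϖ : F), 0], !![0, ((ϖ⁻¹ : Fˣ) : F); 1, 0],
    by simp [Matrix.one_fin_two], by simp [Matrix.one_fin_two]⟩

/-- The scalar matrix `ϖ`. -/
def matScalar (ϖ : Fˣ) : GL2 F :=
  ⟨!![(ϖ : F), 0; 0, (ϖ : F)], !![((ϖ⁻¹ : Fˣ) : F), 0; 0, ((ϖ⁻¹ : Fˣ) : F)],
    by simp [Matrix.one_fin_two], by simp [Matrix.one_fin_two]⟩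

/-- The subgroup `N` of `GL₂(F)` generated by `I` and `Π` (it is the normalizer of `I`). -/
noncomputable def groupN (ϖ : Fˣ) : Subgroup (GL2 F) := Subgroup.closure (groupI F ∪ {matPi ϖ})

theorem inclK_mem (g : GL2 𝒪[F]) : inclK F g ∈ groupKZ F :=
  Subgroup.mem_sup_left ⟨g, rfl⟩

theorem matPi_mem (ϖ : Fˣ) : matPi ϖ ∈ groupN ϖ :=
  Subgroup.subset_closure (Set.mem_union_right _ rfl)

/-- Smoothness of a representation of a subgroup of `GL₂(F)`: stabilizers of vectors are open. -/
def IsSmooth [TopologicalSpace F] {H : Subgroup (GL2 F)} {𝔽 V : Type*} [Field 𝔽] [AddCommGroup V]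
    [Module 𝔽 V] (ρ : Representation 𝔽 H V) : Prop :=
  ∀ x : V, IsOpen {g : H | ρ g x = x}

/-- A basic `0`-diagram `(D₀, D₁, can)` over `𝔽`: smooth representations `D₀` of `KZ` and `D₁` of `N`
on which `ϖ` acts trivially, and an injective `IZ`-equivariant map `can : D₁ → D₀` with
image `D₀^{I(1)}`. -/
structure BasicDiagram [TopologicalSpace F] (ϖ : Fˣ) (𝔽 : Type v) [Field 𝔽] where
  V0 : Type v
  V1 : Type v
  [addCommGroup0 : AddCommGroup V0]
  [module0 : Module 𝔽 V0]
  [addCommGroup1 : AddCommGroup V1]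
  [module1 : Module 𝔽 V1]
  rep0 : Representation 𝔽 (groupKZ F) V0
  rep1 : Representation 𝔽 (groupN ϖ) V1
  smooth0 : IsSmooth rep0
  smooth1 : IsSmooth rep1
  scalar0 : ∀ h : matScalar ϖ ∈ groupKZ F, rep0 ⟨matScalar ϖ, h⟩ = 1
  scalar1 : ∀ h : matScalar ϖ ∈ groupN ϖ, rep1 ⟨matScalar ϖ, h⟩ = 1
  can : V1 →ₗ[𝔽] V0
  can_injective : Function.Injective can
  can_range : ∀ x : V0, x ∈ LinearMap.range can ↔
    ∀ g : groupKZ F, (g : GL2 F) ∈ groupI1 F → rep0 g x = x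
  can_equivariant : ∀ (g : GL2 F) (h0 : g ∈ groupKZ F) (h1 : g ∈ groupN ϖ),
    g ∈ groupI F ⊔ groupZ F → ∀ x, can (rep1 ⟨g, h1⟩ x) = rep0 ⟨g, h0⟩ (can x)

attribute [instance] BasicDiagram.addCommGroup0 BasicDiagram.module0 BasicDiagram.addCommGroup1
  BasicDiagram.module1

/-- A basic diagram is irreducible if it is nonzero and has no basic subdiagrams `(W₀, W₁)` (that is,
`W₀` is `KZ`-stable, `W₁` is `N`-stable and `can` identifies `W₁` with `W₀^{I(1)}`) other than
zero and itself. -/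
def BasicDiagram.IsIrreducible [TopologicalSpace F] {ϖ : Fˣ} {𝔽 : Type v} [Field 𝔽]
    (D : BasicDiagram ϖ 𝔽) : Prop :=
  Nontrivial D.V0 ∧
    ∀ (W0 : Submodule 𝔽 D.V0) (W1 : Submodule 𝔽 D.V1),
      (∀ g, ∀ x ∈ W0, D.rep0 g x ∈ W0) →
      (∀ g, ∀ x ∈ W1, D.rep1 g x ∈ W1) →
      W1.map D.can = W0 ⊓ LinearMap.range D.can →
      W0 = ⊥ ∨ W0 = ⊤

/-- `D` is the diagram `D(λ)`, its space `D₀(∞)` being identified by `φ` with `⨁_{i ∈ ℤ} D₀`; here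
`ι_i(x)` is `Finsupp.single i x`. -/
structure IsDLambda [TopologicalSpace F] {p : ℕ} [Fact p.Prime] {f : ℕ} [NeZero f]
    [CharP 𝓀[F] p] {𝔽 : Type v} [Field 𝔽] [Algebra 𝓀[F] 𝔽] {r : Fin f → ℕ}
    {S : CyclicPair p 𝓀[F] 𝔽 r} (P : PiAction S.rep0) (lam : ℤ → 𝔽ˣ) {ϖ : Fˣ}
    (D : BasicDiagram ϖ 𝔽) (φ : D.V0 ≃ₗ[𝔽] (ℤ →₀ S.D0)) : Prop where
  /-- `K` acts componentwise through `K ↠ Γ`. -/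
  K_action : ∀ (g : GL2 𝒪[F]) (x : D.V0) (i : ℤ),
    φ (D.rep0 ⟨inclK F g, inclK_mem g⟩ x) i = S.rep0 (redK F g) (φ x i)
  /-- `Π v_i = λ_i (Π v)_i` for `v ∈ S₁^{χ(σ)}`. -/
  Pi_base : ∀ (i : ℤ) (v : D1 S.rep0) (w : D.V1),
    (v : S.D0) ∈ S1chi S.rep0 (Weight.chi p 𝓀[F] 𝔽 (baseWeight r)) →
    φ (D.can w) = Finsupp.single i (v : S.D0) →
    φ (D.can (D.rep1 ⟨matPi ϖ, matPi_mem ϖ⟩ w)) =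
      Finsupp.single i ((lam i : 𝔽) • (P.op v : S.D0))
  /-- `Π v_i = (Π v)_{i-1}` for `v ∈ S₁^{χ(σ_1)}`. -/
  Pi_down : ∀ (i : ℤ) (v : D1 S.rep0) (w : D.V1),
    (v : S.D0) ∈ S1chi S.rep0 (Weight.chi p 𝓀[F] 𝔽 (cycWeight p r 0 1)) →
    φ (D.can w) = Finsupp.single i (v : S.D0) →
    φ (D.can (D.rep1 ⟨matPi ϖ, matPi_mem ϖ⟩ w)) = Finsupp.single (i - 1) (P.op v : S.D0)
  /-- `Π v_i = (Π v)_{i+1}` for `v ∈ S₁^{χ(σ'_1)}`. -/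
  Pi_up : ∀ (i : ℤ) (v : D1 S.rep0) (w : D.V1),
    (v : S.D0) ∈ S1chi S.rep0 (Weight.chi p 𝓀[F] 𝔽 (cycWeight p r 1 1)) →
    φ (D.can w) = Finsupp.single i (v : S.D0) →
    φ (D.can (D.rep1 ⟨matPi ϖ, matPi_mem ϖ⟩ w)) = Finsupp.single (i + 1) (P.op v : S.D0)
  /-- `Π v_i = (Π v)_i` for `v ∈ S₁^χ` with `χ` among `χ(σ_n)`, `χ(σ'_n)`, `2 ≤ n ≤ l - 1`. -/
  Pi_other : ∀ (c : Fin 2) (n : ℕ), 2 ≤ n → n ≤ len f - 1 →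
    ∀ (i : ℤ) (v : D1 S.rep0) (w : D.V1),
    (v : S.D0) ∈ S1chi S.rep0 (Weight.chi p 𝓀[F] 𝔽 (cycWeight p r c n)) →
    φ (D.can w) = Finsupp.single i (v : S.D0) →
    φ (D.can (D.rep1 ⟨matPi ϖ, matPi_mem ϖ⟩ w)) = Finsupp.single i (P.op v : S.D0)

end Diagrams

end SplicedDiagram

/-! Irreducibility. The weights `σ`, `σ_n`, `σ'_n` of the socle of `D₀` have pairwise distinct
characters (`socW_chi_injective`), and the cosocle consists of their `[s]`-conjugates, so both
layers are multiplicity free. Let `W` be a nonzero subrepresentation of `⨁_ℤ D₀` coming from a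
subdiagram. For a socle constituent `j` with highest weight vector `v_j`, let `A_j` be the space of
finitely supported `w : ℤ → 𝔽` with `∑ w_i (v_j)_i ∈ W`. The operator `Π` turns such a family into a
family of multiples of one vector lying over the conjugate constituent of the cosocle. Since the
extensions do not split, the `Γ`-module generated by it contains every socle constituent glued below
(`Layers.single_mem_of_edge`). Thus a shift with nonzero weights maps `A_j` into `A_{j'}` for each
constituent `j'` which follows `j` in one of the two cycles. A full turn through `C` makes `A_σ`
stable under `e_i ↦ λ_i e_{i-1}`, a full turn through `C'` under `e_i ↦ λ_i e_{i+1}`. Some `A_j` is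
nonzero (`Layers.exists_coeffs_ne_bot`), hence so is `A_σ`.

It remains to see that the two weighted shifts act irreducibly (`eq_top_of_wshift_mem`). Their
composite is diagonal with eigenvalues `λ_i λ_{i-1}`. On the support of a nonzero vector of `A_σ`
with as few coefficients as possible, and on all its translates, these eigenvalues are constant. If
the support contained two indices at distance `d`, the ratios `λ_{m+d}/λ_m` would alternate between
a unit and its inverse. As units of an algebraic extension of a finite field have finite order, this
forces `λ_m = λ_0` for some `m ≠ 0`. So the support is a single index, and the shifts produce all of
`𝔽^(ℤ)`. A further turn through the cycles gives `A_j = ⊤` for all `j`, and `W` is everything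
(`Layers.eq_bot_or_eq_top`).

Existence. The operator `Π` requires that the highest weight vectors of the cosocle lift to
`U`-invariant eigenvectors of `B`, so the extensions are constructed explicitly
(`ExtPair.exists_extension`). A weight `τ` is the image of the measures on `k²` under `δ_(x,y) ↦ ⊗
(x^(p^j) X₀ + y^(p^j) X₁)^(r_j)`. A second map, to the space of `σ`, is equivariant only on the
kernel of the first. Both together present an extension in which the image of `δ_(1,0)` is the
required lift. Consecutive weights of the cycles fit this pattern (`extPair_cycWeight`). In the
basis of `D₁` made of highest weight vectors and lifts, `Π` is an exchange of coordinates
(`Layers.Lifts.exists_piAction`). The actions of `KZ` and `N` are obtained from generators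
(`exists_monoidHom`).

The combinatorial input is that the twist of `σ_n` modulo `p^f - 1` has explicit base `p` digits
(`tw_modEq`). These digits show that the cycles close after `l` steps and that no weight is repeated
before. -/

namespace SplicedDiagram

set_option linter.unusedSectionVars false

/-! ### Generators of `GL₂` and the Bruhat decomposition -/

section Elements

/-- The upper triangular unipotent matrix `(1 t; 0 1)`. -/
def upper {R : Type*} [CommRing R] (t : R) : GL2 R :=
  ⟨!![1, t; 0, 1], !![1, -t; 0, 1], by simp [Matrix.one_fin_two], by simp [Matrix.one_fin_two]⟩

/-- The permutation matrix `(0 1; 1 0)`. -/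
def swapMat (R : Type*) [CommRing R] : GL2 R :=
  ⟨!![0, 1; 1, 0], !![0, 1; 1, 0], by simp [Matrix.one_fin_two], by simp [Matrix.one_fin_two]⟩

/-- The diagonal matrix `(a 0; 0 d)`. -/
def diagMat {R : Type*} [CommRing R] (a d : Rˣ) : GL2 R :=
  ⟨!![(a : R), 0; 0, (d : R)], !![((a⁻¹ : Rˣ) : R), 0; 0, ((d⁻¹ : Rˣ) : R)],
      by simp [Matrix.one_fin_two], by simp [Matrix.one_fin_two]⟩

variable {R S : Type*} [CommRing R] [CommRing S] (φ : R →+* S)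

theorem GL2_ext {g h : GL2 R} (h00 : g 0 0 = h 0 0) (h01 : g 0 1 = h 0 1) (h10 : g 1 0 = h 1 0)
    (h11 : g 1 1 = h 1 1) : g = h := by
  apply Units.ext
  ext i j
  fin_cases i <;> fin_cases j <;> assumption

@[simp] theorem upper_apply00 (t : R) : upper t 0 0 = 1 := rfl
@[simp] theorem upper_apply01 (t : R) : upper t 0 1 = t := rfl
@[simp] theorem upper_apply10 (t : R) : upper t 1 0 = 0 := rfl
@[simp] theorem upper_apply11 (t : R) : upper t 1 1 = 1 := rfl
@[simp] theorem swapMat_apply00 : swapMat R 0 0 = 0 := rfl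
@[simp] theorem swapMat_apply01 : swapMat R 0 1 = 1 := rfl
@[simp] theorem swapMat_apply10 : swapMat R 1 0 = 1 := rfl
@[simp] theorem swapMat_apply11 : swapMat R 1 1 = 0 := rfl
@[simp] theorem diagMat_apply00 (a d : Rˣ) : diagMat a d 0 0 = a := rfl
@[simp] theorem diagMat_apply01 (a d : Rˣ) : diagMat a d 0 1 = 0 := rfl
@[simp] theorem diagMat_apply10 (a d : Rˣ) : diagMat a d 1 0 = 0 := rfl
@[simp] theorem diagMat_apply11 (a d : Rˣ) : diagMat a d 1 1 = d := rfl

@[simp] theorem mapGL_apply (g : GL2 R) (i j : Fin 2) : mapGL φ g i j = φ (g i j) := rfl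

theorem mapGL_upper (t : R) : mapGL φ (upper t) = upper (φ t) := by
  apply GL2_ext <;> simp

theorem mapGL_swapMat : mapGL φ (swapMat R) = swapMat S := by
  apply GL2_ext <;> simp

theorem mapGL_diagMat (a d : Rˣ) :
    mapGL φ (diagMat a d) = diagMat (Units.map φ.toMonoidHom a) (Units.map φ.toMonoidHom d) := by
  apply GL2_ext <;> simp

variable {k : Type*} [Field k]

theorem upper_mem_unip (t : k) : upper t ∈ unip k := ⟨rfl, rfl, rfl⟩

theorem eq_upper_of_mem_unip {g : GL2 k} (hg : g ∈ unip k) : g = upper (g 0 1) := by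
  obtain ⟨h10, h00, h11⟩ := hg
  apply GL2_ext <;> simp [h10, h00, h11]

theorem borel_eq (b : borel k) :
    (b : GL2 k) = diagMat (borelA k b) (borelD k b) *
      upper (((borelA k b)⁻¹ : kˣ) * (b : GL2 k) 0 1) := by
  have h10 : (b : GL2 k) 1 0 = 0 := b.2
  have hA : ((borelA k b : kˣ) : k) = (b : GL2 k) 0 0 := rfl
  have hD : ((borelD k b : kˣ) : k) = (b : GL2 k) 1 1 := rfl
  apply GL2_ext <;> simp [Matrix.mul_apply, Fin.sum_univ_two, h10, hA, hD]
  rw [← hA]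
  simp

theorem GL2_det_ne (g : GL2 k) : g 0 0 * g 1 1 - g 0 1 * g 1 0 ≠ 0 := by
  have := (Matrix.isUnits_det_units g).ne_zero
  rwa [Matrix.det_fin_two] at this

/-- `GL₂(k)` is generated by the upper unipotent matrices, the diagonal matrices and the
permutation matrix. -/
theorem GL2_induction {P : GL2 k → Prop} (hmul : ∀ g h, P g → P h → P (g * h))
    (hu : ∀ t, P (upper t)) (hd : ∀ a d, P (diagMat a d)) (hw : P (swapMat k)) (g : GL2 k) :
    P g := by
  have hdet := GL2_det_ne g
  by_cases h10 : g 1 0 = 0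
  · have := borel_eq ⟨g, h10⟩
    rw [show g = _ from this]
    exact hmul _ _ (hd _ _) (hu _)
  -- The big Bruhat cell: the second diagonal entry is forced to be `-det g / g 1 0`.
  · have hδ : g 0 1 - g 0 0 * g 1 1 / g 1 0 ≠ 0 := by
      intro h
      field_simp at h
      apply hdet
      linear_combination -h
    have : g = upper (g 0 0 / g 1 0) * (swapMat k * (diagMat (Units.mk0 _ h10) (Units.mk0 _ hδ) *
        upper (g 1 1 / g 1 0))) := by
      apply GL2_ext <;> simp [Matrix.mul_apply, Fin.sum_univ_two] <;> field_simp
      ring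
    rw [this]
    exact hmul _ _ (hu _) (hmul _ _ hw (hmul _ _ (hd _ _) (hu _)))

end Elements

/-! ### Symmetric powers in the monomial basis -/

section SymBasis

open MvPolynomial

variable {𝔽 : Type*} [Field 𝔽]

/-- The exponent of the monomial `X₀^(r-i) X₁^i`. -/
noncomputable def monoExp (r i : ℕ) : Fin 2 →₀ ℕ := Finsupp.single 0 (r - i) + Finsupp.single 1 i

@[simp] theorem monoExp_zero (r i : ℕ) : monoExp r i 0 = r - i := by simp [monoExp]

@[simp] theorem monoExp_one (r i : ℕ) : monoExp r i 1 = i := by simp [monoExp]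

theorem monoExp_inj {r i j : ℕ} : monoExp r i = monoExp r j ↔ i = j :=
  ⟨fun h => by simpa using DFunLike.congr_fun h 1, fun h => h ▸ rfl⟩

theorem eq_monoExp {r : ℕ} {m : Fin 2 →₀ ℕ} (h : m.degree = r) : m = monoExp r (m 1) := by
  have : m 0 + m 1 = r := by simpa [Finsupp.degree_eq_sum, Fin.sum_univ_two] using h
  ext i
  fin_cases i <;> simp
  omega

/-- The monomial `X₀^(r-i) X₁^i` as an element of `Sym ^ r`. -/
noncomputable def symMono (𝔽 : Type*) [Field 𝔽] (r : ℕ) (i : Fin (r + 1)) :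
    homogeneousSubmodule (Fin 2) 𝔽 r :=
  ⟨X 0 ^ (r - i : ℕ) * X 1 ^ (i : ℕ), by
    have h := ((isHomogeneous_X 𝔽 (0 : Fin 2)).pow (r - i : ℕ)).mul
      ((isHomogeneous_X 𝔽 (1 : Fin 2)).pow (i : ℕ))
    have e : 1 * (r - i : ℕ) + 1 * (i : ℕ) = r := by have := i.2; omega
    rwa [e] at h⟩

theorem coe_symMono (r : ℕ) (i : Fin (r + 1)) :
    (symMono 𝔽 r i : MvPolynomial (Fin 2) 𝔽) = X 0 ^ (r - i : ℕ) * X 1 ^ (i : ℕ) := rfl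

theorem mono_eq (r i : ℕ) :
    (X 0 ^ (r - i : ℕ) * X 1 ^ (i : ℕ) : MvPolynomial (Fin 2) 𝔽) = monomial (monoExp r i) 1 := by
  simp [monoExp, X_pow_eq_monomial, monomial_mul]

/-- The coordinates on `Sym ^ r` with respect to the monomials `X₀^(r-i) X₁^i`. -/
noncomputable def symEquiv (𝔽 : Type*) [Field 𝔽] (r : ℕ) :
    homogeneousSubmodule (Fin 2) 𝔽 r ≃ₗ[𝔽] (Fin (r + 1) → 𝔽) where
  toFun P i := coeff (monoExp r i) (P : MvPolynomial (Fin 2) 𝔽)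
  map_add' P Q := by ext i; simp
  map_smul' c P := by ext i; simp
  invFun c := ∑ i, c i • symMono 𝔽 r i
  left_inv P := by
    apply Subtype.ext
    ext m
    simp only [Submodule.coe_sum, Submodule.coe_smul, coeff_sum, coeff_smul, coe_symMono, mono_eq,
      coeff_monomial, smul_eq_mul, mul_ite, mul_one, mul_zero]
    by_cases hm : m.degree = r
    · have hm1 : m 1 < r + 1 := by
        have : m 0 + m 1 = r := by simpa [Finsupp.degree_eq_sum, Fin.sum_univ_two] using hm
        omega
      rw [Finset.sum_eq_single ⟨m 1, hm1⟩]
      · simp [← eq_monoExp hm]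
      · intro b _ hb
        rw [if_neg]
        intro h
        apply hb
        apply Fin.ext
        simpa using DFunLike.congr_fun h 1
      · simp
    · rw [(P.2 : IsHomogeneous _ _).coeff_eq_zero hm, Finset.sum_eq_zero]
      intro i _
      rw [if_neg]
      rintro rfl
      apply hm
      have := i.2
      simp [Finsupp.degree_eq_sum, Fin.sum_univ_two]
      omega
  right_inv c := by
    ext i
    simp only [Submodule.coe_sum, Submodule.coe_smul, coeff_sum, coeff_smul, coe_symMono, mono_eq,
      coeff_monomial, smul_eq_mul, mul_ite, mul_one, mul_zero, monoExp_inj]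
    simp [Fin.val_inj]

/-- The basis `X₀^(r-i) X₁^i` of `Sym ^ r`. -/
noncomputable def symBasis (𝔽 : Type*) [Field 𝔽] (r : ℕ) :
    Module.Basis (Fin (r + 1)) 𝔽 (homogeneousSubmodule (Fin 2) 𝔽 r) :=
  Module.Basis.ofEquivFun (symEquiv 𝔽 r)

theorem symBasis_apply (r : ℕ) (i : Fin (r + 1)) : symBasis 𝔽 r i = symMono 𝔽 r i := by
  rw [symBasis, Module.Basis.coe_ofEquivFun]
  change ∑ j, (Pi.single i 1 : Fin (r + 1) → 𝔽) j • symMono 𝔽 r j = _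
  simp [Pi.single_apply]

theorem coe_symRep (g : GL2 𝔽) (r : ℕ) (P : homogeneousSubmodule (Fin 2) 𝔽 r) :
    (symRep 𝔽 r g P : MvPolynomial (Fin 2) 𝔽) = symHom g P := rfl

theorem symHom_X (g : GL2 𝔽) (j : Fin 2) :
    symHom g (X j) = C (g 0 j) * X 0 + C (g 1 j) * X 1 := by
  simp [symHom, Fin.sum_univ_two]

theorem symRep_upper (r : ℕ) (t : 𝔽) (i : Fin (r + 1)) :
    symRep 𝔽 r (upper t) (symBasis 𝔽 r i) =
      ∑ j : Fin (r + 1), ((i : ℕ).choose j * t ^ (i - j : ℕ)) • symBasis 𝔽 r j := by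
  apply Subtype.ext
  simp only [coe_symRep, symBasis_apply, coe_symMono, map_mul, map_pow, symHom_X,
    Submodule.coe_sum, Submodule.coe_smul, upper_apply00, upper_apply01, upper_apply10,
    upper_apply11, C_1, C_0, one_mul, zero_mul, add_zero]
  rw [Fin.sum_univ_eq_sum_range (fun j => (((i : ℕ).choose j : 𝔽) * t ^ (i - j : ℕ)) •
    (X 0 ^ (r - j : ℕ) * X 1 ^ (j : ℕ) : MvPolynomial (Fin 2) 𝔽)),
    ← Finset.sum_subset (s₁ := Finset.range (i + 1)) _ _,
    add_comm (C t * X 0), add_pow, Finset.mul_sum]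
  · apply Finset.sum_congr rfl
    intro j hj
    have hj' := Finset.mem_range.1 hj
    have hi := i.2
    rw [show r - j = (r - i) + (i - j) by omega, pow_add, MvPolynomial.smul_eq_C_mul]
    simp
    ring
  · intro x hx
    have := i.2
    simp at hx ⊢
    omega
  · intro x _ hx
    have : (i : ℕ) < x := by simpa using hx
    simp [Nat.choose_eq_zero_of_lt this]

theorem symRep_diagMat (r : ℕ) (a d : 𝔽ˣ) (i : Fin (r + 1)) :
    symRep 𝔽 r (diagMat a d) (symBasis 𝔽 r i) =
      ((a : 𝔽) ^ (r - i : ℕ) * (d : 𝔽) ^ (i : ℕ)) • symBasis 𝔽 r i := by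
  apply Subtype.ext
  simp only [coe_symRep, symBasis_apply, coe_symMono, map_mul, map_pow, symHom_X,
    Submodule.coe_smul, MvPolynomial.smul_eq_C_mul, diagMat_apply00, diagMat_apply01,
    diagMat_apply10, diagMat_apply11, C_0, zero_mul, add_zero, zero_add]
  ring

theorem symRep_swapMat (r : ℕ) (i : Fin (r + 1)) :
    symRep 𝔽 r (swapMat 𝔽) (symBasis 𝔽 r i) = symBasis 𝔽 r i.rev := by
  apply Subtype.ext
  have := i.2
  simp only [coe_symRep, symBasis_apply, coe_symMono, map_mul, map_pow, symHom_X,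
    swapMat_apply00, swapMat_apply01, swapMat_apply10, swapMat_apply11, C_0, C_1, zero_mul,
    one_mul, add_zero, zero_add, Fin.val_rev]
  rw [mul_comm]
  congr 2 <;> omega

/-- The power `(x X₀ + y X₁) ^ r`. -/
noncomputable def symPow (r : ℕ) (x : Fin 2 → 𝔽) : homogeneousSubmodule (Fin 2) 𝔽 r :=
  ⟨(C (x 0) * X 0 + C (x 1) * X 1) ^ r, by
    have := (((isHomogeneous_C_mul_X (x 0) (0 : Fin 2)).add
      (isHomogeneous_C_mul_X (x 1) (1 : Fin 2))).pow r)
    rwa [one_mul] at this⟩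

theorem symRep_symPow (r : ℕ) (g : GL2 𝔽) (x : Fin 2 → 𝔽) :
    symRep 𝔽 r g (symPow r x) = symPow r (g.val.mulVec x) := by
  apply Subtype.ext
  simp only [coe_symRep, symPow, map_pow, map_add, map_mul, symHom_X, Matrix.mulVec, dotProduct,
    Fin.sum_univ_two]
  congr 1
  have : ∀ a : 𝔽, symHom g (C a) = C a := fun a => by simp [symHom, algHom_C, algebraMap_eq]
  simp only [this]
  ring

theorem symBasis_repr_symPow (r : ℕ) (x : Fin 2 → 𝔽) (i : Fin (r + 1)) :
    (symBasis 𝔽 r).repr (symPow r x) i = r.choose i * x 0 ^ (r - i : ℕ) * x 1 ^ (i : ℕ) := by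
  have : symPow r x =
      ∑ i : Fin (r + 1), (r.choose i * x 0 ^ (r - i : ℕ) * x 1 ^ (i : ℕ)) • symBasis 𝔽 r i := by
    apply Subtype.ext
    simp only [symPow, Submodule.coe_sum, Submodule.coe_smul, symBasis_apply, coe_symMono]
    rw [Fin.sum_univ_eq_sum_range (fun i => ((r.choose i : 𝔽) * x 0 ^ (r - i : ℕ) *
      x 1 ^ (i : ℕ)) • (X 0 ^ (r - i : ℕ) * X 1 ^ (i : ℕ) : MvPolynomial (Fin 2) 𝔽)), add_comm,
      add_pow]
    apply Finset.sum_congr rfl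
    intro j _
    rw [MvPolynomial.smul_eq_C_mul]
    simp [mul_pow]
    ring
  rw [this, Module.Basis.repr_sum_self]

end SymBasis

/-! ### Base `p` digits -/

section Digits

/-- The number with base `p` digits `d`. -/
def digitSum (p : ℕ) {f : ℕ} (d : Fin f → ℕ) : ℕ := ∑ j : Fin f, d j * p ^ (j : ℕ)

variable {p f : ℕ}

theorem digitSum_lt {d : Fin f → ℕ} (hd : ∀ j, d j < p) : digitSum p d < p ^ f := by
  have := (finFunctionFinEquiv (fun j => (⟨d j, hd j⟩ : Fin p))).2
  rwa [finFunctionFinEquiv_apply_val] at this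

theorem digitSum_inj {d e : Fin f → ℕ} (hd : ∀ j, d j < p) (he : ∀ j, e j < p)
    (h : digitSum p d = digitSum p e) : d = e := by
  have := finFunctionFinEquiv.injective (a₁ := fun j => (⟨d j, hd j⟩ : Fin p))
    (a₂ := fun j => (⟨e j, he j⟩ : Fin p)) (by
      apply Fin.ext
      rwa [finFunctionFinEquiv_apply_val, finFunctionFinEquiv_apply_val])
  ext j
  simpa using congrFun this j

theorem digitSum_mono {d e : Fin f → ℕ} (h : ∀ j, d j ≤ e j) : digitSum p d ≤ digitSum p e :=
  Finset.sum_le_sum fun j _ => Nat.mul_le_mul_right _ (h j)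

theorem digitSum_add (d e : Fin f → ℕ) :
    digitSum p (fun j => d j + e j) = digitSum p d + digitSum p e := by
  simp [digitSum, add_mul, Finset.sum_add_distrib]

@[simp] theorem digitSum_zero : digitSum p (fun _ : Fin f => 0) = 0 := by simp [digitSum]

theorem eq_zero_of_digitSum (hp : 0 < p) {d : Fin f → ℕ} (h : digitSum p d = 0) (j : Fin f) :
    d j = 0 := by
  have := (Finset.sum_eq_zero_iff_of_nonneg (fun i _ => Nat.zero_le _)).1 h j (Finset.mem_univ _)
  simpa [hp.ne'] using this

end Digits

/-! ### Coefficients of polynomial functions on a finite field -/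

section PolyValues

variable {k : Type u} [Field k] {𝔽 : Type v} [Field 𝔽] [Algebra k 𝔽]

/-- If a polynomial of degree less than the number of elements of `k` with coefficients in a vector
space takes values in a subspace at all elements of `k`, then its coefficients are in it. -/
theorem coeff_mem_of_values_mem {V : Type*} [AddCommGroup V] [Module 𝔽 V] [Finite k]
    (W : Submodule 𝔽 V) (y : ℕ → V)
    (h : ∀ t : k, ∑ m ∈ Finset.range (Nat.card k), algebraMap k 𝔽 t ^ m • y m ∈ W)
    {m : ℕ} (hm : m < Nat.card k) : y m ∈ W := by
  classical
  have := Fintype.ofFinite k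
  by_contra hy
  -- A functional which kills `W` but not `y m` reduces the claim to a scalar polynomial of degree
  -- less than the number of its zeros.
  obtain ⟨l, hl, hlW⟩ := W.exists_le_ker_of_notMem hy
  set P : Polynomial 𝔽 :=
    ∑ m ∈ Finset.range (Nat.card k), Polynomial.C (l (y m)) * Polynomial.X ^ m with hP
  have hdeg : P.degree < Nat.card k := by
    refine lt_of_le_of_lt (Polynomial.degree_sum_le _ _) ?_
    rw [Finset.sup_lt_iff (by exact WithBot.bot_lt_coe _)]
    intro b hb
    exact lt_of_le_of_lt (Polynomial.degree_C_mul_X_pow_le _ _)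
      (by exact_mod_cast Finset.mem_range.1 hb)
  have hzero : P = 0 := by
    refine Polynomial.eq_zero_of_degree_lt_of_eval_finset_eq_zero
      (Finset.univ.image (algebraMap k 𝔽)) ?_ ?_
    · rw [Finset.card_image_of_injective _ (algebraMap k 𝔽).injective, Finset.card_univ,
        ← Nat.card_eq_fintype_card]
      exact hdeg
    · intro x hx
      obtain ⟨t, -, rfl⟩ := Finset.mem_image.1 hx
      have := hlW (h t)
      rw [LinearMap.mem_ker, map_sum] at this
      rw [hP, Polynomial.eval_finsetSum, ← this]
      apply Finset.sum_congr rfl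
      intro m _
      simp only [Polynomial.eval_mul, Polynomial.eval_C, Polynomial.eval_pow, Polynomial.eval_X,
        map_smul, smul_eq_mul]
      ring
  have : P.coeff m = l (y m) := by
    rw [hP, Polynomial.finsetSum_coeff]
    simp only [Polynomial.coeff_C_mul, Polynomial.coeff_X_pow, mul_ite, mul_one, mul_zero]
    rw [Finset.sum_ite_eq, if_pos (Finset.mem_range.2 hm)]
  rw [hzero, Polynomial.coeff_zero] at this
  exact hl this.symm

end PolyValues

/-! ### Weights: monomial bases and the action of the unipotent group -/

section WeightBasis

variable (p : ℕ) [Fact p.Prime] (k : Type u) [Field k] [CharP k p] (𝔽 : Type v) [Field 𝔽]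
  [Algebra k 𝔽] {f : ℕ}

/-- The index set of the monomial basis of a weight. -/
abbrev Weight.Idx (w : Weight f) : Type := ∀ j : Fin f, Fin (w.deg j + 1)

/-- The number with digits `i`. -/
def Weight.num {w : Weight f} (i : w.Idx) : ℕ := digitSum p fun j => (i j : ℕ)

/-- The basis of the weight space which consists of tensor products of monomials. -/
noncomputable def Weight.basis (w : Weight f) : Module.Basis w.Idx 𝔽 (w.Space 𝔽) :=
  (Basis.piTensorProduct (fun j => symBasis 𝔽 (w.deg j)) : Module.Basis w.Idx 𝔽
    (PiTensorProduct 𝔽 fun j : Fin f => MvPolynomial.homogeneousSubmodule (Fin 2) 𝔽 (w.deg j)))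

/-- The pure tensors. -/
noncomputable def Weight.tmul (w : Weight f)
    (x : ∀ j : Fin f, MvPolynomial.homogeneousSubmodule (Fin 2) 𝔽 (w.deg j)) : w.Space 𝔽 :=
  PiTensorProduct.tprod 𝔽 x

/-- The highest weight vector. -/
noncomputable def Weight.hw (w : Weight f) : w.Space 𝔽 := w.basis 𝔽 fun _ => 0

variable {𝔽}

theorem Weight.basis_apply (w : Weight f) (i : w.Idx) :
    w.basis 𝔽 i = w.tmul 𝔽 fun j => symBasis 𝔽 (w.deg j) (i j) := by
  unfold Weight.basis Weight.tmul
  exact Basis.piTensorProduct_apply _ _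

theorem Weight.repr_tmul (w : Weight f)
    (x : ∀ j : Fin f, MvPolynomial.homogeneousSubmodule (Fin 2) 𝔽 (w.deg j)) (i : w.Idx) :
    (w.basis 𝔽).repr (w.tmul 𝔽 x) i = ∏ j, (symBasis 𝔽 (w.deg j)).repr (x j) (i j) := by
  unfold Weight.basis Weight.tmul
  erw [Basis.piTensorProduct_repr_tprod_apply]

theorem Weight.tensorOp_tmul (w : Weight f) (g : GL2 k)
    (x : ∀ j : Fin f, MvPolynomial.homogeneousSubmodule (Fin 2) 𝔽 (w.deg j)) :
    w.tensorOp p k 𝔽 g (w.tmul 𝔽 x) = w.tmul 𝔽 fun j => symRep 𝔽 (w.deg j)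
      (mapGL ((algebraMap k 𝔽).comp (iterateFrobenius k p j)) g) (x j) := by
  unfold Weight.tensorOp Weight.tmul
  exact PiTensorProduct.map_tprod _ _

theorem Weight.rep_apply (w : Weight f) (g : GL2 k) (x : w.Space 𝔽) :
    w.rep p k 𝔽 g x =
      ((mapGL (algebraMap k 𝔽) g).det ^ w.tw : 𝔽ˣ).val • w.tensorOp p k 𝔽 g x := rfl

theorem Weight.repr_upper_basis (w : Weight f) (t : k) (i i' : w.Idx) :
    (w.basis 𝔽).repr (w.rep p k 𝔽 (upper t) (w.basis 𝔽 i)) i' =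
      ∏ j, (((i j : ℕ).choose (i' j) : 𝔽) *
        (algebraMap k 𝔽 t ^ p ^ (j : ℕ)) ^ (i j - i' j : ℕ)) := by
  have hdet : (mapGL (algebraMap k 𝔽) (upper t)).det = 1 := by
    rw [mapGL_upper]
    apply Units.ext
    simp [Matrix.GeneralLinearGroup.det, Matrix.det_fin_two]
  rw [Weight.rep_apply, hdet, one_zpow, Units.val_one, one_smul, Weight.basis_apply,
    Weight.tensorOp_tmul, Weight.repr_tmul]
  apply Finset.prod_congr rfl
  intro j _
  rw [mapGL_upper, symRep_upper, Module.Basis.repr_sum_self]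
  simp [iterateFrobenius_def]

theorem det_diagMat {R : Type*} [CommRing R] (a d : Rˣ) : (diagMat a d).det = a * d := by
  apply Units.ext
  simp [Matrix.GeneralLinearGroup.det, Matrix.det_fin_two]

theorem det_swapMat {R : Type*} [CommRing R] : (swapMat R).det = -1 := by
  apply Units.ext
  simp [Matrix.GeneralLinearGroup.det, Matrix.det_fin_two]

/-- Pure tensors are multilinear in scalar factors. -/
theorem Weight.tmul_smul (w : Weight f) (c : Fin f → 𝔽)
    (x : ∀ j : Fin f, MvPolynomial.homogeneousSubmodule (Fin 2) 𝔽 (w.deg j)) :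
    w.tmul 𝔽 (fun j => c j • x j) = (∏ j, c j) • w.tmul 𝔽 x :=
  MultilinearMap.map_smul_univ (PiTensorProduct.tprod 𝔽) c x

theorem Weight.rep_diagMat (w : Weight f) (a d : kˣ) (i : w.Idx) :
    w.rep p k 𝔽 (diagMat a d) (w.basis 𝔽 i) =
      (algebraMap k 𝔽 ((a * d) ^ w.tw : kˣ) *
        ∏ j : Fin f, ((algebraMap k 𝔽 a ^ p ^ (j : ℕ)) ^ (w.deg j - i j : ℕ) *
          (algebraMap k 𝔽 d ^ p ^ (j : ℕ)) ^ (i j : ℕ))) • w.basis 𝔽 i := by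
  rw [Weight.rep_apply, mapGL_diagMat, det_diagMat, Weight.basis_apply, Weight.tensorOp_tmul]
  simp only [mapGL_diagMat, symRep_diagMat]
  rw [Weight.tmul_smul, smul_smul]
  congr 2
  · simp only [← map_mul, ← map_zpow]
    rfl
  · apply Finset.prod_congr rfl
    intro j _
    simp [iterateFrobenius_def]

theorem Weight.rep_swapMat (w : Weight f) (i : w.Idx) :
    w.rep p k 𝔽 (swapMat k) (w.basis 𝔽 i) =
      ((-1 : 𝔽ˣ) ^ w.tw : 𝔽ˣ).val • w.basis 𝔽 fun j => (i j).rev := by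
  rw [Weight.rep_apply, mapGL_swapMat, det_swapMat, Weight.basis_apply, Weight.tensorOp_tmul]
  simp only [mapGL_swapMat, symRep_swapMat]
  rw [← Weight.basis_apply]

variable {p}

theorem Weight.num_lt {w : Weight f} (hw : ∀ j, w.deg j < p) (i : w.Idx) :
    Weight.num p i < p ^ f :=
  digitSum_lt fun j => by have := (i j).2; have := hw j; omega

theorem Weight.num_inj {w : Weight f} (hw : ∀ j, w.deg j < p) {i i' : w.Idx}
    (h : Weight.num p i = Weight.num p i') : i = i' := by
  have := digitSum_inj (fun j => by have := (i j).2; have := hw j; omega)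
    (fun j => by have := (i' j).2; have := hw j; omega) h
  ext j
  exact congrFun this j

variable (p) in
/-- The coefficient of `t ^ m` in the action of the upper unipotent matrix `(1 t; 0 1)`. -/
noncomputable def Weight.part (w : Weight f) (m : ℕ) : w.Space 𝔽 →ₗ[𝔽] w.Space 𝔽 :=
  (w.basis 𝔽).constr 𝔽 fun i => ∑ i' : w.Idx,
    (if Weight.num p i = Weight.num p i' + m then ∏ j, ((i j : ℕ).choose (i' j) : 𝔽) else 0) •
      w.basis 𝔽 i'

theorem Weight.part_basis (w : Weight f) (m : ℕ) (i : w.Idx) :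
    w.part p m (w.basis 𝔽 i) = ∑ i' : w.Idx,
    (if Weight.num p i = Weight.num p i' + m then ∏ j, ((i j : ℕ).choose (i' j) : 𝔽) else 0) •
      w.basis 𝔽 i' := by
  rw [Weight.part, Module.Basis.constr_basis]

/-- All matrix entries of `(1 t; 0 1)` are monomials in `t` of degree less than `|k|`. Hence
`coeff_mem_of_values_mem` applies: a subspace stable under all these matrices is stable under every
`part m`. -/
theorem Weight.rep_upper (w : Weight f) (hw : ∀ j, w.deg j < p) (hk : Nat.card k = p ^ f) (t : k)
    (x : w.Space 𝔽) :
    w.rep p k 𝔽 (upper t) x =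
      ∑ m ∈ Finset.range (Nat.card k), algebraMap k 𝔽 t ^ m • w.part p m x := by
  have : w.rep p k 𝔽 (upper t) =
      ∑ m ∈ Finset.range (Nat.card k), algebraMap k 𝔽 t ^ m • w.part p m := by
    apply (w.basis 𝔽).ext
    intro i
    apply (w.basis 𝔽).ext_elem
    intro i'
    rw [Weight.repr_upper_basis]
    simp only [LinearMap.sum_apply, LinearMap.smul_apply, Weight.part_basis, map_sum, map_smul,
      Finsupp.coe_finsetSum, Finset.sum_apply, Finsupp.smul_apply, Module.Basis.repr_self,
      Finsupp.single_apply, smul_eq_mul, mul_ite, mul_one, mul_zero, Finset.sum_ite_eq',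
      Finset.mem_univ, if_true]
    -- If `i' ≤ i` digit by digit, the subtraction of numbers has no borrows and the powers of `t`
    -- multiply to exponent `num i - num i'`. Otherwise a binomial coefficient vanishes on both
    -- sides.
    by_cases hi : ∀ j, (i' j : ℕ) ≤ i j
    · have hle : Weight.num p i' ≤ Weight.num p i := digitSum_mono hi
      have hnum : Weight.num p i = Weight.num p i' + (Weight.num p i - Weight.num p i') := by omega
      rw [Finset.sum_eq_single (Weight.num p i - Weight.num p i'), if_pos hnum,
        Finset.prod_mul_distrib, mul_comm]
      · congr 1
        simp only [← pow_mul]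
        rw [Finset.prod_pow_eq_pow_sum]
        congr 1
        have : Weight.num p i = Weight.num p i' + digitSum p fun j => (i j - i' j : ℕ) := by
          unfold Weight.num
          rw [← digitSum_add]
          congr 1
          ext j
          have := hi j
          omega
        rw [this, Nat.add_sub_cancel_left]
        simp [digitSum, mul_comm]
      · intro b _ hb
        rw [if_neg]
        omega
      · intro h
        exact absurd (Finset.mem_range.2 (lt_of_le_of_lt (Nat.sub_le _ _)
          (hk ▸ Weight.num_lt hw i))) h
    · push Not at hi
      obtain ⟨j, hj⟩ := hi
      rw [Finset.prod_eq_zero (Finset.mem_univ j) (by simp [Nat.choose_eq_zero_of_lt hj]),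
        Finset.sum_eq_zero]
      intro m _
      rw [Finset.prod_eq_zero (Finset.mem_univ j) (by simp [Nat.choose_eq_zero_of_lt hj])]
      simp
  rw [this]
  simp

/-- `part M` lowers the number of a monomial by `M`, so only monomials with number `M` survive. They
land on the monomial with number `0`, with coefficient `∏ C(i_j, 0) = 1`. -/
theorem Weight.part_of_top (w : Weight f) (x : w.Space 𝔽) (M : ℕ)
    (hM : ∀ i, (w.basis 𝔽).repr x i ≠ 0 → Weight.num p i ≤ M) :
    w.part p M x = (∑ i, if Weight.num p i = M then (w.basis 𝔽).repr x i else 0) • w.hw 𝔽 := by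
  have hp : 0 < p := (Fact.out : p.Prime).pos
  conv_lhs => rw [← (w.basis 𝔽).sum_repr x]
  rw [map_sum, Finset.sum_smul]
  apply Finset.sum_congr rfl
  intro i _
  rw [map_smul, Weight.part_basis]
  by_cases hi : (w.basis 𝔽).repr x i = 0
  · simp [hi]
  have hiM := hM i hi
  rw [Finset.sum_eq_single (fun _ => 0)]
  · have h0 : Weight.num p (w := w) (fun _ => 0) = 0 := by simp [Weight.num]
    rw [h0, zero_add]
    split_ifs <;> simp [Weight.hw]
  · intro i' _ hi'
    rw [if_neg, zero_smul]
    intro h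
    apply hi'
    have : Weight.num p i' = 0 := by omega
    ext j
    simpa using eq_zero_of_digitSum hp this j
  · simp

variable {α : Type*} {wt : α → Weight f}

variable (p 𝔽) in
/-- A nonzero family of vectors in weight spaces has a top coefficient under the action of the upper
unipotent matrices, and it is a family of highest weight vectors. -/
theorem exists_part_eq_hw (hwt : ∀ a j, (wt a).deg j < p) {x : ∀ a, (wt a).Space 𝔽} (hx : x ≠ 0) :
    ∃ M < p ^ f, ∃ c : α → 𝔽, c ≠ 0 ∧ (∀ a, (wt a).part p M (x a) = c a • (wt a).hw 𝔽) ∧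
      (M = 0 → ∀ a, x a = c a • (wt a).hw 𝔽) := by
  classical
  have hp : 0 < p := (Fact.out : p.Prime).pos
  let Q : ℕ → Prop := fun M => ∃ a, ∃ i : (wt a).Idx, ((wt a).basis 𝔽).repr (x a) i ≠ 0 ∧
    Weight.num p i = M
  have hQ : ∃ M, Q M := by
    obtain ⟨a, ha⟩ := Function.ne_iff.1 hx
    have : ((wt a).basis 𝔽).repr (x a) ≠ 0 := by simpa using ha
    obtain ⟨i, hi⟩ := DFunLike.ne_iff.1 this
    exact ⟨_, a, i, hi, rfl⟩
  have hb : ∀ M, Q M → M < p ^ f := by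
    rintro M ⟨a, i, -, rfl⟩
    exact Weight.num_lt (hwt a) i
  obtain ⟨M₀, hM₀⟩ := hQ
  -- A single exponent serves the whole, possibly infinite, family: the largest number of a monomial
  -- occurring in any member, bounded because the digits are less than `p`.
  set M := Nat.findGreatest Q (p ^ f) with hMdef
  have hQM : Q M := Nat.findGreatest_spec (hb _ hM₀).le hM₀
  have hmax : ∀ a, ∀ i : (wt a).Idx, ((wt a).basis 𝔽).repr (x a) i ≠ 0 → Weight.num p i ≤ M :=
    fun a i hi => Nat.le_findGreatest (hb _ ⟨a, i, hi, rfl⟩).le ⟨a, i, hi, rfl⟩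
  refine ⟨M, hb _ hQM, fun a => ∑ i : (wt a).Idx,
    if Weight.num p i = M then ((wt a).basis 𝔽).repr (x a) i else 0, ?_, ?_, ?_⟩
  · obtain ⟨a, i, hi, hiM⟩ := hQM
    refine Function.ne_iff.2 ⟨a, ?_⟩
    -- The number determines the monomial, so no cancellation is possible.
    rw [Finset.sum_eq_single i]
    · simpa [hiM] using hi
    · intro i' _ hi'
      rw [if_neg]
      intro h
      exact hi' (Weight.num_inj (hwt a) (h.trans hiM.symm))
    · simp
  · exact fun a => Weight.part_of_top _ _ _ (hmax a)
  · intro hM0 a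
    rw [hM0] at hmax ⊢
    apply ((wt a).basis 𝔽).ext_elem
    intro i
    rw [map_smul, Weight.hw, Module.Basis.repr_self]
    have key : ∀ i' : (wt a).Idx, Weight.num p i' = 0 ↔ (fun _ => 0) = i' := by
      intro i'
      constructor
      · intro h
        ext j
        simpa using (eq_zero_of_digitSum hp h j).symm
      · rintro rfl
        simp [Weight.num]
    by_cases hi : (fun _ => 0) = i
    · subst hi
      simp [key]
    · simp [hi]
      by_contra hne
      exact hi ((key i).1 (Nat.le_zero.1 (hmax a i hne)))

variable [Finite k]

variable {k}

/-- A nonzero family of vectors in weight spaces generates a nonzero family of highest weight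
vectors. -/
theorem exists_hw_mem (hwt : ∀ a j, (wt a).deg j < p) (hk : Nat.card k = p ^ f)
    (W : Submodule 𝔽 (∀ a, (wt a).Space 𝔽))
    (hW : ∀ t : k, ∀ x ∈ W, piRep (fun a => (wt a).rep p k 𝔽) (upper t) x ∈ W)
    {x : ∀ a, (wt a).Space 𝔽} (hx : x ≠ 0) (hxW : x ∈ W) :
    ∃ c : α → 𝔽, c ≠ 0 ∧ (fun a => c a • (wt a).hw 𝔽) ∈ W := by
  obtain ⟨M, hM, c, hc, h1, -⟩ := exists_part_eq_hw p 𝔽 hwt hx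
  refine ⟨c, hc, ?_⟩
  have := coeff_mem_of_values_mem (k := k) W (fun m a => (wt a).part p m (x a)) (by
    intro t
    convert hW t x hxW using 1
    ext a
    change _ = (wt a).rep p k 𝔽 (upper t) (x a)
    rw [Weight.rep_upper k _ (hwt a) hk]
    simp) (hk ▸ hM)
  simpa only [h1] using this

/-- The vectors fixed by the upper unipotent matrices are multiples of the highest weight
vector. -/
theorem Weight.exists_eq_smul_hw {w : Weight f} (hw : ∀ j, w.deg j < p)
    (hk : Nat.card k = p ^ f) {x : w.Space 𝔽} (hx : ∀ t : k, w.rep p k 𝔽 (upper t) x = x) :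
    ∃ c : 𝔽, x = c • w.hw 𝔽 := by
  by_cases hx0 : x = 0
  · exact ⟨0, by simp [hx0]⟩
  obtain ⟨M, hM, c, hc, h1, h2⟩ := exists_part_eq_hw p 𝔽 (α := Unit) (wt := fun _ => w)
    (fun _ => hw) (x := fun _ => x) (fun h => hx0 (congrFun h ()))
  by_cases hM0 : M = 0
  · exact ⟨_, h2 hM0 ()⟩
  exfalso
  -- The polynomial map `t ↦ (1 t; 0 1) x - x` vanishes on `k`, and for `M > 0` its coefficient in
  -- degree `M` is `part M x`, a nonzero multiple of the highest weight vector.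
  have := coeff_mem_of_values_mem (k := k) (⊥ : Submodule 𝔽 (w.Space 𝔽))
    (fun m => w.part p m x - if m = 0 then x else 0) (by
      intro t
      have h0 : 0 < Nat.card k := Nat.card_pos
      simp only [smul_sub, Finset.sum_sub_distrib, smul_ite, smul_zero, Finset.sum_ite_eq',
        Finset.mem_range, h0, if_true, pow_zero, one_smul]
      rw [← Weight.rep_upper k w hw hk, hx t]
      simp) (hk ▸ hM)
  simp only [hM0, if_false, sub_zero, Submodule.mem_bot] at this
  have hc0 : c () ≠ 0 := fun h => hc (by ext; exact h)
  rw [h1 ()] at this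
  exact smul_ne_zero hc0 ((w.basis 𝔽).ne_zero _) this

theorem cast_choose_ne_zero [CharP 𝔽 p] {n i : ℕ} (hn : n < p) (hi : i ≤ n) :
    ((n.choose i : ℕ) : 𝔽) ≠ 0 := by
  rw [Ne, CharP.cast_eq_zero_iff 𝔽 p]
  intro h
  have : p ∣ n.factorial := by
    rw [← Nat.choose_mul_factorial_mul_factorial hi, mul_assoc]
    exact h.mul_right _
  exact Nat.not_lt.2 (((Fact.out : p.Prime).dvd_factorial).1 this) hn

end WeightBasis

/-! ### Irreducibility of weights and their highest weight vectors -/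

section Irreducible

variable {p : ℕ} [Fact p.Prime] {k : Type u} [Field k] [CharP k p] {𝔽 : Type v} [Field 𝔽]
  [Algebra k 𝔽] {f : ℕ} [Finite k]

/-- A weight is generated by its highest weight vector. -/
theorem Weight.eq_top_of_hw_mem {w : Weight f} (hw : ∀ j, w.deg j < p) (hk : Nat.card k = p ^ f)
    (W : Submodule 𝔽 (w.Space 𝔽)) (hW : ∀ g : GL2 k, ∀ x ∈ W, w.rep p k 𝔽 g x ∈ W)
    (h : w.hw 𝔽 ∈ W) : W = ⊤ := by
  have : CharP 𝔽 p := charP_of_injective_algebraMap (algebraMap k 𝔽).injective p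
  -- The permutation matrix exchanges highest and lowest weight vectors.
  have h1 : w.basis 𝔽 (fun j => Fin.last _) ∈ W := by
    have := hW (swapMat k) _ h
    rw [Weight.hw, Weight.rep_swapMat] at this
    simp only [Fin.rev_zero] at this
    exact (W.smul_mem_iff (Units.ne_zero _)).1 this
  rw [eq_top_iff, ← (w.basis 𝔽).span_eq, Submodule.span_le]
  rintro _ ⟨i, rfl⟩
  have hle : Weight.num p i ≤ Weight.num p (w := w) fun j => Fin.last _ :=
    digitSum_mono fun j => Fin.le_last _
  -- Applied to the lowest weight vector, the part of this degree is `∏ C(r_j, i_j)` times the basis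
  -- vector `i`, and the binomial coefficients are nonzero since `r_j < p`.
  have h2 := coeff_mem_of_values_mem (k := k) W
    (fun m => w.part p m (w.basis 𝔽 fun j => Fin.last _)) (by
      intro t
      rw [← Weight.rep_upper k w hw hk]
      exact hW _ _ h1) (m := (Weight.num p (w := w) fun j => Fin.last _) - Weight.num p i)
      (lt_of_le_of_lt (Nat.sub_le _ _) (hk ▸ Weight.num_lt hw _))
  rw [Weight.part_basis, Finset.sum_eq_single i, if_pos (by omega)] at h2
  · refine (W.smul_mem_iff ?_).1 h2
    exact Finset.prod_ne_zero_iff.2 fun j _ =>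
      cast_choose_ne_zero (hw j) (Nat.le_of_lt_succ (i j).2)
  · intro i' _ hi'
    rw [if_neg, zero_smul]
    intro h
    exact hi' (Weight.num_inj (p := p) hw (by omega))
  · simp

/-- Weights are irreducible. -/
theorem Weight.eq_top_of_ne_zero_mem {w : Weight f} (hw : ∀ j, w.deg j < p)
    (hk : Nat.card k = p ^ f) (W : Submodule 𝔽 (w.Space 𝔽))
    (hW : ∀ g : GL2 k, ∀ x ∈ W, w.rep p k 𝔽 g x ∈ W) {x : w.Space 𝔽} (hx : x ≠ 0) (hxW : x ∈ W) :
    W = ⊤ := by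
  apply Weight.eq_top_of_hw_mem hw hk W hW
  obtain ⟨c, hc, h⟩ := exists_hw_mem (k := k) (α := Unit) (wt := fun _ => w) (fun _ => hw) hk
    (W.comap (LinearMap.proj ())) (fun t y hy => hW _ _ hy) (x := fun _ => x)
    (fun h => hx (congrFun h ())) hxW
  have hc0 : c () ≠ 0 := fun h => hc (by ext; exact h)
  exact (W.smul_mem_iff hc0).1 h

theorem Weight.hw_ne_zero (w : Weight f) : w.hw 𝔽 ≠ 0 := (w.basis 𝔽).ne_zero _

theorem Weight.rep_upper_hw (w : Weight f) (t : k) :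
    w.rep p k 𝔽 (upper t) (w.hw 𝔽) = w.hw 𝔽 := by
  apply (w.basis 𝔽).ext_elem
  intro i
  rw [Weight.hw, Weight.repr_upper_basis, Module.Basis.repr_self]
  by_cases hi : (fun _ => 0) = i
  · subst hi
    simp
  · rw [Finsupp.single_apply, if_neg hi]
    obtain ⟨j, hj⟩ := Function.ne_iff.1 hi
    refine Finset.prod_eq_zero (Finset.mem_univ j) ?_
    have : 0 < (i j : ℕ) := Nat.pos_of_ne_zero fun h => hj (Fin.ext h.symm)
    simp [Nat.choose_eq_zero_of_lt this]

theorem Weight.chi_apply (w : Weight f) (b : borel k) :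
    ((w.chi p k 𝔽 b : 𝔽ˣ) : 𝔽) = algebraMap k 𝔽
      ((borelA k b ^ digitSum p w.deg * (borelA k b * borelD k b) ^ w.tw : kˣ) : k) := rfl

/-- The Borel subgroup acts on the highest weight vector through `χ(w)`. -/
theorem Weight.rep_borel_hw (w : Weight f) (b : borel k) :
    w.rep p k 𝔽 b (w.hw 𝔽) = (w.chi p k 𝔽 b : 𝔽) • w.hw 𝔽 := by
  rw [borel_eq b, map_mul, Module.End.mul_apply, Weight.rep_upper_hw, Weight.hw,
    Weight.rep_diagMat, Weight.chi_apply]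
  congr 1
  rw [Units.val_mul, map_mul, mul_comm]
  congr 1
  simp only [Fin.val_zero, Nat.sub_zero, pow_zero, mul_one, ← pow_mul]
  rw [Finset.prod_pow_eq_pow_sum]
  simp [digitSum, mul_comm]

theorem mem_fixedBy_unip {V : Type*} [AddCommGroup V] [Module 𝔽 V] (ρ : Representation 𝔽 (GL2 k) V)
    (x : V) : x ∈ fixedBy ρ (unip k) ↔ ∀ t, ρ (upper t) x = x := by
  constructor
  · intro h t
    exact h ⟨upper t, upper_mem_unip t⟩
  · rintro h ⟨g, hg⟩
    change ρ g x = x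
    rw [eq_upper_of_mem_unip hg]
    exact h _

end Irreducible

/-! ### Characters of weights -/

section Chars

variable {p : ℕ} [Fact p.Prime] {k : Type u} [Field k] [CharP k p] {𝔽 : Type v} [Field 𝔽]
  [Algebra k 𝔽] {f : ℕ}

theorem borelA_torus (a d : kˣ) : borelA k (torus k (a, d)) = a := Units.ext rfl

theorem borelD_torus (a d : kˣ) : borelD k (torus k (a, d)) = d := Units.ext rfl

theorem conjChar_apply {M : Type*} [MulOneClass M] (χ : borel k →* M) (b : borel k) :
    conjChar χ b = χ (torus k (borelD k b, borelA k b)) := rfl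

theorem Weight.conjChar_conjChar [Finite k] (w : Weight f) :
    conjChar (conjChar (w.chi p k 𝔽)) = w.chi p k 𝔽 := by
  ext b
  rw [conjChar_apply, conjChar_apply, Weight.chi_apply, Weight.chi_apply]
  simp only [borelA_torus, borelD_torus]

/-- The order of the multiplicative group kills the unit group of a finite field. -/
theorem units_pow_card [Finite k] (a : kˣ) : a ^ (Nat.card k - 1) = 1 := by
  have := Fintype.ofFinite k
  apply Units.ext
  rw [Nat.card_eq_fintype_card]
  simpa using FiniteField.pow_card_sub_one_eq_one (a : k) a.ne_zero

theorem digitSum_sub (hk : 0 < p) {d : Fin f → ℕ} (hd : ∀ j, d j < p) :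
    digitSum p (fun j => p - 1 - d j) = p ^ f - 1 - digitSum p d := by
  have h1 : digitSum p (fun j => p - 1 - d j) + digitSum p d =
      digitSum p (fun _ : Fin f => p - 1) := by
    rw [← digitSum_add]
    congr 1
    ext j
    have := hd j
    omega
  have h2 : digitSum p (fun _ : Fin f => p - 1) = p ^ f - 1 := by
    have h := geom_sum_mul_add (p - 1) f
    rw [Nat.sub_add_cancel (Nat.one_le_of_lt hk)] at h
    rw [digitSum, Fin.sum_univ_eq_sum_range (fun i => (p - 1) * p ^ i), ← Finset.mul_sum, mul_comm]
    omega
  omega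

/-- `χ(w^{[s]}) = χ(w)^s`. -/
theorem Weight.chi_conj [Finite k] {w : Weight f} (hw : ∀ j, w.deg j < p)
    (hk : Nat.card k = p ^ f) : (w.conj p).chi p k 𝔽 = conjChar (w.chi p k 𝔽) := by
  have hp : 0 < p := (Fact.out : p.Prime).pos
  ext b
  rw [conjChar_apply, Weight.chi_apply, Weight.chi_apply, borelA_torus, borelD_torus]
  congr 2
  have h1 : digitSum p (w.conj p).deg = p ^ f - 1 - digitSum p w.deg := digitSum_sub hp hw
  have h2 : (w.conj p).tw = w.tw + (digitSum p w.deg : ℤ) := by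
    simp [Weight.conj, digitSum]
  have h3 := digitSum_lt hw
  rw [h1, h2, zpow_add, zpow_natCast, mul_pow]
  have h4 := units_pow_card (borelA k b)
  rw [hk] at h4
  calc borelA k b ^ (p ^ f - 1 - digitSum p w.deg) *
        ((borelA k b * borelD k b) ^ w.tw *
          (borelA k b ^ digitSum p w.deg * borelD k b ^ digitSum p w.deg))
      = (borelA k b ^ (p ^ f - 1 - digitSum p w.deg) * borelA k b ^ digitSum p w.deg) *
        ((borelA k b * borelD k b) ^ w.tw * borelD k b ^ digitSum p w.deg) := by
          simp only [mul_assoc, mul_left_comm]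
    _ = _ := by
      rw [← pow_add, Nat.sub_add_cancel (by omega), h4, one_mul, mul_comm (borelA k b), mul_comm]

theorem Weight.conj_deg_lt (w : Weight f) (j : Fin f) : (w.conj p).deg j < p := by
  have hp : 0 < p := (Fact.out : p.Prime).pos
  change p - 1 - w.deg j < p
  omega

/-- Integers which give the same character of the unit group agree modulo its order. -/
theorem zpow_eq_iff [Finite k] (m n : ℤ) :
    (∀ a : kˣ, algebraMap k 𝔽 ((a ^ m : kˣ) : k) = algebraMap k 𝔽 ((a ^ n : kˣ) : k)) →
      ((Nat.card k : ℤ) - 1) ∣ m - n := by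
  intro h
  have := Fintype.ofFinite k
  obtain ⟨a, ha⟩ := IsCyclic.exists_generator (α := kˣ)
  have hord : orderOf a = Nat.card k - 1 := by
    rw [orderOf_eq_card_of_forall_mem_zpowers ha, Nat.card_units]
  have h1 : a ^ m = a ^ n := Units.ext ((algebraMap k 𝔽).injective (h a))
  have h2 : a ^ (m - n) = 1 := by rw [zpow_sub, h1, mul_inv_cancel]
  have h3 := orderOf_dvd_iff_zpow_eq_one.2 h2
  rwa [hord, Nat.cast_sub Nat.card_pos, Nat.cast_one] at h3

/-- The character of a weight determines the twist. -/
theorem Weight.tw_of_chi_eq [Finite k] {w w' : Weight f} (h : w.chi p k 𝔽 = w'.chi p k 𝔽) :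
    ((Nat.card k : ℤ) - 1) ∣ w.tw - w'.tw := by
  apply zpow_eq_iff (k := k) (𝔽 := 𝔽)
  intro d
  -- On `diag(1, d)` only the twist contributes.
  have := congrArg Units.val (DFunLike.congr_fun h (torus k (1, d)))
  rw [Weight.chi_apply, Weight.chi_apply, borelA_torus, borelD_torus] at this
  simpa using this

/-- The character of a weight determines the degrees. -/
theorem Weight.num_of_chi_eq [Finite k] {w w' : Weight f} (h : w.chi p k 𝔽 = w'.chi p k 𝔽) :
    ((Nat.card k : ℤ) - 1) ∣ (digitSum p w.deg : ℤ) - digitSum p w'.deg := by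
  apply zpow_eq_iff (k := k) (𝔽 := 𝔽)
  intro d
  -- On `diag(d, d⁻¹)` the determinant is `1` and the twist disappears.
  have := congrArg Units.val (DFunLike.congr_fun h (torus k (d, d⁻¹)))
  rw [Weight.chi_apply, Weight.chi_apply, borelA_torus, borelD_torus] at this
  simpa using this

end Chars

/-! ### A binomial identity in characteristic `p` -/

section Binomial

variable {p : ℕ} [Fact p.Prime] {𝔽 : Type*} [Field 𝔽] [CharP 𝔽 p]

/-- `C(p-1-b, s) = (-1)^s C(b+s, s)` in characteristic `p`. -/
theorem cast_choose_sub {b s : ℕ} (h : b + s < p) :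
    (((p - 1 - b).choose s : ℕ) : 𝔽) = (-1) ^ s * ((b + s).choose b : ℕ) := by
  have hs : ((s.factorial : ℕ) : 𝔽) ≠ 0 := by
    rw [Ne, CharP.cast_eq_zero_iff 𝔽 p, (Fact.out : p.Prime).dvd_factorial]
    omega
  apply mul_left_cancel₀ hs
  -- After multiplication by `s!` both sides are products of `s` factors, matched by `p - 1 - b - t
  -- = -(b + 1 + t)` in `𝔽`.
  have h1 : s.factorial * (p - 1 - b).choose s = ∏ t ∈ Finset.range s, (p - 1 - b - t) := by
    rw [← Nat.descFactorial_eq_factorial_mul_choose, Nat.descFactorial_eq_prod_range]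
  have h2 : s.factorial * (b + s).choose b = ∏ t ∈ Finset.range s, (b + 1 + t) := by
    rw [← Nat.ascFactorial_eq_prod_range, Nat.ascFactorial_eq_factorial_mul_choose,
      Nat.choose_symm_add]
  rw [← Nat.cast_mul, h1, mul_left_comm, ← Nat.cast_mul, h2, Nat.cast_prod, Nat.cast_prod,
    ← Finset.card_range s, ← Finset.prod_const, Finset.card_range, ← Finset.prod_mul_distrib]
  apply Finset.prod_congr rfl
  intro t ht
  have ht' := Finset.mem_range.1 ht
  have h3 : (p - 1 - b - t) + (b + 1 + t) = p := by omega
  have h4 : ((p - 1 - b - t : ℕ) : 𝔽) + ((b + 1 + t : ℕ) : 𝔽) = 0 := by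
    rw [← Nat.cast_add, h3, CharP.cast_eq_zero]
  linear_combination h4

/-- The binomial theorem combined with `cast_choose_sub`. The terms with `b' ≤ N` are the action of
`(1 T; 0 1)` on `specialPow`, see `symBasis_repr_symRep_specialPow`. The remaining ones contain `Y`
with exponent at least `p`, which is what makes them negligible later. -/
theorem add_pow_expand (X Y T : 𝔽) {N b : ℕ} (hN : N < p) (hb : b ≤ N) :
    (-1) ^ b * (X + T * Y) ^ (p - 1 - b) * Y ^ (p - 1 - N + b) =
      ∑ b' ∈ Finset.range p, (-1) ^ b' * ((b'.choose b : ℕ) : 𝔽) * T ^ (b' - b) *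
        X ^ (p - 1 - b') * Y ^ (p - 1 - N + b') := by
  have hp : p - 1 - b + 1 + b = p := by omega
  have h0 : Finset.range p = Finset.range (b + (p - 1 - b + 1)) := by
    congr 1; omega
  rw [h0, Finset.sum_range_add, Finset.sum_eq_zero, zero_add, add_comm X, add_pow,
    Finset.mul_sum, Finset.sum_mul]
  · apply Finset.sum_congr rfl
    intro s hs
    have hs' := Finset.mem_range.1 hs
    rw [cast_choose_sub (𝔽 := 𝔽) (b := b) (s := s) (by omega),
      show p - 1 - (b + s) = p - 1 - b - s by omega, Nat.add_sub_cancel_left, ← add_assoc, pow_add,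
      pow_add Y, mul_pow]
    ring
  · intro x hx
    simp [Nat.choose_eq_zero_of_lt (Finset.mem_range.1 hx)]

end Binomial

/-! ### Measures on `k²` and maps to weight spaces -/

section Extension

variable (p : ℕ) [Fact p.Prime] (k : Type u) [Field k] [CharP k p] (𝔽 : Type v) [Field 𝔽]
  [Algebra k 𝔽] {f : ℕ}

/-- The vector `(x^(p^j), y^(p^j))` for `(x, y) ∈ k²`. -/
def frobVec {k : Type u} [Field k] [Algebra k 𝔽] (j : ℕ) (v : Fin 2 → k) : Fin 2 → 𝔽 :=
  fun a => algebraMap k 𝔽 (v a) ^ p ^ j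

/-- The action of `GL₂(k)` on measures on `k²`, twisted by a power of the determinant. -/
noncomputable def measRep (m : ℤ) : Representation 𝔽 (GL2 k) ((Fin 2 → k) →₀ 𝔽) where
  toFun g := ((mapGL (algebraMap k 𝔽) g).det ^ m : 𝔽ˣ).val •
    Finsupp.lmapDomain 𝔽 𝔽 (fun v => g.val.mulVec v)
  map_one' := by
    ext
    simp
  map_mul' g h := by
    apply Finsupp.lhom_ext
    intro v c
    simp only [map_mul, mul_zpow, Units.val_mul, LinearMap.smul_apply, Module.End.mul_apply,
      Finsupp.lmapDomain_apply, Finsupp.mapDomain_single, map_smul, Matrix.mulVec_mulVec, mul_smul]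
    rw [smul_comm]

theorem measRep_single (m : ℤ) (g : GL2 k) (v : Fin 2 → k) (c : 𝔽) :
    measRep k 𝔽 m g (Finsupp.single v c) =
      ((mapGL (algebraMap k 𝔽) g).det ^ m : 𝔽ˣ).val • Finsupp.single (g.val.mulVec v) c := by
  simp [measRep]

/-- The vector `⊗_j (x^(p^j) X₀ + y^(p^j) X₁)^(r_j)`. -/
noncomputable def Weight.purePow (w : Weight f) (v : Fin 2 → k) : w.Space 𝔽 :=
  w.tmul 𝔽 fun j => symPow (w.deg j) (frobVec p 𝔽 j v)

/-- The map from measures on `k²` to a weight space given by `Weight.purePow`. -/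
noncomputable def Weight.measMap (w : Weight f) : ((Fin 2 → k) →₀ 𝔽) →ₗ[𝔽] w.Space 𝔽 :=
  Finsupp.linearCombination 𝔽 (w.purePow p k 𝔽)

variable {k 𝔽}

theorem frobVec_mulVec (j : ℕ) (g : GL2 k) (v : Fin 2 → k) :
    (mapGL ((algebraMap k 𝔽).comp (iterateFrobenius k p j)) g).val.mulVec (frobVec p 𝔽 j v) =
      frobVec p 𝔽 j (g.val.mulVec v) := by
  ext a
  simp only [Matrix.mulVec, dotProduct, Fin.sum_univ_two, mapGL_apply, frobVec,
    RingHom.comp_apply, ← map_pow, ← map_mul, ← map_add, iterateFrobenius_def, ← mul_pow]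
  congr 1
  exact (add_pow_char_pow _ _ _ _).symm

theorem Weight.tensorOp_purePow (w : Weight f) (g : GL2 k) (v : Fin 2 → k) :
    w.tensorOp p k 𝔽 g (w.purePow p k 𝔽 v) = w.purePow p k 𝔽 (g.val.mulVec v) := by
  rw [Weight.purePow, Weight.tensorOp_tmul]
  simp only [symRep_symPow, frobVec_mulVec]
  rfl

theorem Weight.measMap_equivariant (w : Weight f) (g : GL2 k) (c : (Fin 2 → k) →₀ 𝔽) :
    w.measMap p k 𝔽 (measRep k 𝔽 w.tw g c) = w.rep p k 𝔽 g (w.measMap p k 𝔽 c) := by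
  induction c using Finsupp.induction_linear with
  | zero => simp
  | add c d hc hd => simp [hc, hd]
  | single v a =>
    rw [measRep_single, map_smul, Weight.rep_apply, Weight.measMap,
      Finsupp.linearCombination_single, Finsupp.linearCombination_single, map_smul,
      Weight.tensorOp_purePow]

theorem Weight.repr_purePow (w : Weight f) (v : Fin 2 → k) (i : w.Idx) :
    (w.basis 𝔽).repr (w.purePow p k 𝔽 v) i = ∏ j, ((w.deg j).choose (i j) *
      frobVec p 𝔽 j v 0 ^ (w.deg j - i j : ℕ) * frobVec p 𝔽 j v 1 ^ (i j : ℕ)) := by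
  rw [Weight.purePow, Weight.repr_tmul]
  simp only [symBasis_repr_symPow]

theorem Weight.purePow_first (w : Weight f) : w.purePow p k 𝔽 ![1, 0] = w.hw 𝔽 := by
  have hp : p ≠ 0 := (Fact.out : p.Prime).ne_zero
  apply (w.basis 𝔽).ext_elem
  intro i
  rw [Weight.repr_purePow, Weight.hw, Module.Basis.repr_self]
  simp only [frobVec, Matrix.cons_val_zero, Matrix.cons_val_one, map_one, one_pow,
    mul_one, map_zero, zero_pow (pow_ne_zero _ hp)]
  by_cases hi : (fun _ => 0) = i
  · subst hi
    simp
  · rw [Finsupp.single_apply, if_neg hi]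
    obtain ⟨j, hj⟩ := Function.ne_iff.1 hi
    refine Finset.prod_eq_zero (Finset.mem_univ j) ?_
    have : (i j : ℕ) ≠ 0 := fun h => hj (Fin.ext h.symm)
    simp [this]

/-- The span of the functions `x^(p^j)` and `y^(p^j)` on `k²`. -/
def coordSpan (j : ℕ) : Submodule 𝔽 ((Fin 2 → k) → 𝔽) :=
  Submodule.span 𝔽 {fun v => frobVec p 𝔽 j v 0, fun v => frobVec p 𝔽 j v 1}

theorem frobVec_mem_coordSpan (j : ℕ) (a : Fin 2) :
    (fun v : Fin 2 → k => frobVec p 𝔽 j v a) ∈ coordSpan (𝔽 := 𝔽) (k := k) p j := by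
  apply Submodule.subset_span
  fin_cases a <;> simp

/-- The span of the products of the functions `x^(p^j)`, `y^(p^j)` of degrees given by a weight. -/
def Weight.funSpan (k : Type u) [Field k] (𝔽 : Type v) [Field 𝔽] [Algebra k 𝔽] (w : Weight f) :
    Submodule 𝔽 ((Fin 2 → k) → 𝔽) := ∏ j : Fin f, coordSpan (𝔽 := 𝔽) (k := k) p j ^ w.deg j

theorem coordSpan_pow_le (j n : ℕ) : coordSpan (𝔽 := 𝔽) (k := k) p j ^ n ≤
    Submodule.span 𝔽 (Set.range fun b : Fin (n + 1) => fun v : Fin 2 → k =>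
      frobVec p 𝔽 j v 0 ^ (n - b : ℕ) * frobVec p 𝔽 j v 1 ^ (b : ℕ)) := by
  induction n with
  | zero =>
    rw [pow_zero, Submodule.one_eq_span, Submodule.span_le, Set.singleton_subset_iff]
    exact Submodule.subset_span ⟨0, by ext; simp⟩
  | succ n ih =>
    rw [pow_succ, coordSpan]
    refine (mul_le_mul_left ih _).trans ?_
    rw [Submodule.span_mul_span, Submodule.span_le]
    rintro _ ⟨_, ⟨b, rfl⟩, _, (rfl | rfl), rfl⟩
    · refine Submodule.subset_span ⟨b.castSucc, ?_⟩
      ext v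
      have := b.2
      simp only [Pi.mul_apply, Fin.val_castSucc]
      rw [show n + 1 - (b : ℕ) = (n - b) + 1 by omega]
      ring
    · refine Submodule.subset_span ⟨b.succ, ?_⟩
      ext v
      simp only [Pi.mul_apply, Fin.val_succ]
      rw [show n + 1 - ((b : ℕ) + 1) = (n - b) by omega]
      ring

/-- Measures in the kernel of `measMap` annihilate `funSpan`. -/
theorem Weight.annihilates_funSpan {w : Weight f} (hw : ∀ j, w.deg j < p)
    {c : (Fin 2 → k) →₀ 𝔽} (hc : w.measMap p k 𝔽 c = 0) {F : (Fin 2 → k) → 𝔽}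
    (hF : F ∈ w.funSpan p k 𝔽) : Finsupp.linearCombination 𝔽 F c = 0 := by
  have : CharP 𝔽 p := charP_of_injective_algebraMap (algebraMap k 𝔽).injective p
  -- The functions with integral zero against `c` form a subspace, so it suffices to treat products
  -- of monomials, one for each index `j`.
  let M : Submodule 𝔽 ((Fin 2 → k) → 𝔽) :=
    { carrier := {F | Finsupp.linearCombination 𝔽 F c = 0}
      zero_mem' := by simp [Finsupp.linearCombination_apply]
      add_mem' := by
        intro F G hF hG
        simp only [Set.mem_ofPred_eq, Finsupp.linearCombination_apply, Finsupp.sum] at hF hG ⊢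
        simp [mul_add, Finset.sum_add_distrib] at hF hG ⊢
        rw [hF, hG, add_zero]
      smul_mem' := by
        intro a F hF
        simp only [Set.mem_ofPred_eq, Finsupp.linearCombination_apply, Finsupp.sum] at hF ⊢
        simp [mul_left_comm _ a, ← Finset.mul_sum] at hF ⊢
        exact Or.inr hF }
  suffices h : w.funSpan p k 𝔽 ≤ M from h hF
  have h1 : w.funSpan p k 𝔽 ≤ ∏ j : Fin f, Submodule.span 𝔽
      (Set.range fun b : Fin (w.deg j + 1) => fun v : Fin 2 → k =>
      frobVec p 𝔽 j v 0 ^ (w.deg j - b : ℕ) * frobVec p 𝔽 j v 1 ^ (b : ℕ)) :=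
    Finset.prod_le_prod' fun j _ => coordSpan_pow_le p j _
  refine h1.trans ?_
  rw [Submodule.prod_span, Submodule.span_le]
  intro G hG
  obtain ⟨g, hg, rfl⟩ := (Set.mem_fintype_prod _ _).1 hG
  choose i hi using hg
  have h2 := congrArg (fun x => (w.basis 𝔽).repr x i) hc
  simp only [Weight.measMap, Finsupp.linearCombination_apply, Finsupp.sum, map_sum, map_smul,
    Finsupp.coe_finsetSum, Finset.sum_apply, Finsupp.smul_apply, Weight.repr_purePow, map_zero,
    Finsupp.coe_zero, Pi.zero_apply, smul_eq_mul] at h2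
  change Finsupp.linearCombination 𝔽 _ c = 0
  -- Up to this product of binomial coefficients, nonzero because the degrees are less than `p`, the
  -- integral is a coordinate of `measMap c`.
  have h3 : (∏ j, ((w.deg j).choose (i j) : 𝔽)) ≠ 0 :=
    Finset.prod_ne_zero_iff.2 fun j _ =>
      cast_choose_ne_zero (hw j) (Nat.le_of_lt_succ (i j).2)
  apply mul_left_cancel₀ h3
  rw [mul_zero, ← h2, Finsupp.linearCombination_apply, Finsupp.sum, Finset.mul_sum]
  apply Finset.sum_congr rfl
  intro v _
  rw [smul_eq_mul, mul_left_comm, Finset.prod_apply, ← Finset.prod_mul_distrib]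
  congr 1
  apply Finset.prod_congr rfl
  intro j _
  rw [← hi]
  ring

/-- The vector `∑ b, (-1)^b x^(p-1-b) y^(p-1-N+b) X₀^(N-b) X₁^b` of `Sym ^ N`. -/
noncomputable def specialPow (N : ℕ) (x : Fin 2 → 𝔽) :
    MvPolynomial.homogeneousSubmodule (Fin 2) 𝔽 N :=
  ∑ b : Fin (N + 1), ((-1) ^ (b : ℕ) * x 0 ^ (p - 1 - b : ℕ) * x 1 ^ (p - 1 - N + b : ℕ)) •
    symBasis 𝔽 N b

theorem symBasis_repr_specialPow (N : ℕ) (x : Fin 2 → 𝔽) (b : Fin (N + 1)) :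
    (symBasis 𝔽 N).repr (specialPow p N x) b =
      (-1) ^ (b : ℕ) * x 0 ^ (p - 1 - b : ℕ) * x 1 ^ (p - 1 - N + b : ℕ) := by
  rw [specialPow, Module.Basis.repr_sum_self]

theorem symBasis_repr_symRep_specialPow (N : ℕ) (x : Fin 2 → 𝔽) (t : 𝔽) (b : Fin (N + 1)) :
    (symBasis 𝔽 N).repr (symRep 𝔽 N (upper t) (specialPow p N x)) b =
      ∑ b' ∈ Finset.range (N + 1), (-1) ^ b' * ((b'.choose b : ℕ) : 𝔽) * t ^ (b' - b) *
        x 0 ^ (p - 1 - b') * x 1 ^ (p - 1 - N + b') := by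
  rw [specialPow, map_sum, map_sum, Finsupp.coe_finsetSum, Finset.sum_apply,
    ← Fin.sum_univ_eq_sum_range (fun b' => (-1) ^ b' * ((b'.choose b : ℕ) : 𝔽) * t ^ (b' - b) *
        x 0 ^ (p - 1 - b') * x 1 ^ (p - 1 - N + b'))]
  apply Finset.sum_congr rfl
  intro b' _
  rw [map_smul, map_smul, Finsupp.smul_apply, symRep_upper, Module.Basis.repr_sum_self, smul_eq_mul]
  ring

/-- The exponents are chosen such that `a^(p-1-b) d^(p-1-N+b) = (a d)^(p-1-N) · a^(N-b) d^b`: the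
failure of equivariance is a power of the determinant, to be absorbed by the twist. -/
theorem specialPow_diagMat {N : ℕ} (hN : N < p) (x : Fin 2 → 𝔽) (a d : 𝔽ˣ) :
    specialPow p N ((diagMat a d).val.mulVec x) =
      ((a * d : 𝔽ˣ) : 𝔽) ^ (p - 1 - N) • symRep 𝔽 N (diagMat a d) (specialPow p N x) := by
  simp only [specialPow, map_sum, Finset.smul_sum, map_smul, symRep_diagMat, smul_smul]
  apply Finset.sum_congr rfl
  intro b _
  congr 1
  have hb : (b : ℕ) ≤ N := Nat.le_of_lt_succ b.2
  have h0 : (diagMat a d).val.mulVec x 0 = a * x 0 := by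
    simp [Matrix.mulVec, dotProduct, Fin.sum_univ_two, diagMat]
  have h1 : (diagMat a d).val.mulVec x 1 = d * x 1 := by
    simp [Matrix.mulVec, dotProduct, Fin.sum_univ_two, diagMat]
  rw [h0, h1, mul_pow, mul_pow, Units.val_mul, mul_pow,
    show p - 1 - (b : ℕ) = (p - 1 - N) + (N - b) by omega, pow_add (a : 𝔽), pow_add (d : 𝔽)]
  ring

/-- The substitution `b ↦ N - b` exchanges the exponents of `x` and `y`. The signs agree because `p
- 1` is even. -/
theorem specialPow_swapMat (hp2 : Odd p) {N : ℕ} (hN : N < p) (x : Fin 2 → 𝔽) :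
    specialPow p N ((swapMat 𝔽).val.mulVec x) =
      (-1 : 𝔽) ^ (p - 1 - N) • symRep 𝔽 N (swapMat 𝔽) (specialPow p N x) := by
  simp only [specialPow, map_sum, Finset.smul_sum, map_smul, symRep_swapMat, smul_smul]
  rw [← Equiv.sum_comp Fin.revPerm]
  apply Finset.sum_congr rfl
  intro b _
  have hb : (b : ℕ) ≤ N := Nat.le_of_lt_succ b.2
  have h0 : (swapMat 𝔽).val.mulVec x 0 = x 1 := by
    simp [Matrix.mulVec, dotProduct, Fin.sum_univ_two, swapMat]
  have h1 : (swapMat 𝔽).val.mulVec x 1 = x 0 := by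
    simp [Matrix.mulVec, dotProduct, Fin.sum_univ_two, swapMat]
  simp only [Fin.revPerm_apply, Fin.val_rev]
  congr 1
  have hsign : (-1 : 𝔽) ^ (N + 1 - (b + 1)) = (-1) ^ (p - 1 - N) * (-1) ^ (b : ℕ) := by
    have hpp : (-1 : 𝔽) ^ (p - 1) = 1 := by
      obtain ⟨m, hm⟩ := hp2
      rw [hm, Nat.add_sub_cancel, pow_mul]
      simp
    have e1 : (-1 : 𝔽) ^ (p - 1 - N) * (-1) ^ N = 1 := by
      rw [← pow_add, Nat.sub_add_cancel (by omega), hpp]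
    have e2 : (-1 : 𝔽) ^ (N + 1 - (b + 1)) * (-1) ^ (b : ℕ) = (-1) ^ N := by
      rw [← pow_add]
      congr 1
      omega
    have e3 : (-1 : 𝔽) ^ (b : ℕ) * (-1) ^ (b : ℕ) = 1 := by rw [← mul_pow]; simp
    have e4 : (-1 : 𝔽) ^ N * (-1) ^ N = 1 := by rw [← mul_pow]; simp
    linear_combination -(-1 : 𝔽) ^ (N + 1 - (b + 1)) * e3 + (-1 : 𝔽) ^ (b : ℕ) * e2
      - (-1 : 𝔽) ^ (b : ℕ) * (-1 : 𝔽) ^ N * e1 + (-1 : 𝔽) ^ (b : ℕ) * (-1 : 𝔽) ^ (p - 1 - N) * e4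
  rw [h0, h1, hsign, show p - 1 - (N + 1 - ((b : ℕ) + 1)) = p - 1 - N + b by omega,
    show p - 1 - N + (N + 1 - ((b : ℕ) + 1)) = p - 1 - b by omega]
  ring

end Extension

theorem digitSum_lt_sub_one {p f : ℕ} [Fact p.Prime] (hp : 0 < p) {d : Fin f → ℕ} (hd : ∀ j, d j < p)
    {i : Fin f} (hi : d i < p - 1) : digitSum p d < p ^ f - 1 := by
  have h1 := digitSum_sub (f := f) hp hd
  have h2 := digitSum_lt hd
  by_contra h
  have h3 : digitSum p (fun j => p - 1 - d j) = 0 := by omega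
  have := eq_zero_of_digitSum hp h3 i
  omega

/-- The kernel of a surjection stable under a group gives a representation on the target. -/
theorem exists_rep_of_surjective {𝔽 H A E : Type*} [Field 𝔽] [Group H] [AddCommGroup A]
    [Module 𝔽 A] [AddCommGroup E] [Module 𝔽 E] (ρ : Representation 𝔽 H A) (Ψ : A →ₗ[𝔽] E)
    (hΨ : Function.Surjective Ψ) (hker : ∀ g c, Ψ c = 0 → Ψ (ρ g c) = 0) :
    ∃ ρE : Representation 𝔽 H E, ∀ g c, ρE g (Ψ c) = Ψ (ρ g c) := by
  obtain ⟨R, hR⟩ := Ψ.exists_rightInverse_of_surjective (LinearMap.range_eq_top.2 hΨ)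
  have hR' : ∀ e, Ψ (R e) = e := fun e => LinearMap.congr_fun hR e
  have key : ∀ g c, Ψ (ρ g (R (Ψ c))) = Ψ (ρ g c) := by
    intro g c
    have := hker g (R (Ψ c) - c) (by rw [map_sub, hR', sub_self])
    rwa [map_sub, map_sub, sub_eq_zero] at this
  refine ⟨{ toFun g := Ψ ∘ₗ ρ g ∘ₗ R, map_one' := ?_, map_mul' := ?_ }, key⟩
  · ext e
    simp [hR']
  · intro g h
    ext e
    simp [key]

/-! ### Explicit non-split extensions of weights -/

section Extension

variable (p : ℕ) [Fact p.Prime] (k : Type u) [Field k] [CharP k p] (𝔽 : Type v) [Field 𝔽]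
  [Algebra k 𝔽] {f : ℕ}

/-- The vector `⊗_j (x^(p^j) X₀ + y^(p^j) X₁)^(r_j)` with the factor for `j = i` replaced by
`specialPow`. -/
noncomputable def Weight.twistPow (w : Weight f) (i : Fin f) (v : Fin 2 → k) : w.Space 𝔽 :=
  w.tmul 𝔽 fun j => if j = i then specialPow p (w.deg j) (frobVec p 𝔽 j v) else
    symPow (w.deg j) (frobVec p 𝔽 j v)

/-- The map from measures on `k²` to a weight space given by `Weight.twistPow`. -/
noncomputable def Weight.twistMap (w : Weight f) (i : Fin f) :
    ((Fin 2 → k) →₀ 𝔽) →ₗ[𝔽] w.Space 𝔽 :=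
  Finsupp.linearCombination 𝔽 (w.twistPow p k 𝔽 i)

/-- The weight `τ` has a nontrivial extension by the weight `σ` in which the digits with indices
`i` and `i + 1` change. -/
structure ExtPair [NeZero f] (τ σ : Weight f) (i : Fin f) : Prop where
  succ_ne : i + 1 ≠ i
  deg_lt : ∀ j, τ.deg j < p
  deg_le : τ.deg i ≤ p - 2
  deg_pos : 1 ≤ τ.deg (i + 1)
  deg_i : σ.deg i = p - 2 - τ.deg i
  deg_succ : σ.deg (i + 1) = τ.deg (i + 1) - 1
  deg_other : ∀ j, j ≠ i → j ≠ i + 1 → σ.deg j = τ.deg j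
  -- The shift compensates the determinant in `specialPow_diagMat`, where `p - 1 - σ.deg i = τ.deg i
  -- + 1`, raised to the power `p^i` by Frobenius. Only the class modulo the order of `kˣ` matters.
  tw : (p : ℤ) ^ f - 1 ∣ σ.tw - (τ.tw + p ^ (i : ℕ) * (τ.deg i + 1))

variable {p k 𝔽} [NeZero f] {τ σ : Weight f} {i : Fin f}

namespace ExtPair

theorem deg_lt' (h : ExtPair p τ σ i) (j : Fin f) : σ.deg j < p := by
  have hp := (Fact.out : p.Prime).two_le
  by_cases h1 : j = i
  · rw [h1, h.deg_i]; omega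
  by_cases h2 : j = i + 1
  · have := h.deg_lt (i + 1)
    rw [h2, h.deg_succ]; omega
  · rw [h.deg_other j h1 h2]; exact h.deg_lt j

/-- Both degree numbers are less than `p^f - 1`, as their digits at `i` are not `p - 1`. So equal
characters would force equal digits, but the digits at `i + 1` differ by one. -/
theorem chi_ne [Finite k] (h : ExtPair p τ σ i) (hk : Nat.card k = p ^ f) : σ.chi p k 𝔽 ≠ τ.chi p k 𝔽 := by
  have hp := (Fact.out : p.Prime).two_le
  intro heq
  have h1 := Weight.num_of_chi_eq heq
  have h2 : digitSum p σ.deg < p ^ f - 1 := digitSum_lt_sub_one (by omega) h.deg_lt' (i := i) (by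
    rw [h.deg_i]; omega)
  have h3 : digitSum p τ.deg < p ^ f - 1 := digitSum_lt_sub_one (by omega) h.deg_lt (i := i) (by
    have := h.deg_le; omega)
  have h4 : digitSum p σ.deg = digitSum p τ.deg := by
    have h5 := Int.eq_zero_of_abs_lt_dvd h1 (by
      rw [hk, abs_lt]
      push_cast
      have : ((p ^ f - 1 : ℕ) : ℤ) = (p : ℤ) ^ f - 1 := by
        rw [Nat.cast_sub (Nat.one_le_pow _ _ (by omega))]; simp
      omega)
    omega
  have := congrFun (digitSum_inj h.deg_lt' h.deg_lt h4) (i + 1)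
  rw [h.deg_succ] at this
  have := h.deg_pos
  omega

theorem det_zpow [Finite k] (h : ExtPair p τ σ i) (hk : Nat.card k = p ^ f) (a : kˣ) :
    a ^ σ.tw = a ^ τ.tw * a ^ (p ^ (i : ℕ) * (τ.deg i + 1)) := by
  obtain ⟨m, hm⟩ := h.tw
  have h1 := units_pow_card a
  rw [hk] at h1
  have h2 : a ^ ((p : ℤ) ^ f - 1) = 1 := by
    rw [← h1, ← zpow_natCast, Nat.cast_sub (Nat.one_le_pow _ _ (Fact.out : p.Prime).pos)]
    simp
  have : σ.tw = τ.tw + ((p ^ (i : ℕ) * (τ.deg i + 1) : ℕ) : ℤ) + ((p : ℤ) ^ f - 1) * m := by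
    push_cast
    linarith
  rw [this, zpow_add, zpow_add, zpow_mul, h2, one_zpow, mul_one, zpow_natCast]

end ExtPair

theorem frobVec_mulVec' (g : GL2 k) (j : ℕ) (v : Fin 2 → k) :
    frobVec p 𝔽 j (g.val.mulVec v) =
      (mapGL ((algebraMap k 𝔽).comp (iterateFrobenius k p j)) g).val.mulVec (frobVec p 𝔽 j v) :=
  (frobVec_mulVec p j g v).symm

/-- Only the factor with index `i` deviates from equivariance, by `(a d)^(p^i (τ_i + 1))`, which is
precisely the difference between the twists of `σ` and `τ`. -/
theorem Weight.twistPow_diagMat [Finite k] (hk : Nat.card k = p ^ f)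
    (h : ExtPair p τ σ i) (v : Fin 2 → k) (a d : kˣ) :
    ((mapGL (algebraMap k 𝔽) (diagMat a d)).det ^ τ.tw : 𝔽ˣ).val •
      σ.twistPow p k 𝔽 i ((diagMat a d).val.mulVec v) =
      σ.rep p k 𝔽 (diagMat a d) (σ.twistPow p k 𝔽 i v) := by
  have hσ := h.deg_lt'
  have hN : p - 1 - σ.deg i = τ.deg i + 1 := by
    have := h.deg_le
    have := (Fact.out : p.Prime).two_le
    rw [h.deg_i]; omega
  have hdet := h.det_zpow hk (a * d)
  rw [Weight.rep_apply, Weight.twistPow, Weight.twistPow, Weight.tensorOp_tmul, mapGL_diagMat, det_diagMat,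
    ← map_mul, ← map_zpow, ← map_zpow, hdet, map_mul, Units.val_mul, mul_smul]
  congr 1
  have : (fun j : Fin f => if j = i then specialPow p (σ.deg j) (frobVec p 𝔽 j
        ((diagMat a d).val.mulVec v)) else
      symPow (σ.deg j) (frobVec p 𝔽 j ((diagMat a d).val.mulVec v))) =
    fun j => (if j = i then algebraMap k 𝔽 ((a * d : kˣ) ^ (p ^ (i : ℕ) * (τ.deg i + 1)) : kˣ)
      else 1) • symRep 𝔽 (σ.deg j)
        (mapGL ((algebraMap k 𝔽).comp (iterateFrobenius k p j)) (diagMat a d))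
        (if j = i then specialPow p (σ.deg j) (frobVec p 𝔽 j v) else
          symPow (σ.deg j) (frobVec p 𝔽 j v)) := by
    ext1 j
    by_cases hj : j = i
    · subst hj
      simp only [if_true]
      rw [frobVec_mulVec', mapGL_diagMat, specialPow_diagMat p (hσ j), hN]
      congr 1
      simp [iterateFrobenius_def, pow_mul, mul_pow]
    · simp only [hj, if_false, one_smul]
      rw [frobVec_mulVec', symRep_symPow]
  rw [this, Weight.tmul_smul]
  congr 1
  rw [Finset.prod_ite_eq' Finset.univ i, if_pos (Finset.mem_univ _)]
  rfl

/-- As for diagonal matrices, with determinant `-1`; since `p^i` is odd, the Frobenius twist does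
not change the sign. -/
theorem Weight.twistPow_swapMat (hp2 : Odd p) [Finite k] (hk : Nat.card k = p ^ f)
    (h : ExtPair p τ σ i) (v : Fin 2 → k) :
    ((mapGL (algebraMap k 𝔽) (swapMat k)).det ^ τ.tw : 𝔽ˣ).val •
      σ.twistPow p k 𝔽 i ((swapMat k).val.mulVec v) =
      σ.rep p k 𝔽 (swapMat k) (σ.twistPow p k 𝔽 i v) := by
  have hσ := h.deg_lt'
  have hN : p - 1 - σ.deg i = τ.deg i + 1 := by
    have := h.deg_le
    have := (Fact.out : p.Prime).two_le
    rw [h.deg_i]; omega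
  have hdet := congrArg (Units.map (algebraMap k 𝔽).toMonoidHom) (h.det_zpow hk (-1))
  have hm1 : Units.map (algebraMap k 𝔽).toMonoidHom (-1) = -1 := by
    apply Units.ext; simp
  rw [map_mul, map_zpow, map_zpow, map_pow, hm1] at hdet
  rw [Weight.rep_apply, Weight.twistPow, Weight.twistPow, Weight.tensorOp_tmul, mapGL_swapMat, det_swapMat, hdet,
    Units.val_mul, mul_smul]
  congr 1
  have : (fun j : Fin f => if j = i then specialPow p (σ.deg j) (frobVec p 𝔽 j
        ((swapMat k).val.mulVec v)) else
      symPow (σ.deg j) (frobVec p 𝔽 j ((swapMat k).val.mulVec v))) =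
    fun j => (if j = i then (((-1 : 𝔽ˣ) ^ (p ^ (i : ℕ) * (τ.deg i + 1)) : 𝔽ˣ) : 𝔽)
      else 1) • symRep 𝔽 (σ.deg j)
        (mapGL ((algebraMap k 𝔽).comp (iterateFrobenius k p j)) (swapMat k))
        (if j = i then specialPow p (σ.deg j) (frobVec p 𝔽 j v) else
          symPow (σ.deg j) (frobVec p 𝔽 j v)) := by
    ext1 j
    by_cases hj : j = i
    · subst hj
      simp only [if_true]
      rw [frobVec_mulVec', mapGL_swapMat, specialPow_swapMat p hp2 (hσ j), hN, pow_mul,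
        Odd.neg_one_pow hp2.pow]
      simp
    · simp only [hj, if_false, one_smul]
      rw [frobVec_mulVec', symRep_symPow]
  rw [this, Weight.tmul_smul]
  congr 1
  rw [Finset.prod_ite_eq' Finset.univ i, if_pos (Finset.mem_univ _)]

-- Taking `p`-th powers moves the index by one, cyclically because `x^(p^f) = x` on `k`.
variable (p) in
theorem frobVec_pow_mem [Finite k] (hk : Nat.card k = p ^ f) (i : Fin f) (a : Fin 2) :
    (fun v : Fin 2 → k => frobVec p 𝔽 i v a ^ p) ∈
      coordSpan (𝔽 := 𝔽) (k := k) p (i + 1 : Fin f) := by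
  have := Fintype.ofFinite k
  convert frobVec_mem_coordSpan (k := k) (𝔽 := 𝔽) p (i + 1 : Fin f) a using 2 with v
  simp only [frobVec, ← pow_mul, ← pow_succ, ← map_pow]
  congr 1
  by_cases hi : (i : ℕ) + 1 < f
  · rw [Fin.val_add_one_of_lt' hi]
  · have h1 : (i : ℕ) + 1 = f := by have := i.2; omega
    have h2 : ((i + 1 : Fin f) : ℕ) = 0 := by
      rw [Fin.val_add, Fin.val_one', Nat.add_mod_mod, h1, Nat.mod_self]
    rw [h1, h2, pow_zero, pow_one, ← hk, Nat.card_eq_fintype_card, FiniteField.pow_card]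

/-- The deviation from equivariance under `(1 t; 0 1)` consists of the surplus terms of
`add_pow_expand`, all containing the factor `y^(p · p^i)`. This is a coordinate with index `i + 1`,
and it supplies exactly the degree which `σ` lacks there in comparison with `τ`. Hence the deviation
is invisible to measures in the kernel of `τ.measMap`. -/
theorem Weight.twistPow_upper [Finite k] (hk : Nat.card k = p ^ f)
    (h : ExtPair p τ σ i) (t : k) (b : σ.Idx) :
    (fun v : Fin 2 → k => (σ.basis 𝔽).repr (σ.twistPow p k 𝔽 i ((upper t).val.mulVec v) -
      σ.tensorOp p k 𝔽 (upper t) (σ.twistPow p k 𝔽 i v)) b) ∈ τ.funSpan p k 𝔽 := by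
  have : CharP 𝔽 p := charP_of_injective_algebraMap (algebraMap k 𝔽).injective p
  classical
  have hσ := h.deg_lt'
  have hp := (Fact.out : p.Prime).two_le
  have hdi := h.deg_le
  -- the coordinates of the factors with index different from `i`
  let G : Fin f → (Fin 2 → k) → 𝔽 := fun j v =>
    (symBasis 𝔽 (σ.deg j)).repr (symPow (σ.deg j) (frobVec p 𝔽 j ((upper t).val.mulVec v))) (b j)
  let H : (Fin 2 → k) → 𝔽 := fun v =>
    (symBasis 𝔽 (σ.deg i)).repr (specialPow p (σ.deg i)
      (frobVec p 𝔽 i ((upper t).val.mulVec v))) (b i) -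
    (symBasis 𝔽 (σ.deg i)).repr (symRep 𝔽 (σ.deg i)
      (mapGL ((algebraMap k 𝔽).comp (iterateFrobenius k p i)) (upper t))
      (specialPow p (σ.deg i) (frobVec p 𝔽 i v))) (b i)
  -- For `j ≠ i` the factors are honest powers of linear forms and transform equivariantly, so the
  -- difference comes from the factor `i` alone.
  have hGH : (fun v : Fin 2 → k => (σ.basis 𝔽).repr (σ.twistPow p k 𝔽 i
      ((upper t).val.mulVec v) - σ.tensorOp p k 𝔽 (upper t) (σ.twistPow p k 𝔽 i v)) b) =
      H * ∏ j ∈ Finset.univ.erase i, G j := by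
    ext v
    rw [map_sub, Finsupp.sub_apply, Weight.twistPow, Weight.twistPow, Weight.tensorOp_tmul,
      Weight.repr_tmul, Weight.repr_tmul, ← Finset.mul_prod_erase Finset.univ _ (Finset.mem_univ i),
      ← Finset.mul_prod_erase Finset.univ _ (Finset.mem_univ i), Pi.mul_apply, Finset.prod_apply]
    simp only [if_true]
    rw [sub_mul]
    congr 2
    · apply Finset.prod_congr rfl
      intro j hj
      rw [if_neg (Finset.ne_of_mem_erase hj)]
    · apply Finset.prod_congr rfl
      intro j hj
      rw [if_neg (Finset.ne_of_mem_erase hj), symRep_symPow, ← frobVec_mulVec']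
  have hG : ∀ j : Fin f, G j ∈ coordSpan (𝔽 := 𝔽) (k := k) p j ^ σ.deg j := by
    intro j
    have hx : (fun v : Fin 2 → k => frobVec p 𝔽 j ((upper t).val.mulVec v) 0) ∈
        coordSpan (𝔽 := 𝔽) (k := k) p j := by
      have : (fun v : Fin 2 → k => frobVec p 𝔽 j ((upper t).val.mulVec v) 0) =
          (fun v => frobVec p 𝔽 j v 0) +
            algebraMap k 𝔽 t ^ p ^ (j : ℕ) • fun v => frobVec p 𝔽 j v 1 := by
        ext v
        rw [frobVec_mulVec', mapGL_upper]
        simp [Matrix.mulVec, dotProduct, Fin.sum_univ_two, upper, iterateFrobenius_def]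
      rw [this]
      exact add_mem (frobVec_mem_coordSpan p j 0)
        (Submodule.smul_mem _ _ (frobVec_mem_coordSpan p j 1))
    have hy : (fun v : Fin 2 → k => frobVec p 𝔽 j ((upper t).val.mulVec v) 1) ∈
        coordSpan (𝔽 := 𝔽) (k := k) p j := by
      have : (fun v : Fin 2 → k => frobVec p 𝔽 j ((upper t).val.mulVec v) 1) =
          (fun v => frobVec p 𝔽 j v 1) := by
        ext v
        rw [frobVec_mulVec', mapGL_upper]
        simp [Matrix.mulVec, dotProduct, Fin.sum_univ_two, upper]
      rw [this]
      exact frobVec_mem_coordSpan p j 1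
    have h3 := Submodule.mul_mem_mul (Submodule.pow_mem_pow _ hx (σ.deg j - b j))
      (Submodule.pow_mem_pow _ hy (b j))
    rw [← pow_add, Nat.sub_add_cancel (Nat.le_of_lt_succ (b j).2)] at h3
    have : G j = ((σ.deg j).choose (b j) : 𝔽) •
        ((fun v : Fin 2 → k => frobVec p 𝔽 j ((upper t).val.mulVec v) 0) ^ (σ.deg j - b j : ℕ) *
        (fun v : Fin 2 → k => frobVec p 𝔽 j ((upper t).val.mulVec v) 1) ^ (b j : ℕ)) := by
      ext v
      simp only [G, symBasis_repr_symPow, Pi.smul_apply, Pi.mul_apply, Pi.pow_apply, smul_eq_mul,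
        mul_assoc]
    rw [this]
    exact Submodule.smul_mem _ _ h3
  -- The surplus terms have `N < b' < p`. In them `y^(p-1-N+b') = y^(b'-N-1) y^p`, and the part
  -- besides `y^p` has degree `(p-1-b') + (b'-N-1) = p - 2 - N = τ_i`.
  have hH : H ∈ coordSpan (𝔽 := 𝔽) (k := k) p i ^ τ.deg i *
      coordSpan (𝔽 := 𝔽) (k := k) p (i + 1 : Fin f) := by
    set N := σ.deg i with hNdef
    set T : 𝔽 := algebraMap k 𝔽 t ^ p ^ (i : ℕ) with hT
    have hNp : N < p := hσ i
    have hH' : H = ∑ b' ∈ Finset.Ico (N + 1) p, ((-1) ^ b' * ((b'.choose (b i) : ℕ) : 𝔽) *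
        T ^ (b' - b i)) • ((fun v : Fin 2 → k => frobVec p 𝔽 i v 0 ^ (p - 1 - b') *
        frobVec p 𝔽 i v 1 ^ (b' - N - 1)) * fun v : Fin 2 → k => frobVec p 𝔽 i v 1 ^ p) := by
      ext v
      have hu0 : frobVec p 𝔽 i ((upper t).val.mulVec v) 0 =
          frobVec p 𝔽 i v 0 + T * frobVec p 𝔽 i v 1 := by
        rw [frobVec_mulVec', mapGL_upper]
        simp [Matrix.mulVec, dotProduct, Fin.sum_univ_two, upper, iterateFrobenius_def, hT]
      have hu1 : frobVec p 𝔽 i ((upper t).val.mulVec v) 1 = frobVec p 𝔽 i v 1 := by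
        rw [frobVec_mulVec', mapGL_upper]
        simp [Matrix.mulVec, dotProduct, Fin.sum_univ_two, upper]
      have hT' : (algebraMap k 𝔽).comp (iterateFrobenius k p i) t = T := by
        simp [iterateFrobenius_def, hT]
      simp only [H, mapGL_upper, hT']
      rw [symBasis_repr_specialPow, symBasis_repr_symRep_specialPow, hu0, hu1,
        add_pow_expand _ _ _ hNp (Nat.le_of_lt_succ (b i).2),
        ← Finset.sum_range_add_sum_Ico _ (show N + 1 ≤ p by omega), add_sub_cancel_left,
        Finset.sum_apply]
      apply Finset.sum_congr rfl
      intro b' hb'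
      have hb1 := Finset.mem_Ico.1 hb'
      simp only [Pi.smul_apply, Pi.mul_apply, smul_eq_mul]
      rw [show p - 1 - N + b' = (b' - N - 1) + p by omega, pow_add]
      ring
    rw [hH']
    refine Submodule.sum_mem _ fun b' hb' => Submodule.smul_mem _ _ ?_
    have hb1 := Finset.mem_Ico.1 hb'
    refine Submodule.mul_mem_mul ?_ (frobVec_pow_mem p hk i 1)
    have h3 := Submodule.mul_mem_mul
      (Submodule.pow_mem_pow _ (frobVec_mem_coordSpan (k := k) (𝔽 := 𝔽) p i 0) (p - 1 - b'))
      (Submodule.pow_mem_pow _ (frobVec_mem_coordSpan (k := k) (𝔽 := 𝔽) p i 1) (b' - N - 1))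
    rw [← pow_add, show p - 1 - b' + (b' - N - 1) = τ.deg i by
      rw [hNdef, h.deg_i] at hb1 ⊢; omega] at h3
    exact h3
  have hprod : (∏ j ∈ Finset.univ.erase i, G j) ∈
      ∏ j ∈ Finset.univ.erase i, coordSpan (𝔽 := 𝔽) (k := k) p j ^ σ.deg j := by
    have h5 : ∀ s : Finset (Fin f), (∏ j ∈ s, G j) ∈
        ∏ j ∈ s, coordSpan (𝔽 := 𝔽) (k := k) p j ^ σ.deg j := by
      intro s
      induction s using Finset.induction_on with
      | empty => rw [Finset.prod_empty, Finset.prod_empty]; exact Submodule.one_le.1 le_rfl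
      | insert a s ha ih =>
        rw [Finset.prod_insert ha, Finset.prod_insert ha]
        exact Submodule.mul_mem_mul (hG a) ih
    exact h5 _
  rw [hGH]
  have h6 := Submodule.mul_mem_mul hH hprod
  have h7 : coordSpan (𝔽 := 𝔽) (k := k) p i ^ τ.deg i *
      coordSpan (𝔽 := 𝔽) (k := k) p (i + 1 : Fin f) *
      ∏ j ∈ Finset.univ.erase i, coordSpan (𝔽 := 𝔽) (k := k) p j ^ σ.deg j =
      τ.funSpan p k 𝔽 := by
    have hmem : i + 1 ∈ Finset.univ.erase i := Finset.mem_erase.2 ⟨h.succ_ne, Finset.mem_univ _⟩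
    rw [Weight.funSpan, ← Finset.mul_prod_erase Finset.univ _ (Finset.mem_univ i),
      ← Finset.mul_prod_erase _ _ hmem, ← Finset.mul_prod_erase _ _ hmem, mul_assoc]
    congr 1
    rw [← mul_assoc, ← pow_succ', h.deg_succ, Nat.sub_add_cancel h.deg_pos]
    congr 1
    apply Finset.prod_congr rfl
    intro j hj
    rw [h.deg_other j (Finset.ne_of_mem_erase (Finset.mem_of_mem_erase hj))
      (Finset.ne_of_mem_erase hj)]
  rwa [h7] at h6

end Extension

/-! ### The extension determined by the two maps on measures -/

section Extension

variable {p : ℕ} [Fact p.Prime] {k : Type u} [Field k] [CharP k p] {𝔽 : Type v} [Field 𝔽]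
  [Algebra k 𝔽] {f : ℕ} [NeZero f] {τ σ : Weight f} {i : Fin f}

/-- Each coordinate of the deviation is the integral of a function `F` in `τ.funSpan`, and measures
in the kernel of `τ.measMap` annihilate such functions. -/
theorem Weight.twistMap_generator (h : ExtPair p τ σ i) {g : GL2 k}
    (hg : ∀ b : σ.Idx, ∃ F ∈ τ.funSpan p k 𝔽, ∀ v,
      (σ.basis 𝔽).repr (((mapGL (algebraMap k 𝔽) g).det ^ τ.tw : 𝔽ˣ).val •
        σ.twistPow p k 𝔽 i (g.val.mulVec v) - σ.rep p k 𝔽 g (σ.twistPow p k 𝔽 i v)) b = F v)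
    {c : (Fin 2 → k) →₀ 𝔽} (hc : τ.measMap p k 𝔽 c = 0) :
    σ.twistMap p k 𝔽 i (measRep k 𝔽 τ.tw g c) = σ.rep p k 𝔽 g (σ.twistMap p k 𝔽 i c) := by
  rw [← sub_eq_zero]
  apply (σ.basis 𝔽).ext_elem
  intro b
  obtain ⟨F, hF, hFv⟩ := hg b
  rw [map_zero, Finsupp.zero_apply, ← Weight.annihilates_funSpan p h.deg_lt hc hF]
  have : ∀ c : (Fin 2 → k) →₀ 𝔽, (σ.basis 𝔽).repr (σ.twistMap p k 𝔽 i (measRep k 𝔽 τ.tw g c) -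
      σ.rep p k 𝔽 g (σ.twistMap p k 𝔽 i c)) b = Finsupp.linearCombination 𝔽 F c := by
    intro c
    induction c using Finsupp.induction_linear with
    | zero => simp
    | add c d hc hd =>
      rw [map_add (Finsupp.linearCombination 𝔽 F), ← hc, ← hd, ← Finsupp.add_apply, ← map_add]
      congr 2
      simp only [map_add]
      abel
    | single v a =>
      rw [measRep_single, Weight.twistMap, map_smul, Finsupp.linearCombination_single,
        Finsupp.linearCombination_single, Finsupp.linearCombination_single, ← hFv, map_smul,
        smul_comm, ← smul_sub, map_smul, Finsupp.smul_apply]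
  exact this c

/-- The kernel of `τ.measMap` is stable under `GL₂(k)`, so equivariance on it passes to products and
needs to be checked on generators only. -/
theorem Weight.twistMap_equivariant (hp2 : Odd p) [Finite k] (hk : Nat.card k = p ^ f)
    (h : ExtPair p τ σ i) (g : GL2 k)
    {c : (Fin 2 → k) →₀ 𝔽} (hc : τ.measMap p k 𝔽 c = 0) :
    σ.twistMap p k 𝔽 i (measRep k 𝔽 τ.tw g c) = σ.rep p k 𝔽 g (σ.twistMap p k 𝔽 i c) := by
  revert c
  apply GL2_induction (P := fun g => ∀ {c : (Fin 2 → k) →₀ 𝔽}, τ.measMap p k 𝔽 c = 0 →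
    σ.twistMap p k 𝔽 i (measRep k 𝔽 τ.tw g c) = σ.rep p k 𝔽 g (σ.twistMap p k 𝔽 i c))
  · intro g g' hg hg' c hc
    rw [map_mul, Module.End.mul_apply, hg, hg' hc, map_mul, Module.End.mul_apply]
    rw [Weight.measMap_equivariant, hc, map_zero]
  · intro t c hc
    apply Weight.twistMap_generator h _ hc
    intro b
    refine ⟨_, Weight.twistPow_upper hk h t b, fun v => ?_⟩
    have hdet : (mapGL (algebraMap k 𝔽) (upper t)).det = 1 := by
      rw [mapGL_upper]
      apply Units.ext
      simp [Matrix.GeneralLinearGroup.det, Matrix.det_fin_two]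
    rw [Weight.rep_apply, hdet]
    simp
  · intro a d c hc
    apply Weight.twistMap_generator h _ hc
    intro b
    refine ⟨0, zero_mem _, fun v => ?_⟩
    rw [Weight.twistPow_diagMat hk h, sub_self]
    simp
  · intro c hc
    apply Weight.twistMap_generator h _ hc
    intro b
    refine ⟨0, zero_mem _, fun v => ?_⟩
    rw [Weight.twistPow_swapMat hp2 hk h, sub_self]
    simp

/-- All coefficients of `specialPow` contain `y` with exponent at least `τ_i + 1 > 0`. Thus the
translates of `δ_(1,0)` under `B` have trivial component in `σ`. -/
theorem Weight.twistPow_of_second_eq_zero (h : ExtPair p τ σ i) {v : Fin 2 → k}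
    (hv : v 1 = 0) : σ.twistPow p k 𝔽 i v = 0 := by
  have hp := (Fact.out : p.Prime).two_le
  apply (σ.basis 𝔽).ext_elem
  intro b
  rw [Weight.twistPow, Weight.repr_tmul, map_zero, Finsupp.zero_apply]
  refine Finset.prod_eq_zero (Finset.mem_univ i) ?_
  have h1 : p - 1 - σ.deg i + b i ≠ 0 := by
    have := h.deg_i
    have : p - 1 - σ.deg i ≠ 0 := by omega
    omega
  have h2 : frobVec p 𝔽 i v 1 = 0 := by simp [frobVec, hv, (Fact.out : p.Prime).ne_zero]
  rw [if_pos rfl, symBasis_repr_specialPow, h2, zero_pow h1, mul_zero]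

/-- There is a measure in the kernel of `measMap` which is not in the kernel of `twistMap`. -/
theorem Weight.exists_twistMap_ne_zero [Finite k] (hk : Nat.card k = p ^ f)
    (h : ExtPair p τ σ i) :
    ∃ c, τ.measMap p k 𝔽 c = 0 ∧ σ.twistMap p k 𝔽 i c ≠ 0 := by
  classical
  have hp := (Fact.out : p.Prime).two_le
  by_contra! hcon
  -- If `twistMap` vanished on the kernel of `measMap`, its coordinate `K` would be a combination of
  -- the coordinates `L j` of `measMap`.
  let K : ((Fin 2 → k) →₀ 𝔽) →ₗ[𝔽] 𝔽 := (σ.basis 𝔽).coord (fun _ => 0) ∘ₗ σ.twistMap p k 𝔽 i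
  let L : τ.Idx → ((Fin 2 → k) →₀ 𝔽) →ₗ[𝔽] 𝔽 := fun j => (τ.basis 𝔽).coord j ∘ₗ τ.measMap p k 𝔽
  have hK : K ∈ Submodule.span 𝔽 (Set.range L) := by
    apply mem_span_of_iInf_ker_le_ker
    intro c hc
    rw [Submodule.mem_iInf] at hc
    have : τ.measMap p k 𝔽 c = 0 := by
      apply (τ.basis 𝔽).ext_elem
      intro j
      rw [map_zero, Finsupp.zero_apply]
      exact hc j
    simp [K, LinearMap.mem_ker, hcon c this]
  obtain ⟨a, ha⟩ := (Submodule.mem_span_range_iff_exists_fun 𝔽).1 hK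
  set M : ℕ := p ^ (i : ℕ) * (τ.deg i + 1) with hM
  have hMlt : M < Nat.card k := by
    rw [hk, hM]
    calc p ^ (i : ℕ) * (τ.deg i + 1) < p ^ (i : ℕ) * p := by
          apply Nat.mul_lt_mul_of_pos_left _ (by positivity)
          have := h.deg_le
          omega
      _ = p ^ ((i : ℕ) + 1) := (pow_succ _ _).symm
      _ ≤ p ^ f := Nat.pow_le_pow_right (by omega) i.2
  -- The coefficients of the relation at the points `(1, t)`: there `K` is `t^M`, and `L j` is a
  -- multiple of `t^(num j)`.
  let y : ℕ → 𝔽 := fun m => (if m = M then 1 else 0) - ∑ j : τ.Idx,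
    if Weight.num p j = m then a j * ∏ j' : Fin f, ((τ.deg j').choose (j j') : 𝔽) else 0
  have hy := coeff_mem_of_values_mem (k := k) (⊥ : Submodule 𝔽 𝔽) y (by
    intro t
    have h1 := LinearMap.congr_fun ha (Finsupp.single ![1, t] 1)
    simp only [K, L, LinearMap.sum_apply, LinearMap.smul_apply, LinearMap.comp_apply,
      Weight.measMap, Weight.twistMap, Finsupp.linearCombination_single, one_smul,
      Module.Basis.coord_apply, Weight.repr_purePow, Weight.twistPow, Weight.repr_tmul] at h1
    have h2 : (∏ x : Fin f, ((symBasis 𝔽 (σ.deg x)).repr (if x = i then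
        specialPow p (σ.deg x) (frobVec p 𝔽 x ![1, t]) else
        symPow (σ.deg x) (frobVec p 𝔽 x ![1, t]))) 0) = algebraMap k 𝔽 t ^ M := by
      rw [Finset.prod_eq_single i]
      · rw [if_pos rfl, symBasis_repr_specialPow]
        have : p - 1 - (p - 2 - τ.deg i) = τ.deg i + 1 := by
          have := h.deg_le
          omega
        simp [frobVec, h.deg_i, this, hM, pow_mul]
      · intro j _ hj
        rw [if_neg hj, symBasis_repr_symPow]
        simp [frobVec]
      · simp
    rw [h2] at h1
    have h3 : ∀ x : τ.Idx, Weight.num p x ∈ Finset.range (Nat.card k) := fun x =>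
      Finset.mem_range.2 (hk ▸ Weight.num_lt h.deg_lt x)
    rw [Submodule.mem_bot]
    simp only [y, smul_eq_mul, mul_sub, Finset.sum_sub_distrib, mul_ite, mul_one, mul_zero,
      Finset.sum_ite_eq', Finset.mem_range, hMlt, if_true, Finset.mul_sum]
    rw [Finset.sum_comm, ← h1, sub_eq_zero]
    apply Finset.sum_congr rfl
    intro j _
    rw [Finset.sum_ite_eq, if_pos (h3 j), smul_eq_mul, mul_left_comm]
    congr 1
    rw [Finset.prod_mul_distrib, Finset.prod_mul_distrib, mul_comm]
    simp only [frobVec, Matrix.cons_val_zero, Matrix.cons_val_one, map_one, one_pow,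
      Finset.prod_const_one, mul_one, ← pow_mul]
    congr 1
    rw [Finset.prod_pow_eq_pow_sum]
    simp [Weight.num, digitSum, mul_comm]) hMlt
  simp only [y, if_true, Submodule.mem_bot] at hy
  rw [Finset.sum_eq_zero, sub_zero] at hy
  · exact one_ne_zero hy
  intro j _
  rw [if_neg]
  intro hj
  -- The digit of `M` at `i` is `τ_i + 1`, whereas that of `num j` is at most `τ_i`. So `t^M` is not
  -- cancelled.
  have h4 : M = digitSum p fun j => if j = i then τ.deg i + 1 else 0 := by
    simp [digitSum, hM, mul_comm]
  rw [h4] at hj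
  have h5 := congrFun (digitSum_inj (fun l => by have := (j l).2; have := h.deg_lt l; omega)
    (fun l => by have := h.deg_le; split_ifs <;> omega) hj) i
  have := (j i).2
  simp only [if_true] at h5
  omega

theorem exists_mulVec_eq {v : Fin 2 → k} (hv : v ≠ 0) : ∃ g : GL2 k, g.val.mulVec ![1, 0] = v := by
  by_cases h0 : v 0 = 0
  · have h1 : v 1 ≠ 0 := by
      intro h1
      apply hv
      ext a
      fin_cases a <;> assumption
    refine ⟨Matrix.GeneralLinearGroup.mkOfDetNeZero !![0, 1; v 1, 0] (by
      simpa [Matrix.det_fin_two] using h1), ?_⟩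
    ext a
    fin_cases a <;> simp [Matrix.GeneralLinearGroup.mkOfDetNeZero, Matrix.mulVec, dotProduct,
      Fin.sum_univ_two, h0]
  · refine ⟨Matrix.GeneralLinearGroup.mkOfDetNeZero !![v 0, 0; v 1, 1] (by
      simpa [Matrix.det_fin_two] using h0), ?_⟩
    ext a
    fin_cases a <;> simp [Matrix.GeneralLinearGroup.mkOfDetNeZero, Matrix.mulVec, dotProduct,
      Fin.sum_univ_two]

/-- Existence of a nonsplit extension such that the highest weight vector of the quotient lifts to
an eigenvector of the Borel subgroup which is fixed by the unipotent subgroup. -/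
theorem ExtPair.exists_extension (hp2 : Odd p) [Finite k] (hk : Nat.card k = p ^ f)
    (h : ExtPair p τ σ i) :
    ∃ (E : NonsplitExtension (σ.rep p k 𝔽) (τ.rep p k 𝔽)) (x : E.E),
      (∀ t : k, E.rep (upper t) x = x) ∧
      (∀ b : borel k, E.rep b x = (τ.chi p k 𝔽 b : 𝔽) • x) ∧ E.proj x = τ.hw 𝔽 := by
  -- The extension is the space of measures modulo the common kernel of `Φ` and `Θ`. The image of
  -- the kernel of `Φ` is the subrepresentation `σ`, and `δ_(1,0)` gives the lift.
  let Φ := τ.measMap p k 𝔽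
  let Θ := σ.twistMap p k 𝔽 i
  let Ψ : ((Fin 2 → k) →₀ 𝔽) →ₗ[𝔽] τ.Space 𝔽 × σ.Space 𝔽 := Φ.prod Θ
  have hΦeq : ∀ g c, Φ (measRep k 𝔽 τ.tw g c) = τ.rep p k 𝔽 g (Φ c) := fun g c =>
    Weight.measMap_equivariant p τ g c
  have hΘeq : ∀ g c, Φ c = 0 → Θ (measRep k 𝔽 τ.tw g c) = σ.rep p k 𝔽 g (Θ c) := fun g c hc =>
    Weight.twistMap_equivariant hp2 hk h g hc
  have hfirst : Φ (Finsupp.single ![1, 0] 1) = τ.hw 𝔽 := by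
    simp [Φ, Weight.measMap, Weight.purePow_first]
  have hΦ : ∀ x, ∃ c, Φ c = x := by
    have := Weight.eq_top_of_hw_mem h.deg_lt hk (LinearMap.range Φ) (by
      rintro g _ ⟨c, rfl⟩
      exact ⟨_, hΦeq g c⟩) ⟨_, hfirst⟩
    exact fun x => LinearMap.range_eq_top.1 this x
  -- `Θ (ker Φ)` is a nonzero subrepresentation of the irreducible `σ`.
  have hΘ : ∀ y, ∃ c, Φ c = 0 ∧ Θ c = y := by
    obtain ⟨c, hc0, hc⟩ := Weight.exists_twistMap_ne_zero (𝔽 := 𝔽) hk h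
    have := Weight.eq_top_of_ne_zero_mem h.deg_lt' hk ((LinearMap.ker Φ).map Θ) (by
      rintro g _ ⟨c, hc, rfl⟩
      have hc' : Φ c = 0 := hc
      refine ⟨measRep k 𝔽 τ.tw g c, ?_, hΘeq g c hc'⟩
      rw [SetLike.mem_coe, LinearMap.mem_ker, hΦeq, hc', map_zero]) hc ⟨c, hc0, rfl⟩
    intro y
    have hy : y ∈ (LinearMap.ker Φ).map Θ := this ▸ Submodule.mem_top
    exact hy
  have hΨ : Function.Surjective Ψ := by
    rintro ⟨x, y⟩
    obtain ⟨c, hc⟩ := hΦ x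
    obtain ⟨d, hd, hd'⟩ := hΘ (y - Θ c)
    refine ⟨c + d, ?_⟩
    simp [Ψ, hc, hd, hd']
  have hker : ∀ g c, Ψ c = 0 → Ψ (measRep k 𝔽 τ.tw g c) = 0 := by
    intro g c hc
    have h1 : Φ c = 0 := congrArg Prod.fst hc
    have h2 : Θ c = 0 := congrArg Prod.snd hc
    apply Prod.ext
    · change Φ _ = 0
      rw [hΦeq, h1, map_zero]
    · change Θ _ = 0
      rw [hΘeq g c h1, h2, map_zero]
  obtain ⟨ρ, hρ⟩ := exists_rep_of_surjective _ Ψ hΨ hker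
  have hlast : Θ (Finsupp.single ![1, 0] 1) = 0 := by
    simp [Θ, Weight.twistMap, Weight.twistPow_of_second_eq_zero h]
  have hΨfirst : Ψ (Finsupp.single ![1, 0] 1) = (τ.hw 𝔽, 0) := Prod.ext hfirst hlast
  have hproj : ∀ g e, (ρ g e).1 = τ.rep p k 𝔽 g e.1 := by
    intro g e
    obtain ⟨c, rfl⟩ := hΨ e
    rw [hρ]
    exact hΦeq g c
  have hincl : ∀ g y, ρ g (0, y) = (0, σ.rep p k 𝔽 g y) := by
    intro g y
    obtain ⟨c, hc, rfl⟩ := hΘ y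
    have : Ψ c = (0, Θ c) := Prod.ext hc rfl
    rw [← this, hρ]
    apply Prod.ext
    · change Φ _ = 0
      rw [hΦeq, hc, map_zero]
    · exact hΘeq g c hc
  have hupper : ∀ t : k, ρ (upper t) (τ.hw 𝔽, 0) = (τ.hw 𝔽, 0) := by
    intro t
    have hdet : (mapGL (algebraMap k 𝔽) (upper t)).det = 1 := by
      rw [mapGL_upper]
      apply Units.ext
      simp [Matrix.GeneralLinearGroup.det, Matrix.det_fin_two]
    have hv : (upper t).val.mulVec ![1, 0] = ![1, 0] := by
      ext a
      fin_cases a <;> simp [Matrix.mulVec, dotProduct, Fin.sum_univ_two, upper]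
    rw [← hΨfirst, hρ, measRep_single, hdet, hv, one_zpow, Units.val_one, one_smul]
  have hborel : ∀ b : borel k, ρ b (τ.hw 𝔽, 0) = (τ.chi p k 𝔽 b : 𝔽) • (τ.hw 𝔽, 0) := by
    intro b
    have hv1 : (b : GL2 k).val.mulVec ![1, 0] 1 = 0 := by
      have : (b : GL2 k) 1 0 = 0 := b.2
      simpa [Matrix.mulVec, dotProduct, Fin.sum_univ_two] using this
    rw [← hΨfirst, hρ]
    apply Prod.ext
    · change Φ _ = (τ.chi p k 𝔽 b : 𝔽) • Φ _
      rw [hΦeq, hfirst, Weight.rep_borel_hw]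
    · change Θ _ = (τ.chi p k 𝔽 b : 𝔽) • Θ _
      rw [hlast, smul_zero, measRep_single, map_smul]
      simp only [Θ, Weight.twistMap, Finsupp.linearCombination_single]
      rw [Weight.twistPow_of_second_eq_zero h hv1, smul_zero, smul_zero]
  refine ⟨{
    E := τ.Space 𝔽 × σ.Space 𝔽
    rep := ρ
    incl := ⟨LinearMap.inr 𝔽 _ _, fun g => LinearMap.ext fun y => (hincl g y).symm⟩
    proj := ⟨LinearMap.fst 𝔽 _ _, fun g => LinearMap.ext fun e => hproj g e⟩
    incl_injective := LinearMap.inr_injective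
    proj_surjective := LinearMap.fst_surjective
    exact := by
      intro e
      constructor
      · intro he
        exact ⟨e.2, Prod.ext (Eq.symm he) rfl⟩
      · rintro ⟨y, rfl⟩
        rfl
    nonsplit := ?_ }, (τ.hw 𝔽, 0), hupper, hborel, rfl⟩
  rintro ⟨s, hs⟩
  have hs1 : ∀ x, (s x).1 = x := hs
  have hseq : ∀ g x, s (τ.rep p k 𝔽 g x) = ρ g (s x) := fun g x => s.isIntertwining _ _ g x
  -- the difference of the two lifts of the highest weight vector
  set y : σ.Space 𝔽 := (s (τ.hw 𝔽)).2 with hy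
  have hsy : s (τ.hw 𝔽) = (τ.hw 𝔽, 0) + (0, y) := by
    apply Prod.ext
    · simpa using hs1 _
    · simp [hy]
  have hyu : ∀ t : k, σ.rep p k 𝔽 (upper t) y = y := by
    intro t
    have h1 := hseq (upper t) (τ.hw 𝔽)
    rw [Weight.rep_upper_hw, hsy, map_add, hupper, hincl] at h1
    exact (congrArg Prod.snd (add_left_cancel h1)).symm
  have hyb : ∀ b : borel k, σ.rep p k 𝔽 b y = (τ.chi p k 𝔽 b : 𝔽) • y := by
    intro b
    have h1 := hseq b (τ.hw 𝔽)
    rw [Weight.rep_borel_hw, map_smul, hsy, map_add, hborel, hincl, smul_add] at h1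
    exact (congrArg Prod.snd (add_left_cancel h1)).symm
  -- A `U`-invariant of `σ` transforms under `B` through `χ(σ)`, while `y` transforms through `χ(τ)
  -- ≠ χ(σ)`.
  have hy0 : y = 0 := by
    obtain ⟨c, hc⟩ := Weight.exists_eq_smul_hw (p := p) h.deg_lt' hk hyu
    by_contra hne
    apply h.chi_ne (𝔽 := 𝔽) hk
    ext b
    have h1 := hyb b
    rw [hc, map_smul, Weight.rep_borel_hw, smul_comm, ← hc, ← sub_eq_zero, ← sub_smul,
      smul_eq_zero, sub_eq_zero] at h1
    exact h1.resolve_right hne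
  -- With `y = 0` the section passes through the image of `δ_(1,0)`, and the translates of this
  -- vector span everything.
  have hrange : ∀ c, Ψ c ∈ LinearMap.range s.toLinearMap := by
    intro c
    induction c using Finsupp.induction_linear with
    | zero => rw [map_zero]; exact zero_mem _
    | add c d hc hd => rw [map_add]; exact add_mem hc hd
    | single v a =>
      -- The point `0` is not a translate of `(1, 0)`, but `δ_0` is killed by `Φ`, because the
      -- degree of `τ` at `i + 1` is positive, and by `Θ`.
      by_cases hv : v = 0
      · have hp := (Fact.out : p.Prime).ne_zero
        have h1 : Φ (Finsupp.single v a) = 0 := by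
          simp only [Φ, Weight.measMap, Finsupp.linearCombination_single]
          have : τ.purePow p k 𝔽 v = 0 := by
            apply (τ.basis 𝔽).ext_elem
            intro b
            rw [Weight.repr_purePow, map_zero, Finsupp.zero_apply]
            refine Finset.prod_eq_zero (Finset.mem_univ (i + 1)) ?_
            have h2 := h.deg_pos
            have h3 := (b (i + 1)).2
            by_cases h4 : (b (i + 1) : ℕ) = 0
            · have : τ.deg (i + 1) - (b (i + 1) : ℕ) ≠ 0 := by omega
              simp [frobVec, hv, this, hp]
            · simp [frobVec, hv, h4, hp]
          rw [this, smul_zero]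
        have h2 : Θ (Finsupp.single v a) = 0 := by
          simp only [Θ, Weight.twistMap, Finsupp.linearCombination_single]
          rw [Weight.twistPow_of_second_eq_zero h (by rw [hv]; rfl), smul_zero]
        have : Ψ (Finsupp.single v a) = 0 := Prod.ext h1 h2
        rw [this]
        exact zero_mem _
      · obtain ⟨g, rfl⟩ := exists_mulVec_eq hv
        have h1 : s (τ.rep p k 𝔽 g (τ.hw 𝔽)) = Ψ (measRep k 𝔽 τ.tw g (Finsupp.single ![1, 0] 1)) := by
          rw [hseq, hsy, hy0, ← hρ, hΨfirst]
          congr 1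
          ext <;> simp
        rw [measRep_single, map_smul] at h1
        have h2 : Ψ (Finsupp.single (g.val.mulVec ![1, 0]) 1) ∈ LinearMap.range s.toLinearMap :=
          ((LinearMap.range s.toLinearMap).smul_mem_iff (Units.ne_zero _)).1 ⟨_, h1⟩
        have h3 := (LinearMap.range s.toLinearMap).smul_mem a h2
        rwa [← map_smul, Finsupp.smul_single, smul_eq_mul, mul_one] at h3
  obtain ⟨c, hc⟩ := hΨ (0, σ.hw 𝔽)
  obtain ⟨z, hz⟩ := hc ▸ hrange c
  have hz' : s z = (0, σ.hw 𝔽) := hz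
  have hz0 : z = 0 := by rw [← hs1 z, hz']
  rw [hz0, map_zero] at hz'
  exact σ.hw_ne_zero (congrArg Prod.snd hz').symm

end Extension

/-! ### Digits of the weights in the cycles -/

section CycVal

open Polynomial

variable {p f : ℕ} [NeZero f]

theorem shift_iterate {α : Type*} (x : Fin f → α) (n : ℕ) (j : Fin f) :
    (shift f)^[n] x j = x ⟨(j + n) % f, Nat.mod_lt _ (NeZero.pos f)⟩ := by
  induction n generalizing j with
  | zero => simp [Nat.mod_eq_of_lt j.2]
  | succ n ih =>
    rw [Function.iterate_succ_apply']
    change (shift f)^[n] x (j + 1) = _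
    rw [ih]
    congr 2
    rw [Fin.val_add, Fin.val_one', Nat.add_mod_mod, Nat.mod_add_mod, add_assoc, add_comm 1]

theorem cycVal_zero (r : Fin f → ℕ) (c : ℕ) (j : Fin f) : cycVal p r c 0 j = r j := by
  rw [cycVal, shift_iterate]
  simp [muIter]

theorem cycVal_succ (r : Fin f → ℕ) (c n : ℕ) (j : Fin f) :
    cycVal p r c (n + 1) j = if (j + c + n) % f = 0 then cycVal p r c n j - 1 else
      if (j + c + n) % f = 1 then p - 2 - cycVal p r c n j else p - 1 - cycVal p r c n j := by
  simp only [cycVal, shift_iterate, muIter]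
  rw [eval_comp, mu]
  simp only [Nat.mod_add_mod]
  split_ifs <;> simp

/-- The digit `r_j`, corrected for the digit on which `x ↦ p - 2 - x` operates first. -/
def corr (r : Fin f → ℕ) (c : ℕ) (j : Fin f) : ℕ := r j + if (j + c) % f = 1 then 1 else 0

/-- The maps `x - 1` and then `p - 2 - x` compose to the reflection `p - 1 - x`. So the digit is
reflected in every step except those with `(j + c + n) % f = 0`, which are counted by the difference
of the two ceilings; right after such a step it is one too small. A digit starting in the middle of
the pair is treated as `r_j + 1` with the subtraction already made, which is `corr`. -/
theorem cycVal_eq (hf : 1 < f) (r : Fin f → ℕ) (c n : ℕ) (j : Fin f) :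
    cycVal p r c n j = (if Even (n + ((j + c) % f + n + f - 1) / f + ((j + c) % f + f - 1) / f) then
      (corr r c j : ℤ) else p - 1 - corr r c j) - if ((j + c) % f + n) % f = 1 then 1 else 0 := by
  set a := (j + c) % f with ha
  have haf : a < f := Nat.mod_lt _ (by omega)
  induction n with
  | zero =>
    have : Even (0 + (a + 0 + f - 1) / f + (a + f - 1) / f) := by
      rw [zero_add, add_zero]
      exact ⟨_, rfl⟩
    rw [if_pos this, cycVal_zero, add_zero, Nat.mod_eq_of_lt haf, corr, ← ha]
    push_cast
    ring
  | succ n ih =>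
    have h1 : (j + c + n) % f = (a + n) % f := by rw [ha, Nat.mod_add_mod]
    rw [cycVal_succ, h1, ih]
    have h2 : (a + (n + 1) + f - 1) / f = (a + n + f - 1) / f + if (a + n) % f = 0 then 1 else 0 := by
      rw [show a + (n + 1) + f - 1 = (a + n + f - 1) + 1 by omega, Nat.succ_div]
      congr 1
      have : f ∣ a + n + f - 1 + 1 ↔ (a + n) % f = 0 := by
        rw [show a + n + f - 1 + 1 = a + n + f by omega, Nat.dvd_add_self_right,
          Nat.dvd_iff_mod_eq_zero]
      simp only [this]
    rw [h2]
    have hmod : (a + (n + 1)) % f = 1 ↔ (a + n) % f = 0 := by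
      rw [← add_assoc, Nat.add_mod_eq_ite, Nat.mod_eq_of_lt (show 1 < f from hf)]
      have := Nat.mod_lt (a + n) (show 0 < f by omega)
      split_ifs <;> omega
    simp only [hmod]
    by_cases h0 : (a + n) % f = 0
    · simp only [h0, if_true]
      have : Even (n + 1 + ((a + n + f - 1) / f + 1) + (a + f - 1) / f) ↔
          Even (n + (a + n + f - 1) / f + (a + f - 1) / f) := by
        rw [show n + 1 + ((a + n + f - 1) / f + 1) + (a + f - 1) / f =
          (n + (a + n + f - 1) / f + (a + f - 1) / f) + 2 by ring, Nat.even_add]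
        simp
      simp only [this]
      simp
    · simp only [h0, if_false, add_zero]
      have : Even (n + 1 + (a + n + f - 1) / f + (a + f - 1) / f) ↔
          ¬ Even (n + (a + n + f - 1) / f + (a + f - 1) / f) := by
        rw [show n + 1 + (a + n + f - 1) / f + (a + f - 1) / f =
          (n + (a + n + f - 1) / f + (a + f - 1) / f) + 1 by ring, Nat.even_add_one]
      simp only [this]
      split_ifs <;> omega

variable {r : Fin f → ℕ}

theorem corr_bounds (hp : 3 < p) (hr : ∀ j, 1 ≤ r j ∧ r j ≤ p - 3) (c : ℕ) (j : Fin f) :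
    1 ≤ corr r c j ∧ corr r c j ≤ p - 2 := by
  have := hr j
  unfold corr
  split_ifs <;> omega

theorem cycVal_bounds (hf : 1 < f) (hp : 3 < p) (hr : ∀ j, 1 ≤ r j ∧ r j ≤ p - 3) (c n : ℕ)
    (j : Fin f) : 0 ≤ cycVal p r c n j ∧ cycVal p r c n j ≤ p - 2 := by
  have := corr_bounds hp hr c j
  rw [cycVal_eq hf]
  split_ifs <;> omega

/-- The index of the digit on which `x ↦ x - 1` operates in the step with number `n`. -/
def stepIdx (f : ℕ) [NeZero f] (c n : ℕ) : Fin f :=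
  ⟨(f - (n + c) % f) % f, Nat.mod_lt _ (NeZero.pos f)⟩

theorem stepIdx_iff (c n : ℕ) (j : Fin f) : (j + c + n) % f = 0 ↔ j = stepIdx f c n := by
  have h1 := Nat.mod_lt (n + c) (NeZero.pos f)
  have h2 := j.2
  have h3 : (j + c + n) % f = (j + (n + c) % f) % f := by
    rw [Nat.add_mod_mod, add_assoc, add_comm c]
  rw [h3, Fin.ext_iff]
  simp only [stepIdx]
  rcases Nat.eq_zero_or_pos ((n + c) % f) with h0 | h0
  · rw [h0, add_zero, Nat.sub_zero, Nat.mod_self, Nat.mod_eq_of_lt h2]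
  · rw [Nat.mod_eq_of_lt (show f - (n + c) % f < f by omega)]
    constructor
    · intro h
      have h4 := Nat.div_add_mod (j + (n + c) % f) f
      rw [h, add_zero] at h4
      have h5 : (j + (n + c) % f) / f = 1 := by
        have h7 : (j + (n + c) % f) / f < 2 := by rw [Nat.div_lt_iff_lt_mul (NeZero.pos f)]; omega
        have h8 : (j + (n + c) % f) / f ≠ 0 := by
          intro h6
          rw [h6, mul_zero] at h4
          omega
        generalize (j + (n + c) % f) / f = q at h7 h8
        omega
      rw [h5] at h4
      omega
    · intro h
      rw [h, Nat.sub_add_cancel h1.le, Nat.mod_self]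

theorem stepIdx_succ_iff (hf : 1 < f) (c n : ℕ) (j : Fin f) :
    (j + c + n) % f = 1 ↔ j = stepIdx f c n + 1 := by
  rw [← sub_eq_iff_eq_add, ← stepIdx_iff]
  have : ((j - 1 : Fin f) : ℕ) = if (j : ℕ) = 0 then f - 1 else j - 1 := by
    have h2 := j.2
    split_ifs with h
    · rw [Fin.sub_def]
      simp only [Fin.val_one', h, add_zero]
      rw [Nat.mod_eq_of_lt hf, Nat.mod_eq_of_lt (by omega)]
    · rw [Fin.sub_def]
      simp only [Fin.val_one']
      rw [Nat.mod_eq_of_lt hf, show f - 1 + (j : ℕ) = (j - 1) + f by omega, Nat.add_mod_right,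
        Nat.mod_eq_of_lt (by omega)]
  rw [this]
  have hlt := Nat.mod_lt (j + c + n) (show 0 < f by omega)
  split_ifs with h
  · have e : f - 1 + c + n + 1 = j + c + n + f := by omega
    have h3 : (f - 1 + c + n + 1) % f = (j + c + n) % f := by rw [e, Nat.add_mod_right]
    rw [← h3, Nat.add_mod_eq_ite, Nat.mod_eq_of_lt hf]
    have := Nat.mod_lt (f - 1 + c + n) (show 0 < f by omega)
    split_ifs <;> omega
  · have e : (j : ℕ) - 1 + c + n + 1 = j + c + n := by omega
    rw [← e, Nat.add_mod_eq_ite, Nat.mod_eq_of_lt hf]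
    have := Nat.mod_lt ((j : ℕ) - 1 + c + n) (show 0 < f by omega)
    split_ifs <;> omega

theorem stepIdx_succ_ne (hf : 1 < f) (i : Fin f) : i + 1 ≠ i := by
  intro h
  have h1 : (1 : Fin f) = 0 := by simpa using h
  have := congrArg Fin.val h1
  rw [Fin.val_one', Nat.mod_eq_of_lt hf] at this
  simp at this

theorem sum_pred_mul_pow : ∑ j : Fin f, (p : ℤ) ^ (j : ℕ) * (p - 1) = p ^ f - 1 := by
  rw [Fin.sum_univ_eq_sum_range (fun j => (p : ℤ) ^ j * (p - 1)), ← Finset.sum_mul]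
  exact geom_sum_mul _ _

/-- The coefficient of `x` is `-1` rather than `1`. Hence the case distinction in `eExp` only asks
whether the last digit is the one being decremented. -/
theorem mu_ne (j : ℕ) (hj0 : j ≠ 0) (hjf : j < f) :
    ¬ (mu p f ⟨j, hjf⟩ = X ∨ mu p f ⟨j, hjf⟩ = X - 1) := by
  have key : ∀ a : ℤ, (C a - X : ℤ[X]).coeff 1 = -1 := by
    intro a
    rw [coeff_sub, coeff_C_succ, coeff_X_one]
    norm_num
  have hX1 : (X - 1 : ℤ[X]).coeff 1 = 1 := by
    rw [coeff_sub, coeff_X_one, ← C_1, coeff_C_succ]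
    norm_num
  unfold mu
  simp only [hj0, if_false]
  rintro (h | h)
  · have := congrArg (fun P => coeff P 1) h
    split_ifs at this <;> · rw [key, coeff_X_one] at this; norm_num at this
  · have := congrArg (fun P => coeff P 1) h
    split_ifs at this <;> · rw [key, hX1] at this; norm_num at this

/-- The value of `e` at the steps of the two cycles. -/
theorem eExp_eq (hf : 1 < f) (c n : ℕ) (x : Fin f → ℤ) :
    eExp p f ((shift f)^[n + c] (mu p f)) x =
      (∑ j, x j * p ^ (j : ℕ)) - x (stepIdx f c n) * p ^ (stepIdx f c n : ℕ) +
        p ^ ((stepIdx f c n + 1 : Fin f) : ℕ) := by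
  set i := stepIdx f c n with hi
  -- The reflection `p - 1 - x` contributes `2x - (p - 1)`; the other two summands are the
  -- corrections at the digits `i` and `i + 1`.
  have hval : ∀ j : Fin f, (x j - ((shift f)^[n + c] (mu p f) j).eval (x j)) =
      (2 * x j - (p - 1)) + (if j = i then p - 2 * x j else 0) + (if j = i + 1 then 1 else 0) := by
    intro j
    have e1 := stepIdx_iff c n j
    have e2 := stepIdx_succ_iff hf c n j
    rw [← hi] at e1 e2
    have e3 : (j + (n + c)) % f = (j + c + n) % f := by congr 1; ring
    rw [shift_iterate, mu]
    simp only [e3, e1, e2]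
    have hne := stepIdx_succ_ne hf i
    by_cases h1 : j = i
    · rw [if_pos h1, if_pos h1, if_neg (by rw [h1]; exact hne.symm)]
      simp
    · by_cases h2 : j = i + 1
      · rw [if_neg h1, if_pos h2, if_neg h1, if_pos h2]
        simp
        ring
      · rw [if_neg h1, if_neg h2, if_neg h1, if_neg h2]
        simp
        ring
  have hsum : ∑ j : Fin f, (p : ℤ) ^ (j : ℕ) * (x j - ((shift f)^[n + c] (mu p f) j).eval (x j)) =
      2 * ((∑ j, x j * p ^ (j : ℕ)) - x i * p ^ (i : ℕ)) - (p ^ f - 1) + p ^ (i : ℕ) * p +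
        p ^ ((i + 1 : Fin f) : ℕ) := by
    simp only [hval, mul_add, Finset.sum_add_distrib, mul_ite, mul_zero, mul_one,
      Finset.sum_ite_eq', Finset.mem_univ, if_true, mul_sub, Finset.sum_sub_distrib]
    have := sum_pred_mul_pow (p := p) (f := f)
    simp only [mul_sub, Finset.sum_sub_distrib, mul_one] at this
    have h2 : ∑ j : Fin f, (p : ℤ) ^ (j : ℕ) * (2 * x j) = 2 * ∑ j, x j * p ^ (j : ℕ) := by
      rw [Finset.mul_sum]
      apply Finset.sum_congr rfl
      intro j _
      ring
    rw [h2]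
    linear_combination -this
  have hlast : (shift f)^[n + c] (mu p f) (Fin.rev 0) = mu p f ⟨(f - 1 + c + n) % f,
      Nat.mod_lt _ (by omega)⟩ := by
    rw [shift_iterate]
    congr 2
    simp
    congr 1
    ring
  unfold eExp
  rw [hlast, hsum]
  -- For `i = f - 1` the term `p^i · p` is `p^f` and cancels `-(p^f - 1)` up to `1`. Otherwise `p^f
  -- - 1` is added by the definition of `eExp`. Both ways the numerator is visibly even.
  by_cases hif : (i : ℕ) + 1 = f
  · have h0 : (f - 1 + c + n) % f = 0 := by
      have h1 := (stepIdx_iff c n i).2 hi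
      rwa [← hif, Nat.add_sub_cancel, hif]
    have h3 : ((i + 1 : Fin f) : ℕ) = 0 := by
      rw [Fin.val_add, Fin.val_one', Nat.add_mod_mod, hif, Nat.mod_self]
    rw [if_pos (Or.inr _), h3, pow_zero, ← pow_succ, hif]
    · rw [show 2 * ((∑ j, x j * (p : ℤ) ^ (j : ℕ)) - x i * p ^ (i : ℕ)) - (p ^ f - 1) + p ^ f + 1 =
        2 * (((∑ j, x j * (p : ℤ) ^ (j : ℕ)) - x i * p ^ (i : ℕ)) + 1) by ring,
        Int.mul_ediv_cancel_left _ two_ne_zero]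
    · simp [mu, h0]
  · have hlt : (i : ℕ) + 1 < f := by have := i.2; omega
    have h0 : (f - 1 + c + n) % f ≠ 0 := by
      intro h
      have := (stepIdx_iff c n ⟨f - 1, by omega⟩).1 h
      rw [← hi] at this
      rw [← this] at hif
      simp only at hif
      omega
    rw [if_neg (mu_ne _ h0 _), Fin.val_add_one_of_lt' hlt, pow_succ]
    rw [show (p : ℤ) ^ f - 1 + (2 * ((∑ j, x j * (p : ℤ) ^ (j : ℕ)) - x i * p ^ (i : ℕ)) -
      (p ^ f - 1) + p ^ (i : ℕ) * p + p ^ (i : ℕ) * p) =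
        2 * (((∑ j, x j * (p : ℤ) ^ (j : ℕ)) - x i * p ^ (i : ℕ)) + p ^ (i : ℕ) * p) by ring,
        Int.mul_ediv_cancel_left _ two_ne_zero]

end CycVal

/-! ### Base `p` digits of the twists -/

section Twists

variable {p f : ℕ} [NeZero f] {r : Fin f → ℕ}

/-- The quotient `(a + n + f - 1) / f` is `⌈(a + n)/f⌉`, the number of multiples of `f` below `a +
n`. -/
theorem div_succ_eq (hf : 1 < f) (a n : ℕ) :
    (a + (n + 1) + f - 1) / f = (a + n + f - 1) / f + if (a + n) % f = 0 then 1 else 0 := by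
  rw [show a + (n + 1) + f - 1 = (a + n + f - 1) + 1 by omega, Nat.succ_div]
  congr 1
  have : f ∣ a + n + f - 1 + 1 ↔ (a + n) % f = 0 := by
    rw [show a + n + f - 1 + 1 = a + n + f by omega, Nat.dvd_add_self_right,
      Nat.dvd_iff_mod_eq_zero]
  simp only [this]

/-- The digits at position `a` processed before the `n`-th step in its cycle. -/
def IsInner (f n a : ℕ) : Prop := a ≠ 0 ∧ (a + n + f - 1) / f = (n + f - 1) / f

instance (f n a : ℕ) : Decidable (IsInner f n a) := inferInstanceAs (Decidable (_ ∧ _))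

/-- In the turn which starts with step `h f`, the digit at position `a ≠ 0` is decremented in step
`h f + f - a`. The condition says that this step is not among the first `h f + m`. -/
theorem isInner_iff (h m a : ℕ) (hm : 1 ≤ m) (hmf : m ≤ f) (ha : a < f) :
    IsInner f (h * f + m) a ↔ a ≠ 0 ∧ a + m ≤ f := by
  have hf : 0 < f := by omega
  have e1 : (h * f + m + f - 1) / f = h + 1 := by
    rw [show h * f + m + f - 1 = (m - 1) + (h + 1) * f by rw [add_mul]; omega,
      Nat.add_mul_div_right _ _ hf, Nat.div_eq_of_lt (by omega), zero_add]
  have e2 : (a + (h * f + m) + f - 1) / f = h + 1 + (a + m - 1) / f := by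
    rw [show a + (h * f + m) + f - 1 = (a + m - 1) + (h + 1) * f by rw [add_mul]; omega,
      Nat.add_mul_div_right _ _ hf, add_comm]
  unfold IsInner
  rw [e1, e2, Nat.add_eq_left, Nat.div_eq_zero_iff_lt hf]
  omega

theorem ceil_eq (h m : ℕ) (hm : 1 ≤ m) (hmf : m ≤ f) : (h * f + m + f - 1) / f = h + 1 := by
  rw [show h * f + m + f - 1 = (m - 1) + (h + 1) * f by rw [add_mul]; omega,
    Nat.add_mul_div_right _ _ (by omega), Nat.div_eq_of_lt (by omega), zero_add]

/-- The digits of the twist of `cycWeight`. -/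
def twDigit (p : ℕ) (r : Fin f → ℕ) (c n : ℕ) (j : Fin f) : ℕ :=
  if Even (n + (n + f - 1) / f) then (if IsInner f n ((j + c) % f) then corr r c j else 0)
  else (if IsInner f n ((j + c) % f) then p - 1 else corr r c j)

/-- Up to the correction at one digit, the values of `cycVal`. -/
theorem cycVal_add_eq (hf : 1 < f) (c n : ℕ) (j : Fin f) :
    cycVal p r c n j + (if j = stepIdx f c n + 1 then 1 else 0) =
      if (IsInner f n ((j + c) % f) ↔ Even (n + (n + f - 1) / f)) then (p : ℤ) - 1 - corr r c j
      else corr r c j := by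
  have e : (j + c + n) % f = ((j + c) % f + n) % f := by rw [Nat.mod_add_mod]
  rw [cycVal_eq hf]
  simp only [← stepIdx_succ_iff hf, e]
  set a := (j + c) % f with ha
  have haf : a < f := Nat.mod_lt _ (by omega)
  rw [sub_add_cancel]
  have hev : Even (n + (a + n + f - 1) / f + (a + f - 1) / f) ↔
      ¬ (IsInner f n a ↔ Even (n + (n + f - 1) / f)) := by
    by_cases h0 : a = 0
    · have : ¬ IsInner f n a := fun h => h.1 h0
      simp only [this, false_iff, not_not]
      simp only [h0, zero_add, Nat.div_eq_of_lt (show f - 1 < f by omega), add_zero]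
    · have e1 : (a + f - 1) / f = 1 := by
        rw [show a + f - 1 = (a - 1) + 1 * f by omega, Nat.add_mul_div_right _ _ (by omega),
          Nat.div_eq_of_lt (by omega)]
      rw [e1, Nat.even_add_one]
      have h1 : (n + f - 1) / f ≤ (a + n + f - 1) / f := Nat.div_le_div_right (by omega)
      have h2 : (a + n + f - 1) / f ≤ (n + f - 1) / f + 1 := by
        rw [← Nat.add_div_right _ (by omega)]
        exact Nat.div_le_div_right (by omega)
      by_cases h3 : (a + n + f - 1) / f = (n + f - 1) / f
      · have : IsInner f n a := ⟨h0, h3⟩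
        simp only [this, true_iff, h3]
      · have : ¬ IsInner f n a := fun h => h3 h.2
        have h4 : (a + n + f - 1) / f = (n + f - 1) / f + 1 := by omega
        rw [h4, ← add_assoc, Nat.even_add_one]
        simp only [this, false_iff, not_not]
  simp only [hev]
  split_ifs <;> rfl

/-- Within a turn the set of inner positions loses exactly the digit being decremented. -/
theorem isInner_succ (hf : 1 < f) (c n : ℕ) (hn : n % f ≠ 0) (j : Fin f) :
    IsInner f (n + 1) ((j + c) % f) ↔ IsInner f n ((j + c) % f) ∧ j ≠ stepIdx f c n := by
  have e : (j + c + n) % f = ((j + c) % f + n) % f := by rw [Nat.mod_add_mod]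
  rw [Ne, ← stepIdx_iff, e]
  set a := (j + c) % f with ha
  have h1 : (n + f - 1) / f ≤ (a + n + f - 1) / f := Nat.div_le_div_right (by omega)
  have := div_succ_eq hf a n
  have h2 := div_succ_eq hf 0 n
  simp only [zero_add, hn, if_false, add_zero] at h2
  unfold IsInner
  rw [this, h2]
  split_ifs with h <;> omega

theorem isInner_stepIdx (hf : 1 < f) (c n : ℕ) (hn : n % f ≠ 0) :
    IsInner f n ((stepIdx f c n + c) % f) := by
  have e := (stepIdx_iff c n (stepIdx f c n)).2 rfl
  set a := ((stepIdx f c n : ℕ) + c) % f with ha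
  have haf : a < f := Nat.mod_lt _ (by omega)
  rw [← Nat.mod_add_mod, ← ha] at e
  have h0 : a ≠ 0 := by
    intro h
    rw [h, zero_add] at e
    exact hn e
  refine ⟨h0, ?_⟩
  obtain ⟨m, hm⟩ := Nat.dvd_of_mod_eq_zero e
  have h1 : (a + n + f - 1) / f = m := by
    rw [hm, show f * m + f - 1 = (f - 1) + m * f by rw [mul_comm]; omega,
      Nat.add_mul_div_right _ _ (by omega), Nat.div_eq_of_lt (by omega), zero_add]
  rw [h1, show n + f - 1 = (f - 1 - a) + m * f by rw [mul_comm m]; omega,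
    Nat.add_mul_div_right _ _ (by omega), Nat.div_eq_of_lt (by omega), zero_add]

theorem isInner_of_mod_eq_zero (hf : 1 < f) {n : ℕ} (hn : n % f = 0) {a : ℕ} (ha : a < f) :
    ¬ IsInner f n a := by
  obtain ⟨m, rfl⟩ := Nat.dvd_of_mod_eq_zero hn
  rintro ⟨h0, h⟩
  rw [show a + f * m + f - 1 = (a - 1) + (m + 1) * f by rw [add_mul, mul_comm m]; omega,
    show f * m + f - 1 = (f - 1) + m * f by rw [mul_comm m]; omega,
    Nat.add_mul_div_right _ _ (by omega), Nat.add_mul_div_right _ _ (by omega),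
    Nat.div_eq_of_lt (show a - 1 < f by omega), Nat.div_eq_of_lt (show f - 1 < f by omega)] at h
  omega

theorem isInner_succ_of_mod_eq_zero (hf : 1 < f) {n : ℕ} (hn : n % f = 0) {a : ℕ} (ha : a < f) :
    IsInner f (n + 1) a ↔ a ≠ 0 := by
  obtain ⟨m, rfl⟩ := Nat.dvd_of_mod_eq_zero hn
  rw [mul_comm, isInner_iff m 1 a le_rfl hf.le ha]
  omega

/-- The recursion `tw_succ` for the twist holds digit by digit, without carries. In some steps all
digits have to be lowered by `p - 1`, which changes the sum by `p^f - 1`. -/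
theorem twDigit_succ (hf : 1 < f) (hp : 0 < p) (c n : ℕ) (j : Fin f) :
    (twDigit p r c n j : ℤ) + (if j = stepIdx f c n then 0 else
      (cycVal p r c n j + if j = stepIdx f c n + 1 then 1 else 0)) =
    twDigit p r c (n + 1) j +
      if ¬ Even (n + (n + f - 1) / f) ∧ n % f ≠ 0 then (p : ℤ) - 1 else 0 := by
  have hT := div_succ_eq hf 0 n
  simp only [zero_add] at hT
  rw [cycVal_add_eq hf, twDigit, twDigit, hT]
  have hmul : ((p - 1 : ℕ) : ℤ) = p - 1 := by omega
  by_cases hn : n % f = 0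
  · have haf : (j + c) % f < f := Nat.mod_lt _ (by omega)
    have hE : Even (n + 1 + ((n + f - 1) / f + if n % f = 0 then 1 else 0)) ↔
        Even (n + (n + f - 1) / f) := by
      rw [if_pos hn, show n + 1 + ((n + f - 1) / f + 1) = (n + (n + f - 1) / f) + 2 by ring,
        Nat.even_add]
      simp
    have h0 : (j + c) % f = 0 ↔ j = stepIdx f c n := by
      rw [← stepIdx_iff, Nat.add_mod (j + c) n, hn, add_zero, Nat.mod_mod]
    simp only [hE, isInner_of_mod_eq_zero hf hn haf, isInner_succ_of_mod_eq_zero hf hn haf, ne_eq, h0]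
    by_cases hE' : Even (n + (n + f - 1) / f) <;> by_cases hj : j = stepIdx f c n <;>
      simp [hE', hj, hn, hmul]
  · have hE : Even (n + 1 + ((n + f - 1) / f + if n % f = 0 then 1 else 0)) ↔
        ¬ Even (n + (n + f - 1) / f) := by
      rw [if_neg hn, show n + 1 + ((n + f - 1) / f + 0) = (n + (n + f - 1) / f) + 1 by ring,
        Nat.even_add_one]
    simp only [hE, isInner_succ hf c n hn]
    by_cases hE' : Even (n + (n + f - 1) / f) <;> by_cases hj : j = stepIdx f c n
    · have := isInner_stepIdx hf c n hn
      rw [← hj] at this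
      simp [hE', hj]
      simp [← hj, this]
    · by_cases hI : IsInner f n ((j + c) % f) <;> simp [hE', hj, hI, hmul]
    · have := isInner_stepIdx hf c n hn
      rw [← hj] at this
      simp [hE', hj, hmul, hn]
      simp [← hj, this]
    · by_cases hI : IsInner f n ((j + c) % f)
      · simp [hE', hj, hI, hmul, hn]
        ring
      · simp [hE', hj, hI, hn]

theorem tw_succ (hf : 1 < f) (c n : ℕ) :
    (cycWeight p r c (n + 1)).tw = (cycWeight p r c n).tw +
      ((∑ j, cycVal p r c n j * p ^ (j : ℕ)) - cycVal p r c n (stepIdx f c n) *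
        p ^ (stepIdx f c n : ℕ) + p ^ ((stepIdx f c n + 1 : Fin f) : ℕ)) := by
  change ∑ i ∈ Finset.range (n + 1), _ = (∑ i ∈ Finset.range n, _) + _
  rw [Finset.sum_range_succ, eExp_eq hf]

/-- By induction, summing `twDigit_succ` over the digits; the common correction `p - 1` sums to `p^f
- 1`. -/
theorem tw_modEq (hf : 1 < f) (hp : 0 < p) (c n : ℕ) :
    (p : ℤ) ^ f - 1 ∣ (cycWeight p r c n).tw - digitSum p (twDigit p r c n) := by
  induction n with
  | zero =>
    have h : twDigit p r c 0 = fun _ => 0 := by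
      ext j
      have h1 : ¬ IsInner f 0 ((j + c) % f) :=
        isInner_of_mod_eq_zero hf (Nat.zero_mod f) (Nat.mod_lt _ (by omega))
      have h2 : Even (0 + (0 + f - 1) / f) := by
        rw [zero_add, zero_add, Nat.div_eq_of_lt (by omega)]
        exact Even.zero
      rw [twDigit, if_pos h2, if_neg h1]
    rw [h, digitSum_zero]
    simp [cycWeight]
  | succ n ih =>
    rw [tw_succ hf]
    have h1 : ∑ j, ((twDigit p r c n j : ℤ) + (if j = stepIdx f c n then 0 else
        (cycVal p r c n j + if j = stepIdx f c n + 1 then 1 else 0))) * p ^ (j : ℕ) =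
        ∑ j : Fin f, (twDigit p r c (n + 1) j +
          if ¬ Even (n + (n + f - 1) / f) ∧ n % f ≠ 0 then (p : ℤ) - 1 else 0) * p ^ (j : ℕ) :=
      Finset.sum_congr rfl fun j _ => by rw [twDigit_succ hf hp]
    have h2 : ∀ j : Fin f, (if j = stepIdx f c n then (0 : ℤ) else
        (cycVal p r c n j + if j = stepIdx f c n + 1 then 1 else 0)) =
        cycVal p r c n j - (if j = stepIdx f c n then cycVal p r c n j else 0) +
          (if j = stepIdx f c n + 1 then 1 else 0) := by
      intro j
      have := stepIdx_succ_ne hf (stepIdx f c n)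
      by_cases h3 : j = stepIdx f c n
      · simp [h3, this.symm]
      · simp [h3]
    simp only [h2, add_mul, sub_mul, Finset.sum_add_distrib, Finset.sum_sub_distrib, ite_mul,
      zero_mul, one_mul, Finset.sum_ite_eq', Finset.mem_univ, if_true] at h1
    simp only [digitSum] at ih ⊢
    push_cast at ih ⊢
    have hq := sum_pred_mul_pow (p := p) (f := f)
    obtain ⟨z, hz⟩ := ih
    by_cases hc : ¬ Even (n + (n + f - 1) / f) ∧ n % f ≠ 0
    · simp only [if_pos hc] at h1
      have h4 : ∑ j : Fin f, ((p : ℤ) * p ^ (j : ℕ) - 1 * p ^ (j : ℕ)) = p ^ f - 1 := by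
        rw [← hq]
        exact Finset.sum_congr rfl fun j _ => by ring
      simp only [one_mul] at h4
      exact ⟨z + 1, by linear_combination hz + h1 + h4⟩
    · simp only [if_neg hc, Finset.sum_const_zero, add_zero] at h1
      exact ⟨z, by linear_combination hz + h1⟩

/-- A digit different from `p - 1` keeps each number below `p^f - 1`, which removes the ambiguity
between `0` and `p^f - 1`. -/
theorem digits_eq [Fact p.Prime] {d e : Fin f → ℕ} (hd : ∀ j, d j < p) (he : ∀ j, e j < p)
    {i i' : Fin f} (hi : d i < p - 1) (hi' : e i' < p - 1)
    (h : (p : ℤ) ^ f - 1 ∣ (digitSum p d : ℤ) - digitSum p e) : d = e := by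
  have hp : 0 < p := (Fact.out : p.Prime).pos
  apply digitSum_inj hd he
  have h1 := digitSum_lt_sub_one hp hd hi
  have h2 := digitSum_lt_sub_one hp he hi'
  have h3 : (p : ℤ) ^ f = ((p ^ f : ℕ) : ℤ) := by push_cast; rfl
  rw [h3] at h
  have h4 := Int.eq_zero_of_abs_lt_dvd h (by rw [abs_lt]; omega)
  omega

theorem exists_position (c : ℕ) {a : ℕ} (ha : a < f) : ∃ j : Fin f, (j + c) % f = a := by
  refine ⟨⟨(a + c * (f - 1)) % f, Nat.mod_lt _ (by omega)⟩, ?_⟩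
  simp only
  rw [Nat.mod_add_mod, add_assoc, ← Nat.mul_add_one, Nat.sub_add_cancel (by omega),
    Nat.add_mul_mod_self_right, Nat.mod_eq_of_lt ha]

theorem exists_eq_mul_add (f : ℕ) {n : ℕ} (hn : 1 ≤ n) :
    ∃ h m, 1 ≤ m ∧ (0 < f → m ≤ f) ∧ n = h * f + m := by
  refine ⟨(n - 1) / f, (n - 1) % f + 1, by omega, fun hf => ?_, ?_⟩
  · have := Nat.mod_lt (n - 1) hf
    omega
  · have := Nat.div_add_mod' (n - 1) f
    omega

theorem twDigit_lt (hp : 3 < p) (hr : ∀ j, 1 ≤ r j ∧ r j ≤ p - 3) (c n : ℕ)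
    (j : Fin f) : twDigit p r c n j < p := by
  have := corr_bounds hp hr c j
  unfold twDigit
  split_ifs <;> omega

theorem twDigit_of_position_zero (c n : ℕ) {j : Fin f} (hj : (j + c) % f = 0) :
    twDigit p r c n j = if Even (n + (n + f - 1) / f) then 0 else corr r c j := by
  have : ¬ IsInner f n ((j + c) % f) := fun h => h.1 hj
  simp only [twDigit, this, if_false]

/-- A complete turn before the end of the cycle exists only for even `f` and `h = 0`, where the
parity is that of `f + 1`. This is why the cycle does not close after `f` steps. -/
theorem not_even_of_lt_len (hf : 1 < f) {h : ℕ} (hn : h * f + f ≤ len f - 1) :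
    ¬ Even (h * f + f + (h + 1)) := by
  unfold len at hn
  split_ifs at hn with ho
  · have : f ≤ h * f + f := Nat.le_add_left _ _
    omega
  · have h0 : h = 0 := by
      by_contra h0
      have := Nat.le_mul_of_pos_left f (Nat.pos_of_ne_zero h0)
      omega
    rw [Nat.not_odd_iff_even] at ho
    rw [h0, zero_mul, zero_add, zero_add, Nat.even_add_one, not_not]
    exact ho

/-- In the odd case the digit at position `0` is `corr > 0`. In the even case the turn is
incomplete, and the inner position `f - m` carries `corr > 0`. -/
theorem twDigit_ne_zero (hf : 1 < f) (hp : 3 < p) (hr : ∀ j, 1 ≤ r j ∧ r j ≤ p - 3) (c : ℕ)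
    {n : ℕ} (hn : 1 ≤ n) (hnl : n ≤ len f - 1) : twDigit p r c n ≠ fun _ => 0 := by
  intro h
  obtain ⟨i, m, hm, hmf, rfl⟩ := exists_eq_mul_add f hn
  replace hmf := hmf (by omega)
  by_cases hT : Even (i * f + m + (i + 1))
  · have hmf' : m ≠ f := by
      rintro rfl
      exact not_even_of_lt_len hf hnl hT
    obtain ⟨j, hj⟩ := exists_position (f := f) c (a := f - m) (by omega)
    have h1 := congrFun h j
    have h2 : IsInner f (i * f + m) ((j + c) % f) := by
      rw [hj, isInner_iff _ _ _ hm hmf (by omega)]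
      omega
    have := corr_bounds hp hr c j
    rw [twDigit, ceil_eq _ _ hm hmf, if_pos hT, if_pos h2] at h1
    omega
  · obtain ⟨j, hj⟩ := exists_position (f := f) c (a := 0) (by omega)
    have h1 := congrFun h j
    have := corr_bounds hp hr c j
    rw [twDigit_of_position_zero c _ hj, ceil_eq _ _ hm hmf, if_neg hT] at h1
    omega

/-- The digit with index `0` has position `0` in the first cycle and position `1` in the second. Its
values there are `0` or `r_0`, and `0`, `r_0 + 1` or `p - 1`. A common zero would require a complete
turn of even parity. -/
theorem twDigit_ne_of_cycle_ne (hf : 1 < f) (hp : 3 < p) (hr : ∀ j, 1 ≤ r j ∧ r j ≤ p - 3)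
    {n n' : ℕ} (hn' : 1 ≤ n') (hnl' : n' ≤ len f - 1) : twDigit p r 0 n ≠ twDigit p r 1 n' := by
  intro h
  obtain ⟨i, m, hm, hmf, rfl⟩ := exists_eq_mul_add f hn'
  replace hmf := hmf (by omega)
  have h0 := congrFun h ⟨0, by omega⟩
  have h1 := congrFun h ⟨f - 1, by omega⟩
  have b0 := corr_bounds hp hr 0 ⟨0, by omega⟩
  have b1 := corr_bounds hp hr 0 ⟨f - 1, by omega⟩
  have b2 := corr_bounds hp hr 1 ⟨0, by omega⟩
  rw [twDigit_of_position_zero 0 _ (by simp)] at h0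
  rw [twDigit_of_position_zero 1 _ (by simp [Nat.sub_add_cancel hf.le]),
    ceil_eq _ _ hm hmf] at h1
  have e1 : ((⟨0, by omega⟩ : Fin f) + 1) % f = 1 := by simp [Nat.mod_eq_of_lt hf]
  have hin : IsInner f (i * f + m) 1 ↔ 1 + m ≤ f := by
    rw [isInner_iff _ _ _ hm hmf hf]
    omega
  have hmf' : m = f → ¬ Even (i * f + m + (i + 1)) := by
    rintro rfl
    exact not_even_of_lt_len hf hnl'
  have hcorr : corr r 1 ⟨0, by omega⟩ = corr r 0 ⟨0, by omega⟩ + 1 := by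
    simp [corr, Nat.mod_eq_of_lt hf]
  simp only [twDigit, ceil_eq _ _ hm hmf, e1, hin] at h0 h1
  by_cases hT' : Even (i * f + m + (i + 1))
  · simp only [hT', if_true, not_true_eq_false] at h0 h1 hmf'
    have hne : m ≠ f := hmf'
    split_ifs at h0 h1 <;> omega
  · simp only [hT', if_false] at h0 h1
    split_ifs at h0 h1 <;> omega

theorem twDigit_inj (hf : 1 < f) (hp : 3 < p) (hr : ∀ j, 1 ≤ r j ∧ r j ≤ p - 3) (c : ℕ)
    {n n' : ℕ} (hn : 1 ≤ n) (hnl : n ≤ len f - 1) (hn' : 1 ≤ n') (hnl' : n' ≤ len f - 1)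
    (h : twDigit p r c n = twDigit p r c n') : n = n' := by
  have hT : Even (n + (n + f - 1) / f) ↔ Even (n' + (n' + f - 1) / f) := by
    obtain ⟨j, hj⟩ := exists_position (f := f) c (a := 0) (by omega)
    have h1 := congrFun h j
    have := corr_bounds hp hr c j
    rw [twDigit_of_position_zero c _ hj, twDigit_of_position_zero c _ hj] at h1
    split_ifs at h1 with h2 h3 h3
    · exact iff_of_true h2 h3
    · omega
    · omega
    · exact iff_of_false h2 h3
  have hI : ∀ a, a < f → (IsInner f n a ↔ IsInner f n' a) := by
    intro a ha
    obtain ⟨j, hj⟩ := exists_position (f := f) c ha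
    have h1 := congrFun h j
    have := corr_bounds hp hr c j
    simp only [twDigit, hT, hj] at h1
    split_ifs at h1 with h2 h3 h4 h4 h3 h4 h4
    all_goals first | exact iff_of_true ‹_› ‹_› | exact iff_of_false ‹_› ‹_› | omega
  obtain ⟨i, m, hm, hmf, rfl⟩ := exists_eq_mul_add f hn
  obtain ⟨i', m', hm', hmf', rfl⟩ := exists_eq_mul_add f hn'
  replace hmf := hmf (by omega)
  replace hmf' := hmf' (by omega)
  rw [ceil_eq _ _ hm hmf, ceil_eq _ _ hm' hmf'] at hT
  have hI' : ∀ a, a < f → ((a ≠ 0 ∧ a + m ≤ f) ↔ (a ≠ 0 ∧ a + m' ≤ f)) := by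
    intro a ha
    rw [← isInner_iff i m a hm hmf ha, ← isInner_iff i' m' a hm' hmf' ha]
    exact hI a ha
  -- The inner positions are `1, …, f - m`, so they determine `m`.
  have hmm : m = m' := by
    rcases lt_trichotomy m m' with hlt | heq | hlt
    · have := hI' (f - m) (by omega)
      omega
    · exact heq
    · have := hI' (f - m') (by omega)
      omega
  subst hmm
  suffices i = i' by rw [this]
  -- Only the number of the turn is left. There is a choice only for even `f`, and then the two
  -- turns have opposite parities.
  have key : ∀ a : ℕ, a * f + m ≤ len f - 1 → a = 0 ∨ (a = 1 ∧ ¬ Odd f) := by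
    intro a ha
    unfold len at ha
    split_ifs at ha with ho
    · left
      by_contra h0
      have := Nat.le_mul_of_pos_left f (Nat.pos_of_ne_zero h0)
      omega
    · have : a < 2 := by
        by_contra h0
        have := Nat.mul_le_mul_right f (show 2 ≤ a by omega)
        omega
      rcases (show a = 0 ∨ a = 1 by omega) with h | h
      · exact Or.inl h
      · exact Or.inr ⟨h, ho⟩
  rcases key i hnl with rfl | ⟨rfl, ho⟩ <;> rcases key i' hnl' with rfl | ⟨rfl, ho⟩
  · rfl
  · exfalso
    rw [Nat.not_odd_iff_even] at ho
    simp [Nat.even_add, ho, parity_simps] at hT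
    rw [← Nat.not_even_iff_odd] at hT
    tauto
  · exfalso
    rw [Nat.not_odd_iff_even] at ho
    simp [Nat.even_add, ho, parity_simps] at hT
    rw [← Nat.not_even_iff_odd] at hT
    tauto
  · rfl

end Twists

/-! ### Closing of the cycles, extensions between consecutive weights, distinct characters -/

section Keys

variable {p f : ℕ} [NeZero f] {r : Fin f → ℕ}

theorem three_le_len (hf : 1 < f) : 3 ≤ len f := by
  unfold len
  split_ifs with h
  · obtain ⟨m, rfl⟩ := h
    omega
  · omega

theorem len_eq (f : ℕ) : (Odd f ∧ len f = 0 * f + f) ∨ (Even f ∧ len f = 1 * f + f) := by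
  unfold len
  split_ifs with h
  · exact Or.inl ⟨h, by omega⟩
  · exact Or.inr ⟨Nat.not_odd_iff_even.1 h, by omega⟩

theorem not_isInner_len {a : ℕ} (ha : a < f) : ¬ IsInner f (len f) a := by
  rcases len_eq f with ⟨_, h⟩ | ⟨_, h⟩ <;> rw [h, isInner_iff _ _ _ (by omega) le_rfl ha] <;> omega

theorem even_len (hf : 1 < f) : Even (len f + (len f + f - 1) / f) := by
  rcases len_eq f with ⟨ho, h⟩ | ⟨ho, h⟩ <;> rw [h, ceil_eq _ _ (by omega) le_rfl]
  · rw [zero_mul, zero_add, zero_add]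
    exact ho.add_odd odd_one
  · rw [one_mul]
    exact (ho.add ho).add even_two

theorem twDigit_len (hf : 1 < f) (c : ℕ) : twDigit p r c (len f) = fun _ => 0 := by
  ext j
  have h1 := not_isInner_len (f := f) (a := (j + c) % f) (Nat.mod_lt _ (by omega))
  rw [twDigit, if_pos (even_len hf), if_neg h1]

/-- At the end of a complete turn no position is inner, and the length `f` or `2f` is chosen to make
the parity even. So every digit is unreflected. -/
theorem cycVal_len (hf : 1 < f) (c : ℕ) (j : Fin f) : cycVal p r c (len f) j = r j := by
  have h1 := not_isInner_len (f := f) (a := (j + c) % f) (Nat.mod_lt _ (by omega))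
  have h2 := cycVal_add_eq (p := p) (r := r) hf c (len f) j
  simp only [h1, even_len hf, iff_true, if_false, ← stepIdx_succ_iff hf] at h2
  have h3 : (j + c + len f) % f = (j + c) % f := by
    rcases len_eq f with ⟨_, h⟩ | ⟨_, h⟩ <;> rw [h]
    · simp
    · rw [one_mul, ← add_assoc]
      simp
  rw [h3] at h2
  unfold corr at h2
  push_cast at h2
  linarith

theorem cycWeight_zero (r : Fin f → ℕ) (c : ℕ) : cycWeight p r c 0 = baseWeight r := by
  simp [cycWeight, baseWeight, cycVal_zero]

theorem cycWeight_len_deg (hf : 1 < f) (c : ℕ) : (cycWeight p r c (len f)).deg = r := by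
  ext j
  change (cycVal p r c (len f) j).toNat = r j
  rw [cycVal_len hf]
  simp

theorem cycWeight_len_tw (hf : 1 < f) (hp : 0 < p) (c : ℕ) :
    (p : ℤ) ^ f - 1 ∣ (cycWeight p r c (len f)).tw := by
  have := tw_modEq (r := r) hf hp c (len f)
  rwa [twDigit_len hf, digitSum_zero, Nat.cast_zero, sub_zero] at this

theorem cycVal_stepIdx_pos (hf : 1 < f) (hp : 3 < p) (hr : ∀ j, 1 ≤ r j ∧ r j ≤ p - 3) (c n : ℕ) :
    1 ≤ cycVal p r c n (stepIdx f c n) := by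
  have h1 := cycVal_add_eq (p := p) (r := r) hf c n (stepIdx f c n)
  rw [if_neg (stepIdx_succ_ne hf _).symm] at h1
  have := corr_bounds hp hr c (stepIdx f c n)
  split_ifs at h1 <;> omega

theorem cycWeight_deg (hf : 1 < f) (hp : 3 < p) (hr : ∀ j, 1 ≤ r j ∧ r j ≤ p - 3) (c n : ℕ)
    (j : Fin f) : ((cycWeight p r c n).deg j : ℤ) = cycVal p r c n j :=
  Int.toNat_of_nonneg (cycVal_bounds hf hp hr c n j).1

/-- Consecutive weights of the two cycles admit a non-split extension. -/
theorem extPair_cycWeight [Fact p.Prime] (hf : 1 < f) (hp : 3 < p)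
    (hr : ∀ j, 1 ≤ r j ∧ r j ≤ p - 3) (c n : ℕ) :
    ExtPair p ((cycWeight p r c n).conj p) (cycWeight p r c (n + 1)) (stepIdx f c n) := by
  have hb := cycVal_bounds hf hp hr c n
  have hd := cycWeight_deg hf hp hr c n
  have hd' := cycWeight_deg hf hp hr c (n + 1)
  have hi := cycVal_stepIdx_pos hf hp hr c n
  have hne := stepIdx_succ_ne hf (stepIdx f c n)
  have hsucc := cycVal_succ (p := p) r c n
  simp only [stepIdx_iff, stepIdx_succ_iff hf] at hsucc
  have hcd : ∀ j, ((cycWeight p r c n).conj p).deg j = p - 1 - (cycWeight p r c n).deg j :=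
    fun _ => rfl
  set i := stepIdx f c n with hidef
  constructor
  · exact hne
  · exact Weight.conj_deg_lt _
  · rw [hcd]
    have := hd i
    omega
  · rw [hcd]
    have := hd (i + 1)
    have := hb (i + 1)
    omega
  · rw [hcd]
    have h1 := hd i
    have h2 := hd' i
    have h3 := hsucc i
    have h4 := hb i
    rw [if_pos rfl] at h3
    omega
  · rw [hcd]
    have h1 := hd (i + 1)
    have h2 := hd' (i + 1)
    have h3 := hsucc (i + 1)
    have h4 := hb (i + 1)
    rw [if_neg hne, if_pos rfl] at h3
    omega
  · intro j hj hj'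
    rw [hcd]
    have h1 := hd j
    have h2 := hd' j
    have h3 := hsucc j
    have h4 := hb j
    rw [if_neg hj, if_neg hj'] at h3
    omega
  · rw [tw_succ hf, ← hidef]
    have h1 : ((cycWeight p r c n).conj p).tw = (cycWeight p r c n).tw +
        ∑ j, cycVal p r c n j * p ^ (j : ℕ) := by
      change _ + ∑ j, _ = _
      simp only [hd]
    have h2 : (((cycWeight p r c n).conj p).deg i : ℤ) = p - 1 - cycVal p r c n i := by
      rw [hcd, ← hd i]
      have := hb i
      have := hd i
      omega
    rw [h1, h2]
    -- The difference to be divided is `p^(i+1) - p^i · p` with `i + 1` read modulo `f`: it is `1 -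
    -- p^f` if the index wraps around and `0` otherwise.
    by_cases hif : (i : ℕ) + 1 = f
    · have h3 : ((i + 1 : Fin f) : ℕ) = 0 := by
        rw [Fin.val_add, Fin.val_one', Nat.add_mod_mod, hif, Nat.mod_self]
      have h4 : (p : ℤ) ^ f = p ^ (i : ℕ) * p := by rw [← pow_succ, hif]
      rw [h3, pow_zero]
      exact ⟨-1, by rw [h4]; ring⟩
    · have hlt : (i : ℕ) + 1 < f := by have := i.2; omega
      rw [Fin.val_add_one_of_lt' hlt]
      exact ⟨0, by ring⟩

/-- The indices of the irreducible constituents of the socle and of the cosocle of the spliced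
module. -/
abbrev Idx (f : ℕ) : Type := Option (Fin 2 × Option (Fin (len f - 2)))

/-- The weights in the socle of the spliced module, indexed by the extensions containing them, with
`none` for `σ`. -/
noncomputable def socW (p : ℕ) (r : Fin f → ℕ) : Idx f → Weight f
  | none => baseWeight r
  | some (c, none) => cycWeight p r c 1
  | some (c, some n) => cycWeight p r c (n + 2)

/-- The weights whose conjugates are the constituents of the cosocle of the spliced module, indexed by
the extensions involving them, with `none` for `σ`. -/
noncomputable def topB (p : ℕ) (r : Fin f → ℕ) : Idx f → Weight f
  | none => baseWeight r
  | some (c, none) => cycWeight p r c (len f - 1)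
  | some (c, some n) => cycWeight p r c (n + 1)

/-- The matching of socle and cosocle, on the indices of one cycle. -/
def matchFun (m : ℕ) [NeZero m] : Option (Fin m) → Option (Fin m)
  | none => some 0
  | some n => if h : (n : ℕ) + 1 < m then some ⟨n + 1, h⟩ else none

theorem matchFun_injective (m : ℕ) [NeZero m] : Function.Injective (matchFun m) := by
  intro a b h
  rcases a with _ | a <;> rcases b with _ | b
  · rfl
  · simp only [matchFun] at h
    split_ifs at h
    have := congrArg Fin.val (Option.some.inj h)
    simp at this
  · simp only [matchFun] at h
    split_ifs at h
    have := congrArg Fin.val (Option.some.inj h)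
    simp at this
  · simp only [matchFun] at h
    have ha := a.2
    have hb := b.2
    split_ifs at h with h1 h2 h2
    · have := congrArg Fin.val (Option.some.inj h)
      simp only at this
      congr 1
      apply Fin.ext
      omega
    · congr 1
      apply Fin.ext
      omega

theorem neZero_len_sub (hf : 1 < f) : NeZero (len f - 2) := ⟨by have := three_le_len hf; omega⟩

/-- The bijection between the constituents of the socle and those of the cosocle given by
`τ ↦ τ^{[s]}`. -/
theorem exists_match (hf : 1 < f) (p : ℕ) (r : Fin f → ℕ) :
    ∃ e : Idx f ≃ Idx f, e none = none ∧
      (∀ c : Fin 2, e (some (c, none)) = some (c, some ⟨0, by have := three_le_len hf; omega⟩)) ∧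
      (∀ (c : Fin 2) (n : Fin (len f - 2)), e (some (c, some n)) = some (c,
        if h : (n : ℕ) + 1 < len f - 2 then some ⟨n + 1, h⟩ else none)) ∧
      ∀ j, topB p r (e j) = socW p r j := by
  have := neZero_len_sub hf
  have hbij : Function.Bijective (matchFun (len f - 2)) :=
    Finite.injective_iff_bijective.1 (matchFun_injective _)
  refine ⟨Equiv.optionCongr (Equiv.prodCongr (Equiv.refl _) (Equiv.ofBijective _ hbij)), rfl,
    fun c => rfl, fun c n => rfl, ?_⟩
  rintro (_ | ⟨c, _ | n⟩)
  · rfl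
  · rfl
  · have hn := n.2
    by_cases h : (n : ℕ) + 1 < len f - 2
    · simp [matchFun, h, topB, socW]
    · have h2 : len f - 1 = n + 2 := by omega
      simp [matchFun, h, topB, socW, h2]

theorem socW_deg_lt [Fact p.Prime] (hf : 1 < f) (hp : 3 < p) (hr : ∀ j, 1 ≤ r j ∧ r j ≤ p - 3)
    (j : Idx f) (i : Fin f) : (socW p r j).deg i < p := by
  have key : ∀ c n, (cycWeight p r c n).deg i < p := by
    intro c n
    have h1 := cycWeight_deg hf hp hr c n i
    have h2 := cycVal_bounds hf hp hr c n i
    omega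
  rcases j with _ | ⟨c, _ | n⟩
  · change r i < p
    have := hr i
    omega
  · exact key _ _
  · exact key _ _

variable {k : Type u} [Field k] [CharP k p] {𝔽 : Type v} [Field 𝔽] [Algebra k 𝔽]

/-- The constituents of the socle of the spliced module have pairwise distinct characters. -/
theorem socW_chi_injective [Fact p.Prime] [Finite k] (hk : Nat.card k = p ^ f) (hf : 1 < f)
    (hp : 3 < p) (hr : ∀ j, 1 ≤ r j ∧ r j ≤ p - 3) :
    Function.Injective fun j => (socW p r j).chi p k 𝔽 := by
  have hp0 : 0 < p := by omega
  have hl := three_le_len hf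
  -- The digit at position `0` is `0` or `corr ≤ p - 2`; this makes `digits_eq` applicable.
  have hdig : ∀ c n, ∃ i, twDigit p r c n i < p - 1 := by
    intro c n
    obtain ⟨j, hj⟩ := exists_position (f := f) c (a := 0) (by omega)
    refine ⟨j, ?_⟩
    rw [twDigit_of_position_zero _ _ hj]
    have := corr_bounds hp hr c j
    split_ifs <;> omega
  have key : ∀ c n c' n', (cycWeight p r c n).chi p k 𝔽 = (cycWeight p r c' n').chi p k 𝔽 →
      twDigit p r c n = twDigit p r c' n' := by
    intro c n c' n' h
    obtain ⟨i, hi⟩ := hdig c n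
    obtain ⟨i', hi'⟩ := hdig c' n'
    apply digits_eq (twDigit_lt hp hr c n) (twDigit_lt hp hr c' n') hi hi'
    have h1 := Weight.tw_of_chi_eq h
    rw [hk] at h1
    push_cast at h1
    have h2 := tw_modEq (r := r) hf hp0 c n
    have h3 := tw_modEq (r := r) hf hp0 c' n'
    have h4 := dvd_add (dvd_sub h1 h2) h3
    ring_nf at h4 ⊢
    exact h4
  have keyb : ∀ c n, 1 ≤ n → n ≤ len f - 1 →
      (cycWeight p r c n).chi p k 𝔽 ≠ (baseWeight r).chi p k 𝔽 := by
    intro c n hn hn' h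
    rw [← cycWeight_zero (p := p) r c] at h
    have h1 := key _ _ _ _ h
    obtain ⟨i, hi⟩ := hdig c n
    apply twDigit_ne_zero hf hp hr c hn hn'
    rw [h1]
    ext j
    have h2 : ¬ IsInner f 0 ((j + c) % f) :=
      isInner_of_mod_eq_zero hf (Nat.zero_mod f) (Nat.mod_lt _ (by omega))
    have h3 : Even (0 + (0 + f - 1) / f) := by
      rw [zero_add, zero_add, Nat.div_eq_of_lt (by omega)]
      exact Even.zero
    rw [twDigit, if_pos h3, if_neg h2]
  have keyc : ∀ (c c' : Fin 2) n n', 1 ≤ n → n ≤ len f - 1 → 1 ≤ n' → n' ≤ len f - 1 →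
      (cycWeight p r c n).chi p k 𝔽 = (cycWeight p r c' n').chi p k 𝔽 → c = c' ∧ n = n' := by
    intro c c' n n' h1 h2 h1' h2' h
    have h3 := key _ _ _ _ h
    fin_cases c <;> fin_cases c'
    · exact ⟨rfl, twDigit_inj hf hp hr _ h1 h2 h1' h2' h3⟩
    · exact absurd h3 (twDigit_ne_of_cycle_ne hf hp hr h1' h2')
    · exact absurd h3.symm (twDigit_ne_of_cycle_ne hf hp hr h1 h2)
    · exact ⟨rfl, twDigit_inj hf hp hr _ h1 h2 h1' h2' h3⟩
  intro j j' h
  rcases j with _ | ⟨c, _ | n⟩ <;> rcases j' with _ | ⟨c', _ | n'⟩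
  · rfl
  · exact absurd h.symm (keyb c' 1 le_rfl (by omega))
  · exact absurd h.symm (keyb c' (n' + 2) (by omega) (by omega))
  · exact absurd h (keyb c 1 le_rfl (by omega))
  · obtain ⟨rfl, -⟩ := keyc c c' _ _ le_rfl (by omega) le_rfl (by omega) h
    rfl
  · have := (keyc c c' _ _ le_rfl (by omega) (by omega) (by omega) h).2
    omega
  · exact absurd h (keyb c (n + 2) (by omega) (by omega))
  · have := (keyc c c' _ _ (by omega) (by omega) le_rfl (by omega) h).2
    omega
  · obtain ⟨rfl, h2⟩ := keyc c c' _ _ (by omega) (by omega) (by omega) (by omega) h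
    have h3 : n = n' := Fin.ext (by omega)
    rw [h3]

/-- Needed because `σ_l` and `σ` are different as indices: their degrees agree, but their twists
only modulo `p^f - 1`. -/
theorem ExtPair.congr [Fact p.Prime] {τ σ σ' : Weight f} {i : Fin f} (h : ExtPair p τ σ i)
    (hd : σ.deg = σ'.deg) (ht : (p : ℤ) ^ f - 1 ∣ σ'.tw - σ.tw) : ExtPair p τ σ' i where
  succ_ne := h.succ_ne
  deg_lt := h.deg_lt
  deg_le := h.deg_le
  deg_pos := h.deg_pos
  deg_i := hd ▸ h.deg_i
  deg_succ := hd ▸ h.deg_succ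
  deg_other := hd ▸ h.deg_other
  tw := by
    have := dvd_add h.tw ht
    ring_nf at this ⊢
    exact this

theorem extPair_first [Fact p.Prime] (hf : 1 < f) (hp : 3 < p)
    (hr : ∀ j, 1 ≤ r j ∧ r j ≤ p - 3) (c : ℕ) :
    ExtPair p ((baseWeight r).conj p) (cycWeight p r c 1) (stepIdx f c 0) := by
  have := extPair_cycWeight hf hp hr c 0
  rwa [cycWeight_zero] at this

theorem extPair_last [Fact p.Prime] (hf : 1 < f) (hp : 3 < p)
    (hr : ∀ j, 1 ≤ r j ∧ r j ≤ p - 3) (c : ℕ) :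
    ExtPair p ((cycWeight p r c (len f - 1)).conj p) (baseWeight r) (stepIdx f c (len f - 1)) := by
  have h := extPair_cycWeight hf hp hr c (len f - 1)
  have hl := three_le_len hf
  rw [Nat.sub_add_cancel (by omega)] at h
  apply h.congr (cycWeight_len_deg hf c)
  rw [← dvd_neg, neg_sub]
  simpa [baseWeight] using cycWeight_len_tw hf (by omega) c

end Keys

/-! ### Subrepresentations of multiplicity free sums and of non-split extensions -/

section Semisimple

variable {p : ℕ} [Fact p.Prime] {k : Type u} [Field k] [CharP k p] {𝔽 : Type v} [Field 𝔽]
  [Algebra k 𝔽] {f : ℕ}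

theorem piRep_apply {ι H : Type*} [Group H] {V : ι → Type*} [∀ i, AddCommGroup (V i)]
    [∀ i, Module 𝔽 (V i)] (ρ : ∀ i, Representation 𝔽 H (V i)) (g : H) (x : ∀ i, V i) (i : ι) :
    piRep ρ g x i = ρ i g (x i) := rfl

theorem piRep_single {ι H : Type*} [DecidableEq ι] [Group H] {V : ι → Type*}
    [∀ i, AddCommGroup (V i)] [∀ i, Module 𝔽 (V i)] (ρ : ∀ i, Representation 𝔽 H (V i)) (g : H)
    (i : ι) (x : V i) : piRep ρ g (Pi.single i x) = Pi.single i (ρ i g x) := by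
  ext j
  rw [piRep_apply]
  by_cases h : j = i
  · subst h
    simp
  · simp [h]

/-- The direct sum of copies of a representation. -/
noncomputable def finsuppRep (ι : Type*) {H V : Type*} [Group H] [AddCommGroup V] [Module 𝔽 V]
    (ρ : Representation 𝔽 H V) : Representation 𝔽 H (ι →₀ V) where
  toFun g := Finsupp.mapRange.linearMap (ρ g)
  map_one' := by
    ext
    simp
  map_mul' := by
    intro a b
    ext
    simp

@[simp] theorem finsuppRep_apply (ι : Type*) {H V : Type*} [Group H] [AddCommGroup V] [Module 𝔽 V]
    (ρ : Representation 𝔽 H V) (g : H) (x : ι →₀ V) (i : ι) :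
    finsuppRep ι ρ g x i = ρ g (x i) := rfl

/-- Eigenvectors for distinct characters can be separated. -/
theorem mem_of_sum_mem {V : Type*} [AddCommGroup V] [Module 𝔽 V] (ρ : Representation 𝔽 (GL2 k) V)
    (M : Submodule 𝔽 V) (hM : ∀ b : borel k, ∀ x ∈ M, ρ b x ∈ M) {ι : Type*}
    {χ : ι → borel k →* 𝔽ˣ} (hχ : Function.Injective χ) (s : Finset ι) (v : ι → V)
    (hv : ∀ a, v a ∈ isotypic ρ (borel k) (χ a)) (h : ∑ a ∈ s, v a ∈ M) : ∀ a ∈ s, v a ∈ M := by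
  classical
  induction s using Finset.induction_on generalizing v with
  | empty => simp
  | insert a₀ s ha₀ ih =>
    have hs : ∀ a ∈ s, v a ∈ M := by
      intro a ha
      have hne : χ a ≠ χ a₀ := fun he => ha₀ (hχ he ▸ ha)
      obtain ⟨b, hb⟩ : ∃ b, χ a b ≠ χ a₀ b := by
        by_contra! hcon
        exact hne (MonoidHom.ext hcon)
      -- The operator `ρ b - χ_{a₀}(b)` removes the summand `a₀` and multiplies that of `a` by a
      -- nonzero scalar.
      have h1 := ih (fun a' => ((χ a' b : 𝔽) - χ a₀ b) • v a')
        (fun a' => Submodule.smul_mem _ _ (hv a')) (by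
          have h2 := M.sub_mem (hM b _ h) (M.smul_mem (χ a₀ b : 𝔽) h)
          rw [Finset.sum_insert ha₀, map_add, map_sum, smul_add, Finset.smul_sum] at h2
          have h3 : ρ b (v a₀) = (χ a₀ b : 𝔽) • v a₀ := hv a₀ b
          have h4 : ∀ a', ρ b (v a') = (χ a' b : 𝔽) • v a' := fun a' => hv a' b
          simp only [h3, h4, add_sub_add_left_eq_sub, ← Finset.sum_sub_distrib, ← sub_smul] at h2
          exact h2) a ha
      have h5 : ((χ a b : 𝔽) - χ a₀ b) ≠ 0 := by
        rw [sub_ne_zero]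
        exact fun h6 => hb (Units.ext h6)
      exact (Submodule.smul_mem_iff M h5).1 h1
    rw [Finset.sum_insert ha₀] at h
    have h0 := (Submodule.add_mem_iff_left M (M.sum_mem hs)).1 h
    intro a ha
    rcases Finset.mem_insert.1 ha with rfl | ha
    · exact h0
    · exact hs a ha

variable [Finite k]

/-- A subrepresentation of a sum of pairwise non-isomorphic weights is a partial sum. -/
theorem single_mem_of_mem {ι : Type*} [Finite ι] [DecidableEq ι] {wt : ι → Weight f}
    (hwt : ∀ a j, (wt a).deg j < p) (hk : Nat.card k = p ^ f)
    (hχ : Function.Injective fun a => (wt a).chi p k 𝔽)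
    (Z : Submodule 𝔽 (∀ a, (wt a).Space 𝔽))
    (hZ : ∀ g : GL2 k, ∀ x ∈ Z, piRep (fun a => (wt a).rep p k 𝔽) g x ∈ Z)
    {z : ∀ a, (wt a).Space 𝔽} (hz : z ∈ Z) {a : ι} (ha : z a ≠ 0) (x : (wt a).Space 𝔽) :
    Pi.single a x ∈ Z := by
  classical
  have := Fintype.ofFinite ι
  set A : ι → Prop := fun a => ∀ x : (wt a).Space 𝔽, Pi.single a x ∈ Z with hA
  have htop : ∀ a (y : (wt a).Space 𝔽), y ≠ 0 → Pi.single a y ∈ Z → A a := by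
    intro a y hy hyZ x
    have := Weight.eq_top_of_ne_zero_mem (hwt a) hk
      (Z.comap (LinearMap.single 𝔽 (fun a => (wt a).Space 𝔽) a)) (by
        intro g x hx
        have h1 := hZ g _ hx
        change piRep _ g (Pi.single a x) ∈ Z at h1
        rwa [piRep_single] at h1) hy hyZ
    exact (Submodule.eq_top_iff'.1 this x :)
  by_contra hcon
  have hnA : ¬ A a := fun h => hcon (h x)
  -- The part of `Z` without components in the constituents already contained in `Z`. If it were
  -- nonzero, its highest weight vectors could be separated by characters, giving a constituent of
  -- `Z` which `N` excludes.
  let N : Submodule 𝔽 (∀ a, (wt a).Space 𝔽) :=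
    Z ⊓ ⨅ (a : ι) (_ : A a), LinearMap.ker (LinearMap.proj a)
  have hN : ∀ y, y ∈ N ↔ y ∈ Z ∧ ∀ a, A a → y a = 0 := by
    intro y
    simp [N, Submodule.mem_iInf]
  have hz' : z - ∑ b ∈ Finset.univ.filter A, Pi.single b (z b) ∈ N := by
    rw [hN]
    refine ⟨Z.sub_mem hz (Z.sum_mem fun b hb => (Finset.mem_filter.1 hb).2 _), fun b hb => ?_⟩
    rw [Pi.sub_apply, Finset.sum_apply, Finset.sum_pi_single, if_pos (by simpa using hb), sub_self]
  have hz0 : z - ∑ b ∈ Finset.univ.filter A, Pi.single b (z b) ≠ 0 := by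
    intro h
    apply ha
    have h1 := congrFun h a
    rwa [Pi.sub_apply, Finset.sum_apply, Finset.sum_pi_single, if_neg (by simpa using hnA),
      sub_zero] at h1
  obtain ⟨c, hc, hcN⟩ := exists_hw_mem (k := k) hwt hk N (by
    intro t y hy
    rw [hN] at hy ⊢
    refine ⟨hZ _ _ hy.1, fun b hb => ?_⟩
    rw [piRep_apply, hy.2 b hb, map_zero]) hz0 hz'
  rw [hN] at hcN
  obtain ⟨b, hb⟩ := Function.ne_iff.1 hc
  have hsum : ∑ b, Pi.single b (c b • (wt b).hw 𝔽) = fun a => c a • (wt a).hw 𝔽 :=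
    Finset.univ_sum_single _
  have h1 := mem_of_sum_mem (piRep (fun a => (wt a).rep p k 𝔽)) Z (fun b x hx => hZ b x hx) hχ
    Finset.univ (fun b => Pi.single b (c b • (wt b).hw 𝔽)) (by
      intro b' g
      rw [piRep_single, map_smul, Weight.rep_borel_hw, ← Pi.single_smul, smul_comm])
    (by rw [hsum]; exact hcN.1) b (Finset.mem_univ _)
  have h2 : c b • (wt b).hw 𝔽 ≠ 0 := smul_ne_zero hb ((wt b).hw_ne_zero)
  exact h2 (hcN.2 b (htop b _ h2 h1))

/-- A subrepresentation of a non-split extension of weights which is not contained in the kernel of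
the projection is everything. -/
theorem NonsplitExtension.eq_top {σ τ : Weight f}
    (E : NonsplitExtension (σ.rep p k 𝔽) (τ.rep p k 𝔽)) (hσ : ∀ j, σ.deg j < p)
    (hτ : ∀ j, τ.deg j < p) (hk : Nat.card k = p ^ f) (W : Submodule 𝔽 E.E)
    (hW : ∀ g : GL2 k, ∀ x ∈ W, E.rep g x ∈ W) {x : E.E} (hx : x ∈ W) (hx0 : E.proj x ≠ 0) :
    W = ⊤ := by
  have h1 : W.map E.proj.toLinearMap = ⊤ := by
    refine Weight.eq_top_of_ne_zero_mem hτ hk (W.map E.proj.toLinearMap) ?_ hx0 ⟨x, hx, rfl⟩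
    rintro g _ ⟨y, hy, rfl⟩
    exact ⟨E.rep g y, hW g y hy, E.proj.isIntertwining _ _ g y⟩
  -- If `W` meets `σ` trivially it maps isomorphically to `τ` and splits the extension. Otherwise it
  -- contains `σ`.
  by_cases h2 : W.comap E.incl.toLinearMap = ⊥
  · exfalso
    have hbij : Function.Bijective (E.proj.toLinearMap.comp W.subtype) := by
      constructor
      · rw [← LinearMap.ker_eq_bot, LinearMap.ker_eq_bot']
        rintro ⟨y, hy⟩ h
        obtain ⟨z, rfl⟩ := (E.exact y).1 h
        have : z ∈ W.comap E.incl.toLinearMap := hy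
        rw [h2, Submodule.mem_bot] at this
        apply Subtype.ext
        simp [this]
      · intro y
        have : y ∈ W.map E.proj.toLinearMap := by rw [h1]; trivial
        obtain ⟨z, hz, rfl⟩ := this
        exact ⟨⟨z, hz⟩, rfl⟩
    let e := LinearEquiv.ofBijective _ hbij
    have he : ∀ y, E.proj (e.symm y : E.E) = y := fun y => e.apply_symm_apply y
    refine E.nonsplit ⟨(W.subtype.comp e.symm.toLinearMap).intertwiningMap_of_isIntertwiningMap _ _
      fun g y => ?_, he⟩
    have h3 : (⟨E.rep g (e.symm y : E.E), hW g _ (e.symm y).2⟩ : W) = e.symm (τ.rep p k 𝔽 g y) := by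
      apply e.injective
      rw [e.apply_symm_apply]
      change E.proj (E.rep g (e.symm y : E.E)) = _
      rw [E.proj.isIntertwining, he]
    exact (congrArg Subtype.val h3).symm
  · obtain ⟨y, hy, hy0⟩ := Submodule.exists_mem_ne_zero_of_ne_bot h2
    have h3 := Weight.eq_top_of_ne_zero_mem hσ hk _ (fun g z hz => by
      change E.incl (σ.rep p k 𝔽 g z) ∈ W
      rw [E.incl.isIntertwining]
      exact hW g _ hz) hy0 hy
    rw [Submodule.eq_top_iff'] at h3 ⊢
    intro z
    have : E.proj z ∈ W.map E.proj.toLinearMap := by rw [h1]; trivial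
    obtain ⟨w, hw, hwz⟩ := this
    have h4 : E.proj (z - w) = 0 := by
      rw [map_sub, sub_eq_zero]
      exact hwz.symm
    obtain ⟨a, ha⟩ := (E.exact _).1 h4
    have h5 : z = E.incl a + w := by rw [ha, sub_add_cancel]
    rw [h5]
    exact W.add_mem (h3 a) hw

end Semisimple

/-! ### Representations with two multiplicity free layers -/

section Layers

variable (p : ℕ) [Fact p.Prime] (k : Type u) [Field k] [CharP k p] (𝔽 : Type v) [Field 𝔽]
  [Algebra k 𝔽] {f : ℕ}

/-- A presentation of `ρ` as an extension of a multiplicity free sum of weights `τ i` by a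
multiplicity free sum of weights `σ j`, in which the extensions of `τ i` by `σ j` with `edge i j` do
not split. -/
structure Layers {J : Type} [DecidableEq J] {V : Type v} [AddCommGroup V] [Module 𝔽 V]
    (ρ : Representation 𝔽 (GL2 k) V) (σ τ : J → Weight f) (edge : J → J → Prop) where
  s : (∀ j, (σ j).Space 𝔽) →ₗ[𝔽] V
  t : V →ₗ[𝔽] ∀ i, (τ i).Space 𝔽
  s_rep : ∀ g x, s (piRep (fun j => (σ j).rep p k 𝔽) g x) = ρ g (s x)
  t_rep : ∀ g v, t (ρ g v) = piRep (fun i => (τ i).rep p k 𝔽) g (t v)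
  s_injective : Function.Injective s
  t_surjective : Function.Surjective t
  exact : Function.Exact s t
  -- `R` is an equivariant correspondence between `V` and the extension `E`. It need not come from a
  -- map on all of `V`: the common constituent `σ` of the last extensions of both cycles has to be
  -- separated, which is possible over the top constituent `i` alone.
  glue : ∀ i j, edge i j →
    ∃ (E : NonsplitExtension ((σ j).rep p k 𝔽) ((τ i).rep p k 𝔽)) (R : Submodule 𝔽 (V × E.E)),
      (∀ g v u, (v, u) ∈ R → (ρ g v, E.rep g u) ∈ R) ∧
      (∀ v, (∀ i' ≠ i, t v i' = 0) → ∃ u, (v, u) ∈ R) ∧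
      (∀ v u, (v, u) ∈ R → E.proj u = t v i) ∧
      ∀ x y, (s x, E.incl y) ∈ R → y ≠ 0 → x j ≠ 0
  deg_soc : ∀ j m, (σ j).deg m < p
  deg_top : ∀ i m, (τ i).deg m < p
  chi_soc : Function.Injective fun j => (σ j).chi p k 𝔽
  chi_top : Function.Injective fun i => (τ i).chi p k 𝔽
  edge_soc : ∀ j, ∃ i, edge i j
  edge_top : ∀ i, ∃ j, edge i j

variable {p k 𝔽} {J : Type} [DecidableEq J]

/-- In a sum of pairwise non-isomorphic weights, eigenvectors of the Borel subgroup for the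
character of a highest weight vector which are fixed by the unipotent radical are multiples of
this vector. -/
theorem eq_single_hw [Finite k] {wt : J → Weight f} (hwt : ∀ a m, (wt a).deg m < p)
    (hk : Nat.card k = p ^ f) (hχ : Function.Injective fun a => (wt a).chi p k 𝔽) (j : J)
    {x : ∀ a, (wt a).Space 𝔽}
    (hU : ∀ t : k, piRep (fun a => (wt a).rep p k 𝔽) (upper t) x = x)
    (hB : ∀ b : borel k, piRep (fun a => (wt a).rep p k 𝔽) b x = ((wt j).chi p k 𝔽 b : 𝔽) • x) :
    ∃ c : 𝔽, x = Pi.single j (c • (wt j).hw 𝔽) := by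
  have h : ∀ a, ∃ c : 𝔽, x a = c • (wt a).hw 𝔽 := fun a =>
    Weight.exists_eq_smul_hw (hwt a) hk fun t => congrFun (hU t) a
  choose c hc using h
  refine ⟨c j, funext fun a => ?_⟩
  by_cases ha : a = j
  · subst ha
    rw [Pi.single_eq_same, hc]
  · rw [Pi.single_eq_of_ne ha, hc]
    by_contra hne
    apply ha
    apply hχ
    ext b
    have h1 := congrFun (hB b) a
    rw [piRep_apply, Pi.smul_apply, hc, map_smul, Weight.rep_borel_hw, smul_comm] at h1
    exact smul_left_injective 𝔽 hne h1

variable {V : Type v} [AddCommGroup V] [Module 𝔽 V] {ρ : Representation 𝔽 (GL2 k) V}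
  {σ τ : J → Weight f} {edge : J → J → Prop} (L : Layers p k 𝔽 ρ σ τ edge)

namespace Layers

/-- The highest weight vectors of the socle. -/
noncomputable def hwv (j : J) : V := L.s (Pi.single j ((σ j).hw 𝔽))

theorem hwv_ne_zero (j : J) : L.hwv j ≠ 0 := by
  intro h
  rw [hwv, ← map_zero L.s] at h
  have h1 := congrFun (L.s_injective h) j
  rw [Pi.single_eq_same] at h1
  exact (σ j).hw_ne_zero h1

theorem rep_borel_hwv [Finite k] (j : J) (b : borel k) :
    ρ b (L.hwv j) = ((σ j).chi p k 𝔽 b : 𝔽) • L.hwv j := by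
  rw [hwv, ← L.s_rep, piRep_single, Weight.rep_borel_hw, Pi.single_smul, map_smul]

theorem rep_upper_hwv [Finite k] (j : J) (t : k) : ρ (upper t) (L.hwv j) = L.hwv j := by
  rw [hwv, ← L.s_rep, piRep_single, Weight.rep_upper_hw]

theorem hwv_mem_D1 [Finite k] (j : J) : L.hwv j ∈ D1 ρ :=
  (mem_fixedBy_unip ρ _).2 fun t => L.rep_upper_hwv j t

theorem t_s (x : ∀ j, (σ j).Space 𝔽) : L.t (L.s x) = 0 := L.exact.apply_apply_eq_zero x

variable [Finite k]

/-- The image of `X` in `E` under the correspondence is a subrepresentation not contained in the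
kernel of the projection, so it is `E` and contains the highest weight vector of `σ j`. The map `α`
allows `X` to live in a direct sum of copies of `V`, with `α` the evaluation at one copy. -/
theorem exists_soc (hk : Nat.card k = p ^ f) {i j : J} (h : edge i j) {M : Type*} [AddCommGroup M]
    [Module 𝔽 M] (ρM : Representation 𝔽 (GL2 k) M) (α : M →ₗ[𝔽] V)
    (hα : ∀ g m, α (ρM g m) = ρ g (α m)) (X : Submodule 𝔽 M) (hX : ∀ g, ∀ m ∈ X, ρM g m ∈ X)
    (hX0 : ∀ m ∈ X, ∀ i' ≠ i, L.t (α m) i' = 0) {m : M} (hm : m ∈ X) (hmi : L.t (α m) i ≠ 0) :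
    ∃ m' ∈ X, ∃ z, α m' = L.s z ∧ z j ≠ 0 := by
  obtain ⟨E, R, h1, h2, h3, h4⟩ := L.glue i j h
  let W : Submodule 𝔽 E.E := (R ⊓ (X.map α).prod ⊤).map (LinearMap.snd 𝔽 V E.E)
  have hW : W = ⊤ := by
    obtain ⟨u, hu⟩ := h2 (α m) (hX0 m hm)
    refine E.eq_top (L.deg_soc j) (L.deg_top i) hk W ?_
      (x := u) ⟨(α m, u), ⟨hu, ⟨m, hm, rfl⟩, trivial⟩, rfl⟩ (by rwa [h3 _ _ hu])
    rintro g _ ⟨⟨v, u⟩, ⟨hu, ⟨m', hm', hv⟩, -⟩, rfl⟩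
    refine ⟨(ρ g v, E.rep g u), ⟨h1 g v u hu, ⟨ρM g m', hX g m' hm', ?_⟩, trivial⟩, rfl⟩
    rw [hα, hv]
  have h5 : E.incl ((σ j).hw 𝔽) ∈ W := by
    rw [hW]
    trivial
  obtain ⟨⟨v, u⟩, ⟨hu, ⟨m', hm', rfl⟩, -⟩, hvu⟩ := h5
  change u = _ at hvu
  subst hvu
  have h6 : L.t (α m') = 0 := by
    ext i'
    by_cases hi : i' = i
    · subst hi
      rw [← h3 _ _ hu]
      exact E.exact.apply_apply_eq_zero _
    · exact hX0 m' hm' i' hi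
  obtain ⟨z, hz⟩ := (L.exact _).1 h6
  change (α m', E.incl ((σ j).hw 𝔽)) ∈ R at hu
  rw [← hz] at hu
  exact ⟨m', hm', z, hz.symm, h4 z _ hu ((σ j).hw_ne_zero)⟩

variable [Finite J]

theorem single_mem_of_s_mem (hk : Nat.card k = p ^ f) (X : Submodule 𝔽 V)
    (hX : ∀ g, ∀ x ∈ X, ρ g x ∈ X) {z : ∀ j, (σ j).Space 𝔽} (hz : L.s z ∈ X) {j : J}
    (hj : z j ≠ 0) (x : (σ j).Space 𝔽) : L.s (Pi.single j x) ∈ X :=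
  single_mem_of_mem L.deg_soc hk L.chi_soc (X.comap L.s) (fun g x hx => by
    rw [Submodule.mem_comap, L.s_rep]
    exact hX g _ hx) hz hj x

/-- A subrepresentation with a non-zero projection to a constituent of the top contains the
constituents of the socle glued to it. -/
theorem single_mem_of_edge (hk : Nat.card k = p ^ f) (X : Submodule 𝔽 V)
    (hX : ∀ g, ∀ x ∈ X, ρ g x ∈ X) {i j : J} (h : edge i j) {y : V} (hy : y ∈ X)
    (hyi : L.t y i ≠ 0) (x : (σ j).Space 𝔽) : L.s (Pi.single j x) ∈ X := by
  -- As the top is multiplicity free, `y` may be replaced by an element of `X` whose image in the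
  -- top is concentrated at `i`.
  have h1 : Pi.single i (L.t y i) ∈ X.map L.t :=
    single_mem_of_mem L.deg_top hk L.chi_top (X.map L.t) (by
      rintro g _ ⟨v, hv, rfl⟩
      exact ⟨ρ g v, hX g v hv, L.t_rep g v⟩) ⟨y, hy, rfl⟩ hyi _
  obtain ⟨y', hy', hty⟩ := h1
  let N : Submodule 𝔽 V := X ⊓ ⨅ (i' : J) (_ : i' ≠ i), LinearMap.ker (LinearMap.proj i' ∘ₗ L.t)
  have hN : ∀ v, v ∈ N ↔ v ∈ X ∧ ∀ i' ≠ i, L.t v i' = 0 := by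
    intro v
    simp [N, Submodule.mem_iInf]
  obtain ⟨m, hm, z, hz, hzj⟩ := L.exists_soc hk h ρ LinearMap.id (fun _ _ => rfl) N (by
      intro g m hm
      rw [hN] at hm ⊢
      refine ⟨hX g m hm.1, fun i' hi' => ?_⟩
      rw [L.t_rep, piRep_apply, hm.2 i' hi', map_zero])
    (fun m hm => ((hN m).1 hm).2) (m := y') ((hN y').2 ⟨hy', fun i' hi' => by
      rw [hty, Pi.single_eq_of_ne hi']⟩)
    (by
      change L.t y' i ≠ 0
      rwa [hty, Pi.single_eq_same])
  exact L.single_mem_of_s_mem hk X hX (z := z) (by rw [← hz]; exact ((hN m).1 hm).1) hzj x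

theorem s_mem_of_single_mem (X : Submodule 𝔽 V) (x : ∀ j, (σ j).Space 𝔽)
    (h : ∀ j, L.s (Pi.single j (x j)) ∈ X) : L.s x ∈ X := by
  have := Fintype.ofFinite J
  rw [← Finset.univ_sum_single x, map_sum]
  exact X.sum_mem fun j _ => h j

/-- The subrepresentation generated by a constituent of the socle. -/
noncomputable def socPart (j : J) : Subrepresentation ρ where
  toSubmodule := LinearMap.range (L.s ∘ₗ LinearMap.single 𝔽 (fun j => (σ j).Space 𝔽) j)
  apply_mem_toSubmodule := by
    rintro g _ ⟨x, rfl⟩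
    refine ⟨(σ j).rep p k 𝔽 g x, ?_⟩
    simp only [LinearMap.comp_apply, LinearMap.coe_single]
    rw [← L.s_rep, piRep_single]

theorem mem_socPart (j : J) (v : V) : v ∈ L.socPart j ↔ ∃ x, L.s (Pi.single j x) = v := Iff.rfl

theorem isAtom_socPart (hk : Nat.card k = p ^ f) (j : J) : IsAtom (L.socPart j) := by
  constructor
  · intro h
    have h1 : L.hwv j ∈ L.socPart j := ⟨_, rfl⟩
    rw [h] at h1
    exact L.hwv_ne_zero j h1
  · intro b hb
    by_contra hne
    obtain ⟨y, hy, hy0⟩ : ∃ y ∈ b, y ≠ 0 := by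
      by_contra! hcon
      apply hne
      apply le_bot_iff.1
      intro y hy
      exact hcon y hy
    obtain ⟨x, rfl⟩ := (L.mem_socPart j y).1 (hb.le hy)
    have hx : (Pi.single j x : ∀ j, (σ j).Space 𝔽) j ≠ 0 := by
      rw [Pi.single_eq_same]
      rintro rfl
      simp at hy0
    apply hb.not_ge
    rintro _ ⟨x', rfl⟩
    exact L.single_mem_of_s_mem hk b.toSubmodule (fun g x hx => b.apply_mem_toSubmodule g hx) hy hx x'

/-- An irreducible subrepresentation with nonzero image in the top would contain some constituent of
the bottom layer, as every top constituent has an edge, and hence equal it. -/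
theorem socle_eq (hk : Nat.card k = p ^ f) : socle ρ = LinearMap.range L.s := by
  apply le_antisymm
  · apply sSup_le
    rintro _ ⟨S, hS, rfl⟩
    by_contra hle
    obtain ⟨y, hy, hyR⟩ := SetLike.not_le_iff_exists.1 hle
    have hty : L.t y ≠ 0 := fun h => hyR ((L.exact y).1 h)
    obtain ⟨i, hi⟩ := Function.ne_iff.1 hty
    obtain ⟨j, hj⟩ := L.edge_top i
    have h1 := L.single_mem_of_edge hk S.toSubmodule (fun g x hx => S.apply_mem_toSubmodule g hx) hj hy hi
    have h2 : L.socPart j ≤ S := by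
      rintro _ ⟨x, rfl⟩
      exact h1 x
    have h3 := (hS.le_iff.1 h2).resolve_left (L.isAtom_socPart hk j).1
    rw [← h3] at hy
    obtain ⟨x, rfl⟩ := hy
    exact hyR ⟨_, rfl⟩
  · rintro _ ⟨x, rfl⟩
    apply L.s_mem_of_single_mem
    intro j
    exact (le_sSup ⟨L.socPart j, L.isAtom_socPart hk j, rfl⟩ :
      (L.socPart j).toSubmodule ≤ socle ρ) ⟨x j, rfl⟩

/-- The kernel of the projection to a constituent of the top. -/
noncomputable def topKer (i : J) : Subrepresentation ρ where
  toSubmodule := LinearMap.ker (LinearMap.proj i ∘ₗ L.t)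
  apply_mem_toSubmodule := by
    intro g v hv
    change L.t (ρ g v) i = 0
    rw [L.t_rep, piRep_apply, show L.t v i = 0 from hv, map_zero]

theorem isCoatom_topKer (hk : Nat.card k = p ^ f) (i : J) : IsCoatom (L.topKer i) := by
  constructor
  · intro h
    obtain ⟨v, hv⟩ := L.t_surjective (Pi.single i ((τ i).hw 𝔽))
    have h1 : v ∈ L.topKer i := by rw [h]; exact Submodule.mem_top
    change L.t v i = 0 at h1
    rw [hv, Pi.single_eq_same] at h1
    exact (τ i).hw_ne_zero h1
  · intro b hb
    obtain ⟨y, hy, hy0⟩ := SetLike.not_le_iff_exists.1 hb.not_ge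
    change L.t y i ≠ 0 at hy0
    have h1 := Weight.eq_top_of_ne_zero_mem (L.deg_top i) hk
      (b.toSubmodule.map (LinearMap.proj i ∘ₗ L.t)) (by
        rintro g _ ⟨v, hv, rfl⟩
        exact ⟨ρ g v, b.apply_mem_toSubmodule g hv, congrFun (L.t_rep g v) i⟩) hy0 ⟨y, hy, rfl⟩
    apply top_le_iff.1
    intro z _
    obtain ⟨w, hw, hwz⟩ : L.t z i ∈ b.toSubmodule.map (LinearMap.proj i ∘ₗ L.t) := by
      rw [h1]
      trivial
    have h2 : z - w ∈ L.topKer i := by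
      change L.t (z - w) i = 0
      rw [map_sub, Pi.sub_apply, sub_eq_zero]
      exact hwz.symm
    have h3 := b.toSubmodule.add_mem (hb.le h2) hw
    rwa [sub_add_cancel] at h3

/-- The projections to single top constituents have maximal kernels. Conversely, if a maximal `M`
missed the constituent `j`, then `M` would map onto the top. An edge `i → j` would then force `j`
into `M`. -/
theorem radical_eq (hk : Nat.card k = p ^ f) : radical ρ = LinearMap.range L.s := by
  apply le_antisymm
  · intro v hv
    apply (L.exact v).1
    ext i
    exact (sInf_le ⟨L.topKer i, L.isCoatom_topKer hk i, rfl⟩ :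
      radical ρ ≤ (L.topKer i).toSubmodule) hv
  · apply le_sInf
    rintro _ ⟨M, hM, rfl⟩
    rintro _ ⟨x, rfl⟩
    apply L.s_mem_of_single_mem
    intro j
    by_contra hcon
    have h1 : M ⊔ L.socPart j = ⊤ := by
      apply hM.2
      apply lt_of_le_of_ne le_sup_left
      intro h
      apply hcon
      have h2 : L.socPart j ≤ M := by
        rw [h]
        exact le_sup_right
      exact h2 ⟨x j, rfl⟩
    obtain ⟨i, hi⟩ := L.edge_soc j
    obtain ⟨v, hv⟩ := L.t_surjective (Pi.single i ((τ i).hw 𝔽))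
    have h2 : v ∈ M.toSubmodule ⊔ (L.socPart j).toSubmodule := by
      rw [← Subrepresentation.toSubmodule_sup, h1]
      exact Submodule.mem_top
    obtain ⟨m, hm, _, ⟨y, rfl⟩, rfl⟩ := Submodule.mem_sup.1 h2
    rw [map_add, LinearMap.comp_apply, L.t_s, add_zero] at hv
    exact hcon (L.single_mem_of_edge hk M.toSubmodule (fun g x hx => M.apply_mem_toSubmodule g hx)
      hi hm (by rw [hv, Pi.single_eq_same]; exact (τ i).hw_ne_zero) _)

theorem mem_S1 (hk : Nat.card k = p ^ f) (v : V) :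
    v ∈ S1 ρ ↔ ∃ c : J → 𝔽, v = L.s fun j => c j • (σ j).hw 𝔽 := by
  rw [S1, L.socle_eq hk, Submodule.mem_inf, D1, mem_fixedBy_unip]
  constructor
  · rintro ⟨⟨x, rfl⟩, h⟩
    have h1 : ∀ j, ∃ c : 𝔽, x j = c • (σ j).hw 𝔽 := fun j =>
      Weight.exists_eq_smul_hw (L.deg_soc j) hk fun t => by
        have h2 := h t
        rw [← L.s_rep] at h2
        exact congrFun (L.s_injective h2) j
    choose c hc using h1
    exact ⟨c, congrArg L.s (funext hc)⟩
  · rintro ⟨c, rfl⟩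
    refine ⟨⟨_, rfl⟩, fun t => ?_⟩
    rw [← L.s_rep]
    congr 1
    ext j
    rw [piRep_apply, map_smul, Weight.rep_upper_hw]

theorem hwv_mem_S1chi (hk : Nat.card k = p ^ f) (j : J) :
    L.hwv j ∈ S1chi ρ ((σ j).chi p k 𝔽) := by
  refine ⟨?_, L.rep_borel_hwv j⟩
  rw [S1, L.socle_eq hk]
  exact ⟨⟨_, rfl⟩, L.hwv_mem_D1 j⟩

/-- Distinct characters make the eigenspace a line; this is what determines `Π` on it up to a
scalar. -/
theorem S1chi_eq (hk : Nat.card k = p ^ f) (j : J) :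
    S1chi ρ ((σ j).chi p k 𝔽) = Submodule.span 𝔽 {L.hwv j} := by
  apply le_antisymm
  · rintro v ⟨⟨hv, hU⟩, hB⟩
    rw [SetLike.mem_coe, L.socle_eq hk] at hv
    obtain ⟨x, rfl⟩ := hv
    rw [SetLike.mem_coe, D1, mem_fixedBy_unip] at hU
    obtain ⟨c, rfl⟩ := eq_single_hw L.deg_soc hk L.chi_soc j (x := x)
      (fun t => L.s_injective (by rw [L.s_rep, hU]))
      (fun b => L.s_injective (by rw [L.s_rep, map_smul]; exact hB b))
    rw [Pi.single_smul, map_smul]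
    exact Submodule.smul_mem _ _ (Submodule.mem_span_singleton_self _)
  · rw [Submodule.span_singleton_le_iff_mem]
    exact L.hwv_mem_S1chi hk j

theorem S1chi_eq_bot (L : Layers p k 𝔽 ρ σ τ edge) (hk : Nat.card k = p ^ f) {χ : borel k →* 𝔽ˣ}
    (hχ : ∀ j, χ ≠ (σ j).chi p k 𝔽) : S1chi ρ χ = ⊥ := by
  rw [eq_bot_iff]
  rintro v ⟨hv, hB⟩
  obtain ⟨c, rfl⟩ := (L.mem_S1 hk v).1 hv
  suffices c = 0 by
    simp only [this, Pi.zero_apply, zero_smul]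
    exact L.s.map_zero
  ext j
  by_contra hne
  apply hχ j
  ext b
  have h1 := hB b
  rw [← L.s_rep, ← map_smul] at h1
  have h2 := congrFun (L.s_injective h1) j
  rw [piRep_apply, map_smul, Weight.rep_borel_hw, Pi.smul_apply, smul_comm, smul_smul,
    smul_smul] at h2
  have h3 := smul_left_injective 𝔽 (σ j).hw_ne_zero h2
  exact (mul_right_cancel₀ hne h3).symm

/-- The image of a highest weight vector of the socle under `Π` generates a constituent of the
top. -/
theorem exists_t_op (hk : Nat.card k = p ^ f) (P : PiAction ρ) {i j : J}
    (h : (τ i).chi p k 𝔽 = conjChar ((σ j).chi p k 𝔽)) :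
    ∃ c : 𝔽, c ≠ 0 ∧
      L.t (P.op ⟨L.hwv j, L.hwv_mem_D1 j⟩) = Pi.single i (c • (τ i).hw 𝔽) := by
  set v : D1 ρ := ⟨L.hwv j, L.hwv_mem_D1 j⟩ with hv
  have h1 : (P.op v : V) ∈ P.Q1 ⊓ isotypic ρ (borel k) (conjChar ((σ j).chi p k 𝔽)) := by
    rw [← P.op_map]
    · exact ⟨P.op v, ⟨v, L.hwv_mem_S1chi hk j, rfl⟩, rfl⟩
    · intro h0
      have := L.hwv_mem_S1chi hk j
      rw [h0] at this
      exact L.hwv_ne_zero j this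
  have hU : ∀ t : k, ρ (upper t) (P.op v : V) = P.op v := (mem_fixedBy_unip ρ _).1 (P.op v).2
  obtain ⟨c, hc⟩ := eq_single_hw L.deg_top hk L.chi_top i (x := L.t (P.op v))
    (fun t => by rw [← L.t_rep, hU]) (fun b => by
      rw [← L.t_rep, h, ← map_smul]
      exact congrArg L.t (h1.2 b))
  refine ⟨c, ?_, hc⟩
  -- With `c = 0` the vector `Π v` would lie in `S₁ ∩ Q₁ = 0`, against `Π² = 1`.
  rintro rfl
  rw [zero_smul, Pi.single_zero] at hc
  have h2 : (P.op v : V) ∈ S1 ρ ⊓ P.Q1 := by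
    refine ⟨⟨?_, (P.op v).2⟩, h1.1⟩
    rw [SetLike.mem_coe, L.socle_eq hk]
    exact (L.exact _).1 hc
  rw [P.inf_eq, Submodule.mem_bot] at h2
  have h3 : P.op v = 0 := Subtype.ext h2
  have h4 := P.op_op v
  rw [h3, map_zero] at h4
  exact L.hwv_ne_zero j (congrArg Subtype.val h4).symm

end Layers

end Layers

/-! ### The two layers of the spliced module -/

section SplicedLayers

variable {p : ℕ} [Fact p.Prime] {f : ℕ} [NeZero f] {k : Type u} [Field k] [CharP k p]
  {𝔽 : Type v} [Field 𝔽] [Algebra k 𝔽] {r : Fin f → ℕ}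

/-- The pairs of constituents of cosocle and socle between which the spliced module has a non-split
extension. -/
def spliceEdge (f : ℕ) [NeZero f] : Idx f → Idx f → Prop
  | none, some (_, none) => True
  | some (c, some n), some (c', some n') => c = c' ∧ n = n'
  | some (_, none), none => True
  | _, _ => False

/-- The weights in the cosocle of the spliced module. -/
noncomputable def topW (p : ℕ) (r : Fin f → ℕ) (i : Idx f) : Weight f := (topB p r i).conj p

namespace CyclicPair

variable (S : CyclicPair p k 𝔽 r)

/-- The families representing elements of the spliced module. -/
noncomputable def fib : Submodule 𝔽 (∀ c, S.Cyc c) :=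
  S.fiber.comap (LinearEquiv.piFinTwo 𝔽 S.Cyc).toLinearMap

theorem mem_fib (x : ∀ c, S.Cyc c) :
    x ∈ S.fib ↔ (S.first 0).proj (x 0).1 = (S.first 1).proj (x 1).1 := Iff.rfl

theorem proj_first_of_mem_fib {x : ∀ c, S.Cyc c} (hx : x ∈ S.fib) (c : Fin 2) :
    (S.first c).proj (x c).1 = (S.first 0).proj (x 0).1 := by
  fin_cases c
  · rfl
  · exact ((S.mem_fib x).1 hx).symm

theorem rep_mem_fib {x : ∀ c, S.Cyc c} (hx : x ∈ S.fib) (g : GL2 k) :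
    piRep S.cycRep g x ∈ S.fib := S.fiber_le_comap g hx

/-- The projection to the spliced module. -/
noncomputable def cls : S.fib →ₗ[𝔽] S.D0 :=
  (((LinearMap.range S.iotaSigma).mkQ ∘ₗ (LinearEquiv.piFinTwo 𝔽 S.Cyc).toLinearMap ∘ₗ
    S.fib.subtype).codRestrict S.spliced fun x => ⟨_, x.2, rfl⟩ : S.fib →ₗ[𝔽] S.spliced)

theorem cls_surjective : Function.Surjective S.cls := by
  rintro ⟨_, ⟨x, hx, rfl⟩⟩
  exact ⟨⟨(LinearEquiv.piFinTwo 𝔽 S.Cyc).symm x, by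
    rw [fib, Submodule.mem_comap]
    simpa using! hx⟩, rfl⟩

theorem cls_eq_zero_iff (x : S.fib) :
    S.cls x = 0 ↔ ∃ y, ∀ c, (x : ∀ c, S.Cyc c) c = (0, 0, (S.last c).incl y) := by
  have h : S.cls x = 0 ↔ (LinearMap.range S.iotaSigma).mkQ ((x : ∀ c, S.Cyc c) 0, (x : ∀ c, S.Cyc c) 1) = 0 :=
    Subtype.ext_iff
  rw [h, Submodule.mkQ_apply, Submodule.Quotient.mk_eq_zero]
  constructor
  · rintro ⟨y, hy⟩
    refine ⟨y, fun c => ?_⟩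
    fin_cases c
    · exact (congrArg Prod.fst hy).symm
    · exact (congrArg Prod.snd hy).symm
  · rintro ⟨y, hy⟩
    exact ⟨y, Prod.ext (hy 0).symm (hy 1).symm⟩

theorem rep0_cls (g : GL2 k) (x : S.fib) :
    S.rep0 g (S.cls x) = S.cls ⟨piRep S.cycRep g x, S.rep_mem_fib x.2 g⟩ := rfl

/-- The projection from the families to the constituents of the cosocle. -/
noncomputable def topMap : (i : Idx f) → (∀ c, S.Cyc c) →ₗ[𝔽] (topW p r i).Space 𝔽
  | none => (S.first 0).proj.toLinearMap ∘ₗ LinearMap.fst 𝔽 _ _ ∘ₗ LinearMap.proj 0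
  | some (c, none) => (S.last c).proj.toLinearMap ∘ₗ LinearMap.snd 𝔽 _ _ ∘ₗ
      LinearMap.snd 𝔽 _ _ ∘ₗ LinearMap.proj c
  | some (c, some n) => (S.mid c n).proj.toLinearMap ∘ₗ LinearMap.proj n ∘ₗ
      LinearMap.fst 𝔽 _ _ ∘ₗ LinearMap.snd 𝔽 _ _ ∘ₗ LinearMap.proj c

theorem topMap_rep (g : GL2 k) (x : ∀ c, S.Cyc c) (i : Idx f) :
    S.topMap i (piRep S.cycRep g x) = (topW p r i).rep p k 𝔽 g (S.topMap i x) := by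
  rcases i with _ | ⟨c, _ | n⟩
  · exact (S.first 0).proj.isIntertwining _ _ g _
  · exact (S.last c).proj.isIntertwining _ _ g _
  · exact (S.mid c n).proj.isIntertwining _ _ g _

/-- The inclusion of the constituents of the socle in the families. -/
noncomputable def socMap : (∀ j, (socW p r j).Space 𝔽) →ₗ[𝔽] ∀ c, S.Cyc c :=
  LinearMap.pi fun c => ((S.first c).incl.toLinearMap ∘ₗ LinearMap.proj (some (c, none))).prod
    ((LinearMap.pi fun n => (S.mid c n).incl.toLinearMap ∘ₗ LinearMap.proj (some (c, some n))).prod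
      -- Modulo the diagonal copy of `σ` the two copies differ by a sign only, so `σ` is represented
      -- in the first cycle.
      ((if c = 0 then (1 : 𝔽) else 0) • ((S.last c).incl.toLinearMap ∘ₗ LinearMap.proj none)))

theorem socMap_apply (z : ∀ j, (socW p r j).Space 𝔽) (c : Fin 2) :
    S.socMap z c = ((S.first c).incl (z (some (c, none))),
      fun n => (S.mid c n).incl (z (some (c, some n))),
      (if c = 0 then (1 : 𝔽) else 0) • (S.last c).incl (z none)) := rfl

theorem topMap_socMap (z : ∀ j, (socW p r j).Space 𝔽) (i : Idx f) : S.topMap i (S.socMap z) = 0 := by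
  rcases i with _ | ⟨c, _ | n⟩
  · exact (S.first 0).exact.apply_apply_eq_zero _
  · change (S.last c).proj ((if c = 0 then (1 : 𝔽) else 0) • (S.last c).incl (z none)) = 0
    exact (((S.last c).proj.toLinearMap.map_smul _ _).trans
      (congrArg _ ((S.last c).exact.apply_apply_eq_zero _))).trans (smul_zero _)
  · exact (S.mid c n).exact.apply_apply_eq_zero _

theorem socMap_mem_fib (z : ∀ j, (socW p r j).Space 𝔽) : S.socMap z ∈ S.fib := by
  rw [mem_fib]
  change (S.first 0).proj ((S.first 0).incl _) = (S.first 1).proj ((S.first 1).incl _)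
  rw [(S.first 0).exact.apply_apply_eq_zero, (S.first 1).exact.apply_apply_eq_zero]

theorem socMap_rep (g : GL2 k) (z : ∀ j, (socW p r j).Space 𝔽) :
    S.socMap (piRep (fun j => (socW p r j).rep p k 𝔽) g z) = piRep S.cycRep g (S.socMap z) := by
  funext c
  rw [piRep_apply, socMap_apply, socMap_apply]
  refine Prod.ext ?_ (Prod.ext ?_ ?_)
  · exact (S.first c).incl.isIntertwining _ _ g _
  · funext n
    exact (S.mid c n).incl.isIntertwining _ _ g _
  · exact ((((S.last c).rep g).map_smul (if c = 0 then (1 : 𝔽) else 0) _).trans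
      (congrArg _ ((S.last c).incl.isIntertwining _ _ g _).symm)).symm

/-- The inclusion of the socle in the spliced module. -/
noncomputable def socCls : (∀ j, (socW p r j).Space 𝔽) →ₗ[𝔽] S.D0 :=
  S.cls ∘ₗ S.socMap.codRestrict S.fib S.socMap_mem_fib

/-- Families with the same image in the spliced module as an element of the socle. -/
theorem exists_of_cls_eq_socCls {x : S.fib} {z : ∀ j, (socW p r j).Space 𝔽}
    (h : S.cls x = S.socCls z) :
    ∃ y, ∀ c, (x : ∀ c, S.Cyc c) c = S.socMap z c + (0, 0, (S.last c).incl y) := by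
  have h1 : S.cls (x - S.socMap.codRestrict S.fib S.socMap_mem_fib z) = 0 := by
    rw [map_sub, sub_eq_zero, h]
    rfl
  obtain ⟨y, hy⟩ := (S.cls_eq_zero_iff _).1 h1
  refine ⟨y, fun c => ?_⟩
  rw [← hy c]
  change _ = S.socMap z c + ((x : ∀ c, S.Cyc c) c - S.socMap z c)
  rw [add_sub_cancel]

theorem socCls_injective : Function.Injective S.socCls := by
  rw [← LinearMap.ker_eq_bot, LinearMap.ker_eq_bot']
  intro z hz
  obtain ⟨y, hy⟩ := S.exists_of_cls_eq_socCls (x := 0) (z := z) (by rw [hz, map_zero])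
  have h1 : ∀ c, (S.first c).incl (z (some (c, none))) = 0 := by
    intro c
    have := congrArg Prod.fst (hy c)
    simpa [socMap_apply] using this.symm
  have h2 : ∀ c n, (S.mid c n).incl (z (some (c, some n))) = 0 := by
    intro c n
    have := congrFun (congrArg (fun x => x.2.1) (hy c)) n
    simpa [socMap_apply] using this.symm
  have h3 : (S.last 1).incl y = 0 := by
    have := congrArg (fun x => x.2.2) (hy 1)
    simpa [socMap_apply] using this.symm
  have h4 : (S.last 0).incl (z none) + (S.last 0).incl y = 0 := by
    have := congrArg (fun x => x.2.2) (hy 0)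
    simpa [socMap_apply] using this.symm
  have hy0 : y = 0 := (S.last 1).incl_injective (by rw [h3, map_zero])
  funext j
  rcases j with _ | ⟨c, _ | n⟩
  · rw [hy0, map_zero, add_zero] at h4
    exact (S.last 0).incl_injective (by rw [h4]; exact (map_zero _).symm)
  · exact (S.first c).incl_injective (by rw [h1]; exact (map_zero _).symm)
  · exact (S.mid c n).incl_injective (by rw [h2]; exact (map_zero _).symm)

/-- A family whose images in the cosocle vanish represents an element of the socle. -/
theorem exists_socCls_eq {x : S.fib} (hx : ∀ i, S.topMap i x = 0) : ∃ z, S.socCls z = S.cls x := by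
  have h0 : ∀ c, (S.first c).proj ((x : ∀ c, S.Cyc c) c).1 = 0 := fun c => by
    rw [S.proj_first_of_mem_fib x.2 c]
    exact hx none
  choose a ha using fun c => ((S.first c).exact _).1 (h0 c)
  choose b hb using fun c n => ((S.mid c n).exact _).1 (hx (some (c, some n)))
  choose d hd using fun c => ((S.last c).exact _).1 (hx (some (c, none)))
  let z : ∀ j, (socW p r j).Space 𝔽 := fun j => match j with
    -- Subtracting the diagonal vector of `d 1` clears the second cycle and leaves `d 0 - d 1` in
    -- the first.
    | none => d 0 - d 1
    | some (c, none) => a c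
    | some (c, some n) => b c n
  refine ⟨z, ?_⟩
  rw [eq_comm, ← sub_eq_zero]
  change S.cls x - S.cls (S.socMap.codRestrict S.fib S.socMap_mem_fib z) = 0
  rw [← map_sub, cls_eq_zero_iff]
  refine ⟨d 1, fun c => ?_⟩
  change (x : ∀ c, S.Cyc c) c - S.socMap z c = _
  rw [socMap_apply]
  refine Prod.ext ?_ (Prod.ext ?_ ?_)
  · change ((x : ∀ c, S.Cyc c) c).1 - (S.first c).incl (a c) = 0
    rw [ha, sub_self]
  · funext n
    change ((x : ∀ c, S.Cyc c) c).2.1 n - (S.mid c n).incl (b c n) = 0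
    rw [hb, sub_eq_zero]
    rfl
  · change ((x : ∀ c, S.Cyc c) c).2.2 - (if c = 0 then (1 : 𝔽) else 0) • (S.last c).incl (d 0 - d 1) =
      (S.last c).incl (d 1)
    have h1 : (S.last c).incl (d c) = ((x : ∀ c, S.Cyc c) c).2.2 := hd c
    rw [← h1]
    fin_cases c
    · simp
    · simp

theorem exists_topMap_eq (y : ∀ i, (topW p r i).Space 𝔽) : ∃ x : S.fib, ∀ i, S.topMap i x = y i := by
  choose a ha using fun c => (S.first c).proj_surjective (y none)
  choose b hb using fun c n => (S.mid c n).proj_surjective (y (some (c, some n)))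
  choose d hd using fun c => (S.last c).proj_surjective (y (some (c, none)))
  refine ⟨⟨fun c => (a c, b c, d c), ?_⟩, ?_⟩
  · rw [mem_fib]
    exact (ha 0).trans (ha 1).symm
  · rintro (_ | ⟨c, _ | n⟩)
    · exact ha 0
    · exact hd c
    · exact hb c n

/-- The projections to the cosocle vanish on the diagonal copy of `σ`, so they may be computed on
any linear choice of representatives. -/
theorem exists_top :
    ∃ t : S.D0 →ₗ[𝔽] ∀ i, (topW p r i).Space 𝔽, ∀ (x : S.fib) i, t (S.cls x) i = S.topMap i x := by
  obtain ⟨g, hg⟩ := S.cls.exists_rightInverse_of_surjective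
    (LinearMap.range_eq_top.2 S.cls_surjective)
  refine ⟨LinearMap.pi S.topMap ∘ₗ S.fib.subtype ∘ₗ g, fun x i => ?_⟩
  change S.topMap i (g (S.cls x) : ∀ c, S.Cyc c) = S.topMap i x
  rw [← sub_eq_zero, ← map_sub]
  have h1 : S.cls (g (S.cls x) - x) = 0 := by
    rw [map_sub, sub_eq_zero]
    exact LinearMap.congr_fun hg _
  obtain ⟨y, hy⟩ := (S.cls_eq_zero_iff _).1 h1
  change ∀ c, ((g (S.cls x) : ∀ c, S.Cyc c) - (x : ∀ c, S.Cyc c)) c = _ at hy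
  set w := (g (S.cls x) : ∀ c, S.Cyc c) - (x : ∀ c, S.Cyc c)
  rcases i with _ | ⟨c, _ | n⟩
  · change (S.first 0).proj (w 0).1 = 0
    rw [hy]
    exact map_zero _
  · change (S.last c).proj (w c).2.2 = 0
    rw [hy]
    exact (S.last c).exact.apply_apply_eq_zero _
  · change (S.mid c n).proj ((w c).2.1 n) = 0
    rw [hy]
    exact map_zero _

end CyclicPair

end SplicedLayers

/-! ### Gluing data of the spliced module -/

section SplicedLayers

variable {p : ℕ} [Fact p.Prime] {f : ℕ} [NeZero f] {k : Type u} [Field k] [CharP k p]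
  {𝔽 : Type v} [Field 𝔽] [Algebra k 𝔽] {r : Fin f → ℕ}

namespace CyclicPair

variable (S : CyclicPair p k 𝔽 r)

/-- The diagonal copy of `σ` has no component in the first extensions. So the component of a family
there depends only on its class, and by the fibre condition it lies over the common image in
`σ^{[s]}`. -/
theorem glue_first (t : S.D0 →ₗ[𝔽] ∀ i, (topW p r i).Space 𝔽)
    (ht : ∀ (x : S.fib) i, t (S.cls x) i = S.topMap i x) (c : Fin 2) :
    ∃ R : Submodule 𝔽 (S.D0 × (S.first c).E),
      (∀ g v u, (v, u) ∈ R → (S.rep0 g v, (S.first c).rep g u) ∈ R) ∧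
      (∀ v, (∀ i' ≠ none, t v i' = 0) → ∃ u, (v, u) ∈ R) ∧
      (∀ v u, (v, u) ∈ R → (S.first c).proj u = t v none) ∧
      ∀ x y, (S.socCls x, (S.first c).incl y) ∈ R → y ≠ 0 → x (some (c, none)) ≠ 0 := by
  refine ⟨LinearMap.range (S.cls.prod (LinearMap.fst 𝔽 _ _ ∘ₗ LinearMap.proj c ∘ₗ S.fib.subtype)),
    ?_, ?_, ?_, ?_⟩
  · rintro g v u ⟨x, hx⟩
    obtain ⟨rfl, rfl⟩ := Prod.mk.inj hx
    exact ⟨⟨piRep S.cycRep g x, S.rep_mem_fib x.2 g⟩, rfl⟩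
  · intro v _
    obtain ⟨x, rfl⟩ := S.cls_surjective v
    exact ⟨_, x, rfl⟩
  · rintro v u ⟨x, hx⟩
    obtain ⟨rfl, rfl⟩ := Prod.mk.inj hx
    rw [ht]
    exact S.proj_first_of_mem_fib x.2 c
  · rintro z y ⟨x, hx⟩ hy h0
    obtain ⟨h1, h2⟩ := Prod.mk.inj hx
    obtain ⟨w, hw⟩ := S.exists_of_cls_eq_socCls h1
    apply hy
    apply (S.first c).incl_injective
    have h3 := congrArg Prod.fst (hw c)
    rw [← h2]
    refine h3.trans ?_
    change (S.first c).incl (z (some (c, none))) + 0 = _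
    rw [h0, add_zero]
    rfl

theorem glue_mid (t : S.D0 →ₗ[𝔽] ∀ i, (topW p r i).Space 𝔽)
    (ht : ∀ (x : S.fib) i, t (S.cls x) i = S.topMap i x) (c : Fin 2) (n : Fin (len f - 2)) :
    ∃ R : Submodule 𝔽 (S.D0 × (S.mid c n).E),
      (∀ g v u, (v, u) ∈ R → (S.rep0 g v, (S.mid c n).rep g u) ∈ R) ∧
      (∀ v, (∀ i' ≠ some (c, some n), t v i' = 0) → ∃ u, (v, u) ∈ R) ∧
      (∀ v u, (v, u) ∈ R → (S.mid c n).proj u = t v (some (c, some n))) ∧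
      ∀ x y, (S.socCls x, (S.mid c n).incl y) ∈ R → y ≠ 0 → x (some (c, some n)) ≠ 0 := by
  refine ⟨LinearMap.range (S.cls.prod (LinearMap.proj n ∘ₗ LinearMap.fst 𝔽 _ _ ∘ₗ
    LinearMap.snd 𝔽 _ _ ∘ₗ LinearMap.proj c ∘ₗ S.fib.subtype)), ?_, ?_, ?_, ?_⟩
  · rintro g v u ⟨x, hx⟩
    obtain ⟨rfl, rfl⟩ := Prod.mk.inj hx
    exact ⟨⟨piRep S.cycRep g x, S.rep_mem_fib x.2 g⟩, rfl⟩
  · intro v _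
    obtain ⟨x, rfl⟩ := S.cls_surjective v
    exact ⟨_, x, rfl⟩
  · rintro v u ⟨x, hx⟩
    obtain ⟨rfl, rfl⟩ := Prod.mk.inj hx
    rw [ht]
    rfl
  · rintro z y ⟨x, hx⟩ hy h0
    obtain ⟨h1, h2⟩ := Prod.mk.inj hx
    obtain ⟨w, hw⟩ := S.exists_of_cls_eq_socCls h1
    apply hy
    apply (S.mid c n).incl_injective
    have h3 := congrFun (congrArg (fun x => x.2.1) (hw c)) n
    rw [← h2]
    refine h3.trans ?_
    change (S.mid c n).incl (z (some (c, some n))) + 0 = _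
    rw [h0, add_zero]
    rfl

/-- Classes do not determine the component in the last extension of the cycle `c`. If the top
component of the other cycle vanishes, however, the other last component is the image of some `w` in
`σ`. Subtracting `w` in the cycle `c` as well cancels the ambiguity by the diagonal. -/
theorem glue_last (t : S.D0 →ₗ[𝔽] ∀ i, (topW p r i).Space 𝔽)
    (ht : ∀ (x : S.fib) i, t (S.cls x) i = S.topMap i x) (c : Fin 2) :
    ∃ R : Submodule 𝔽 (S.D0 × (S.last c).E),
      (∀ g v u, (v, u) ∈ R → (S.rep0 g v, (S.last c).rep g u) ∈ R) ∧
      (∀ v, (∀ i' ≠ some (c, none), t v i' = 0) → ∃ u, (v, u) ∈ R) ∧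
      (∀ v u, (v, u) ∈ R → (S.last c).proj u = t v (some (c, none))) ∧
      ∀ x y, (S.socCls x, (S.last c).incl y) ∈ R → y ≠ 0 → x none ≠ 0 := by
  have hcc : c + 1 ≠ c := by fin_cases c <;> decide
  let N : Submodule 𝔽 (S.fib × (baseWeight r).Space 𝔽) :=
    LinearMap.eqLocus (LinearMap.snd 𝔽 _ _ ∘ₗ LinearMap.snd 𝔽 _ _ ∘ₗ LinearMap.proj (c + 1) ∘ₗ
      S.fib.subtype ∘ₗ LinearMap.fst 𝔽 _ _)
      ((S.last (c + 1)).incl.toLinearMap ∘ₗ LinearMap.snd 𝔽 _ _)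
  let ψ : (S.fib × (baseWeight r).Space 𝔽) →ₗ[𝔽] S.D0 × (S.last c).E :=
    (S.cls ∘ₗ LinearMap.fst 𝔽 _ _).prod
      ((LinearMap.snd 𝔽 _ _ ∘ₗ LinearMap.snd 𝔽 _ _ ∘ₗ LinearMap.proj c ∘ₗ
        S.fib.subtype ∘ₗ LinearMap.fst 𝔽 _ _) - (S.last c).incl.toLinearMap ∘ₗ LinearMap.snd 𝔽 _ _)
  have hN : ∀ x w, (x, w) ∈ N ↔ ((x : ∀ c, S.Cyc c) (c + 1)).2.2 = (S.last (c + 1)).incl w :=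
    fun _ _ => Iff.rfl
  have hψ : ∀ x w, ψ (x, w) = (S.cls x, ((x : ∀ c, S.Cyc c) c).2.2 - (S.last c).incl w) :=
    fun _ _ => rfl
  refine ⟨N.map ψ, ?_, ?_, ?_, ?_⟩
  · rintro g v u ⟨⟨x, w⟩, hN', hx⟩
    rw [hψ] at hx
    obtain ⟨rfl, rfl⟩ := Prod.mk.inj hx
    refine ⟨(⟨piRep S.cycRep g x, S.rep_mem_fib x.2 g⟩, (baseWeight r).rep p k 𝔽 g w), ?_, ?_⟩
    · have h1 := (hN _ _).1 hN'
      refine (hN _ _).2 ?_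
      change (S.last (c + 1)).rep g ((x : ∀ c, S.Cyc c) (c + 1)).2.2 = _
      rw [h1, (S.last (c + 1)).incl.isIntertwining]
    · rw [hψ, map_sub, (S.last c).incl.isIntertwining]
      rfl
  · intro v hv
    obtain ⟨x, rfl⟩ := S.cls_surjective v
    have h1 := hv (some (c + 1, none)) (fun h => hcc (Prod.mk.inj (Option.some.inj h)).1)
    rw [ht] at h1
    obtain ⟨w, hw⟩ := ((S.last (c + 1)).exact _).1 h1
    exact ⟨_, (x, w), (hN _ _).2 hw.symm, rfl⟩
  · rintro v u ⟨⟨x, w⟩, hN', hx⟩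
    rw [hψ] at hx
    obtain ⟨rfl, rfl⟩ := Prod.mk.inj hx
    rw [ht, map_sub, (S.last c).exact.apply_apply_eq_zero, sub_zero]
    rfl
  · rintro z y ⟨⟨x, w⟩, hN', hx⟩ hy h0
    rw [hψ] at hx
    obtain ⟨h1, h2⟩ := Prod.mk.inj hx
    obtain ⟨a, ha⟩ := S.exists_of_cls_eq_socCls h1
    have h3 : ∀ c', ((x : ∀ c, S.Cyc c) c').2.2 = (S.last c').incl a := by
      intro c'
      refine (congrArg (fun x => x.2.2) (ha c')).trans ?_
      change (if c' = 0 then (1 : 𝔽) else 0) • (S.last c').incl (z none) + (S.last c').incl a = _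
      rw [h0]
      have h4 : (S.last c').incl (0 : (baseWeight r).Space 𝔽) = 0 := map_zero _
      exact (congrArg (fun b => (if c' = 0 then (1 : 𝔽) else 0) • b + (S.last c').incl a) h4).trans
        (by rw [smul_zero, zero_add])
    have h5 : w = a := (S.last (c + 1)).incl_injective (by rw [← (hN _ _).1 hN', h3])
    apply hy
    apply (S.last c).incl_injective
    rw [← h2, h3, h5, sub_self, map_zero]

/-- Valid for arbitrary choices of the extensions. The top is multiplicity free because its
characters are the conjugates of those of the socle and conjugation is an involution on them. -/
theorem exists_layers [Finite k] (hk : Nat.card k = p ^ f) (hf : 1 < f) (hp : 3 < p)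
    (hr : ∀ j, 1 ≤ r j ∧ r j ≤ p - 3) :
    ∃ L : Layers p k 𝔽 S.rep0 (socW p r) (topW p r) (spliceEdge f),
      ∀ (x : S.fib) i, L.t (S.cls x) i = S.topMap i x := by
  obtain ⟨t, ht⟩ := S.exists_top
  obtain ⟨e, -, -, -, he⟩ := exists_match hf p r
  refine ⟨⟨S.socCls, t, ?_, ?_, S.socCls_injective, ?_, ?_, ?_, socW_deg_lt hf hp hr,
    fun i => Weight.conj_deg_lt _, socW_chi_injective hk hf hp hr, ?_, ?_, ?_⟩, ht⟩
  · intro g x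
    rw [socCls, LinearMap.comp_apply, LinearMap.comp_apply, rep0_cls]
    exact congrArg S.cls (Subtype.ext (S.socMap_rep g x))
  · intro g v
    obtain ⟨x, rfl⟩ := S.cls_surjective v
    ext i
    rw [rep0_cls, ht, piRep_apply, ht]
    exact S.topMap_rep g x i
  · intro y
    obtain ⟨x, hx⟩ := S.exists_topMap_eq y
    exact ⟨S.cls x, funext fun i => by rw [ht, hx]⟩
  · intro v
    obtain ⟨x, rfl⟩ := S.cls_surjective v
    constructor
    · intro h
      exact S.exists_socCls_eq fun i => by rw [← ht, h, Pi.zero_apply]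
    · rintro ⟨z, hz⟩
      ext i
      rw [← hz]
      exact (ht _ i).trans (S.topMap_socMap z i)
  · rintro (_ | ⟨c, _ | n⟩) (_ | ⟨c', _ | n'⟩) h
    · exact h.elim
    · exact ⟨S.first c', S.glue_first t ht c'⟩
    · exact h.elim
    · exact ⟨S.last c, S.glue_last t ht c⟩
    · exact h.elim
    · exact h.elim
    · exact h.elim
    · exact h.elim
    · obtain ⟨rfl, rfl⟩ := h
      exact ⟨S.mid c n, S.glue_mid t ht c n⟩
  · intro i i' h
    obtain ⟨j, rfl⟩ := e.surjective i
    obtain ⟨j', rfl⟩ := e.surjective i'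
    simp only [topW, he, Weight.chi_conj (socW_deg_lt hf hp hr _) hk] at h
    have h1 := congrArg conjChar h
    rw [Weight.conjChar_conjChar, Weight.conjChar_conjChar] at h1
    rw [socW_chi_injective hk hf hp hr h1]
  · rintro (_ | ⟨c, _ | n⟩)
    · exact ⟨some (0, none), trivial⟩
    · exact ⟨none, trivial⟩
    · exact ⟨some (c, some n), rfl, rfl⟩
  · rintro (_ | ⟨c, _ | n⟩)
    · exact ⟨some (0, none), trivial⟩
    · exact ⟨none, trivial⟩
    · exact ⟨some (c, some n), rfl, rfl⟩

end CyclicPair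

end SplicedLayers

/-! ### Weighted shifts on finitely supported sequences -/

section WeightedShifts

variable {𝔽 : Type*} [Field 𝔽]

/-- The weighted shift `e_i ↦ a_i e_{i+d}`. -/
noncomputable def wshift (a : ℤ → 𝔽) (d : ℤ) : (ℤ →₀ 𝔽) →ₗ[𝔽] ℤ →₀ 𝔽 :=
  Finsupp.lsum 𝔽 fun i => a i • Finsupp.lsingle (i + d)

theorem wshift_single (a : ℤ → 𝔽) (d i : ℤ) (c : 𝔽) :
    wshift a d (Finsupp.single i c) = Finsupp.single (i + d) (a i * c) := by
  simp [wshift]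

theorem wshift_apply (a : ℤ → 𝔽) (d : ℤ) (w : ℤ →₀ 𝔽) (j : ℤ) :
    wshift a d w j = a (j - d) * w (j - d) := by
  induction w using Finsupp.induction_linear with
  | zero => simp
  | add w w' h h' => rw [map_add, Finsupp.add_apply, h, h', Finsupp.add_apply, mul_add]
  | single i c =>
    rw [wshift_single, Finsupp.single_apply, Finsupp.single_apply]
    by_cases h : i = j - d
    · rw [if_pos (by omega), if_pos h, h]
    · rw [if_neg (by omega), if_neg h, mul_zero]

theorem support_wshift {a : ℤ → 𝔽} (ha : ∀ i, a i ≠ 0) (d : ℤ) (w : ℤ →₀ 𝔽) :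
    (wshift a d w).support = w.support.map (addRightEmbedding d) := by
  ext j
  simp only [Finsupp.mem_support_iff, wshift_apply, Finset.mem_map, addRightEmbedding_apply]
  constructor
  · intro h
    exact ⟨j - d, right_ne_zero_of_mul h, by ring⟩
  · rintro ⟨i, hi, rfl⟩
    rw [add_sub_cancel_right]
    exact mul_ne_zero (ha i) hi

theorem wshift_ne_zero {a : ℤ → 𝔽} (ha : ∀ i, a i ≠ 0) (d : ℤ) {w : ℤ →₀ 𝔽} (hw : w ≠ 0) :
    wshift a d w ≠ 0 := by
  rw [← Finsupp.support_nonempty_iff] at hw ⊢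
  rw [support_wshift ha]
  exact hw.map

/-- A sequence of units in which the ratio `a_{m+d} / a_m` alternates between two inverse values of
finite order takes the value `a_0` again. -/
theorem exists_eq_of_alternating {lam : ℤ → 𝔽ˣ} (htors : ∀ c : 𝔽ˣ, ∃ n : ℕ, 0 < n ∧ c ^ n = 1)
    {d : ℤ} (hd : d ≠ 0) (h : ∀ m, lam (m + 1 + d) * lam (m + d) = lam (m + 1) * lam m) :
    ∃ i, i ≠ 0 ∧ lam i = lam 0 := by
  have h1 : ∀ m, lam (m + 1 + d) * (lam (m + 1))⁻¹ = (lam (m + d) * (lam m)⁻¹)⁻¹ := by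
    intro m
    rw [mul_inv_rev, inv_inv, mul_inv_eq_iff_eq_mul, mul_right_comm, eq_mul_inv_iff_mul_eq, h,
      mul_comm]
  -- The hypothesis says `R (m + 1) = (R m)⁻¹`, so `R` has period `2`.
  set R : ℤ → 𝔽ˣ := fun m => lam (m + d) * (lam m)⁻¹ with hR
  have h2 : ∀ m, R (m + 2) = R m := by
    intro m
    have e1 := h1 m
    have e2 := h1 (m + 1)
    have e3 : m + 1 + 1 = m + 2 := by ring
    rw [e1, inv_inv, e3] at e2
    exact e2
  have h3 : ∀ n m : ℤ, R (m + 2 * n) = R m := by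
    intro n
    induction n using Int.induction_on with
    | zero => simp
    | succ n ih =>
      intro m
      rw [show m + 2 * ((n : ℤ) + 1) = m + 2 * n + 2 by ring, h2, ih]
    | pred n ih =>
      intro m
      rw [← ih m, ← h2 (m + 2 * (-(n : ℤ) - 1))]
      congr 1
      ring
  have h4 : ∀ m, lam (m + d) = R m * lam m := by
    intro m
    rw [hR]
    simp
  -- For even `d` all ratios along the multiples of `d` equal `R 0`, and a multiple of `d` by the
  -- order of `R 0` works. For odd `d` consecutive ratios are inverse, and `2d` works.
  rcases Int.even_or_odd' d with ⟨b, hb | hb⟩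
  · obtain ⟨n, hn, hc⟩ := htors (R 0)
    have h5 : ∀ n : ℕ, lam (n * d) = R 0 ^ n * lam 0 := by
      intro n
      induction n with
      | zero => simp
      | succ n ih =>
        rw [show ((n + 1 : ℕ) : ℤ) * d = n * d + d by push_cast; ring, h4, ih, pow_succ,
          show (n : ℤ) * d = 0 + 2 * (n * b) by rw [hb]; ring, h3, ← mul_assoc, mul_comm (R 0)]
    exact ⟨n * d, mul_ne_zero (by exact_mod_cast hn.ne') hd, by rw [h5, hc, one_mul]⟩
  · refine ⟨d + d, by omega, ?_⟩
    have h6 : R d = (R 0)⁻¹ := by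
      have e1 := h1 0
      rw [zero_add] at e1
      rw [hb, add_comm, h3]
      exact e1
    have h7 := h4 0
    rw [zero_add] at h7
    rw [h4, h6, h7, inv_mul_cancel_left]

/-- The weighted shifts in both directions act irreducibly if the weights satisfy a genericity
condition. -/
theorem eq_top_of_wshift_mem {lam : ℤ → 𝔽ˣ} (hlam : ∀ i, i ≠ 0 → lam i ≠ lam 0)
    (htors : ∀ c : 𝔽ˣ, ∃ n : ℕ, 0 < n ∧ c ^ n = 1) (A : Submodule 𝔽 (ℤ →₀ 𝔽))
    (hX : ∀ w ∈ A, wshift (fun i => (lam i : 𝔽)) (-1) w ∈ A)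
    (hY : ∀ w ∈ A, wshift (fun i => (lam i : 𝔽)) 1 w ∈ A) (hA : A ≠ ⊥) : A = ⊤ := by
  classical
  have ha : ∀ i, (lam i : 𝔽) ≠ 0 := fun i => (lam i).ne_zero
  obtain ⟨w₀, hw₀, hw₀'⟩ := Submodule.exists_mem_ne_zero_of_ne_bot hA
  have hex : ∃ n, ∃ w ∈ A, w ≠ 0 ∧ w.support.card = n := ⟨_, w₀, hw₀, hw₀', rfl⟩
  set N := Nat.find hex with hN
  let good : (ℤ →₀ 𝔽) → Prop := fun w => w ∈ A ∧ w ≠ 0 ∧ w.support.card = N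
  have hmin : ∀ w ∈ A, w ≠ 0 → N ≤ w.support.card := fun w hw hw' =>
    Nat.find_min' hex ⟨w, hw, hw', rfl⟩
  have gX : ∀ w, good w → good (wshift (fun i => (lam i : 𝔽)) (-1) w) := fun w hw =>
    ⟨hX w hw.1, wshift_ne_zero ha _ hw.2.1, by rw [support_wshift ha, Finset.card_map, hw.2.2]⟩
  have gY : ∀ w, good w → good (wshift (fun i => (lam i : 𝔽)) 1 w) := fun w hw =>
    ⟨hY w hw.1, wshift_ne_zero ha _ hw.2.1, by rw [support_wshift ha, Finset.card_map, hw.2.2]⟩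
  -- The composite of the shifts is diagonal with entries `λ_i λ_{i-1}`. Subtracting the eigenvalue
  -- at `i` would give a vector with smaller nonempty support if the eigenvalues were not constant
  -- on the support.
  have hb : ∀ w, good w → ∀ i ∈ w.support, ∀ i' ∈ w.support,
      lam i * lam (i - 1) = lam i' * lam (i' - 1) := by
    intro w hw i hi i' hi'
    set u := wshift (fun i => (lam i : 𝔽)) 1 (wshift (fun i => (lam i : 𝔽)) (-1) w) -
      ((lam i : 𝔽) * lam (i - 1)) • w with hu
    have hcoe : ∀ j, u j = ((lam j : 𝔽) * lam (j - 1) - lam i * lam (i - 1)) * w j := by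
      intro j
      rw [hu, Finsupp.sub_apply, Finsupp.smul_apply, wshift_apply, wshift_apply]
      simp only [sub_neg_eq_add, sub_add_cancel, smul_eq_mul]
      ring
    have huA : u ∈ A := A.sub_mem (hY _ (hX _ hw.1)) (A.smul_mem _ hw.1)
    have hu0 : u = 0 := by
      by_contra hne
      have h1 := hmin u huA hne
      have h2 : u.support ⊂ w.support := by
        rw [Finset.ssubset_iff_of_subset]
        · exact ⟨i, hi, by rw [Finsupp.notMem_support_iff, hcoe, sub_self, zero_mul]⟩
        · intro j hj
          rw [Finsupp.mem_support_iff, hcoe] at hj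
          exact Finsupp.mem_support_iff.2 (right_ne_zero_of_mul hj)
      have h3 := Finset.card_lt_card h2
      rw [hw.2.2] at h3
      omega
    have h1 := hcoe i'
    rw [hu0, Finsupp.zero_apply, eq_comm, mul_eq_zero, sub_eq_zero] at h1
    have h2 := h1.resolve_right (Finsupp.mem_support_iff.1 hi')
    apply Units.ext
    push_cast
    exact h2.symm
  have hbY : ∀ (n : ℕ) w, good w → ∀ i ∈ w.support, ∀ i' ∈ w.support,
      lam (i + n) * lam (i + n - 1) = lam (i' + n) * lam (i' + n - 1) := by
    intro n
    induction n with
    | zero => simpa using hb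
    | succ n ih =>
      intro w hw i hi i' hi'
      have := ih _ (gY w hw) (i + 1) (by
        rw [support_wshift ha]
        exact Finset.mem_map_of_mem _ hi) (i' + 1) (by
        rw [support_wshift ha]
        exact Finset.mem_map_of_mem _ hi')
      push_cast
      rwa [add_assoc, add_comm (1 : ℤ), add_assoc, add_comm (1 : ℤ)] at this
  have hbX : ∀ (n : ℕ) w, good w → ∀ i ∈ w.support, ∀ i' ∈ w.support,
      lam (i - n) * lam (i - n - 1) = lam (i' - n) * lam (i' - n - 1) := by
    intro n
    induction n with
    | zero => simpa using hb
    | succ n ih =>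
      intro w hw i hi i' hi'
      have := ih _ (gX w hw) (i + -1) (by
        rw [support_wshift ha]
        exact Finset.mem_map_of_mem _ hi) (i' + -1) (by
        rw [support_wshift ha]
        exact Finset.mem_map_of_mem _ hi')
      have e : ∀ x : ℤ, x - ((n + 1 : ℕ) : ℤ) = x + -1 - n := fun x => by push_cast; ring
      rwa [e, e]
  obtain ⟨w, hw⟩ : ∃ w, good w := Nat.find_spec hex
  -- Shifts of a minimal vector are minimal, so the equality of eigenvalues holds along all
  -- translates of `i` and `i'`, which is the hypothesis of `exists_eq_of_alternating` with `d = i'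
  -- - i`.
  have hone : ∀ i ∈ w.support, ∀ i' ∈ w.support, i = i' := by
    intro i hi i' hi'
    by_contra hne
    obtain ⟨m, hm, hm'⟩ := exists_eq_of_alternating htors (lam := lam) (d := i' - i)
      (by omega) (by
        intro m
        rcases le_total (m + 1 - i) 0 with h | h
        · obtain ⟨n, hn⟩ := Int.eq_ofNat_of_zero_le (show 0 ≤ i - (m + 1) by omega)
          have := hbX n w hw i hi i' hi'
          rw [show i - (n : ℤ) = m + 1 by omega, show i' - (n : ℤ) = m + 1 + (i' - i) by omega,
            show m + 1 + (i' - i) - 1 = m + (i' - i) by ring, add_sub_cancel_right] at this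
          exact this.symm
        · obtain ⟨n, hn⟩ := Int.eq_ofNat_of_zero_le h
          have := hbY n w hw i hi i' hi'
          rw [show i + (n : ℤ) = m + 1 by omega, show i' + (n : ℤ) = m + 1 + (i' - i) by omega,
            show m + 1 + (i' - i) - 1 = m + (i' - i) by ring, add_sub_cancel_right] at this
          exact this.symm)
    exact hlam m hm hm'
  obtain ⟨i, hi⟩ := Finsupp.support_nonempty_iff.2 hw.2.1
  have hsingle : Finsupp.single i (1 : 𝔽) ∈ A := by
    have h1 : w = w i • Finsupp.single i 1 := by
      ext j
      rw [Finsupp.smul_apply, Finsupp.single_apply, smul_eq_mul]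
      by_cases h : i = j
      · rw [if_pos h, h, mul_one]
      · rw [if_neg h, mul_zero]
        by_contra hj
        exact h (hone i hi j (Finsupp.mem_support_iff.2 hj))
    have h2 := hw.1
    rw [h1] at h2
    exact (Submodule.smul_mem_iff A (Finsupp.mem_support_iff.1 hi)).1 h2
  have hstep : ∀ j, Finsupp.single j (1 : 𝔽) ∈ A →
      Finsupp.single (j + 1) (1 : 𝔽) ∈ A ∧ Finsupp.single (j + -1) (1 : 𝔽) ∈ A := by
    intro j hj
    have h1 := hY _ hj
    have h2 := hX _ hj
    rw [wshift_single, ← smul_eq_mul, ← Finsupp.smul_single] at h1 h2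
    exact ⟨(Submodule.smul_mem_iff A (ha j)).1 h1, (Submodule.smul_mem_iff A (ha j)).1 h2⟩
  have hall : ∀ n : ℤ, Finsupp.single (i + n) (1 : 𝔽) ∈ A := by
    intro n
    induction n using Int.induction_on with
    | zero => simpa using hsingle
    | succ n ih =>
      rw [← add_assoc]
      exact (hstep _ ih).1
    | pred n ih =>
      rw [sub_eq_add_neg, ← add_assoc]
      exact (hstep _ ih).2
  rw [Submodule.eq_top_iff']
  intro x
  rw [← Finsupp.sum_single x]
  apply A.sum_mem
  intro j _
  have := A.smul_mem (x j) (hall (j - i))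
  rwa [Finsupp.smul_single, smul_eq_mul, mul_one, add_sub_cancel] at this

/-- The units of an algebraic extension of a finite field have finite order. -/
theorem exists_pow_eq_one {k : Type*} [Field k] [Finite k] [Algebra k 𝔽] [Algebra.IsAlgebraic k 𝔽]
    (c : 𝔽ˣ) : ∃ n : ℕ, 0 < n ∧ c ^ n = 1 := by
  have hfin : FiniteDimensional k (IntermediateField.adjoin k {(c : 𝔽)}) :=
    IntermediateField.adjoin.finiteDimensional (Algebra.IsIntegral.isIntegral _)
  have hF : Finite (IntermediateField.adjoin k {(c : 𝔽)}) := Module.finite_of_finite k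
  let x : IntermediateField.adjoin k {(c : 𝔽)} := ⟨c, IntermediateField.mem_adjoin_simple_self k _⟩
  have hx : x ≠ 0 := fun h => c.ne_zero (congrArg Subtype.val h)
  obtain ⟨n, hn, h⟩ := isOfFinOrder_iff_pow_eq_one.1 (isOfFinOrder_of_finite (Units.mk0 x hx))
  refine ⟨n, hn, ?_⟩
  apply Units.ext
  have h1 := congrArg (fun u : (IntermediateField.adjoin k {(c : 𝔽)})ˣ =>
    ((u : IntermediateField.adjoin k {(c : 𝔽)}) : 𝔽)) h
  simpa [x] using h1

end WeightedShifts

/-! ### Families of multiples of one vector -/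

section Shifts

variable {𝔽 : Type*} [Field 𝔽]

theorem wshift_one_zero (w : ℤ →₀ 𝔽) : wshift 1 0 w = w := by
  ext j
  rw [wshift_apply, Pi.one_apply, one_mul, sub_zero]

theorem wshift_one_wshift (a : ℤ → 𝔽) (d : ℤ) (w : ℤ →₀ 𝔽) :
    wshift 1 d (wshift a 0 w) = wshift a d w := by
  ext j
  rw [wshift_apply, wshift_apply, wshift_apply, Pi.one_apply, one_mul, sub_zero]

theorem wshift_surjective {a : ℤ → 𝔽} (ha : ∀ i, a i ≠ 0) (d : ℤ) :
    Function.Surjective (wshift a d) := by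
  intro w
  refine ⟨wshift (fun i => (a (i - d))⁻¹) (-d) w, ?_⟩
  ext j
  rw [wshift_apply, wshift_apply, sub_neg_eq_add, sub_add_cancel, ← mul_assoc,
    mul_inv_cancel₀ (ha _), one_mul]

/-- The family of multiples of `v` with coefficients `w`. -/
noncomputable def ten {V : Type*} [AddCommGroup V] [Module 𝔽 V] (w : ℤ →₀ 𝔽) :
    V →ₗ[𝔽] ℤ →₀ V where
  toFun v := w.mapRange (fun a => a • v) (zero_smul 𝔽 v)
  map_add' := by
    intro v v'
    ext
    simp
  map_smul' := by
    intro c v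
    exact Finsupp.ext fun i => smul_comm (w i) c v

variable {V : Type*} [AddCommGroup V] [Module 𝔽 V]

@[simp] theorem ten_apply (w : ℤ →₀ 𝔽) (v : V) (i : ℤ) : ten w v i = w i • v := rfl

theorem ten_single (i : ℤ) (v : V) : ten (Finsupp.single i (1 : 𝔽)) v = Finsupp.single i v := by
  ext j
  rw [ten_apply, Finsupp.single_apply, Finsupp.single_apply]
  split_ifs <;> simp

/-- The coefficient families `w` with `ten w v ∈ W`. -/
noncomputable def coeffs (W : Submodule 𝔽 (ℤ →₀ V)) (v : V) : Submodule 𝔽 (ℤ →₀ 𝔽) :=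
  W.comap (Finsupp.mapRange.linearMap (LinearMap.toSpanSingleton 𝔽 V v))

theorem mem_coeffs {W : Submodule 𝔽 (ℤ →₀ V)} {v : V} {w : ℤ →₀ 𝔽} :
    w ∈ coeffs W v ↔ ten w v ∈ W := Iff.rfl

theorem finsuppRep_ten {H : Type*} [Group H] (ρ : Representation 𝔽 H V) (g : H) (w : ℤ →₀ 𝔽)
    (v : V) : finsuppRep ℤ ρ g (ten w v) = ten w (ρ g v) := by
  ext i
  simp

end Shifts

/-! ### Irreducibility of sums of copies of the spliced module under `Π` -/

section Irreducibility

variable {p : ℕ} [Fact p.Prime] {k : Type u} [Field k] [CharP k p] {𝔽 : Type v} [Field 𝔽]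
  [Algebra k 𝔽] {f : ℕ} [Finite k]

/-- Subrepresentations of a direct sum of copies of a multiplicity free sum of weights contain a
highest weight vector in an isotypic component. -/
theorem exists_ten_hw_mem {J : Type} [DecidableEq J] [Finite J] {wt : J → Weight f}
    (hwt : ∀ a j, (wt a).deg j < p) (hk : Nat.card k = p ^ f)
    (hχ : Function.Injective fun a => (wt a).chi p k 𝔽)
    (M : Submodule 𝔽 (ℤ →₀ ∀ a, (wt a).Space 𝔽))
    (hM : ∀ g : GL2 k, ∀ x ∈ M, finsuppRep ℤ (piRep fun a => (wt a).rep p k 𝔽) g x ∈ M)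
    (hM0 : M ≠ ⊥) :
    ∃ (j : J) (w : ℤ →₀ 𝔽), w ≠ 0 ∧ ten w (Pi.single j ((wt j).hw 𝔽)) ∈ M := by
  have := Fintype.ofFinite J
  -- Copies are treated as one family indexed by `ℤ × J`; `exists_hw_mem` permits repeated weights
  -- and infinite index sets.
  let flat : (ℤ →₀ ∀ a, (wt a).Space 𝔽) →ₗ[𝔽] ∀ b : ℤ × J, (wt b.2).Space 𝔽 :=
    LinearMap.pi fun b => LinearMap.proj b.2 ∘ₗ Finsupp.lapply b.1
  have hflat : ∀ x b, flat x b = x b.1 b.2 := fun _ _ => rfl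
  obtain ⟨x, hx, hx0⟩ := Submodule.exists_mem_ne_zero_of_ne_bot hM0
  obtain ⟨c, hc, ⟨y, hy, hyc⟩⟩ := exists_hw_mem (k := k) (wt := fun b : ℤ × J => wt b.2)
    (fun b => hwt b.2) hk (M.map flat) (by
      rintro t _ ⟨y, hy, rfl⟩
      exact ⟨finsuppRep ℤ (piRep fun a => (wt a).rep p k 𝔽) (upper t) y, hM _ y hy, rfl⟩)
    (x := flat x) (fun h => hx0 (by
      exact Finsupp.ext fun i => funext fun j => congrFun h (i, j))) ⟨x, hx, rfl⟩
  have hyc' : ∀ i j, y i j = c (i, j) • (wt j).hw 𝔽 := fun i j => congrFun hyc (i, j)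
  let w : J → ℤ →₀ 𝔽 := fun j => Finsupp.onFinset y.support (fun i => c (i, j)) (by
    intro i hi
    rw [Finsupp.mem_support_iff]
    intro h0
    have h1 := hyc' i j
    rw [h0] at h1
    exact smul_ne_zero hi (wt j).hw_ne_zero h1.symm)
  have hsum : ∑ j, ten (w j) (Pi.single j ((wt j).hw 𝔽) : ∀ a, (wt a).Space 𝔽) = y := by
    refine Finsupp.ext fun i => funext fun j => ?_
    rw [Finsupp.finsetSum_apply, hyc']
    simp only [ten_apply, ← Pi.single_smul]
    rw [Finset.sum_apply, Finset.sum_pi_single, if_pos (Finset.mem_univ _)]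
    rfl
  obtain ⟨⟨i, j⟩, hij⟩ := Function.ne_iff.1 hc
  refine ⟨j, w j, fun h => hij (DFunLike.congr_fun h i), ?_⟩
  -- Characters separate the types `j`; the copies of one type stay together in the coefficient
  -- family `w j`.
  refine mem_of_sum_mem (finsuppRep ℤ (piRep fun a => (wt a).rep p k 𝔽)) M
    (fun b x hx => hM b x hx) hχ Finset.univ
    (fun j => ten (w j) (Pi.single j ((wt j).hw 𝔽))) ?_ (by rwa [hsum]) j (Finset.mem_univ _)
  intro j b
  rw [finsuppRep_ten, piRep_single, Weight.rep_borel_hw, Pi.single_smul, map_smul]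

namespace Layers

section First

variable {J : Type} [DecidableEq J] [Finite J] {V : Type v} [AddCommGroup V] [Module 𝔽 V]
  {ρ : Representation 𝔽 (GL2 k) V} {σ τ : J → Weight f} {edge : J → J → Prop}
  (L : Layers p k 𝔽 ρ σ τ edge)

theorem exists_coeffs_ne_bot_of_t_eq_zero (hk : Nat.card k = p ^ f) (W : Submodule 𝔽 (ℤ →₀ V))
    (hW : ∀ g, ∀ x ∈ W, finsuppRep ℤ ρ g x ∈ W) {x : ℤ →₀ V} (hx : x ∈ W) (hx0 : x ≠ 0)
    (hxt : ∀ i, L.t (x i) = 0) : ∃ j, coeffs W (L.hwv j) ≠ ⊥ := by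
  choose z hz using fun i => (L.exact (x i)).1 (hxt i)
  obtain ⟨j, w, hw, hwM⟩ := exists_ten_hw_mem L.deg_soc hk L.chi_soc
    (W.comap (Finsupp.mapRange.linearMap L.s)) (by
      intro g y hy
      rw [Submodule.mem_comap] at hy ⊢
      convert hW g _ hy using 1
      ext i
      exact L.s_rep g (y i)) (by
      have hmem : ∀ i, z i ≠ 0 → i ∈ x.support := by
        intro i hi
        rw [Finsupp.mem_support_iff, ← hz]
        intro h
        exact hi (L.s_injective (by rw [h, map_zero]))
      rw [Submodule.ne_bot_iff]
      refine ⟨Finsupp.onFinset x.support z hmem, ?_, ?_⟩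
      · rw [Submodule.mem_comap]
        convert hx using 1
        ext i
        exact hz i
      · intro h
        apply hx0
        ext i
        rw [← hz]
        have := DFunLike.congr_fun h i
        rw [Finsupp.onFinset_apply] at this
        rw [this]
        exact L.s.map_zero)
  refine ⟨j, (Submodule.ne_bot_iff _).2 ⟨w, ?_, hw⟩⟩
  rw [mem_coeffs]
  rw [Submodule.mem_comap] at hwM
  convert hwM using 1
  ext i
  change w i • L.s _ = L.s (w i • _)
  rw [map_smul]

/-- If `W` is not contained in the socle, its image in the top contains a family of multiples of one
highest weight vector. The subspace of `W` over the corresponding copy of `τ i` is mapped to a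
single copy of `V`, where non-splitness produces a nonzero vector of the socle. -/
theorem exists_coeffs_ne_bot (hk : Nat.card k = p ^ f) (W : Submodule 𝔽 (ℤ →₀ V))
    (hW : ∀ g, ∀ x ∈ W, finsuppRep ℤ ρ g x ∈ W) (hW0 : W ≠ ⊥) :
    ∃ j, coeffs W (L.hwv j) ≠ ⊥ := by
  by_cases hall : ∀ x ∈ W, ∀ i, L.t (x i) = 0
  · obtain ⟨x, hx, hx0⟩ := Submodule.exists_mem_ne_zero_of_ne_bot hW0
    exact L.exists_coeffs_ne_bot_of_t_eq_zero hk W hW hx hx0 (hall x hx)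
  push Not at hall
  obtain ⟨x, hx, i₁, hx1⟩ := hall
  obtain ⟨i, w, hw, y, hy, hyw⟩ := exists_ten_hw_mem L.deg_top hk L.chi_top
    (W.map (Finsupp.mapRange.linearMap L.t)) (by
      rintro g _ ⟨y, hy, rfl⟩
      refine ⟨finsuppRep ℤ ρ g y, hW g y hy, ?_⟩
      exact Finsupp.ext fun i => L.t_rep g (y i)) (by
      rw [Submodule.ne_bot_iff]
      exact ⟨_, ⟨x, hx, rfl⟩, fun h => hx1 (DFunLike.congr_fun h i₁)⟩)
  obtain ⟨i₀, hi₀⟩ := Finsupp.support_nonempty_iff.2 hw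
  rw [Finsupp.mem_support_iff] at hi₀
  have hyw' : ∀ a, L.t (y a) = w a • Pi.single i ((τ i).hw 𝔽) := fun a => DFunLike.congr_fun hyw a
  let X : Submodule 𝔽 (ℤ →₀ V) := W ⊓ (LinearMap.range (ten w ∘ₗ
    LinearMap.single 𝔽 (fun i => (τ i).Space 𝔽) i)).comap (Finsupp.mapRange.linearMap L.t)
  have hX : ∀ m, m ∈ X ↔ m ∈ W ∧ ∃ u : (τ i).Space 𝔽, ∀ a, L.t (m a) = w a • Pi.single i u := by
    intro m
    constructor
    · rintro ⟨h1, u, hu⟩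
      exact ⟨h1, u, fun a => (DFunLike.congr_fun hu a).symm⟩
    · rintro ⟨h1, u, hu⟩
      exact ⟨h1, u, Finsupp.ext fun a => (hu a).symm⟩
  obtain ⟨j, hj⟩ := L.edge_top i
  obtain ⟨m, hm, z, hz, hzj⟩ := L.exists_soc hk hj (finsuppRep ℤ ρ) (Finsupp.lapply i₀)
    (fun _ _ => rfl) X (by
      intro g m hm
      rw [hX] at hm ⊢
      obtain ⟨h1, u, hu⟩ := hm
      refine ⟨hW g m h1, (τ i).rep p k 𝔽 g u, fun a => ?_⟩
      rw [finsuppRep_apply, L.t_rep, hu, map_smul, piRep_single]) (by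
      intro m hm i' hi'
      obtain ⟨-, u, hu⟩ := (hX m).1 hm
      change L.t (m i₀) i' = 0
      rw [hu, Pi.smul_apply, Pi.single_eq_of_ne hi', smul_zero])
    (m := y) ((hX y).2 ⟨hy, _, hyw'⟩) (by
      change L.t (y i₀) i ≠ 0
      rw [hyw', Pi.smul_apply, Pi.single_eq_same]
      exact smul_ne_zero hi₀ (τ i).hw_ne_zero)
  obtain ⟨hmW, u, hu⟩ := (hX m).1 hm
  change m i₀ = _ at hz
  -- The element `m` lies over `w ⊗ u`. Its component at `i₀` is in the socle and `w i₀ ≠ 0`, so `u`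
  -- vanishes and all components are in the socle.
  have hu0 : u = 0 := by
    have h1 := congrFun (hu i₀) i
    rw [hz, L.t_s, Pi.smul_apply, Pi.single_eq_same, Pi.zero_apply] at h1
    exact (smul_eq_zero.1 h1.symm).resolve_left hi₀
  refine L.exists_coeffs_ne_bot_of_t_eq_zero hk W hW hmW ?_ (fun a => by
    rw [hu, hu0, Pi.single_zero, smul_zero])
  rintro rfl
  rw [Finsupp.zero_apply, ← map_zero L.s] at hz
  exact hzj (congrFun (L.s_injective hz) j).symm

/-- A subrepresentation of a direct sum of copies containing the highest weight vectors of the socle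
and representatives of those of the top is everything. -/
theorem eq_top_of_forall_mem (hk : Nat.card k = p ^ f) (W : Submodule 𝔽 (ℤ →₀ V))
    (hW : ∀ g, ∀ x ∈ W, finsuppRep ℤ ρ g x ∈ W)
    (hs : ∀ i j, Finsupp.single i (L.hwv j) ∈ W)
    (ht : ∀ i j, ∃ (v : V) (c : 𝔽), c ≠ 0 ∧ Finsupp.single i v ∈ W ∧
      L.t v = Pi.single j (c • (τ j).hw 𝔽)) : W = ⊤ := by
  have := Fintype.ofFinite J
  have key : ∀ i v, Finsupp.single i v ∈ W := by
    intro i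
    let X : Submodule 𝔽 V := W.comap (Finsupp.lsingle i)
    have hX : ∀ g, ∀ x ∈ X, ρ g x ∈ X := by
      intro g x hx
      have h1 := hW g _ hx
      change Finsupp.single i (ρ g x) ∈ W
      convert h1 using 1
      ext a
      rw [finsuppRep_apply]
      by_cases ha : i = a
      · subst ha
        simp
      · simp [ha]
    have h1 : ∀ z, L.s z ∈ X := fun z => L.s_mem_of_single_mem X z fun j =>
      L.single_mem_of_s_mem hk X hX (hs i j) (by
        rw [Pi.single_eq_same]
        exact (σ j).hw_ne_zero) _
    have h2 : ∀ y, y ∈ X.map L.t := by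
      intro y
      rw [← Finset.univ_sum_single y]
      refine Submodule.sum_mem _ fun j _ => ?_
      obtain ⟨v, c, hc, hv, hvt⟩ := ht i j
      refine single_mem_of_mem L.deg_top hk L.chi_top (X.map L.t) ?_ ⟨v, hv, rfl⟩ (a := j) (by
        rw [hvt, Pi.single_eq_same]
        exact smul_ne_zero hc (τ j).hw_ne_zero) _
      rintro g _ ⟨v, hv, rfl⟩
      exact ⟨ρ g v, hX g v hv, L.t_rep g v⟩
    intro v
    obtain ⟨y, hy, hyv⟩ := h2 (L.t v)
    obtain ⟨z, hz⟩ := (L.exact (v - y)).1 (by rw [map_sub, hyv, sub_self])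
    have h3 := X.add_mem (h1 z) hy
    rw [hz, sub_add_cancel] at h3
    exact h3
  rw [Submodule.eq_top_iff']
  intro x
  rw [← Finsupp.sum_single x]
  exact W.sum_mem fun i _ => key i _

end First

section Dynamics

variable [NeZero f] {V : Type v} [AddCommGroup V] [Module 𝔽 V]
  {ρ : Representation 𝔽 (GL2 k) V} {σ τ : Idx f → Weight f}
  (L : Layers p k 𝔽 ρ σ τ (spliceEdge f))

/-- The displacement of the summands by `Π`. -/
def displacement (f : ℕ) [NeZero f] : Idx f → ℤ
  | none => 0
  | some (c, none) => if c = 0 then -1 else 1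
  | some (_, some _) => 0

/-- The scalars by which `Π` is modified. -/
def modifier (lam : ℤ → 𝔽ˣ) : Idx f → ℤ → 𝔽
  | none => fun i => lam i
  | some _ => 1

theorem modifier_ne_zero (lam : ℤ → 𝔽ˣ) (j : Idx f) (i : ℤ) : modifier lam j i ≠ 0 := by
  rcases j with _ | j
  · exact (lam i).ne_zero
  · exact one_ne_zero

/-- Irreducibility of a direct sum of copies of the spliced module under a twisted action
of `Π`. -/
theorem eq_bot_or_eq_top (hk : Nat.card k = p ^ f) (hf : 1 < f) {lam : ℤ → 𝔽ˣ}
    (hlam : ∀ i, i ≠ 0 → lam i ≠ lam 0) (htors : ∀ c : 𝔽ˣ, ∃ n : ℕ, 0 < n ∧ c ^ n = 1)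
    (e : Idx f ≃ Idx f) (he0 : e none = none)
    (he1 : ∀ c : Fin 2, e (some (c, none)) =
      some (c, some ⟨0, by have := three_le_len hf; omega⟩))
    (he2 : ∀ (c : Fin 2) (n : Fin (len f - 2)), e (some (c, some n)) = some (c,
        if h : (n : ℕ) + 1 < len f - 2 then some ⟨n + 1, h⟩ else none))
    (u : Idx f → V) (hu : ∀ j, ∃ c : 𝔽, c ≠ 0 ∧ L.t (u j) = Pi.single (e j) (c • (τ (e j)).hw 𝔽))
    (W : Submodule 𝔽 (ℤ →₀ V)) (hW : ∀ g, ∀ x ∈ W, finsuppRep ℤ ρ g x ∈ W)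
    (hPi : ∀ j w, ten w (L.hwv j) ∈ W →
      ten (wshift (modifier lam j) (displacement f j) w) (u j) ∈ W) : W = ⊥ ∨ W = ⊤ := by
  have hl := three_le_len hf
  rw [or_iff_not_imp_left]
  intro hW0
  set A : Idx f → Submodule 𝔽 (ℤ →₀ 𝔽) := fun j => coeffs W (L.hwv j) with hA
  have hstep : ∀ j j', spliceEdge f (e j) j' → ∀ w ∈ A j,
      wshift (modifier lam j) (displacement f j) w ∈ A j' := by
    intro j j' hjj w hw
    obtain ⟨c, hc, hcu⟩ := hu j
    -- For fixed coefficients the map `v ↦ ten _ v` is equivariant, so the preimage of `W` is a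
    -- subrepresentation of one copy of `V`, and it contains `u j`.
    exact L.single_mem_of_edge hk (W.comap (ten (wshift (modifier lam j) (displacement f j) w)))
      (fun g x hx => by
        rw [Submodule.mem_comap, ← finsuppRep_ten]
        exact hW g _ hx) hjj (y := u j) (hPi j w hw) (by
        rw [hcu, Pi.single_eq_same]
        exact smul_ne_zero hc (τ (e j)).hw_ne_zero) _
  -- From `σ_2` onward `Π` preserves the summands. The induction runs on the distance `d` to the end
  -- of the cycle.
  have hmid : ∀ (c : Fin 2) (d : ℕ) (n : Fin (len f - 2)), (n : ℕ) + d + 1 = len f - 2 →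
      A (some (c, some n)) ≤ A none := by
    intro c d
    induction d with
    | zero =>
      intro n hn w hw
      have := hstep (some (c, some n)) none (by
        rw [he2, dif_neg (by omega)]
        trivial) w hw
      rwa [← wshift_one_zero w]
    | succ d ih =>
      intro n hn w hw
      apply ih ⟨n + 1, by omega⟩ (by simp only; omega)
      have := hstep (some (c, some n)) (some (c, some ⟨n + 1, by omega⟩)) (by
        rw [he2, dif_pos (by omega)]
        exact ⟨rfl, rfl⟩) w hw
      rwa [← wshift_one_zero w]
  have hmid' : ∀ (c : Fin 2) (n : Fin (len f - 2)), A (some (c, some n)) ≤ A none := fun c n =>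
    hmid c (len f - 2 - n - 1) n (by have := n.2; omega)
  have hfirst : ∀ c : Fin 2, ∀ w ∈ A (some (c, none)),
      wshift 1 (displacement f (some (c, none))) w ∈ A none := fun c w hw =>
    hmid' c _ (hstep (some (c, none)) (some (c, some ⟨0, by omega⟩)) (by
      rw [he1]
      exact ⟨rfl, rfl⟩) w hw)
  have hbase : ∀ c : Fin 2, ∀ w ∈ A none, wshift (fun i => (lam i : 𝔽)) 0 w ∈ A (some (c, none)) :=
    fun c w hw => hstep none (some (c, none)) (by
      rw [he0]
      trivial) w hw
  -- A full turn: the scalars `λ_i` enter at `σ`, the displacement by `∓1` at `σ_1` or `σ'_1`, and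
  -- nothing afterwards.
  have hcycle : ∀ c : Fin 2, ∀ w ∈ A none,
      wshift (fun i => (lam i : 𝔽)) (displacement f (some (c, none))) w ∈ A none := by
    intro c w hw
    rw [← wshift_one_wshift]
    exact hfirst c _ (hbase c w hw)
  have hA0 : A none ≠ ⊥ := by
    obtain ⟨j, hj⟩ := L.exists_coeffs_ne_bot hk W hW hW0
    rcases j with _ | ⟨c, _ | n⟩
    · exact hj
    · obtain ⟨w, hw, hw0⟩ := Submodule.exists_mem_ne_zero_of_ne_bot hj
      exact (Submodule.ne_bot_iff _).2 ⟨_, hfirst c w hw,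
        wshift_ne_zero (fun _ => one_ne_zero) _ hw0⟩
    · exact ne_bot_of_le_ne_bot hj (hmid' c n)
  have htop0 : A none = ⊤ := eq_top_of_wshift_mem hlam htors _ (hcycle 0) (hcycle 1) hA0
  -- The transition maps are surjective, so fullness of `A none` spreads along both cycles.
  have htop_step : ∀ j j', spliceEdge f (e j) j' → A j = ⊤ → A j' = ⊤ := by
    intro j j' hjj hj
    rw [Submodule.eq_top_iff']
    intro w
    obtain ⟨w', rfl⟩ := wshift_surjective (modifier_ne_zero lam j) (displacement f j) w
    apply hstep j j' hjj
    rw [hj]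
    trivial
  have htop1 : ∀ c, A (some (c, none)) = ⊤ := fun c => htop_step none _ (by
    rw [he0]
    trivial) htop0
  have htop2 : ∀ (c : Fin 2) (n : ℕ) (hn : n < len f - 2), A (some (c, some ⟨n, hn⟩)) = ⊤ := by
    intro c n
    induction n with
    | zero =>
      intro hn
      exact htop_step (some (c, none)) _ (by
        rw [he1]
        exact ⟨rfl, rfl⟩) (htop1 c)
    | succ n ih =>
      intro hn
      exact htop_step (some (c, some ⟨n, by omega⟩)) _ (by
        rw [he2, dif_pos hn]
        exact ⟨rfl, rfl⟩) (ih (by omega))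
  have htop : ∀ j, A j = ⊤ := by
    rintro (_ | ⟨c, _ | n⟩)
    · exact htop0
    · exact htop1 c
    · exact htop2 c n n.2
  apply L.eq_top_of_forall_mem hk W hW
  · intro i j
    rw [← ten_single (𝔽 := 𝔽), ← mem_coeffs]
    change _ ∈ A j
    rw [htop]
    trivial
  · intro i j
    obtain ⟨c, hc, hcu⟩ := hu (e.symm j)
    rw [e.apply_symm_apply] at hcu
    refine ⟨u (e.symm j), c, hc, ?_, hcu⟩
    obtain ⟨w, hw⟩ := wshift_surjective (modifier_ne_zero lam (e.symm j))
      (displacement f (e.symm j)) (Finsupp.single i 1)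
    rw [← ten_single (𝔽 := 𝔽), ← hw]
    apply hPi
    rw [← mem_coeffs]
    change w ∈ A (e.symm j)
    rw [htop]
    trivial

end Dynamics

end Layers

end Irreducibility

/-! ### Reduction from `K` to `Γ` -/

section LocalField

variable (F : Type u) [Field F] [ValuativeRel F]

/-- Entrywise lifts suffice, as an element of a local ring with nonzero residue is a unit. -/
theorem redK_surjective : Function.Surjective (redK F) := by
  intro g
  choose a ha using fun i j => IsLocalRing.residue_surjective (R := 𝒪[F]) (g i j)
  have hdet : IsUnit (Matrix.det (Matrix.of a)) := by
    rw [← IsLocalRing.residue_ne_zero_iff_isUnit, RingHom.map_det]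
    have : (IsLocalRing.residue 𝒪[F]).mapMatrix (Matrix.of a) = (g : Matrix (Fin 2) (Fin 2) 𝓀[F]) := by
      ext i j
      exact ha i j
    rw [this, Matrix.det_fin_two]
    exact GL2_det_ne g
  refine ⟨Matrix.GeneralLinearGroup.mk'' (Matrix.of a) hdet, ?_⟩
  exact GL2_ext (ha 0 0) (ha 0 1) (ha 1 0) (ha 1 1)

end LocalField

/-! ### Irreducibility of the diagrams `D(λ)` -/

section DiagramIrreducible

variable {p : ℕ} [Fact p.Prime] {f : ℕ} [NeZero f] {F : Type u} [Field F] [ValuativeRel F]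
  [TopologicalSpace F] [CharP 𝓀[F] p] {ϖ : Fˣ} {𝔽 : Type v} [Field 𝔽] [Algebra 𝓀[F] 𝔽]
  {r : Fin f → ℕ} {S : CyclicPair p 𝓀[F] 𝔽 r} {P : PiAction S.rep0} {lam : ℤ → 𝔽ˣ}
  {D : BasicDiagram ϖ 𝔽} {φ : D.V0 ≃ₗ[𝔽] (ℤ →₀ S.D0)}

theorem topW_chi [Finite 𝓀[F]] (hk : Nat.card 𝓀[F] = p ^ f) (hf : 1 < f) (hp : 3 < p)
    (hr : ∀ j, 1 ≤ r j ∧ r j ≤ p - 3) {i j : Idx f} (h : topB p r i = socW p r j) :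
    (topW p r i).chi p 𝓀[F] 𝔽 = conjChar ((socW p r j).chi p 𝓀[F] 𝔽) := by
  rw [topW, h, Weight.chi_conj (socW_deg_lt hf hp hr j) hk]

namespace IsDLambda

variable (hD : IsDLambda P lam D φ)

theorem map_rep0 (hD : IsDLambda P lam D φ) (g : GL2 𝒪[F]) (x : D.V0) :
    φ (D.rep0 ⟨inclK F g, inclK_mem g⟩ x) = finsuppRep ℤ S.rep0 (redK F g) (φ x) :=
  Finsupp.ext fun i => hD.K_action g x i

theorem symm_mem_range (hD : IsDLambda P lam D φ) {y : ℤ →₀ S.D0} (hy : ∀ i, y i ∈ D1 S.rep0) :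
    φ.symm y ∈ LinearMap.range D.can := by
  rw [D.can_range]
  rintro ⟨_, hg⟩ ⟨h, hh, rfl⟩
  apply φ.injective
  have h1 := hD.map_rep0 h (φ.symm y)
  rw [φ.apply_symm_apply] at h1 ⊢
  refine h1.trans (Finsupp.ext fun i => ?_)
  exact hy i ⟨redK F h, hh⟩

variable [Finite 𝓀[F]] (L : Layers p 𝓀[F] 𝔽 S.rep0 (socW p r) (topW p r) (spliceEdge f))

/-- The four clauses defining the action of `Π`, in the uniform notation of displacement and
modifier. -/
theorem map_matPi_single (hk : Nat.card 𝓀[F] = p ^ f) (hD : IsDLambda P lam D φ) (j : Idx f)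
    (i : ℤ) (y : D.V1) (hy : φ (D.can y) = Finsupp.single i (L.hwv j)) :
    φ (D.can (D.rep1 ⟨matPi ϖ, matPi_mem ϖ⟩ y)) =
      Finsupp.single (i + Layers.displacement f j)
        (Layers.modifier lam j i • (P.op ⟨L.hwv j, L.hwv_mem_D1 j⟩ : S.D0)) := by
  have hmem := L.hwv_mem_S1chi hk j
  rcases j with _ | ⟨c, _ | n⟩
  · rw [hD.Pi_base i ⟨L.hwv none, L.hwv_mem_D1 none⟩ y hmem hy]
    simp [Layers.displacement, Layers.modifier]
  · fin_cases c
    · rw [hD.Pi_down i ⟨_, L.hwv_mem_D1 (some (0, none))⟩ y hmem hy]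
      simp [Layers.displacement, Layers.modifier, sub_eq_add_neg]
    · rw [hD.Pi_up i ⟨_, L.hwv_mem_D1 (some (1, none))⟩ y hmem hy]
      simp [Layers.displacement, Layers.modifier]
  · rw [hD.Pi_other c (n + 2) (by omega) (by have := n.2; omega) i
      ⟨_, L.hwv_mem_D1 (some (c, some n))⟩ y hmem hy]
    simp [Layers.displacement, Layers.modifier]

theorem exists_map_matPi (hk : Nat.card 𝓀[F] = p ^ f) (hD : IsDLambda P lam D φ) (j : Idx f)
    (w : ℤ →₀ 𝔽) : ∃ y : D.V1, φ (D.can y) = ten w (L.hwv j) ∧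
      φ (D.can (D.rep1 ⟨matPi ϖ, matPi_mem ϖ⟩ y)) =
        ten (wshift (Layers.modifier lam j) (Layers.displacement f j) w)
          (P.op ⟨L.hwv j, L.hwv_mem_D1 j⟩ : S.D0) := by
  have hadd : ∀ (w w' : ℤ →₀ 𝔽) (v : S.D0), ten (w + w') v = ten w v + ten w' v := fun w w' v =>
    Finsupp.ext fun i => add_smul (w i) (w' i) v
  induction w using Finsupp.induction_linear with
  | zero =>
    refine ⟨0, ?_, ?_⟩
    · rw [map_zero, map_zero]
      exact Finsupp.ext fun i => (zero_smul 𝔽 _).symm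
    · rw [map_zero, map_zero, map_zero, map_zero]
      exact Finsupp.ext fun i => (zero_smul 𝔽 _).symm
  | add w w' h h' =>
    obtain ⟨y, h1, h2⟩ := h
    obtain ⟨y', h1', h2'⟩ := h'
    exact ⟨y + y', by rw [map_add, map_add, h1, h1', hadd],
      by rw [map_add, map_add, map_add, h2, h2', map_add, hadd]⟩
  | single i c =>
    obtain ⟨y, hy⟩ := hD.symm_mem_range (y := Finsupp.single i (L.hwv j)) (by
      intro i'
      rw [Finsupp.single_apply]
      split_ifs
      · exact L.hwv_mem_D1 j
      · exact Submodule.zero_mem _)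
    have hy' : φ (D.can y) = Finsupp.single i (L.hwv j) := by rw [hy, φ.apply_symm_apply]
    refine ⟨c • y, ?_, ?_⟩
    · rw [map_smul, map_smul, hy']
      ext i'
      rw [Finsupp.smul_apply, ten_apply, Finsupp.single_apply, Finsupp.single_apply]
      split_ifs <;> simp
    · rw [map_smul, map_smul, map_smul, hD.map_matPi_single L hk j i y hy', wshift_single]
      ext i'
      rw [Finsupp.smul_apply, ten_apply, Finsupp.single_apply, Finsupp.single_apply]
      split_ifs
      · rw [smul_smul, mul_comm]
      · simp

/-- A subdiagram yields a `Γ`-stable subspace of the sum of copies which `Π` respects on families of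
highest weight vectors of the socle; `Layers.eq_bot_or_eq_top` requires no more. -/
theorem isIrreducible (hk : Nat.card 𝓀[F] = p ^ f) (hf : 1 < f) (hp : 3 < p)
    (hr : ∀ j, 1 ≤ r j ∧ r j ≤ p - 3) (hlam : ∀ i, i ≠ 0 → lam i ≠ lam 0)
    (htors : ∀ c : 𝔽ˣ, ∃ n : ℕ, 0 < n ∧ c ^ n = 1) (hD : IsDLambda P lam D φ) :
    D.IsIrreducible := by
  obtain ⟨L, -⟩ := S.exists_layers hk hf hp hr
  obtain ⟨e, he0, he1, he2, he⟩ := exists_match hf p r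
  constructor
  · refine ⟨φ.symm (Finsupp.single 0 (L.hwv none)), 0, ?_⟩
    rw [Ne, map_eq_zero_iff _ φ.symm.injective, Finsupp.single_eq_zero]
    exact L.hwv_ne_zero none
  · intro W0 W1 hW0 hW1 hcan
    have hmain := L.eq_bot_or_eq_top hk hf hlam htors e he0 he1 he2
      (fun j => (P.op ⟨L.hwv j, L.hwv_mem_D1 j⟩ : S.D0))
      (fun j => L.exists_t_op hk P (topW_chi hk hf hp hr (he j)))
      (W0.map φ.toLinearMap) (by
        rintro g _ ⟨x, hx, rfl⟩
        obtain ⟨h, rfl⟩ := redK_surjective F g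
        exact ⟨_, hW0 ⟨inclK F h, inclK_mem h⟩ x hx, hD.map_rep0 h x⟩) (by
        rintro j w ⟨x, hx, hxw⟩
        obtain ⟨y, hy1, hy2⟩ := hD.exists_map_matPi L hk j w
        have hyx : D.can y = x := φ.injective (hy1.trans hxw.symm)
        have h1 : D.can y ∈ W1.map D.can := by
          rw [hcan]
          exact ⟨by rwa [hyx], ⟨y, rfl⟩⟩
        obtain ⟨y', hy', hyy⟩ := h1
        rw [D.can_injective hyy] at hy'
        have h2 : D.can (D.rep1 ⟨matPi ϖ, matPi_mem ϖ⟩ y) ∈ W1.map D.can :=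
          ⟨_, hW1 _ y hy', rfl⟩
        rw [hcan] at h2
        exact ⟨_, h2.1, hy2⟩)
    rcases hmain with h | h
    · left
      exact (Submodule.map_eq_bot_iff (e := φ)).1 h
    · right
      rw [Submodule.eq_top_iff']
      intro x
      have : φ x ∈ W0.map φ.toLinearMap := by
        rw [h]
        trivial
      obtain ⟨x', hx', hxx⟩ := this
      rwa [← φ.injective hxx]

end IsDLambda

end DiagramIrreducible

/-! ### Invariant lifts of the highest weight vectors of the cosocle -/

section Lifts

variable {p : ℕ} [Fact p.Prime] {f : ℕ} [NeZero f] {k : Type u} [Field k] [CharP k p]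
  {𝔽 : Type v} [Field 𝔽] [Algebra k 𝔽] {r : Fin f → ℕ} [Finite k]

/-- `y` is a `U`-invariant eigenvector of `B` lifting the highest weight vector of the quotient
of an extension. -/
def IsLift {σ τ : Weight f} (E : NonsplitExtension (σ.rep p k 𝔽) (τ.rep p k 𝔽)) (y : E.E) : Prop :=
  (∀ t, E.rep (upper t) y = y) ∧ (∀ b : borel k, E.rep b y = (τ.chi p k 𝔽 b : 𝔽) • y) ∧
    E.proj y = τ.hw 𝔽

/-- The extensions of the cyclic modules can be chosen such that the highest weight vectors of their
cosocles lift to invariant eigenvectors. -/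
theorem exists_cyclicPair (hk : Nat.card k = p ^ f) (hf : 1 < f) (hp : 3 < p)
    (hr : ∀ j, 1 ≤ r j ∧ r j ≤ p - 3) :
    ∃ S : CyclicPair p k 𝔽 r, (∀ c, ∃ y, IsLift (S.first c) y) ∧
      (∀ c n, ∃ y, IsLift (S.mid c n) y) ∧ ∀ c, ∃ y, IsLift (S.last c) y := by
  have hodd : Odd p := (Fact.out : p.Prime).odd_of_ne_two (by omega)
  have h1 : ∀ c : Fin 2, ∃ (E : NonsplitExtension ((cycWeight p r c 1).rep p k 𝔽)
      (((baseWeight r).conj p).rep p k 𝔽)) (y : E.E), IsLift E y := fun c =>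
    (extPair_first hf hp hr c).exists_extension hodd hk
  have h2 : ∀ (c : Fin 2) (n : Fin (len f - 2)),
      ∃ (E : NonsplitExtension ((cycWeight p r c (n + 2)).rep p k 𝔽)
        (((cycWeight p r c (n + 1)).conj p).rep p k 𝔽)) (y : E.E), IsLift E y := fun c n =>
    (extPair_cycWeight hf hp hr c (n + 1)).exists_extension hodd hk
  have h3 : ∀ c : Fin 2, ∃ (E : NonsplitExtension ((baseWeight r).rep p k 𝔽)
      (((cycWeight p r c (len f - 1)).conj p).rep p k 𝔽)) (y : E.E), IsLift E y := fun c =>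
    (extPair_last hf hp hr c).exists_extension hodd hk
  choose E1 y1 hy1 using h1
  choose E2 y2 hy2 using h2
  choose E3 y3 hy3 using h3
  exact ⟨⟨E1, E2, E3⟩, fun c => ⟨_, hy1 c⟩, fun c n => ⟨_, hy2 c n⟩, fun c => ⟨_, hy3 c⟩⟩

/-- The highest weight vectors of the cosocle of the spliced module lift to invariant
eigenvectors. -/
theorem CyclicPair.exists_lift {S : CyclicPair p k 𝔽 r} (h1 : ∀ c, ∃ y, IsLift (S.first c) y)
    (h2 : ∀ c n, ∃ y, IsLift (S.mid c n) y) (h3 : ∀ c, ∃ y, IsLift (S.last c) y) (i : Idx f) :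
    ∃ y : S.fib, (∀ t, S.rep0 (upper t) (S.cls y) = S.cls y) ∧
      (∀ b : borel k, S.rep0 b (S.cls y) = ((topW p r i).chi p k 𝔽 b : 𝔽) • S.cls y) ∧
      ∀ i', S.topMap i' y = (Pi.single i ((topW p r i).hw 𝔽) : ∀ i, (topW p r i).Space 𝔽) i' := by
  classical
  choose y1 hy1 using h1
  choose y2 hy2 using h2
  choose y3 hy3 using h3
  obtain ⟨x, hx, hU, hB, ht⟩ : ∃ x : ∀ c, S.Cyc c, x ∈ S.fib ∧
      (∀ t, piRep S.cycRep (upper t) x = x) ∧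
      (∀ b : borel k, piRep S.cycRep b x = ((topW p r i).chi p k 𝔽 b : 𝔽) • x) ∧
      ∀ i', S.topMap i' x =
        (Pi.single i ((topW p r i).hw 𝔽) : ∀ i, (topW p r i).Space 𝔽) i' := by
    -- The lift is placed in the extension belonging to `i`. For `σ^{[s]}` it is placed in both
    -- cycles at once, as the fibre condition demands.
    refine ⟨fun c => (if i = none then y1 c else 0,
      fun n => if i = some (c, some n) then y2 c n else 0,
      if i = some (c, none) then y3 c else 0), ?_, ?_, ?_, ?_⟩
    · rw [mem_fib]
      dsimp only
      split_ifs
      · rw [(hy1 0).2.2, (hy1 1).2.2]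
      · exact (map_zero _).trans (map_zero _).symm
    · intro t
      funext c
      refine Prod.ext ?_ (Prod.ext ?_ ?_)
      · change (S.first c).rep (upper t) (if i = none then y1 c else 0) = if i = none then y1 c else 0
        split_ifs
        · exact (hy1 c).1 t
        · exact map_zero _
      · funext n
        change (S.mid c n).rep (upper t) (if i = some (c, some n) then y2 c n else 0) =
          if i = some (c, some n) then y2 c n else 0
        split_ifs
        · exact (hy2 c n).1 t
        · exact map_zero _
      · change (S.last c).rep (upper t) (if i = some (c, none) then y3 c else 0) =
          if i = some (c, none) then y3 c else 0
        split_ifs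
        · exact (hy3 c).1 t
        · exact map_zero _
    · intro b
      funext c
      refine Prod.ext ?_ (Prod.ext ?_ ?_)
      · change (S.first c).rep b (if i = none then y1 c else 0) =
          ((topW p r i).chi p k 𝔽 b : 𝔽) • (if i = none then y1 c else 0)
        split_ifs with h
        · subst h
          exact (hy1 c).2.1 b
        · exact (map_zero _).trans (smul_zero _).symm
      · funext n
        change (S.mid c n).rep b (if i = some (c, some n) then y2 c n else 0) =
          ((topW p r i).chi p k 𝔽 b : 𝔽) • (if i = some (c, some n) then y2 c n else 0)
        split_ifs with h
        · subst h
          exact (hy2 c n).2.1 b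
        · exact (map_zero _).trans (smul_zero _).symm
      · change (S.last c).rep b (if i = some (c, none) then y3 c else 0) =
          ((topW p r i).chi p k 𝔽 b : 𝔽) • (if i = some (c, none) then y3 c else 0)
        split_ifs with h
        · subst h
          exact (hy3 c).2.1 b
        · exact (map_zero _).trans (smul_zero _).symm
    · rintro (_ | ⟨c, _ | n⟩)
      · change (S.first 0).proj (if i = none then y1 0 else 0) = _
        split_ifs with h
        · subst h
          rw [Pi.single_eq_same]
          exact (hy1 0).2.2
        · rw [Pi.single_eq_of_ne (Ne.symm h)]
          exact map_zero _
      · change (S.last c).proj (if i = some (c, none) then y3 c else 0) = _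
        split_ifs with h
        · subst h
          rw [Pi.single_eq_same]
          exact (hy3 c).2.2
        · rw [Pi.single_eq_of_ne (Ne.symm h)]
          exact map_zero _
      · change (S.mid c n).proj (if i = some (c, some n) then y2 c n else 0) = _
        split_ifs with h
        · subst h
          rw [Pi.single_eq_same]
          exact (hy2 c n).2.2
        · rw [Pi.single_eq_of_ne (Ne.symm h)]
          exact map_zero _
  exact ⟨⟨x, hx⟩, fun t => by
      rw [rep0_cls]
      exact congrArg S.cls (Subtype.ext (hU t)), fun b => by
      rw [rep0_cls, ← map_smul]
      exact congrArg S.cls (Subtype.ext (hB b)), ht⟩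

end Lifts

/-! ### Construction of `Q₁` and of `Π` on `D₁` -/

section PiActionExistence

variable {p : ℕ} [Fact p.Prime] {k : Type u} [Field k] [CharP k p] {𝔽 : Type v} [Field 𝔽]
  [Algebra k 𝔽] {f : ℕ} {J : Type} [DecidableEq J] [Fintype J] [Finite k]
  {V : Type v} [AddCommGroup V] [Module 𝔽 V] {ρ : Representation 𝔽 (GL2 k) V}
  {σ τ : J → Weight f} {edge : J → J → Prop} (L : Layers p k 𝔽 ρ σ τ edge)

namespace Layers

theorem linearCombination_hwv (a : J → 𝔽) :
    Fintype.linearCombination 𝔽 L.hwv a = L.s fun j => a j • (σ j).hw 𝔽 := by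
  rw [Fintype.linearCombination_apply, ← Finset.univ_sum_single fun j => a j • (σ j).hw 𝔽, map_sum]
  exact Finset.sum_congr rfl fun j _ => by rw [hwv, Pi.single_smul, map_smul]

/-- Invariant eigenvectors lifting the highest weight vectors of the top, indexed by the
corresponding constituents of the socle. -/
structure Lifts (e : J ≃ J) where
  vec : J → V
  chi_eq : ∀ j, (τ (e j)).chi p k 𝔽 = conjChar ((σ j).chi p k 𝔽)
  rep_upper : ∀ j t, ρ (upper t) (vec j) = vec j
  rep_borel : ∀ j (b : borel k), ρ b (vec j) = (conjChar ((σ j).chi p k 𝔽) b : 𝔽) • vec j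
  t_vec : ∀ j, L.t (vec j) = Pi.single (e j) ((τ (e j)).hw 𝔽)

namespace Lifts

variable {L} {e : J ≃ J} (Y : L.Lifts e)

theorem t_linearCombination (b : J → 𝔽) (i : J) :
    L.t (Fintype.linearCombination 𝔽 Y.vec b) i = b (e.symm i) • (τ i).hw 𝔽 := by
  rw [Fintype.linearCombination_apply, map_sum, Finset.sum_apply, Finset.sum_eq_single (e.symm i)]
  · rw [map_smul, Y.t_vec, Pi.smul_apply, e.apply_symm_apply, Pi.single_eq_same]
  · intro j _ hj
    rw [map_smul, Y.t_vec, Pi.smul_apply, Pi.single_eq_of_ne, smul_zero]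
    intro h
    exact hj (by rw [h, e.symm_apply_apply])
  · intro h
    exact absurd (Finset.mem_univ _) h

theorem vec_mem_D1 (j : J) : Y.vec j ∈ D1 ρ := (mem_fixedBy_unip ρ _).2 (Y.rep_upper j)

/-- The coordinates of the invariants of the unipotent radical. -/
noncomputable def comb : ((J → 𝔽) × (J → 𝔽)) →ₗ[𝔽] V :=
  (Fintype.linearCombination 𝔽 L.hwv).coprod (Fintype.linearCombination 𝔽 Y.vec)

theorem comb_apply (a b : J → 𝔽) :
    Y.comb (a, b) = ∑ j, a j • L.hwv j + ∑ j, b j • Y.vec j := rfl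

theorem t_comb (a b : J → 𝔽) (i : J) : L.t (Y.comb (a, b)) i = b (e.symm i) • (τ i).hw 𝔽 := by
  rw [comb, LinearMap.coprod_apply, map_add, linearCombination_hwv, L.t_s, zero_add,
    Y.t_linearCombination]

theorem comb_mem_D1 (x : (J → 𝔽) × (J → 𝔽)) : Y.comb x ∈ D1 ρ :=
  (D1 ρ).add_mem ((D1 ρ).sum_mem fun j _ => (D1 ρ).smul_mem _ (L.hwv_mem_D1 j))
    ((D1 ρ).sum_mem fun j _ => (D1 ρ).smul_mem _ (Y.vec_mem_D1 j))

/-- The images in the top determine the coefficients of the lifts, and injectivity of `s` the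
remaining ones. -/
theorem comb_injective : Function.Injective Y.comb := by
  rw [← LinearMap.ker_eq_bot, LinearMap.ker_eq_bot']
  rintro ⟨a, b⟩ h
  have hb : b = 0 := by
    ext j
    have h1 := congrArg (fun v => L.t v (e j)) h
    simp only [t_comb, e.symm_apply_apply, map_zero, Pi.zero_apply] at h1
    exact (smul_eq_zero.1 h1).resolve_right (τ (e j)).hw_ne_zero
  subst hb
  rw [comb, LinearMap.coprod_apply, map_zero, add_zero, linearCombination_hwv,
    ← map_zero L.s] at h
  have ha : a = 0 := by
    ext j
    exact (smul_eq_zero.1 (congrFun (L.s_injective h) j)).resolve_right (σ j).hw_ne_zero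
  rw [ha]
  rfl

/-- The image of `v` in the top is `U`-invariant, hence a combination of highest weight vectors.
Subtracting the corresponding lifts leaves an invariant of the socle. -/
theorem exists_comb_eq (hk : Nat.card k = p ^ f) {v : V} (hv : v ∈ D1 ρ) : ∃ x, Y.comb x = v := by
  have hU := (mem_fixedBy_unip ρ v).1 hv
  have h1 : ∀ i, ∃ c : 𝔽, L.t v i = c • (τ i).hw 𝔽 := fun i =>
    Weight.exists_eq_smul_hw (L.deg_top i) hk fun t => by
      have h2 := congrFun (L.t_rep (upper t) v) i
      rw [hU] at h2
      exact h2.symm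
  choose c hc using h1
  have h3 : L.t (v - Y.comb (0, fun j => c (e j))) = 0 := by
    ext i
    rw [map_sub, Pi.sub_apply, t_comb, e.apply_symm_apply, hc, sub_self]
    rfl
  obtain ⟨a, ha⟩ := (L.mem_S1 hk (v - Y.comb (0, fun j => c (e j)))).1 (by
    refine ⟨?_, (D1 ρ).sub_mem hv (Y.comb_mem_D1 _)⟩
    rw [SetLike.mem_coe, L.socle_eq hk]
    exact (L.exact _).1 h3)
  refine ⟨(a, fun j => c (e j)), ?_⟩
  have h4 : Y.comb (a, 0) = L.s fun j => a j • (σ j).hw 𝔽 := by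
    rw [comb, LinearMap.coprod_apply, map_zero, add_zero, linearCombination_hwv]
  have h5 : ((a, fun j => c (e j)) : (J → 𝔽) × (J → 𝔽)) = (a, 0) + (0, fun j => c (e j)) := by
    simp
  rw [h5, map_add, h4, ← ha, sub_add_cancel]

/-- The coordinates of `D₁`. -/
noncomputable def combEquiv (hk : Nat.card k = p ^ f) : ((J → 𝔽) × (J → 𝔽)) ≃ₗ[𝔽] D1 ρ :=
  LinearEquiv.ofBijective (Y.comb.codRestrict (D1 ρ) Y.comb_mem_D1)
    ⟨fun x y h => Y.comb_injective (congrArg Subtype.val h), fun v => by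
      obtain ⟨x, hx⟩ := Y.exists_comb_eq hk v.2
      exact ⟨x, Subtype.ext hx⟩⟩

theorem comb_single_left (j : J) : Y.comb (Pi.single j 1, 0) = L.hwv j := by
  rw [comb_apply, Finset.sum_eq_single j]
  · simp
  · intro i _ hi
    rw [Pi.single_eq_of_ne hi, zero_smul]
  · simp

theorem comb_single_right (j : J) : Y.comb (0, Pi.single j 1) = Y.vec j := by
  rw [comb_apply, Finset.sum_eq_single (a := j) (f := fun i => (Pi.single j 1 : J → 𝔽) i • Y.vec i)]
  · simp
  · intro i _ hi
    rw [Pi.single_eq_of_ne hi, zero_smul]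
  · simp

/-- The operator exchanging the highest weight vectors of the socle and the lifts. -/
noncomputable def op (hk : Nat.card k = p ^ f) : D1 ρ →ₗ[𝔽] D1 ρ :=
  (Y.combEquiv hk).toLinearMap ∘ₗ (LinearEquiv.prodComm 𝔽 (J → 𝔽) (J → 𝔽)).toLinearMap ∘ₗ
    (Y.combEquiv hk).symm.toLinearMap

theorem op_combEquiv (hk : Nat.card k = p ^ f) (x : (J → 𝔽) × (J → 𝔽)) :
    Y.op hk (Y.combEquiv hk x) = Y.combEquiv hk x.swap := by
  simp [op]

theorem op_hwv (hk : Nat.card k = p ^ f) (j : J) :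
    Y.op hk ⟨L.hwv j, L.hwv_mem_D1 j⟩ = ⟨Y.vec j, Y.vec_mem_D1 j⟩ := by
  have h : (⟨L.hwv j, L.hwv_mem_D1 j⟩ : D1 ρ) = Y.combEquiv hk (Pi.single j 1, 0) :=
    Subtype.ext (Y.comb_single_left j).symm
  rw [h, op_combEquiv]
  exact Subtype.ext (Y.comb_single_right j)

theorem exists_of_mem_span {v : V} (hv : v ∈ Submodule.span 𝔽 (Set.range Y.vec)) :
    ∃ b, Y.comb (0, b) = v := by
  rw [← Fintype.range_linearCombination] at hv
  obtain ⟨b, rfl⟩ := hv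
  exact ⟨b, by rw [comb, LinearMap.coprod_apply, map_zero, zero_add]⟩

theorem comb_mem_span (b : J → 𝔽) :
    Y.comb (0, b) ∈ Submodule.span 𝔽 (Set.range Y.vec) := by
  rw [← Fintype.range_linearCombination]
  exact ⟨b, by rw [comb, LinearMap.coprod_apply, map_zero, zero_add]⟩

theorem inf_range_eq_bot : Submodule.span 𝔽 (Set.range Y.vec) ⊓ LinearMap.range L.s = ⊥ := by
  rw [eq_bot_iff]
  rintro v ⟨hv, ⟨x, rfl⟩⟩
  obtain ⟨b, hb⟩ := Y.exists_of_mem_span hv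
  have h0 : b = 0 := by
    ext j
    have h1 := Y.t_comb 0 b (e j)
    rw [hb, L.t_s, e.symm_apply_apply] at h1
    exact (smul_eq_zero.1 h1.symm).resolve_right (τ (e j)).hw_ne_zero
  rw [← hb, h0]
  exact map_zero Y.comb

/-- The operator `Π` defined by lifts. -/
theorem exists_piAction (hk : Nat.card k = p ^ f) :
    ∃ P : PiAction ρ, ∀ j, P.op ⟨L.hwv j, L.hwv_mem_D1 j⟩ = ⟨Y.vec j, Y.vec_mem_D1 j⟩ := by
  have hS1 : S1 ρ ≤ LinearMap.range L.s := by
    rw [← L.socle_eq hk]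
    exact inf_le_left
  refine ⟨⟨Submodule.span 𝔽 (Set.range Y.vec), ?_, ?_, ?_, ?_, ?_, Y.op hk, ?_, ?_⟩, Y.op_hwv hk⟩
  · apply le_antisymm
    · apply sup_le inf_le_right
      rw [Submodule.span_le]
      rintro _ ⟨j, rfl⟩
      exact Y.vec_mem_D1 j
    · intro v hv
      obtain ⟨⟨a, b⟩, rfl⟩ := Y.exists_comb_eq hk hv
      have h5 : ((a, b) : (J → 𝔽) × (J → 𝔽)) = (a, 0) + (0, b) := by simp
      rw [h5, map_add]
      refine Submodule.add_mem_sup ?_ (Y.comb_mem_span b)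
      rw [L.mem_S1 hk]
      exact ⟨a, by rw [comb, LinearMap.coprod_apply, map_zero, add_zero, linearCombination_hwv]⟩
  · rw [eq_bot_iff, ← Y.inf_range_eq_bot, inf_comm]
    exact inf_le_inf_left _ hS1
  · intro b hb v hv
    induction hv using Submodule.span_induction with
    | mem v hv =>
      obtain ⟨j, rfl⟩ := hv
      rw [Y.rep_borel j ⟨b, hb⟩]
      exact Submodule.smul_mem _ _ (Submodule.subset_span ⟨j, rfl⟩)
    | zero => simp
    | add x y _ _ hx hy =>
      rw [map_add]
      exact Submodule.add_mem _ hx hy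
    | smul c x _ hx =>
      rw [map_smul]
      exact Submodule.smul_mem _ _ hx
  · rw [L.radical_eq hk, Y.inf_range_eq_bot]
  · apply le_antisymm
    · rw [Submodule.map_span_le]
      rintro _ ⟨j, rfl⟩
      rw [mem_fixedBy_unip]
      intro t
      exact congrArg (radical ρ).mkQ (Y.rep_upper j t)
    -- Invariants of the cosocle need not lift a priori, but they are combinations of highest weight
    -- vectors, which do lift by construction.
    · intro v hv
      obtain ⟨v, rfl⟩ := (radical ρ).mkQ_surjective v
      rw [mem_fixedBy_unip] at hv
      have h1 : ∀ t : k, ρ (upper t) v - v ∈ radical ρ := fun t =>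
        (Submodule.Quotient.eq _).1 (hv t)
      simp only [L.radical_eq hk] at h1
      have h2 : ∀ i, ∃ c : 𝔽, L.t v i = c • (τ i).hw 𝔽 := fun i =>
        Weight.exists_eq_smul_hw (L.deg_top i) hk fun t => by
          obtain ⟨x, hx⟩ := h1 t
          have h3 := congrArg (fun v => L.t v i) hx
          simp only [L.t_s, map_sub, Pi.sub_apply, L.t_rep, piRep_apply] at h3
          exact sub_eq_zero.1 h3.symm
      choose c hc using h2
      refine ⟨Y.comb (0, fun j => c (e j)), Y.comb_mem_span _, ?_⟩
      rw [Submodule.mkQ_apply, Submodule.mkQ_apply, Submodule.Quotient.eq, L.radical_eq hk]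
      apply (L.exact _).1
      ext i
      rw [map_sub, Pi.sub_apply, t_comb, e.apply_symm_apply, hc, sub_self]
      rfl
  · intro x
    obtain ⟨x, rfl⟩ := (Y.combEquiv hk).surjective x
    rw [op_combEquiv, op_combEquiv, Prod.swap_swap]
  · intro χ hχ
    obtain ⟨j, rfl⟩ : ∃ j, χ = (σ j).chi p k 𝔽 := by
      by_contra! hcon
      exact hχ (L.S1chi_eq_bot hk hcon)
    apply le_antisymm
    · rintro _ ⟨_, ⟨⟨x, hx⟩, hxS, rfl⟩, rfl⟩
      change x ∈ S1chi ρ ((σ j).chi p k 𝔽) at hxS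
      rw [L.S1chi_eq hk, Submodule.mem_span_singleton] at hxS
      obtain ⟨c, rfl⟩ := hxS
      have h1 : (⟨c • L.hwv j, hx⟩ : D1 ρ) = c • ⟨L.hwv j, L.hwv_mem_D1 j⟩ := rfl
      rw [h1, map_smul, Y.op_hwv, map_smul]
      exact Submodule.smul_mem _ _ ⟨Submodule.subset_span ⟨j, rfl⟩, Y.rep_borel j⟩
    -- Multiplicity freeness of the top shows that the eigenspace in `Q₁` is spanned by the one lift
    -- `vec j`.
    · rintro v ⟨hv, hB⟩
      obtain ⟨b, rfl⟩ := Y.exists_of_mem_span hv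
      have hU := (mem_fixedBy_unip ρ _).1 (Y.comb_mem_D1 (0, b))
      obtain ⟨c, hc⟩ := eq_single_hw L.deg_top hk L.chi_top (e j) (x := L.t (Y.comb (0, b)))
        (fun t => by rw [← L.t_rep, hU]) (fun b' => by
          rw [← L.t_rep, Y.chi_eq, ← map_smul]
          exact congrArg L.t (hB b'))
      have hbj : b = c • Pi.single j 1 := by
        ext j'
        have h1 := congrFun hc (e j')
        rw [t_comb, e.symm_apply_apply] at h1
        by_cases hj : j' = j
        · subst hj
          rw [Pi.single_eq_same] at h1
          have := smul_left_injective 𝔽 (τ (e j')).hw_ne_zero h1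
          simpa using this
        · rw [Pi.single_eq_of_ne (fun h => hj (e.injective h))] at h1
          have := (smul_eq_zero.1 h1).resolve_right (τ (e j')).hw_ne_zero
          simp [this, hj]
      have h6 : ((0, c • Pi.single j 1) : (J → 𝔽) × (J → 𝔽)) = c • (0, Pi.single j 1) := by simp
      rw [hbj, h6, map_smul, comb_single_right]
      refine Submodule.smul_mem _ _ ⟨_, ⟨⟨L.hwv j, L.hwv_mem_D1 j⟩, L.hwv_mem_S1chi hk j, rfl⟩, ?_⟩
      rw [Y.op_hwv]
      rfl

end Lifts

end Layers

end PiActionExistence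

/-! ### Homomorphisms prescribed on generators -/

section ExtendHom

/-- A homomorphism on a group generated by the image of `i` and an element `z` which normalizes this
image and no nontrivial power of which lies in it is given by its values on the generators. -/
theorem exists_monoidHom {G A I₀ : Type*} [Group G] [Group A] [Group I₀] {z : G} {ω : A}
    {i : I₀ →* G} {θ : I₀ →* A} (hi : Function.Injective i)
    (hc : ∀ h, ∃ h', z * i h * z⁻¹ = i h' ∧ ω * θ h * ω⁻¹ = θ h')
    (hc' : ∀ h, ∃ h', z⁻¹ * i h * z⁻¹⁻¹ = i h' ∧ ω⁻¹ * θ h * ω⁻¹⁻¹ = θ h')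
    (hz : ∀ (n : ℤ) h, z ^ n * i h = 1 → n = 0) (H : Subgroup G)
    (hH : H ≤ Subgroup.zpowers z ⊔ i.range) :
    ∃ Ψ : H →* A, (∀ h : z ∈ H, Ψ ⟨z, h⟩ = ω) ∧ ∀ x (h : i x ∈ H), Ψ ⟨i x, h⟩ = θ x := by
  -- The homomorphism is constructed through its graph, the subgroup of `G × A` generated by the
  -- pairs of prescribed values.
  set R : Subgroup (G × A) := (i.prod θ).range with hR
  set Λ : Subgroup (G × A) := Subgroup.zpowers (z, ω) ⊔ R with hΛ
  have hnorm : Subgroup.zpowers (z, ω) ≤ Subgroup.normalizer (R : Set (G × A)) := by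
    rw [Subgroup.zpowers_le, Subgroup.mem_normalizer_iff]
    have h1 : ∀ x ∈ R, (z, ω) * x * (z, ω)⁻¹ ∈ R := by
      rintro _ ⟨h, rfl⟩
      obtain ⟨h', h1, h2⟩ := hc h
      exact ⟨h', Prod.ext h1.symm h2.symm⟩
    have h2 : ∀ x ∈ R, (z, ω)⁻¹ * x * (z, ω)⁻¹⁻¹ ∈ R := by
      rintro _ ⟨h, rfl⟩
      obtain ⟨h', h1, h2⟩ := hc' h
      exact ⟨h', Prod.ext h1.symm h2.symm⟩
    refine fun x => ⟨h1 x, fun h => ?_⟩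
    have h3 := h2 _ h
    rwa [show (z, ω)⁻¹ * ((z, ω) * x * (z, ω)⁻¹) * (z, ω)⁻¹⁻¹ = x by group] at h3
  have hmem : ∀ y ∈ Λ, ∃ (n : ℤ) (h : I₀), y = (z ^ n * i h, ω ^ n * θ h) := by
    intro y hy
    rw [← SetLike.mem_coe, hΛ, Subgroup.coe_mul_of_left_le_normalizer_right _ _ hnorm] at hy
    obtain ⟨_, ⟨n, rfl⟩, _, ⟨h, rfl⟩, rfl⟩ := hy
    exact ⟨n, h, rfl⟩
  set P : Λ →* G := (MonoidHom.fst G A).comp Λ.subtype with hP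
  -- Elements of the graph have the form `(z^n i(h), ω^n θ(h))`; if the first entry is `1`, then `n
  -- = 0` and `h = 1`.
  have hPinj : Function.Injective P := by
    rw [injective_iff_map_eq_one]
    rintro ⟨y, hy⟩ h1
    obtain ⟨n, h, rfl⟩ := hmem y hy
    have h2 : z ^ n * i h = 1 := h1
    obtain rfl := hz n h h2
    rw [zpow_zero, one_mul] at h2
    obtain rfl : h = 1 := hi (by rw [h2, map_one])
    apply Subtype.ext
    simp
  have hzΛ : (z, ω) ∈ Λ := Subgroup.mem_sup_left (Subgroup.mem_zpowers _)
  have hiΛ : ∀ h, (i h, θ h) ∈ Λ := fun h => Subgroup.mem_sup_right ⟨h, rfl⟩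
  have hle : H ≤ P.range := by
    refine hH.trans (sup_le ?_ ?_)
    · rw [Subgroup.zpowers_le]
      exact ⟨⟨_, hzΛ⟩, rfl⟩
    · rintro _ ⟨h, rfl⟩
      exact ⟨⟨_, hiΛ h⟩, rfl⟩
  let e : Λ ≃* P.range := MonoidHom.ofInjective hPinj
  have key : ∀ (y : G × A) (hy : y ∈ Λ) (h : y.1 ∈ H),
      (((MonoidHom.snd G A).comp Λ.subtype).comp
        (e.symm.toMonoidHom.comp (Subgroup.inclusion hle))) ⟨y.1, h⟩ = y.2 := by
    intro y hy h
    have h1 : e.symm (Subgroup.inclusion hle ⟨y.1, h⟩) = ⟨y, hy⟩ := by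
      rw [MulEquiv.symm_apply_eq]
      rfl
    change (e.symm (Subgroup.inclusion hle ⟨y.1, h⟩)).1.2 = y.2
    rw [h1]
  exact ⟨_, fun h => key _ hzΛ h, fun x h => key _ (hiΛ x) h⟩

end ExtendHom

/-! ### The groups `KZ`, `N` and `I` and smoothness -/

section LocalGroups

variable {F : Type u} [Field F] [ValuativeRel F]

theorem inclK_apply (g : GL2 𝒪[F]) (i j : Fin 2) : inclK F g i j = (g i j : F) := rfl

theorem redK_apply (g : GL2 𝒪[F]) (i j : Fin 2) :
    redK F g i j = IsLocalRing.residue 𝒪[F] (g i j) := rfl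

theorem inclK_injective : Function.Injective (inclK F) := by
  intro g h hgh
  have h1 : ∀ i j, g i j = h i j := fun i j => Subtype.ext (congrArg (fun x : GL2 F => x i j) hgh)
  exact GL2_ext (h1 0 0) (h1 0 1) (h1 1 0) (h1 1 1)

theorem isUnit_iff_valuation_eq_one (x : 𝒪[F]) :
    IsUnit x ↔ ValuativeRel.valuation F (x : F) = 1 :=
  Valuation.Integers.isUnit_iff_valuation_eq_one
    (Valuation.integer.integers (ValuativeRel.valuation F))

theorem residue_eq_zero_iff (x : 𝒪[F]) :
    IsLocalRing.residue 𝒪[F] x = 0 ↔ ValuativeRel.valuation F (x : F) < 1 := by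
  have h1 : ValuativeRel.valuation F (x : F) ≤ 1 := x.2
  rw [← not_iff_not, ← ne_eq, IsLocalRing.residue_ne_zero_iff_isUnit, isUnit_iff_valuation_eq_one,
    not_lt]
  exact ⟨fun h => h.ge, fun h => le_antisymm h1 h⟩

theorem IsUniformizer.valuation_lt_one {ϖ : Fˣ} (hϖ : IsUniformizer ϖ) :
    ValuativeRel.valuation F ϖ < 1 := by
  obtain ⟨h, hi⟩ := hϖ
  rw [← residue_eq_zero_iff ⟨(ϖ : F), h⟩]
  by_contra hne
  exact hi.not_isUnit ((IsLocalRing.residue_ne_zero_iff_isUnit _).1 hne)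

theorem IsUniformizer.eq_zero_of_zpow {ϖ : Fˣ} (hϖ : IsUniformizer ϖ) {n : ℤ}
    (h : ValuativeRel.valuation F ϖ ^ n = 1) : n = 0 :=
  (zpow_eq_one_iff_right₀ zero_le hϖ.valuation_lt_one.ne).1 h

theorem valuation_det_inclK (g : GL2 𝒪[F]) :
    ValuativeRel.valuation F ((inclK F g).det : F) = 1 := by
  rw [inclK, Matrix.GeneralLinearGroup.map_det]
  exact (isUnit_iff_valuation_eq_one _).1 g.det.isUnit

/-- Powers of a matrix whose determinant has the valuation of a power of a uniformizer do not lie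
in `K`. -/
theorem IsUniformizer.eq_zero_of_det {ϖ : Fˣ} (hϖ : IsUniformizer ϖ) {z : GL2 F} {m : ℕ} (hm : m ≠ 0)
    (hz : ValuativeRel.valuation F (z.det : F) = ValuativeRel.valuation F ϖ ^ m) {n : ℤ}
    {g : GL2 𝒪[F]} (h : z ^ n * inclK F g = 1) : n = 0 := by
  have h1 := congrArg (fun x : GL2 F => ValuativeRel.valuation F (x.det : F)) h
  simp only [map_mul, map_zpow, map_one, Units.val_mul, Units.val_one, Units.val_zpow_eq_zpow_val,
    map_zpow₀, valuation_det_inclK, mul_one, hz] at h1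
  rw [← zpow_natCast, ← zpow_mul] at h1
  have h2 := hϖ.eq_zero_of_zpow h1
  simpa [hm] using h2

theorem det_matPi (ϖ : Fˣ) : ((matPi ϖ).det : F) = -ϖ := by
  simp [matPi, Matrix.det_fin_two]

theorem det_matScalar (ϖ : Fˣ) : ((matScalar ϖ).det : F) = ϖ ^ 2 := by
  simp [matScalar, Matrix.det_fin_two, sq]

theorem matPi_mul_self (ϖ : Fˣ) : matPi ϖ * matPi ϖ = matScalar ϖ := by
  apply GL2_ext <;> simp [matPi, matScalar]

theorem matScalar_mul_comm (ϖ : Fˣ) (g : GL2 F) : matScalar ϖ * g = g * matScalar ϖ := by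
  apply GL2_ext <;> simp [matScalar, Matrix.mul_apply, Fin.sum_univ_two, mul_comm]

variable [TopologicalSpace F] [IsNonarchimedeanLocalField F]

/-- Conjugation by `Π` on the Iwahori subgroup. -/
theorem IsUniformizer.exists_conj {ϖ : Fˣ} (hϖ : IsUniformizer ϖ) {h : GL2 𝒪[F]}
    (hh : redK F h ∈ borel 𝓀[F]) :
    ∃ h' : GL2 𝒪[F], inclK F h' = matPi ϖ * inclK F h * (matPi ϖ)⁻¹ ∧
      redK F h' 0 0 = redK F h 1 1 ∧ redK F h' 1 0 = 0 ∧ redK F h' 1 1 = redK F h 0 0 := by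
  obtain ⟨hmem, hirr⟩ := hϖ
  have h1 : h 1 0 ∈ IsLocalRing.maximalIdeal 𝒪[F] := Ideal.Quotient.eq_zero_iff_mem.1 hh
  rw [hirr.maximalIdeal_eq, Ideal.mem_span_singleton] at h1
  obtain ⟨c, hc⟩ := h1
  -- Conjugation by `Π` takes `(a b; ϖc d)` to `(d c; ϖb a)`.
  have hdet : IsUnit (!![h 1 1, c; ⟨(ϖ : F), hmem⟩ * h 0 1, h 0 0] : Matrix (Fin 2) (Fin 2) 𝒪[F]).det := by
    have h2 : IsUnit (h : Matrix (Fin 2) (Fin 2) 𝒪[F]).det := h.det.isUnit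
    convert h2 using 1
    rw [Matrix.det_fin_two_of, Matrix.det_fin_two, hc]
    ring
  have hcF : ((h 1 0 : 𝒪[F]) : F) = ϖ * (c : F) := congrArg Subtype.val hc
  refine ⟨Matrix.GeneralLinearGroup.mk'' _ hdet, ?_, rfl, ?_, rfl⟩
  · rw [eq_mul_inv_iff_mul_eq]
    apply GL2_ext <;>
      simp [matPi, inclK_apply, Matrix.mul_apply, Fin.sum_univ_two, hcF, mul_comm]
  · rw [redK_apply]
    change IsLocalRing.residue 𝒪[F] (⟨(ϖ : F), hmem⟩ * h 0 1) = 0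
    rw [map_mul, (IsLocalRing.residue_eq_zero_iff _).2, zero_mul]
    rw [hirr.maximalIdeal_eq]
    exact Ideal.mem_span_singleton_self _

/-- The centre is generated by `ϖ` and the scalar matrices with unit entries. -/
theorem IsUniformizer.exists_of_mem_groupZ {ϖ : Fˣ} (hϖ : IsUniformizer ϖ) {g : GL2 F}
    (hg : g ∈ groupZ F) : ∃ (n : ℤ) (h : GL2 𝒪[F]), redK F h ∈ borel 𝓀[F] ∧
      g = matScalar ϖ ^ n * inclK F h := by
  obtain ⟨hmem, hirr⟩ := hϖ
  obtain ⟨a, ha⟩ := Matrix.GeneralLinearGroup.mem_center_iff_val_mem_range_scalar.1 hg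
  have ha' : ∀ i j, g i j = if i = j then a else 0 := by
    intro i j
    rw [← ha, Matrix.scalar_apply, Matrix.diagonal_apply]
  have ha0 : a ≠ 0 := by
    intro h0
    have := GL2_det_ne g
    simp [ha', h0] at this
  have hpos : ∀ b : F, b ≠ 0 → ValuativeRel.valuation F b ≤ 1 →
      ∃ (n : ℤ) (u : 𝒪[F]ˣ), b = (ϖ : F) ^ n * ((u : 𝒪[F]) : F) := by
    intro b hb hb1
    obtain ⟨n, u, hu⟩ := IsDiscreteValuationRing.eq_unit_mul_pow_irreducible
      (x := (⟨b, hb1⟩ : 𝒪[F])) (fun h => hb (congrArg Subtype.val h)) hirr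
    refine ⟨n, u, ?_⟩
    have := congrArg Subtype.val hu
    rw [zpow_natCast, mul_comm]
    exact this
  have hall : ∃ (n : ℤ) (u : 𝒪[F]ˣ), a = (ϖ : F) ^ n * ((u : 𝒪[F]) : F) := by
    rcases le_total (ValuativeRel.valuation F a) 1 with h | h
    · exact hpos a ha0 h
    · obtain ⟨n, u, hu⟩ := hpos a⁻¹ (inv_ne_zero ha0) (by
        rw [map_inv₀]
        exact inv_le_one_of_one_le₀ h)
      have huu : ((u : 𝒪[F]) : F) * (((u⁻¹ : 𝒪[F]ˣ) : 𝒪[F]) : F) = 1 :=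
        congrArg Subtype.val u.mul_inv
      refine ⟨-n, u⁻¹, ?_⟩
      rw [← inv_inv a, hu, mul_inv, zpow_neg, eq_inv_of_mul_eq_one_right huu]
  obtain ⟨n, u, hu⟩ := hall
  have hpow : ∀ n : ℤ, ∀ i j, (matScalar ϖ ^ n) i j = if i = j then (ϖ : F) ^ n else 0 := by
    let s : Fˣ →* GL2 F := Units.map (Matrix.scalar (Fin 2)).toMonoidHom
    have hs : matScalar ϖ = s ϖ := by
      apply GL2_ext <;> simp [matScalar, s]
    intro n i j
    rw [hs, ← map_zpow]
    change Matrix.scalar (Fin 2) ((ϖ ^ n : Fˣ) : F) i j = _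
    rw [Matrix.scalar_apply, Matrix.diagonal_apply, Units.val_zpow_eq_zpow_val]
  refine ⟨n, diagMat u u, map_zero (IsLocalRing.residue 𝒪[F]), ?_⟩
  have hn := hpow n
  generalize matScalar ϖ ^ n = Z at hn ⊢
  apply GL2_ext <;>
    simp [ha', hn, inclK_apply, Matrix.mul_apply, hu]

theorem IsUniformizer.groupKZ_le {ϖ : Fˣ} (hϖ : IsUniformizer ϖ) :
    groupKZ F ≤ Subgroup.zpowers (matScalar ϖ) ⊔ (inclK F).range := by
  refine sup_le le_sup_right fun g hg => ?_
  obtain ⟨n, h, -, rfl⟩ := hϖ.exists_of_mem_groupZ hg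
  exact mul_mem (Subgroup.mem_sup_left ⟨n, rfl⟩) (Subgroup.mem_sup_right ⟨h, rfl⟩)

theorem IsUniformizer.exists_of_mem_groupIZ {ϖ : Fˣ} (hϖ : IsUniformizer ϖ) {g : GL2 F}
    (hg : g ∈ groupI F ⊔ groupZ F) : ∃ (n : ℤ) (h : GL2 𝒪[F]), redK F h ∈ borel 𝓀[F] ∧
      g = matScalar ϖ ^ n * inclK F h := by
  have : (groupZ F).Normal := inferInstanceAs (Subgroup.center (GL2 F)).Normal
  obtain ⟨_, ⟨h, hh, rfl⟩, z, hz, rfl⟩ := Subgroup.mem_sup_of_normal_right.1 hg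
  obtain ⟨n, h', hh', rfl⟩ := hϖ.exists_of_mem_groupZ hz
  refine ⟨n, h * h', by rw [map_mul]; exact mul_mem hh hh', ?_⟩
  have h1 : Commute (matScalar ϖ ^ n) (inclK F h) :=
    Commute.zpow_left (matScalar_mul_comm ϖ (inclK F h)) n
  rw [map_mul, ← mul_assoc, ← mul_assoc, h1.eq]

variable (F) in
/-- The principal congruence subgroup is open. -/
theorem image_ker_redK_mem_nhds : inclK F '' {h | redK F h = 1} ∈ nhds (1 : GL2 F) := by
  have h1 : {x : F | ValuativeRel.valuation F x < 1} ∈ nhds (0 : F) :=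
    (IsValuativeTopology.mem_nhds_zero_iff _).2 ⟨1, by simp⟩
  have h2 : ∀ i j, ∀ᶠ g : GL2 F in nhds 1,
      ValuativeRel.valuation F (g i j - (1 : GL2 F) i j) < 1 := by
    intro i j
    have hcont : Continuous fun g : GL2 F => g i j - (1 : GL2 F) i j :=
      ((Units.continuous_val.matrix_elem i j).sub continuous_const)
    have h3 := hcont.tendsto 1
    rw [sub_self] at h3
    exact h3 h1
  filter_upwards [Filter.eventually_all.2 fun i => Filter.eventually_all.2 (h2 i)] with g hg
  have hone : ∀ i j, ((1 : GL2 𝒪[F]) i j : F) = (1 : GL2 F) i j := by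
    intro i j
    rw [← inclK_apply, map_one]
  have hle : ∀ i j, ValuativeRel.valuation F (g i j) ≤ 1 := by
    intro i j
    have h4 : g i j = (g i j - (1 : GL2 F) i j) + ((1 : GL2 𝒪[F]) i j : F) := by
      rw [hone, sub_add_cancel]
    rw [h4]
    exact (ValuativeRel.valuation F).map_add_le (hg i j).le ((1 : GL2 𝒪[F]) i j).2
  set M : Matrix (Fin 2) (Fin 2) 𝒪[F] := Matrix.of fun i j => ⟨g i j, hle i j⟩ with hM
  have hres : ∀ i j, IsLocalRing.residue 𝒪[F] (M i j) = (1 : GL2 𝓀[F]) i j := by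
    intro i j
    rw [← map_one (redK F), redK_apply, ← sub_eq_zero, ← map_sub, residue_eq_zero_iff]
    have h5 : ((M i j - (1 : GL2 𝒪[F]) i j : 𝒪[F]) : F) = g i j - (1 : GL2 F) i j := by
      rw [← hone]
      rfl
    rw [h5]
    exact hg i j
  have hdet : IsUnit M.det := by
    rw [← IsLocalRing.residue_ne_zero_iff_isUnit, Matrix.det_fin_two]
    simp [hres]
  refine ⟨Matrix.GeneralLinearGroup.mk'' M hdet, ?_, ?_⟩
  · exact GL2_ext (hres 0 0) (hres 0 1) (hres 1 0) (hres 1 1)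
  · exact GL2_ext rfl rfl rfl rfl

/-- A representation on which the principal congruence subgroup acts trivially is smooth. -/
theorem isSmooth_of_forall_redK_eq_one {H : Subgroup (GL2 F)} {𝔽 V : Type*} [Field 𝔽]
    [AddCommGroup V] [Module 𝔽 V] (ρ : Representation 𝔽 H V)
    (hρ : ∀ (h : GL2 𝒪[F]) (hh : inclK F h ∈ H), redK F h = 1 → ρ ⟨inclK F h, hh⟩ = 1) :
    IsSmooth ρ := by
  intro x
  let St : Subgroup H :=
    { carrier := {g | ρ g x = x}
      one_mem' := by simp
      mul_mem' := by
        intro a b (ha : ρ a x = x) (hb : ρ b x = x)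
        change ρ (a * b) x = x
        rw [map_mul, Module.End.mul_apply, hb, ha]
      inv_mem' := by
        intro a (ha : ρ a x = x)
        change ρ a⁻¹ x = x
        nth_rewrite 1 [← ha]
        rw [← Module.End.mul_apply, ← map_mul, inv_mul_cancel, map_one, Module.End.one_apply] }
  -- A stabilizer is a subgroup, so a neighbourhood of `1` inside it makes it open.
  refine St.isOpen_of_mem_nhds (g := 1) ?_
  have h1 : (Subtype.val : H → GL2 F) ⁻¹' (inclK F '' {h | redK F h = 1}) ∈ nhds (1 : H) :=
    continuous_subtype_val.continuousAt.preimage_mem_nhds (image_ker_redK_mem_nhds F)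
  filter_upwards [h1]
  rintro ⟨_, hg⟩ ⟨h, hh, rfl⟩
  change ρ ⟨inclK F h, hg⟩ x = x
  rw [hρ h hg hh, Module.End.one_apply]

theorem groupN_le {ϖ : Fˣ} :
    groupN ϖ ≤ Subgroup.zpowers (matPi ϖ) ⊔
      ((inclK F).comp ((borel 𝓀[F]).comap (redK F)).subtype).range := by
  rw [groupN, Subgroup.closure_le]
  rintro g (⟨h, hh, rfl⟩ | rfl)
  · exact Subgroup.mem_sup_right ⟨⟨h, hh⟩, rfl⟩
  · exact Subgroup.mem_sup_left (Subgroup.mem_zpowers _)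

end LocalGroups

/-! ### Coordinates for the action of the Iwahori group and of `Π` -/

section Coordinates

variable {k : Type u} [Field k] {𝔽 : Type v} [Field 𝔽] {J : Type}

/-- The action of `B` on pairs of families through characters and their conjugates. -/
noncomputable def coordRep (χ : J → borel k →* 𝔽ˣ) :
    Representation 𝔽 (borel k) ((J → ℤ →₀ 𝔽) × (J → ℤ →₀ 𝔽)) where
  toFun b :=
    (LinearMap.pi fun j => (χ j b : 𝔽) • LinearMap.proj j).prodMap
      (LinearMap.pi fun j => (conjChar (χ j) b : 𝔽) • LinearMap.proj j)
  map_one' := by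
    refine LinearMap.ext fun x => Prod.ext (funext fun j => ?_) (funext fun j => ?_) <;> simp
  map_mul' := by
    intro a b
    refine LinearMap.ext fun x => Prod.ext (funext fun j => ?_) (funext fun j => ?_) <;>
      simp [mul_smul]

theorem coordRep_apply (χ : J → borel k →* 𝔽ˣ) (b : borel k)
    (x : (J → ℤ →₀ 𝔽) × (J → ℤ →₀ 𝔽)) :
    coordRep χ b x = (fun j => (χ j b : 𝔽) • x.1 j, fun j => (conjChar (χ j) b : 𝔽) • x.2 j) := rfl

/-- The involution `(A, B) ↦ (T⁻¹ B, T A)`. -/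
noncomputable def coordSwap (T : J → (ℤ →₀ 𝔽) ≃ₗ[𝔽] ℤ →₀ 𝔽) :
    Module.End 𝔽 ((J → ℤ →₀ 𝔽) × (J → ℤ →₀ 𝔽)) :=
  LinearMap.prod
    (LinearMap.pi fun j => (T j).symm.toLinearMap ∘ₗ LinearMap.proj j ∘ₗ LinearMap.snd 𝔽 _ _)
    (LinearMap.pi fun j => (T j).toLinearMap ∘ₗ LinearMap.proj j ∘ₗ LinearMap.fst 𝔽 _ _)

theorem coordSwap_apply (T : J → (ℤ →₀ 𝔽) ≃ₗ[𝔽] ℤ →₀ 𝔽) (x : (J → ℤ →₀ 𝔽) × (J → ℤ →₀ 𝔽)) :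
    coordSwap T x = (fun j => (T j).symm (x.2 j), fun j => T j (x.1 j)) := rfl

theorem coordSwap_mul_self (T : J → (ℤ →₀ 𝔽) ≃ₗ[𝔽] ℤ →₀ 𝔽) : coordSwap T * coordSwap T = 1 := by
  refine LinearMap.ext fun x => ?_
  rw [Module.End.mul_apply, coordSwap_apply, coordSwap_apply]
  simp

/-- Conjugation by the swap exchanges conjugate characters. -/
theorem coordSwap_conj (T : J → (ℤ →₀ 𝔽) ≃ₗ[𝔽] ℤ →₀ 𝔽) {χ : J → borel k →* 𝔽ˣ} {b b' : borel k}
    (h : ∀ j, χ j b' = conjChar (χ j) b) (h' : ∀ j, conjChar (χ j) b' = χ j b) :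
    coordSwap T * coordRep χ b * coordSwap T = coordRep χ b' := by
  refine LinearMap.ext fun x => ?_
  rw [Module.End.mul_apply, Module.End.mul_apply, coordSwap_apply, coordRep_apply, coordSwap_apply,
    coordRep_apply]
  simp [h, h']

/-- The character sees only the diagonal entries. Hence conjugation by `Π`, which exchanges them
modulo `ϖ`, turns `χ` into `χ^s`. -/
theorem Weight.chi_torus {p : ℕ} [Fact p.Prime] [CharP k p] [Algebra k 𝔽] {f : ℕ} [Finite k]
    (w : Weight f) (b : borel k) :
    w.chi p k 𝔽 (torus k (borelA k b, borelD k b)) = w.chi p k 𝔽 b := by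
  apply Units.ext
  rw [Weight.chi_apply, Weight.chi_apply, borelA_torus, borelD_torus]

end Coordinates

/-! ### The map `can` in coordinates -/

section LiftsCan

variable {p : ℕ} [Fact p.Prime] {k : Type u} [Field k] [CharP k p] {𝔽 : Type v} [Field 𝔽]
  [Algebra k 𝔽] {f : ℕ} {J : Type} [DecidableEq J] [Fintype J] [Finite k]
  {V : Type v} [AddCommGroup V] [Module 𝔽 V] {ρ : Representation 𝔽 (GL2 k) V}
  {σ τ : J → Weight f} {edge : J → J → Prop} {L : Layers p k 𝔽 ρ σ τ edge} {e : J ≃ J}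

namespace Layers.Lifts

/-- The families in `⨁_ℤ D₁` in terms of coordinates. -/
noncomputable def can (Y : L.Lifts e) : ((J → ℤ →₀ 𝔽) × (J → ℤ →₀ 𝔽)) →ₗ[𝔽] ℤ →₀ V :=
  (LinearMap.lsum 𝔽 (fun _ : J => ℤ →₀ 𝔽) 𝔽 fun j =>
      Finsupp.mapRange.linearMap (LinearMap.toSpanSingleton 𝔽 V (L.hwv j))).coprod
    (LinearMap.lsum 𝔽 (fun _ : J => ℤ →₀ 𝔽) 𝔽 fun j =>
      Finsupp.mapRange.linearMap (LinearMap.toSpanSingleton 𝔽 V (Y.vec j)))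

variable (Y : L.Lifts e)

theorem can_eq (x : (J → ℤ →₀ 𝔽) × (J → ℤ →₀ 𝔽)) :
    Y.can x = ∑ j, ten (x.1 j) (L.hwv j) + ∑ j, ten (x.2 j) (Y.vec j) := by
  rw [can, LinearMap.coprod_apply, LinearMap.lsum_apply, LinearMap.lsum_apply,
    LinearMap.sum_apply, LinearMap.sum_apply]
  rfl

theorem can_apply (x : (J → ℤ →₀ 𝔽) × (J → ℤ →₀ 𝔽)) (i : ℤ) :
    Y.can x i = Y.comb (fun j => x.1 j i, fun j => x.2 j i) := by
  rw [can_eq, comb_apply, Finsupp.add_apply, Finsupp.finsetSum_apply, Finsupp.finsetSum_apply]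
  rfl

theorem can_injective : Function.Injective Y.can := by
  intro x x' h
  have h1 : ∀ i, (fun j => x.1 j i, fun j => x.2 j i) =
      ((fun j => x'.1 j i, fun j => x'.2 j i) : (J → 𝔽) × (J → 𝔽)) := by
    intro i
    apply Y.comb_injective
    rw [← can_apply, ← can_apply, h]
  refine Prod.ext (funext fun j => Finsupp.ext fun i => ?_) (funext fun j => Finsupp.ext fun i => ?_)
  · exact congrFun (congrArg Prod.fst (h1 i)) j
  · exact congrFun (congrArg Prod.snd (h1 i)) j

theorem mem_range_can (hk : Nat.card k = p ^ f) (x : ℤ →₀ V) :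
    x ∈ LinearMap.range Y.can ↔ ∀ i, x i ∈ D1 ρ := by
  constructor
  · rintro ⟨y, rfl⟩ i
    rw [can_apply]
    exact Y.comb_mem_D1 _
  · intro hx
    -- Ensures that the coordinate families have finite support.
    have h0 : ∀ i, x i = 0 → (Y.combEquiv hk).symm ⟨x i, hx i⟩ = 0 := by
      intro i hi
      rw [LinearEquiv.symm_apply_eq, map_zero]
      exact Subtype.ext hi
    refine ⟨(fun j => Finsupp.onFinset x.support (fun i => ((Y.combEquiv hk).symm ⟨x i, hx i⟩).1 j) ?_,
      fun j => Finsupp.onFinset x.support (fun i => ((Y.combEquiv hk).symm ⟨x i, hx i⟩).2 j) ?_), ?_⟩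
    · intro i hi
      rw [Finsupp.mem_support_iff]
      exact fun h => hi (by rw [h0 i h]; rfl)
    · intro i hi
      rw [Finsupp.mem_support_iff]
      exact fun h => hi (by rw [h0 i h]; rfl)
    · refine Finsupp.ext fun i => ?_
      rw [can_apply]
      exact congrArg Subtype.val ((Y.combEquiv hk).apply_symm_apply ⟨x i, hx i⟩)

theorem can_coordRep (b : borel k) (x : (J → ℤ →₀ 𝔽) × (J → ℤ →₀ 𝔽)) :
    Y.can (coordRep (fun j => (σ j).chi p k 𝔽) b x) = finsuppRep ℤ ρ b (Y.can x) := by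
  refine Finsupp.ext fun i => ?_
  rw [finsuppRep_apply, can_apply, can_apply, comb_apply, comb_apply, map_add, map_sum, map_sum]
  congr 1
  · refine Finset.sum_congr rfl fun j _ => ?_
    rw [map_smul, L.rep_borel_hwv, smul_smul, mul_comm]
    rfl
  · refine Finset.sum_congr rfl fun j _ => ?_
    rw [map_smul, Y.rep_borel, smul_smul, mul_comm]
    rfl

theorem can_single (j : J) (w : ℤ →₀ 𝔽) : Y.can (Pi.single j w, 0) = ten w (L.hwv j) := by
  refine Finsupp.ext fun i => ?_
  rw [can_apply, ten_apply, comb_apply, Finset.sum_eq_single j]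
  · simp
  · intro j' _ hj
    simp [hj]
  · simp

theorem can_swap_single (T : J → (ℤ →₀ 𝔽) ≃ₗ[𝔽] ℤ →₀ 𝔽) (j : J) (w : ℤ →₀ 𝔽) :
    Y.can (coordSwap T (Pi.single j w, 0)) = ten (T j w) (Y.vec j) := by
  refine Finsupp.ext fun i => ?_
  rw [coordSwap_apply, can_apply, ten_apply, comb_apply,
    Finset.sum_eq_single (a := j) (f := fun j' => (T j' ((Pi.single j w : J → ℤ →₀ 𝔽) j')) i • Y.vec j')]
  · simp
  · intro j' _ hj
    simp [hj]
  · simp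

end Layers.Lifts

end LiftsCan

/-! ### Construction of basic diagrams -/

section DiagramExistence

variable {p : ℕ} [Fact p.Prime] {F : Type u} [Field F] [ValuativeRel F] [TopologicalSpace F]
  [IsNonarchimedeanLocalField F] [CharP 𝓀[F] p] {𝔽 : Type v} [Field 𝔽] [Algebra 𝓀[F] 𝔽] {ϖ : Fˣ}

/-- `KZ` is generated by `K` and the central scalar `ϖ`. No nontrivial power of this scalar lies in
`K`, by the valuation of the determinant, so it may be let act trivially. -/
theorem exists_rep_groupKZ (hϖ : IsUniformizer ϖ) {W : Type v} [AddCommGroup W] [Module 𝔽 W]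
    (θ : Representation 𝔽 (GL2 𝓀[F]) W) : ∃ R : Representation 𝔽 (groupKZ F) W,
      (∀ h : matScalar ϖ ∈ groupKZ F, R ⟨matScalar ϖ, h⟩ = 1) ∧
      ∀ g, R ⟨inclK F g, inclK_mem g⟩ = θ (redK F g) := by
  have hcomm : ∀ g, matScalar ϖ * inclK F g * (matScalar ϖ)⁻¹ = inclK F g := fun g => by
    rw [matScalar_mul_comm, mul_inv_cancel_right]
  have hcomm' : ∀ g, (matScalar ϖ)⁻¹ * inclK F g * (matScalar ϖ)⁻¹⁻¹ = inclK F g := fun g => by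
    rw [inv_inv, mul_assoc, ← matScalar_mul_comm, inv_mul_cancel_left]
  obtain ⟨Ψ, h1, h2⟩ := exists_monoidHom (ω := (1 : (Module.End 𝔽 W)ˣ)) (i := inclK F)
    (θ := (MonoidHom.toHomUnits θ).comp (redK F)) inclK_injective
    (fun h => ⟨h, hcomm h, by simp⟩) (fun h => ⟨h, hcomm' h, by simp⟩)
    (fun n h => hϖ.eq_zero_of_det two_ne_zero (by rw [det_matScalar, map_pow])) _ hϖ.groupKZ_le
  refine ⟨(Units.coeHom _).comp Ψ, fun h => ?_, fun g => ?_⟩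
  · rw [MonoidHom.comp_apply, h1]
    rfl
  · rw [MonoidHom.comp_apply, h2]
    rfl

variable {J : Type}

/-- `N` is generated by `Π` and `I`. The determinant excludes relations between powers of `Π` and
`I`, so only compatibility with conjugation is needed, and the swap of coordinates exchanges the
characters `χ` and `χ^s`. -/
theorem exists_rep_groupN [Finite 𝓀[F]] {f : ℕ} (hϖ : IsUniformizer ϖ) (σ : J → Weight f)
    (T : J → (ℤ →₀ 𝔽) ≃ₗ[𝔽] ℤ →₀ 𝔽) :
    ∃ R : Representation 𝔽 (groupN ϖ) ((J → ℤ →₀ 𝔽) × (J → ℤ →₀ 𝔽)),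
      R ⟨matPi ϖ, matPi_mem ϖ⟩ = coordSwap T ∧
      ∀ (g : GL2 𝒪[F]) (h : redK F g ∈ borel 𝓀[F]) (hN : inclK F g ∈ groupN ϖ),
        R ⟨inclK F g, hN⟩ = coordRep (fun j => (σ j).chi p 𝓀[F] 𝔽) ⟨redK F g, h⟩ := by
  set χ : J → borel 𝓀[F] →* 𝔽ˣ := fun j => (σ j).chi p 𝓀[F] 𝔽 with hχ
  set I₀ : Subgroup (GL2 𝒪[F]) := (borel 𝓀[F]).comap (redK F) with hI₀
  let red : I₀ →* borel 𝓀[F] := ((redK F).comp I₀.subtype).codRestrict (borel 𝓀[F]) fun g => g.2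
  let ω : (Module.End 𝔽 ((J → ℤ →₀ 𝔽) × (J → ℤ →₀ 𝔽)))ˣ :=
    ⟨coordSwap T, coordSwap T, coordSwap_mul_self T, coordSwap_mul_self T⟩
  have hω : ω⁻¹ = ω := rfl
  let θ := (MonoidHom.toHomUnits (coordRep χ)).comp red
  have hc : ∀ h : I₀, ∃ h' : I₀,
      matPi ϖ * ((inclK F).comp I₀.subtype) h * (matPi ϖ)⁻¹ = ((inclK F).comp I₀.subtype) h' ∧
      ω * θ h * ω⁻¹ = θ h' := by
    intro h
    obtain ⟨h', h1, h00, h10, h11⟩ := hϖ.exists_conj h.2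
    refine ⟨⟨h', h10⟩, h1.symm, ?_⟩
    have hA : borelA _ (red ⟨h', h10⟩) = borelD _ (red h) := Units.ext h00
    have hD : borelD _ (red ⟨h', h10⟩) = borelA _ (red h) := Units.ext h11
    apply Units.ext
    rw [hω]
    refine coordSwap_conj T (fun j => ?_) (fun j => ?_)
    · rw [hχ, conjChar_apply, ← hA, ← hD, Weight.chi_torus]
    · rw [hχ, conjChar_apply, hA, hD, Weight.chi_torus]
  have hc' : ∀ h : I₀, ∃ h' : I₀,
      (matPi ϖ)⁻¹ * ((inclK F).comp I₀.subtype) h * (matPi ϖ)⁻¹⁻¹ = ((inclK F).comp I₀.subtype) h' ∧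
      ω⁻¹ * θ h * ω⁻¹⁻¹ = θ h' := by
    intro h
    obtain ⟨h', h1, h2⟩ := hc h
    refine ⟨h', ?_, h2⟩
    rw [← h1, inv_inv, mul_assoc, inv_mul_eq_iff_eq_mul, eq_comm, ← mul_assoc, ← mul_assoc,
      matPi_mul_self, matScalar_mul_comm, mul_assoc, ← matPi_mul_self, mul_assoc, mul_inv_cancel, mul_one]
  obtain ⟨Ψ, h1, h2⟩ := exists_monoidHom (i := (inclK F).comp I₀.subtype)
    (inclK_injective.comp Subtype.val_injective) hc hc'
    (fun n h => hϖ.eq_zero_of_det one_ne_zero (by rw [det_matPi, pow_one, Valuation.map_neg])) _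
    groupN_le
  refine ⟨(Units.coeHom _).comp Ψ, ?_, fun g h hN => ?_⟩
  · rw [MonoidHom.comp_apply, h1]
    rfl
  · have h3 := h2 ⟨g, h⟩ hN
    exact congrArg Units.val h3

variable [DecidableEq J] [Fintype J] [Finite 𝓀[F]] {f : ℕ}
  {V : Type v} [AddCommGroup V] [Module 𝔽 V] {ρ : Representation 𝔽 (GL2 𝓀[F]) V}
  {σ τ : J → Weight f} {edge : J → J → Prop} {L : Layers p 𝓀[F] 𝔽 ρ σ τ edge} {e : J ≃ J}

/-- The basic diagram defined by lifts and a family of automorphisms. -/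
theorem Layers.Lifts.exists_basicDiagram (Y : L.Lifts e) (hk : Nat.card 𝓀[F] = p ^ f)
    (hϖ : IsUniformizer ϖ) (T : J → (ℤ →₀ 𝔽) ≃ₗ[𝔽] ℤ →₀ 𝔽) :
    ∃ (D : BasicDiagram ϖ 𝔽) (φ : D.V0 ≃ₗ[𝔽] (ℤ →₀ V)),
      (∀ (g : GL2 𝒪[F]) (x : D.V0) (i : ℤ),
        φ (D.rep0 ⟨inclK F g, inclK_mem g⟩ x) i = ρ (redK F g) (φ x i)) ∧
      ∀ (j : J) (w : ℤ →₀ 𝔽) (y : D.V1), φ (D.can y) = ten w (L.hwv j) →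
        φ (D.can (D.rep1 ⟨matPi ϖ, matPi_mem ϖ⟩ y)) = ten (T j w) (Y.vec j) := by
  obtain ⟨R₀, hs₀, hK⟩ := exists_rep_groupKZ hϖ (finsuppRep ℤ ρ)
  obtain ⟨R₁, hPi, hI⟩ := exists_rep_groupN hϖ σ T
  have hs₁ : ∀ h : matScalar ϖ ∈ groupN ϖ, R₁ ⟨matScalar ϖ, h⟩ = 1 := by
    intro h
    have h1 : (⟨matScalar ϖ, h⟩ : groupN ϖ) = ⟨matPi ϖ, matPi_mem ϖ⟩ * ⟨matPi ϖ, matPi_mem ϖ⟩ :=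
      Subtype.ext (matPi_mul_self ϖ).symm
    rw [h1, map_mul, hPi, coordSwap_mul_self]
  have hsKZ : matScalar ϖ ∈ groupKZ F := by
    refine Subgroup.mem_sup_right (Subgroup.mem_center_iff.2 fun g => ?_)
    exact (matScalar_mul_comm ϖ g).symm
  have hsN : matScalar ϖ ∈ groupN ϖ := by
    rw [← matPi_mul_self]
    exact mul_mem (matPi_mem ϖ) (matPi_mem ϖ)
  have hT : ∀ (j : J) (w : ℤ →₀ 𝔽) (y : (J → ℤ →₀ 𝔽) × (J → ℤ →₀ 𝔽)),
      Y.can y = ten w (L.hwv j) → Y.can (R₁ ⟨matPi ϖ, matPi_mem ϖ⟩ y) = ten (T j w) (Y.vec j) := by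
    intro j w y hy
    rw [← can_single] at hy
    obtain rfl := Y.can_injective hy
    rw [hPi, can_swap_single]
  -- `V1` is the coordinate space itself, with coefficients of highest weight vectors and of lifts,
  -- so that `N` acts by explicit formulas and `can` is the evaluation of coordinates.
  refine ⟨⟨ℤ →₀ V, (J → ℤ →₀ 𝔽) × (J → ℤ →₀ 𝔽), R₀, R₁, ?_, ?_, hs₀, hs₁, Y.can, Y.can_injective,
    ?_, ?_⟩, LinearEquiv.refl 𝔽 _, ?_, ?_⟩
  · refine isSmooth_of_forall_redK_eq_one _ fun h hh h1 => ?_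
    rw [hK, h1, map_one]
  · refine isSmooth_of_forall_redK_eq_one _ fun h hh h1 => ?_
    have hB : redK F h ∈ borel 𝓀[F] := by
      rw [h1]
      exact one_mem _
    have h2 : (⟨redK F h, hB⟩ : borel 𝓀[F]) = 1 := Subtype.ext h1
    rw [hI h hB, h2, map_one]
  · intro x
    rw [Y.mem_range_can hk]
    constructor
    · rintro hx ⟨_, hg⟩ ⟨h, hh, rfl⟩
      rw [hK]
      exact Finsupp.ext fun i => hx i ⟨redK F h, hh⟩
    · intro hx i
      rw [D1, mem_fixedBy_unip]
      intro t
      obtain ⟨h, hh⟩ := redK_surjective F (upper t)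
      have h1 := hx ⟨inclK F h, inclK_mem h⟩ ⟨h, by
        change redK F h ∈ unip 𝓀[F]
        rw [hh]
        exact upper_mem_unip t, rfl⟩
      rw [hK, hh] at h1
      exact congrArg (fun y => y i) h1
  · intro g hg₀ hg₁ hg x
    obtain ⟨n, h, hB, rfl⟩ := hϖ.exists_of_mem_groupIZ hg
    have hhN : inclK F h ∈ groupN ϖ := by
      have := mul_mem (zpow_mem (inv_mem hsN) n) hg₁
      rwa [inv_zpow, inv_mul_cancel_left] at this
    have e₀ : (⟨matScalar ϖ ^ n * inclK F h, hg₀⟩ : groupKZ F) =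
      ⟨matScalar ϖ, hsKZ⟩ ^ n * ⟨inclK F h, inclK_mem h⟩ := rfl
    have e₁ : (⟨matScalar ϖ ^ n * inclK F h, hg₁⟩ : groupN ϖ) =
      ⟨matScalar ϖ, hsN⟩ ^ n * ⟨inclK F h, hhN⟩ := rfl
    have key : ∀ {H : Type u} [Group H] {W : Type v} [AddCommGroup W] [Module 𝔽 W]
        (R : Representation 𝔽 H W) (z : H), R z = 1 → R (z ^ n) = 1 := by
      intro H _ W _ _ R z hz
      have h3 := congrArg Units.val (map_zpow (MonoidHom.toHomUnits R) z n)
      have h4 : MonoidHom.toHomUnits R z = 1 := Units.ext hz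
      rw [h4, one_zpow] at h3
      exact h3
    rw [e₀, e₁, map_mul, map_mul, key R₀ _ (hs₀ _), key R₁ _ (hs₁ _), one_mul, one_mul, hK,
      hI h hB, Y.can_coordRep]
  · intro g x i
    change R₀ ⟨inclK F g, inclK_mem g⟩ x i = ρ (redK F g) (x i)
    rw [hK, finsuppRep_apply]
  · intro j w y hy
    exact hT j w y hy

end DiagramExistence

/-! ### Existence of `D(λ)` -/

section DLambdaExistence

/-- The automorphism `e_i ↦ a_i e_{i+d}`, for nonzero `a_i`. -/
noncomputable def wshiftEquiv {𝔽 : Type*} [Field 𝔽] {a : ℤ → 𝔽} (ha : ∀ i, a i ≠ 0) (d : ℤ) :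
    (ℤ →₀ 𝔽) ≃ₗ[𝔽] ℤ →₀ 𝔽 :=
  LinearEquiv.ofBijective (wshift a d)
    ⟨(injective_iff_map_eq_zero _).2 fun w hw => by
      by_contra h
      exact wshift_ne_zero ha d h hw, wshift_surjective ha d⟩

theorem wshiftEquiv_single {𝔽 : Type*} [Field 𝔽] {a : ℤ → 𝔽} (ha : ∀ i, a i ≠ 0) (d i : ℤ) (c : 𝔽) :
    wshiftEquiv ha d (Finsupp.single i c) = Finsupp.single (i + d) (a i * c) := wshift_single a d i c

theorem ten_single_apply {𝔽 V : Type*} [Field 𝔽] [AddCommGroup V] [Module 𝔽 V] (i : ℤ) (c : 𝔽)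
    (v : V) : ten (Finsupp.single i c) v = Finsupp.single i (c • v) := by
  refine Finsupp.ext fun j => ?_
  rw [ten_apply, Finsupp.single_apply, Finsupp.single_apply]
  split_ifs <;> simp

variable {p : ℕ} [Fact p.Prime] {f : ℕ} [NeZero f] {F : Type u} [Field F] [ValuativeRel F]
  [TopologicalSpace F] [IsNonarchimedeanLocalField F] [CharP 𝓀[F] p] {𝔽 : Type v} [Field 𝔽]
  [Algebra 𝓀[F] 𝔽] {ϖ : Fˣ}

/-- The automorphism for the constituent `j` is the shift by its displacement, weighted by its
modifier. All clauses then follow from one computation on the lines `S₁^χ`. -/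
theorem exists_isDLambda (hk : Nat.card 𝓀[F] = p ^ f) (hf : 1 < f)
    (hp : 3 < p) {r : Fin f → ℕ} (hr : ∀ j, 1 ≤ r j ∧ r j ≤ p - 3) (hϖ : IsUniformizer ϖ)
    (lam : ℤ → 𝔽ˣ) :
    ∃ (S : CyclicPair p 𝓀[F] 𝔽 r) (P : PiAction S.rep0) (D : BasicDiagram ϖ 𝔽)
      (φ : D.V0 ≃ₗ[𝔽] (ℤ →₀ S.D0)), IsDLambda P lam D φ := by
  obtain ⟨S, h1, h2, h3⟩ := exists_cyclicPair (k := 𝓀[F]) (𝔽 := 𝔽) hk hf hp hr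
  obtain ⟨L, hL⟩ := S.exists_layers hk hf hp hr
  obtain ⟨e, -, -, -, he⟩ := exists_match hf p r
  choose y hyU hyB hyt using fun i => S.exists_lift h1 h2 h3 i
  have hchi : ∀ j, (topW p r (e j)).chi p 𝓀[F] 𝔽 = conjChar ((socW p r j).chi p 𝓀[F] 𝔽) :=
    fun j => topW_chi hk hf hp hr (he j)
  let Y : L.Lifts e :=
    { vec := fun j => S.cls (y (e j))
      chi_eq := hchi
      rep_upper := fun j t => hyU (e j) t
      rep_borel := fun j b => by rw [hyB, hchi]
      t_vec := fun j => funext fun i => by rw [hL, hyt] }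
  obtain ⟨P, hP⟩ := Y.exists_piAction hk
  obtain ⟨D, φ, hK, hPi⟩ := Y.exists_basicDiagram hk hϖ fun j =>
    wshiftEquiv (Layers.modifier_ne_zero lam j) (Layers.displacement f j)
  have key : ∀ (j : Idx f) (i : ℤ) (v : D1 S.rep0) (w : D.V1),
      (v : S.D0) ∈ S1chi S.rep0 ((socW p r j).chi p 𝓀[F] 𝔽) →
      φ (D.can w) = Finsupp.single i (v : S.D0) →
      φ (D.can (D.rep1 ⟨matPi ϖ, matPi_mem ϖ⟩ w)) =
        Finsupp.single (i + Layers.displacement f j)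
          (Layers.modifier lam j i • (P.op v : S.D0)) := by
    rintro j i ⟨v, hv⟩ w hvS hw
    rw [L.S1chi_eq hk, Submodule.mem_span_singleton] at hvS
    obtain ⟨c, rfl⟩ := hvS
    have h4 : (⟨c • L.hwv j, hv⟩ : D1 S.rep0) = c • ⟨L.hwv j, L.hwv_mem_D1 j⟩ := rfl
    rw [hPi j (Finsupp.single i c) w (by rw [hw, ten_single_apply]), wshiftEquiv_single,
      ten_single_apply, h4, map_smul, hP, mul_smul]
    rfl
  refine ⟨S, P, D, φ, hK, fun i v w hv hw => ?_, fun i v w hv hw => ?_, fun i v w hv hw => ?_,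
    fun c n hn hn' i v w hv hw => ?_⟩
  · rw [key none i v w hv hw]
    simp [Layers.displacement, Layers.modifier]
  · rw [key (some (0, none)) i v w hv hw]
    simp [Layers.displacement, Layers.modifier, sub_eq_add_neg]
  · rw [key (some (1, none)) i v w hv hw]
    simp [Layers.displacement, Layers.modifier]
  · obtain ⟨m, rfl⟩ := Nat.exists_eq_add_of_le' hn
    rw [key (some (c, some ⟨m, by omega⟩)) i v w hv hw]
    simp [Layers.displacement, Layers.modifier]

end DLambdaExistence

end SplicedDiagram

theorem proposition3p1
    (p : ℕ) [Fact p.Prime] (hp : 3 < p) (f : ℕ) [NeZero f] (hf : 1 < f)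
    (F : Type u) [Field F] [ValuativeRel F] [TopologicalSpace F] [IsNonarchimedeanLocalField F]
    [CharP 𝓀[F] p] (hcard : Nat.card 𝓀[F] = p ^ f)
    (ϖ : Fˣ) (hϖ : SplicedDiagram.IsUniformizer ϖ)
    (𝔽 : Type v) [Field 𝔽] [Algebra 𝓀[F] 𝔽] [IsAlgClosure 𝓀[F] 𝔽]
    (r : Fin f → ℕ) (hr : ∀ j, 1 ≤ r j ∧ r j ≤ p - 3)
    (lam : ℤ → 𝔽ˣ)
    (hlam : ∀ i : ℤ, i ≠ 0 → (lam i : 𝔽) ≠ (lam 0 : 𝔽) ∧ (lam i : 𝔽) ≠ -(lam 0 : 𝔽)) :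
    (∃ (S : SplicedDiagram.CyclicPair p 𝓀[F] 𝔽 r) (P : SplicedDiagram.PiAction S.rep0)
      (D : SplicedDiagram.BasicDiagram ϖ 𝔽) (φ : D.V0 ≃ₗ[𝔽] (ℤ →₀ S.D0)),
      SplicedDiagram.IsDLambda P lam D φ) ∧
    ∀ (S : SplicedDiagram.CyclicPair p 𝓀[F] 𝔽 r) (P : SplicedDiagram.PiAction S.rep0)
      (D : SplicedDiagram.BasicDiagram ϖ 𝔽) (φ : D.V0 ≃ₗ[𝔽] (ℤ →₀ S.D0)),
      SplicedDiagram.IsDLambda P lam D φ → D.IsIrreducible := by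
  have : Algebra.IsAlgebraic 𝓀[F] 𝔽 := IsAlgClosure.isAlgebraic
  refine ⟨SplicedDiagram.exists_isDLambda hcard hf hp hr hϖ lam, fun S P D φ hD => ?_⟩
  exact hD.isIrreducible hcard hf hp hr (fun i hi h => (hlam i hi).1 (congrArg Units.val h))
    -- Algebraicity over the finite residue field enters here: every unit of `𝔽` is a root of unity.
    fun c => SplicedDiagram.exists_pow_eq_one (k := 𝓀[F]) c
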